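/- Let $M$ be a smooth compact manifold of dimension $n$, let $V$ be a smooth vector field on $M$ with flow $\varphi^t$, and let $\Lambda$ be a closed orbit of minimal period $\mathcal P>0$. Suppose that $V$ is $C^\infty$-diagonalizable near the hyperbolic orbit $\Lambda$ (as is the case for every closed orbit of a $C^\infty$-diagonalizable Morse--Smale flow), that is: * there is a smooth diffeomorphism $h$ from $B_{n-1}(0,r)\times\mathbb R/\mathcal P\mathbb Z$ onto a neighborhood of $\Lambda=h(\{0\}\times\mathbb R/\mathcal P\mathbb Z)$ that conjugates $V$ to $A(\theta)x\cdot\partial_x+\partial_\theta$, where $A$ is smooth and $\mathcal P$-periodic with values in $M_{n-1}(\mathbb R)$; * if $U$ is the solution of $U'(\theta)=A(\theta)U(\theta)$, $U(0)=\mathrm{Id}$, then the monodromy matrix $U(\mathcal P)$ is diagonalizable over $\mathbb C$ and has no eigenvalue of modulus $1$. **Adapted coordinates.** There is a linear change of coordinates of $\mathbb R^{n-1}$ after which $U(\mathcal P)$ is block diagonal, with stable blocks followed by unstable blocks: the blocks are $\nu_j$ ($j\in L_s$, $0<|\nu_j|<1$), $\nu_jR_{\vartheta_j}$ ($j\in P_s$,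 $0<\nu_j<1$), $\nu_j$ ($j\in L_u$, $|\nu_j|>1$), $\nu_jR_{\vartheta_j}$ ($j\in P_u$, $\nu_j>1$), where $R_\vartheta=\begin{pmatrix}\cos\vartheta&-\sin\vartheta\\ \sin\vartheta&\cos\vartheta\end{pmatrix}$. Fix any such coordinates. Set $\chi_j=\frac{\log|\nu_j|}{\mathcal P}$, $\omega_j=\frac{\vartheta_j}{\mathcal P}$, and let the twisting index be $\tilde\varepsilon_j=\frac12$ if $j\in L_s\cup L_u$ and $\nu_j<0$, and $\tilde\varepsilon_j=0$ otherwise. Let $A_\Lambda$ be the block-diagonal matrix with blocks $\chi_j$ for lines and $\begin{pmatrix}\chi_j&-\omega_j\\ \omega_j&\chi_j\end{pmatrix}$ for planes, and let $P(\theta)=U(\theta)e^{-\theta A_\Lambda}$. Write $z=(x,y)$ for the stable and unstable coordinates, with $w_j=y_{j1}+iy_{j2}$ and $\partial_{z_j}=\partial_{x_{j1}}+i\partial_{x_{j2}}$, $\partial_{\bar z_j}=\partial_{x_{j1}}-i\partial_{x_{j2}}$ for planes. For $\alpha=(\alpha_x,\alpha_y,\alpha_n)\in\mathbb N^{n-1}\times\mathbb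 Z$, with components $\alpha_j$ for a line $j$ and $(\alpha_j,\bar\alpha_j)$ for a plane $j$, put $$\delta_0^{(\alpha_x)}=\prod_{j\in L_s}\partial_{x_j}^{\alpha_j}\prod_{j\in P_s}\partial_{z_j}^{\alpha_j}\partial_{\bar z_j}^{\bar\alpha_j}\,\delta_0(x),\qquad y^{\alpha_y}=\prod_{j\in L_u}y_j^{\alpha_j}\prod_{j\in P_u}w_j^{\alpha_j}\bar w_j^{\bar\alpha_j},\qquad \tilde\varepsilon\cdot\alpha'=\sum_{j\in L_s\cup L_u}\tilde\varepsilon_j\alpha_j,$$ $$u_\alpha(x,y,\theta)=e^{2i\pi(\alpha_n-\tilde\varepsilon\cdot\alpha')\theta/\mathcal P}\,(P(\theta)^{-1})^*\big(\delta_0^{(\alpha_x)}(x)\,y^{\alpha_y}\big),$$ $$\lambda_\alpha=-\sum_{j\in L_s}|\chi_j|-2\sum_{j\in P_s}|\chi_j|-\frac{2i\pi\alpha_n}{\mathcal P}+\sum_{j\in L_s}\alpha_j\Big(\chi_j+\frac{2i\pi\tilde\varepsilon_j}{\mathcal P}\Big)+\sum_{j\in P_s}\big(\alpha_j(\chi_j-i\omega_j)+\bar\alpha_j(\chi_j+i\omega_j)\big)-\sum_{j\in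 L_u}\alpha_j\Big(\chi_j-\frac{2i\pi\tilde\varepsilon_j}{\mathcal P}\Big)-\sum_{j\in P_u}\big(\alpha_j(\chi_j+i\omega_j)+\bar\alpha_j(\chi_j-i\omega_j)\big).$$ **Conclusion.** Let $\delta>0$ be so small that the tube $U_\Lambda=\{(P(\theta)z,\theta):|z|<\delta\}$ (Euclidean norm) lies in the domain of the coordinates. Let $W^u(\Lambda)=\{q\in M:\varphi^{-t}(q)\to\Lambda\text{ as }t\to+\infty\}$, and for $q_0=(0,\theta_0)\in\Lambda$ let $W^{uu}(q_0)=\{(P(\theta_0)(0,y),\theta_0)\}$ in the coordinates. Let $u\in\mathcal D'(M)$ (a complex scalar distribution), $\lambda\in\mathbb C$ and $p\ge1$ be such that $u\neq0$ on $U_\Lambda$, $$(\mathcal L_V+\lambda)^pu=0\ \text{on}\ U_\Lambda,\qquad \operatorname{supp}(u)\cap U_\Lambda\subset W^u(\Lambda),\qquad \operatorname{WF}(u)\cap T^*U_\Lambda\subset\bigcup_{q_0\in\Lambda}N^*(W^{uu}(q_0)).$$ Then $\lambda\in\{\lambda_\alpha:\alpha\in\mathbb N^{n-1}\times\mathbb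 Z\}$; on $U_\Lambda$, in the local coordinates, $u$ is a finite linear combination $$u=\sum_{\alpha:\ \lambda_\alpha=\lambda}c_\alpha u_\alpha,\qquad c_\alpha\in\mathbb C;$$ and $(\mathcal L_V+\lambda)u=0$ on $U_\Lambda$. -/

import Mathlib

open Set Filter Topology TopologicalSpace MeasureTheory
open scoped Manifold ContDiff Distributions Matrix

noncomputable section

namespace ClosedOrbit

/-! ### Distributions on open subsets of a finite-dimensional real vector space -/

section Euclidean

variable {E : Type*} [NormedAddCommGroup E] [NormedSpace ℝ E]

/-- `ψ` is a complex test function supported in the set `S`. -/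
def IsTest (S : Set E) (ψ : E → ℂ) : Prop :=
  ContDiff ℝ ∞ ψ ∧ HasCompactSupport ψ ∧ tsupport ψ ⊆ S

/-- The space of complex distributions on the open set `Ω`: continuous complex linear forms on
the complex test functions on `Ω`. -/
abbrev Distr (Ω : Opens E) := 𝓓(Ω, ℂ) →L[ℂ] ℂ

open Classical in
/-- The pairing `⟨u, ψ⟩` of a distribution on `Ω` with a test function on `Ω`
(with value `0` if `ψ` is not a test function on `Ω`). -/
def pair {Ω : Opens E} (u : Distr Ω) (ψ : E → ℂ) : ℂ :=
  if h : IsTest (Ω : Set E) ψ then u ⟨ψ, h.1, h.2.1, h.2.2⟩ else 0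

/-- The wavefront set of a distribution on `Ω`, as a set of pairs of a point and a nonzero
covector. A pair `(x, η)` is not in the wavefront set if the Fourier transform of `χ u` is rapidly
decreasing in an open cone around `η`, for some cut-off `χ` with `χ x ≠ 0`. -/
def waveFront {Ω : Opens E} (u : Distr Ω) : Set (E × (E →L[ℝ] ℝ)) :=
  {q | q.1 ∈ Ω ∧ q.2 ≠ 0 ∧
    ¬ ∃ χ : E → ℂ, IsTest (Ω : Set E) χ ∧ χ q.1 ≠ 0 ∧
      ∃ Γ : Set (E →L[ℝ] ℝ), IsOpen Γ ∧ q.2 ∈ Γ ∧ (∀ ξ ∈ Γ, ∀ t : ℝ, 0 < t → t • ξ ∈ Γ) ∧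
        ∀ N : ℕ, ∃ C : ℝ, ∀ ξ ∈ Γ,
          (1 + ‖ξ‖) ^ N *
            ‖pair u (fun y => χ y * Complex.exp (-(Complex.I * (ξ y : ℂ))))‖ ≤ C}

/-- The transpose of `b · ∂ + lam` for a vector field `b` and a complex number `lam`:
`ψ ↦ lam ψ - div (ψ b)`. -/
def transposeOp (b : E → E) (lam : ℂ) (ψ : E → ℂ) : E → ℂ := fun x =>
  lam * ψ x - (fderiv ℝ ψ x (b x) + ψ x * ((LinearMap.trace ℝ E (fderiv ℝ b x) : ℝ) : ℂ))

end Euclidean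

/-! ### Distributions on a manifold of dimension `d + 1` -/

/-- The model space `ℝ ^ d × ℝ` of manifolds of dimension `d + 1`. -/
abbrev Model (d : ℕ) := EuclideanSpace ℝ (Fin d) × ℝ

section Manifold

variable {d : ℕ} {M : Type*} [TopologicalSpace M] [ChartedSpace (Model d) M]

/-- The smooth charts of `M`: the elements of the maximal smooth atlas. -/
abbrev SmoothChart (d : ℕ) (M : Type*) [TopologicalSpace M] [ChartedSpace (Model d) M] :=
  {κ : OpenPartialHomeomorph M (Model d) //
    κ ∈ IsManifold.maximalAtlas 𝓘(ℝ, Model d) ∞ M}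

/-- The open image of a chart. -/
def SmoothChart.image (κ : SmoothChart d M) : Opens (Model d) :=
  ⟨κ.1.target, κ.1.open_target⟩

/-- The part of the image of a chart that corresponds to the set `O` of `M`. -/
def SmoothChart.imageOf (κ : SmoothChart d M) (O : Set M) : Set (Model d) :=
  κ.1.target ∩ κ.1.symm ⁻¹' O

variable (d M) in
/-- A (scalar, complex) distribution on the manifold `M`: a distribution on the image of every
smooth chart, such that the distributions in two charts correspond to each other under
pull-back by the change of charts `τ`, i.e. `u κ = τ ^* (u κ')`. -/
structure MDistr where
  /-- The distribution in a chart. -/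
  inChart : ∀ κ : SmoothChart d M, Distr κ.image
  compatible : ∀ (κ κ' : SmoothChart d M) (ψ : Model d → ℂ),
    IsTest (κ.1.symm.trans κ'.1).target ψ →
      pair (inChart κ') ψ =
        pair (inChart κ) ((κ.1.symm.trans κ'.1).source.indicator fun x =>
          ((|(fderiv ℝ (κ.1.symm.trans κ'.1) x).det| : ℝ) : ℂ) * ψ (κ.1.symm.trans κ'.1 x))

/-- The distribution `u` vanishes on the open set `O`. -/
def MDistr.VanishesOn (u : MDistr d M) (O : Set M) : Prop :=
  ∀ (κ : SmoothChart d M) (ψ : Model d → ℂ), IsTest (κ.imageOf O) ψ → pair (u.inChart κ) ψ = 0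

/-- The support of a distribution. -/
def MDistr.support (u : MDistr d M) : Set M :=
  {x | ∀ O : Set M, IsOpen O → x ∈ O → ¬ u.VanishesOn O}

/-- The cotangent bundle, as the set of pairs of a point and a covector at this point. -/
abbrev Cotangent (d : ℕ) (M : Type*) [TopologicalSpace M] [ChartedSpace (Model d) M] :=
  Σ x : M, (TangentSpace 𝓘(ℝ, Model d) x →L[ℝ] ℝ)

/-- The wavefront set of a distribution on `M`: the wavefront sets in the charts, transported to
the cotangent bundle of `M`. -/
def MDistr.waveFront (u : MDistr d M) : Set (Cotangent d M) :=
  {q | ∃ κ : SmoothChart d M, q.1 ∈ κ.1.source ∧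
    ∃ η : Model d →L[ℝ] ℝ, (κ.1 q.1, η) ∈ ClosedOrbit.waveFront (u.inChart κ) ∧
      q.2 = η.comp (mfderiv 𝓘(ℝ, Model d) 𝓘(ℝ, Model d) κ.1 q.1)}

/-- The expression of a vector field in a chart. -/
def fieldInChart (V : ∀ x : M, TangentSpace 𝓘(ℝ, Model d) x) (κ : SmoothChart d M) :
    Model d → Model d := fun y =>
  mfderiv 𝓘(ℝ, Model d) 𝓘(ℝ, Model d) κ.1 (κ.1.symm y) (V (κ.1.symm y))

/-- The equation `(L_V + lam) ^ p u = 0` on the open set `O`, in the sense of distributions. -/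
def MDistr.SolvesOn (V : ∀ x : M, TangentSpace 𝓘(ℝ, Model d) x) (lam : ℂ) (p : ℕ)
    (u : MDistr d M) (O : Set M) : Prop :=
  ∀ (κ : SmoothChart d M) (ψ : Model d → ℂ), IsTest (κ.imageOf O) ψ →
    pair (u.inChart κ) ((transposeOp (fieldInChart V κ) lam)^[p] ψ) = 0

/-! ### Closed orbits and linearizing coordinates -/

/-- `Λ` is a closed orbit of the flow `φ`, with minimal period `P`. -/
def IsClosedOrbit (φ : Flow ℝ M) (Λ : Set M) (P : ℝ) : Prop :=
  0 < P ∧ ∃ x₀ : M, φ P x₀ = x₀ ∧ (∀ t ∈ Ioo 0 P, φ t x₀ ≠ x₀) ∧ Λ = range fun t : ℝ => φ t x₀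

/-- The unstable manifold of `Λ`: the points whose backward orbit converges to `Λ`. -/
def unstableManifold (φ : Flow ℝ M) (Λ : Set M) : Set M :=
  {x | Tendsto (fun t : ℝ => φ (-t) x) atTop (𝓝ˢ Λ)}

end Manifold

/-- The action of a real matrix on `ℝ ^ d`. -/
def act {d : ℕ} (A : Matrix (Fin d) (Fin d) ℝ) (x : EuclideanSpace ℝ (Fin d)) :
    EuclideanSpace ℝ (Fin d) :=
  WithLp.toLp 2 (A *ᵥ x.ofLp)

/-- Smooth linearizing coordinates near a closed orbit `Λ` of period `P` of the vector field `V`.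
The diffeomorphism from `B(0, r) × ℝ / P ℤ` onto a neighborhood of `Λ` is given by its lift `h`
to `B(0, r) × ℝ`, and it conjugates `V` to `A(θ) x · ∂_x + ∂_θ`. The matrix `U θ` is the
fundamental solution of `dU / dθ = A(θ) U` with `U 0 = 1`. -/
structure LinearizingChart {d : ℕ} {M : Type*} [TopologicalSpace M] [ChartedSpace (Model d) M]
    (V : ∀ x : M, TangentSpace 𝓘(ℝ, Model d) x) (Λ : Set M) (P : ℝ) where
  r : ℝ
  r_pos : 0 < r
  h : Model d → M
  A : ℝ → Matrix (Fin d) (Fin d) ℝ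
  U : ℝ → Matrix (Fin d) (Fin d) ℝ
  smooth : IsLocalDiffeomorphOn 𝓘(ℝ, Model d) 𝓘(ℝ, Model d) ∞ h (Metric.ball 0 r ×ˢ univ)
  periodic : ∀ x ∈ Metric.ball (0 : EuclideanSpace ℝ (Fin d)) r, ∀ θ : ℝ, h (x, θ + P) = h (x, θ)
  injective : ∀ x ∈ Metric.ball (0 : EuclideanSpace ℝ (Fin d)) r,
    ∀ x' ∈ Metric.ball (0 : EuclideanSpace ℝ (Fin d)) r, ∀ θ θ' : ℝ,
      h (x, θ) = h (x', θ') → x = x' ∧ ∃ k : ℤ, θ' = θ + k * P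
  center : h (0, 0) ∈ Λ
  A_smooth : ∀ i j, ContDiff ℝ ∞ fun θ => A θ i j
  A_periodic : ∀ θ, A (θ + P) = A θ
  conj : ∀ x ∈ Metric.ball (0 : EuclideanSpace ℝ (Fin d)) r, ∀ θ : ℝ,
    V (h (x, θ)) = mfderiv 𝓘(ℝ, Model d) 𝓘(ℝ, Model d) h (x, θ) ((act (A θ) x, 1) : Model d)
  U_zero : U 0 = 1
  U_deriv : ∀ θ i j, HasDerivAt (fun s => U s i j) ((A θ * U θ) i j) θ

/-- A real matrix is diagonalizable over `ℂ`. -/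
def IsDiagonalizableOverComplex {d : ℕ} (A : Matrix (Fin d) (Fin d) ℝ) : Prop :=
  ∃ (S : Matrix (Fin d) (Fin d) ℂ) (D : Fin d → ℂ),
    IsUnit S.det ∧ A.map Complex.ofReal * S = S * Matrix.diagonal D

/-- A real matrix has no complex eigenvalue of modulus one. -/
def IsHyperbolicMatrix {d : ℕ} (A : Matrix (Fin d) (Fin d) ℝ) : Prop :=
  ∀ μ ∈ spectrum ℂ (A.map Complex.ofReal), ‖μ‖ ≠ 1

/-! ### The block-diagonal form of the monodromy matrix -/

/-- The labels of real coordinates attached to `l` lines and `p` planes: one label for every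
line, two labels `(0, j)` and `(1, j)` for every plane `j`. -/
abbrev Label (l p : ℕ) := Fin l ⊕ (Fin 2 × Fin p)

/-- The block-diagonal matrix with blocks `a j` of size one and blocks
`!![re j, -im j; im j, re j]` of size two. -/
def blockMatrix {l p : ℕ} (a : Fin l → ℝ) (re im : Fin p → ℝ) :
    Matrix (Label l p) (Label l p) ℝ :=
  Matrix.fromBlocks (Matrix.diagonal a) 0 0
    (Matrix.blockDiagonal fun j => !![re j, -im j; im j, re j])

/-- The data of a hyperbolic block-diagonal matrix of size `d`: numbers `ls`, `ps`, `lu`, `pu` of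
stable lines, stable planes, unstable lines and unstable planes, a numbering of the corresponding
coordinates, the factors `ν` of all the blocks, and the angles `ϑ` of the planes. -/
structure Blocks (d : ℕ) where
  ls : ℕ
  ps : ℕ
  lu : ℕ
  pu : ℕ
  numbering : (Label ls ps ⊕ Label lu pu) ≃ Fin d
  νls : Fin ls → ℝ
  νps : Fin ps → ℝ
  ϑps : Fin ps → ℝ
  νlu : Fin lu → ℝ
  νpu : Fin pu → ℝ
  ϑpu : Fin pu → ℝ
  νls_mem : ∀ j, 0 < |νls j| ∧ |νls j| < 1
  νps_mem : ∀ j, 0 < νps j ∧ νps j < 1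
  νlu_mem : ∀ j, 1 < |νlu j|
  νpu_mem : ∀ j, 1 < νpu j

namespace Blocks

variable {d : ℕ} (B : Blocks d)

/-- The block-diagonal matrix with blocks `ν` for the lines and `ν R_ϑ` for the planes. -/
def matrix : Matrix (Fin d) (Fin d) ℝ :=
  Matrix.reindex B.numbering B.numbering
    (Matrix.fromBlocks
      (blockMatrix B.νls (fun j => B.νps j * Real.cos (B.ϑps j))
        (fun j => B.νps j * Real.sin (B.ϑps j))) 0 0
      (blockMatrix B.νlu (fun j => B.νpu j * Real.cos (B.ϑpu j))
        (fun j => B.νpu j * Real.sin (B.ϑpu j))))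

/-- The real matrix `A_Λ` with `exp (2 P A_Λ) = matrix ^ 2`: it has blocks `log |ν| / P` for the
lines and `(log ν + ϑ J) / P` for the planes, where `J` is the rotation of angle `π / 2`. -/
def generator (P : ℝ) : Matrix (Fin d) (Fin d) ℝ :=
  Matrix.reindex B.numbering B.numbering
    (Matrix.fromBlocks
      (blockMatrix (fun j => Real.log |B.νls j| / P) (fun j => Real.log (B.νps j) / P)
        (fun j => B.ϑps j / P)) 0 0
      (blockMatrix (fun j => Real.log |B.νlu j| / P) (fun j => Real.log (B.νpu j) / P)
        (fun j => B.ϑpu j / P)))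

open Classical in
/-- The twisting index of a line with factor `ν`. -/
def twist (ν : ℝ) : ℝ := if ν < 0 then 1 / 2 else 0

/-- The indices `α = (α', α_n)` in `ℕ ^ d × ℤ`, where `α' = (α_x, α_y)`. For a plane `j`, the label
`(0, j)` carries the exponent `α_j` of `z_j` or `w_j` and the label `(1, j)` that of the complex
conjugate. -/
abbrev Index := (Label B.ls B.ps ⊕ Label B.lu B.pu → ℕ) × ℤ

/-- The pairing `ε · α'` of the twisting indices with `α'`. -/
def twistPairing (α : B.Index) : ℝ :=
  (∑ j, twist (B.νls j) * α.1 (.inl (.inl j))) + ∑ j, twist (B.νlu j) * α.1 (.inr (.inl j))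

/-- The number `λ_α`, with `χ = log |ν| / P` and `ω = ϑ / P`. -/
def eigenvalue (P : ℝ) (α : B.Index) : ℂ :=
  -(∑ j, ((|Real.log |B.νls j| / P| : ℝ) : ℂ)) - 2 * (∑ j, ((|Real.log (B.νps j) / P| : ℝ) : ℂ))
    - 2 * Real.pi * Complex.I * α.2 / P
    + (∑ j, α.1 (.inl (.inl j)) *
        (((Real.log |B.νls j| / P : ℝ) : ℂ) + 2 * Real.pi * Complex.I * twist (B.νls j) / P))
    + (∑ j,
        (α.1 (.inl (.inr (0, j))) *
            (((Real.log (B.νps j) / P : ℝ) : ℂ) - Complex.I * ((B.ϑps j / P : ℝ) : ℂ)) +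
          α.1 (.inl (.inr (1, j))) *
            (((Real.log (B.νps j) / P : ℝ) : ℂ) + Complex.I * ((B.ϑps j / P : ℝ) : ℂ))))
    - (∑ j, α.1 (.inr (.inl j)) *
        (((Real.log |B.νlu j| / P : ℝ) : ℂ) - 2 * Real.pi * Complex.I * twist (B.νlu j) / P))
    - (∑ j,
        (α.1 (.inr (.inr (0, j))) *
            (((Real.log (B.νpu j) / P : ℝ) : ℂ) + Complex.I * ((B.ϑpu j / P : ℝ) : ℂ)) +
          α.1 (.inr (.inr (1, j))) *
            (((Real.log (B.νpu j) / P : ℝ) : ℂ) - Complex.I * ((B.ϑpu j / P : ℝ) : ℂ))))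

/-- The set of resonances `{λ_α}`. -/
def resonances (P : ℝ) : Set ℂ := range (B.eigenvalue P)

/-- The unit vector of a coordinate. -/
def unitVec (k : Label B.ls B.ps ⊕ Label B.lu B.pu) : EuclideanSpace ℝ (Fin d) :=
  EuclideanSpace.single (B.numbering k) 1

/-- The point `(0, y)`. -/
def embedUnstable (y : Label B.lu B.pu → ℝ) : EuclideanSpace ℝ (Fin d) :=
  WithLp.toLp 2 fun i => Sum.elim (fun _ => 0) y (B.numbering.symm i)

/-- The operator `∂_v + s ∂_w` on functions on `ℝ ^ d`. -/
def derivPair (s : ℂ) (v w : EuclideanSpace ℝ (Fin d)) (g : EuclideanSpace ℝ (Fin d) → ℂ) :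
    EuclideanSpace ℝ (Fin d) → ℂ := fun z => fderiv ℝ g z v + s * fderiv ℝ g z w

/-- The differential operator `∂ ^ α_x` in the stable variables: the composition of the powers of
`∂_{x_j}` for the stable lines and of `∂_{x_{j1}} + i ∂_{x_{j2}}` and
`∂_{x_{j1}} - i ∂_{x_{j2}}` for the stable planes. -/
def stableDeriv (α : B.Index) (g : EuclideanSpace ℝ (Fin d) → ℂ) :
    EuclideanSpace ℝ (Fin d) → ℂ :=
  let lines := (List.finRange B.ls).foldr
    (fun j f => (derivPair 0 (B.unitVec (.inl (.inl j))) 0)^[α.1 (.inl (.inl j))] f) g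
  (List.finRange B.ps).foldr
    (fun j f =>
      (derivPair Complex.I (B.unitVec (.inl (.inr (0, j))))
        (B.unitVec (.inl (.inr (1, j)))))^[α.1 (.inl (.inr (0, j)))]
      ((derivPair (-Complex.I) (B.unitVec (.inl (.inr (0, j))))
        (B.unitVec (.inl (.inr (1, j)))))^[α.1 (.inl (.inr (1, j)))] f)) lines

/-- The order `|α_x|` of `stableDeriv`. -/
def stableOrder (α : B.Index) : ℕ := ∑ k, α.1 (.inl k)

/-- The monomial `y ^ α_y` in the real variables `y_j` of the unstable lines and the complex
variables `w_j = y_{j1} + i y_{j2}` of the unstable planes and their conjugates. -/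
def unstableMonomial (α : B.Index) (y : Label B.lu B.pu → ℝ) : ℂ :=
  (∏ j, (y (.inl j) : ℂ) ^ α.1 (.inr (.inl j))) *
    ∏ j, ((y (.inr (0, j)) : ℂ) + Complex.I * (y (.inr (1, j)) : ℂ)) ^ α.1 (.inr (.inr (0, j))) *
      ((y (.inr (0, j)) : ℂ) - Complex.I * (y (.inr (1, j)) : ℂ)) ^ α.1 (.inr (.inr (1, j)))

/-- The pairing of the distribution `δ_0^{(α_x)}(x) y ^ α_y` on `ℝ ^ d` with `g`. -/
def transversePairing (α : B.Index) (g : EuclideanSpace ℝ (Fin d) → ℂ) : ℂ :=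
  ∫ y : Label B.lu B.pu → ℝ,
    B.unstableMonomial α y * ((-1) ^ B.stableOrder α * B.stableDeriv α g (B.embedUnstable y))

end Blocks

/-! ### Floquet coordinates -/

namespace LinearizingChart

variable {d : ℕ} {M : Type*} [TopologicalSpace M] [ChartedSpace (Model d) M]
  {V : ∀ x : M, TangentSpace 𝓘(ℝ, Model d) x} {Λ : Set M} {P : ℝ}
  (C : LinearizingChart V Λ P) (B : Blocks d) (Q : Matrix (Fin d) (Fin d) ℝ)

/-- The monodromy matrix. -/
def monodromy : Matrix (Fin d) (Fin d) ℝ := C.U P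

/-- The linear change of coordinates `Q` puts the monodromy matrix into the block-diagonal form
given by `B`. -/
def IsAdapted : Prop := IsUnit Q.det ∧ C.monodromy * Q = Q * B.matrix

/-- The Floquet matrix `P(θ)` defined by `U θ Q = P(θ) exp (θ A_Λ)`. It sends the adapted
coordinates `z = (x, y)` to the linearizing coordinates. -/
def floquet (θ : ℝ) : Matrix (Fin d) (Fin d) ℝ :=
  C.U θ * Q * NormedSpace.exp (-(θ • B.generator P))

/-- The lift to `ℝ ^ d × ℝ` of the tube of radius `δ`. -/
def liftedTube (δ : ℝ) : Set (Model d) :=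
  {q | ∃ z : EuclideanSpace ℝ (Fin d), ‖z‖ < δ ∧ q.1 = act (C.floquet B Q q.2) z}

/-- The tube of radius `δ` around the closed orbit: the set of points of `M` with coordinates
`(P(θ) z, θ)` with `‖z‖ < δ`. -/
def tube (δ : ℝ) : Set M := C.h '' C.liftedTube B Q δ

/-- The direction `P(θ) ({0} × ℝ ^ u)` of the strong unstable manifold through `h (0, θ)`. In
the linearizing coordinates this strong unstable manifold is `unstableSpace θ × {θ}`. -/
def unstableSpace (θ : ℝ) : Set (EuclideanSpace ℝ (Fin d)) :=
  range fun y => act (C.floquet B Q θ) (B.embedUnstable y)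

/-- The union of the conormal bundles of the strong unstable manifolds of the points of the closed
orbit, in the domain of the linearizing coordinates. -/
def strongUnstableConormals : Set (Cotangent d M) :=
  {q | ∃ (v : EuclideanSpace ℝ (Fin d)) (θ : ℝ)
      (ξ : TangentSpace 𝓘(ℝ, Model d) (C.h (v, θ)) →L[ℝ] ℝ),
    v ∈ Metric.ball 0 C.r ∧ v ∈ C.unstableSpace B Q θ ∧
    (∀ w ∈ C.unstableSpace B Q θ,
      ξ (mfderiv 𝓘(ℝ, Model d) 𝓘(ℝ, Model d) C.h (v, θ) ((w, 0) : Model d)) = 0) ∧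
    q = ⟨C.h (v, θ), ξ⟩}

/-- The pairing with `ψ` of the model distribution
`u_α = exp (2 i π (α_n - ε · α') θ / P) (P(θ)⁻¹) ^* (δ_0^{(α_x)}(x) y ^ α_y)`,
in the lifted linearizing coordinates. -/
def modelPairing (α : B.Index) (ψ : Model d → ℂ) : ℂ :=
  ∫ θ : ℝ,
    Complex.exp (2 * Complex.I * Real.pi * ((α.2 : ℂ) - (B.twistPairing α : ℂ)) * θ / P) *
      (((|(C.floquet B Q θ).det| : ℝ) : ℂ) *
        B.transversePairing α fun z => ψ (act (C.floquet B Q θ) z, θ))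

/-- A smooth chart of `M` that is given by the linearizing coordinates: its inverse is the
restriction of `h` to an open set on which `h` is injective. -/
def IsCoordinateChart (κ : SmoothChart d M) : Prop :=
  κ.1.target ⊆ Metric.ball 0 C.r ×ˢ univ ∧ EqOn κ.1.symm C.h κ.1.target

/-- On the tube of radius `δ`, the distribution `u` is equal, in the linearizing coordinates, to the
finite combination of the models `u_α` with coefficients `c α`. -/
def EqCombination (δ : ℝ) (u : MDistr d M) (c : B.Index →₀ ℂ) : Prop :=
  ∀ κ : SmoothChart d M, C.IsCoordinateChart κ → ∀ ψ : Model d → ℂ,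
    IsTest (κ.1.target ∩ C.liftedTube B Q δ) ψ →
      pair (u.inChart κ) ψ = c.sum fun α a => a * C.modelPairing B Q α ψ

end LinearizingChart

end ClosedOrbit

end

open ClosedOrbit

/-!
In the linearizing coordinates, the change of variables `ζ = Q⁻¹ U(θ)⁻¹ x` turns the vector field
into `∂_θ`. It unrolls the tube to the set `box` of the points `(ζ, θ) ∈ ℝ ^ d × ℝ` with
`‖exp(θ A_Λ) ζ‖ < δ`, on which the return map acts by the deck transformation
`(ζ, θ) ↦ (D ζ, θ - P)`, where `D` is the block-diagonal form of the monodromy matrix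
(`LinearizingChart.flowBox`, `LinearizingChart.IsTube.flowBox_eq`). The distribution `u` lifts to a
functional `w` on the test functions of `box` that is equivariant under the deck transformation and
satisfies `(∂_θ + lam) ^ p w = 0` (`IsLift.comp_deck`, `IsLift.apply_thetaOp_iterate`).

The two geometric conditions on `u` enter as follows. Off the local unstable manifold the wavefront
set is empty, so that `u` is smooth there; it vanishes off the global unstable manifold, which is a
countable union of compact sets with empty interior, so that `u` vanishes on a dense set. Hence `w` is
carried by the unstable space `ζ_s = 0` (`IsLift.eq_zero_of_tsupport`). As the wavefront set is
conormal to the leaves `θ = const` of the unstable manifold, `w` is a smooth density when it is tested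
near a point of the orbit against functions of the unstable variable
(`exists_density_of_waveFront`). In particular, `u` can be extended to all the unstable directions
that are reached by the backward flow (`Blocks.basin`).

The core of the argument is `HyperbolicSplitting.exists_flow_expansion`. Write `R` for the composition
of functions of `ζ` with `D`, with the factor `exp(-lam P) |det D|`. The equivariance identifies the
action of `R` on `w` with a translation by `P` along the flow. If `(∂_θ + lam) ^ p w = 0`, this
translation minus the identity is nilpotent on `w`, so that `n ↦ w(R ^ n ψ)` is a polynomial in `n`.
On the other hand, Taylor expansion shows that `w(R ^ n ψ)` is asymptotically a combination of the
pure exponentials `(κ jac mult l) ^ n`, with coefficients given by the functionals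
`form l = ∫ y ^ l' ∂ ^ l` : the contraction in the stable directions makes the stable Taylor remainder
of `ψ` negligible against the finite order of `w`, and the contraction of `D⁻¹` in the unstable
directions makes the Taylor remainder of the smooth density negligible
(`HyperbolicSplitting.exists_form_expansion`). No power of `n` occurs in the exponentials because `D`
is diagonalizable. A polynomial that agrees asymptotically with such a sum is the constant given by
the terms with `κ jac mult l = 1`. Hence `(R - 1) w = 0`, the nilpotent part vanishes, and `w` is the
combination of the `form l` of the means of `ψ` along the flow.

Finally `κ jac mult l = 1` says that `exp((λ_α - lam) P) = 1` for the multi-index `α` of the words `l`,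
i.e. `lam = λ_α` for one choice of `α_n` (`Blocks.exists_eigenvalue_eq`), and the functional of the
means is the model `u_α` (`LinearizingChart.form_expMean_pullDensity`). The equation
`(∂_θ + lam) w = 0` passes to arbitrary charts by the formula of Jacobi (`pullOn_transposeOp`). The
existence of adapted coordinates is the real canonical form of a matrix that is diagonalizable over
`ℂ` (`exists_blocks`).
-/

set_option linter.unusedSectionVars false

noncomputable section

namespace ClosedOrbit


/-! ### Test functions and the pairing with a distribution -/

section Test

variable {X : Type*} [NormedAddCommGroup X] [NormedSpace ℝ X]

namespace IsTest

variable {S S' : Set X} {ψ φ : X → ℂ}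

lemma mono (h : IsTest S ψ) (hS : S ⊆ S') : IsTest S' ψ := ⟨h.1, h.2.1, h.2.2.trans hS⟩

lemma of_tsupport (h : IsTest S ψ) (h' : tsupport ψ ⊆ S') : IsTest S' ψ := ⟨h.1, h.2.1, h'⟩

lemma zero : IsTest S (0 : X → ℂ) :=
  ⟨contDiff_const, HasCompactSupport.zero, by simp [tsupport]⟩

lemma add (h : IsTest S ψ) (h' : IsTest S φ) : IsTest S (ψ + φ) :=
  ⟨h.1.add h'.1, h.2.1.add h'.2.1, (tsupport_add ψ φ).trans (union_subset h.2.2 h'.2.2)⟩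

lemma mul_left (h : IsTest S ψ) {f : X → ℂ} (hf : ContDiff ℝ ∞ f) : IsTest S (f * ψ) :=
  ⟨hf.mul h.1, h.2.1.mul_left, (tsupport_mul_subset_right).trans h.2.2⟩

lemma mul_right (h : IsTest S ψ) {f : X → ℂ} (hf : ContDiff ℝ ∞ f) : IsTest S (ψ * f) := by
  rw [mul_comm]; exact h.mul_left hf

lemma smul (h : IsTest S ψ) (c : ℂ) : IsTest S (c • ψ) :=
  h.mul_left (f := fun _ => c) contDiff_const

lemma neg (h : IsTest S ψ) : IsTest S (-ψ) := by
  simpa using h.smul (-1)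

lemma sub (h : IsTest S ψ) (h' : IsTest S φ) : IsTest S (ψ - φ) := by
  rw [sub_eq_add_neg]; exact h.add h'.neg

lemma sum {ι : Type*} {t : Finset ι} {f : ι → X → ℂ} (h : ∀ i ∈ t, IsTest S (f i)) :
    IsTest S (∑ i ∈ t, f i) := by
  classical
  induction t using Finset.induction_on with
  | empty => simpa using zero
  | insert a t ha ih =>
    rw [Finset.sum_insert ha]
    exact (h a (Finset.mem_insert_self _ _)).add
      (ih fun i hi => h i (Finset.mem_insert_of_mem hi))

lemma eq_zero (h : IsTest S ψ) {x : X} (hx : x ∉ S) : ψ x = 0 :=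
  image_eq_zero_of_notMem_tsupport fun h' => hx (h.2.2 h')

/-- A function that is smooth on an open set and vanishes off a compact subset of this open set is
a test function. -/
lemma of_contDiffOn {K O : Set X} (hK : IsCompact K) (hO : IsOpen O) (hKO : K ⊆ O)
    (hψ : ContDiffOn ℝ ∞ ψ O) (h0 : ∀ x ∉ K, ψ x = 0) : IsTest K ψ := by
  have hs : tsupport ψ ⊆ K := closure_minimal
    (fun x hx => by_contra fun h => hx (h0 x h)) hK.isClosed
  refine ⟨contDiff_iff_contDiffAt.2 fun x => ?_, hK.of_isClosed_subset (isClosed_tsupport _) hs, hs⟩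
  by_cases hx : x ∈ O
  · exact (hψ x hx).contDiffAt (hO.mem_nhds hx)
  · have : ψ =ᶠ[𝓝 x] fun _ => 0 := by
      filter_upwards [hK.isClosed.isOpen_compl.mem_nhds fun h => hx (hKO h)] with y hy
      exact h0 y hy
    exact contDiffAt_const.congr_of_eventuallyEq this

end IsTest

variable {Ω : Opens X} (u : Distr Ω)

lemma pair_eq {ψ : X → ℂ} (h : IsTest (Ω : Set X) ψ) : pair u ψ = u ⟨ψ, h.1, h.2.1, h.2.2⟩ := by
  simp [pair, h]

lemma pair_add {ψ φ : X → ℂ} (h : IsTest (Ω : Set X) ψ) (h' : IsTest (Ω : Set X) φ) :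
    pair u (ψ + φ) = pair u ψ + pair u φ := by
  rw [pair_eq u h, pair_eq u h', pair_eq u (h.add h'), ← map_add]
  rfl

lemma pair_smul {ψ : X → ℂ} (h : IsTest (Ω : Set X) ψ) (c : ℂ) :
    pair u (c • ψ) = c * pair u ψ := by
  rw [pair_eq u h, pair_eq u (h.smul c), ← smul_eq_mul, ← map_smul]
  rfl

lemma pair_zero : pair u (0 : X → ℂ) = 0 := by
  simpa using pair_smul u (IsTest.zero (S := (Ω : Set X))) 0

lemma pair_sum {ι : Type*} {t : Finset ι} {f : ι → X → ℂ}
    (h : ∀ i ∈ t, IsTest (Ω : Set X) (f i)) :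
    pair u (∑ i ∈ t, f i) = ∑ i ∈ t, pair u (f i) := by
  classical
  induction t using Finset.induction_on with
  | empty => simpa using pair_zero u
  | insert a t ha ih =>
    rw [Finset.sum_insert ha, Finset.sum_insert ha, pair_add u (h a (Finset.mem_insert_self _ _)),
      ih fun i hi => h i (Finset.mem_insert_of_mem hi)]
    exact IsTest.sum fun i hi => h i (Finset.mem_insert_of_mem hi)

/-- A distribution has finite order on every compact set. -/
lemma exists_order_bound {K : Set X} (hK : IsCompact K) (hKΩ : K ⊆ Ω) :
    ∃ (N : ℕ) (C : ℝ), 0 ≤ C ∧ ∀ (ψ : X → ℂ) (b : ℝ), IsTest K ψ → 0 ≤ b →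
      (∀ j ≤ N, ∀ x ∈ K, ‖iteratedFDeriv ℝ j ψ x‖ ≤ b) → ‖pair u ψ‖ ≤ C * b := by
  let K' : Compacts X := ⟨K, hK⟩
  have hK' : (K' : Set X) ⊆ Ω := hKΩ
  let T : 𝓓_{K'}(X, ℂ) →L[ℂ] ℂ := u.comp (TestFunction.ofSupportedInCLM ℂ hK')
  have hT := T.continuous
  let q : Seminorm ℂ 𝓓_{K'}(X, ℂ) := (normSeminorm ℂ ℂ).comp T.toLinearMap
  have hq : Continuous q := by
    change Continuous fun x => ‖T x‖
    exact hT.norm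
  obtain ⟨s, C, hC, hqs⟩ :=
    Seminorm.bound_of_continuous (ContDiffMapSupportedIn.withSeminorms ℂ X ℂ ⊤ K') q hq
  refine ⟨s.sup id, C, C.2, fun ψ b hψ hb hbound => ?_⟩
  have hc : ContDiff ℝ ((⊤ : ℕ∞) : WithTop ℕ∞) ψ := hψ.1
  let f : 𝓓_{K'}(X, ℂ) := ⟨ψ, hc, fun x hx => hψ.eq_zero hx⟩
  have h1 : pair u ψ = T f := by
    rw [pair_eq u (hψ.mono hKΩ)]; rfl
  have h2 := hqs f
  have h3 : (s.sup (ContDiffMapSupportedIn.seminorm ℂ X ℂ ⊤ K')) f ≤ b := by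
    refine Seminorm.finset_sup_apply_le hb fun i hi => ?_
    rw [ContDiffMapSupportedIn.seminorm_top_le_iff ℂ hb]
    intro x hx
    exact hbound i (Finset.le_sup (f := id) hi) x hx
  rw [h1]
  calc ‖T f‖ = q f := rfl
    _ ≤ (C • s.sup (ContDiffMapSupportedIn.seminorm ℂ X ℂ ⊤ K')) f := h2
    _ = C * (s.sup (ContDiffMapSupportedIn.seminorm ℂ X ℂ ⊤ K')) f := rfl
    _ ≤ C * b := by gcongr

variable [FiniteDimensional ℝ X]

/-- Decomposition of a test function subordinate to an open covering of its support. -/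
lemma IsTest.exists_decomposition {S : Set X} {ψ : X → ℂ} (h : IsTest S ψ) {ι : Type*}
    (O : ι → Set X) (hO : ∀ i, IsOpen (O i)) (hcov : tsupport ψ ⊆ ⋃ i, O i) :
    ∃ (t : Finset ι) (f : ι → X → ℂ), (∀ i ∈ t, IsTest (tsupport ψ ∩ O i) (f i)) ∧
      ψ = ∑ i ∈ t, f i := by
  obtain ⟨ρ, hρ⟩ := SmoothPartitionOfUnity.exists_isSubordinate 𝓘(ℝ, X)
    (isClosed_tsupport ψ) O hO hcov
  have hfin : {i | (Function.support (ρ i) ∩ tsupport ψ).Nonempty}.Finite :=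
    ρ.locallyFinite.finite_nonempty_inter_compact h.2.1
  have hsm : ∀ i, ContDiff ℝ ∞ fun x => ((ρ i x : ℝ) : ℂ) := fun i =>
    Complex.ofRealCLM.contDiff.comp (ρ i).contMDiff.contDiff
  refine ⟨hfin.toFinset, fun i x => ((ρ i x : ℝ) : ℂ) * ψ x, fun i _ => ?_, ?_⟩
  · refine ⟨(h.mul_left (hsm i)).1, (h.mul_left (hsm i)).2.1, subset_inter ?_ ?_⟩
    · exact tsupport_mul_subset_right
    · refine (tsupport_mul_subset_left (f := fun x => ((ρ i x : ℝ) : ℂ))).trans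
        (subset_trans (closure_mono ?_) (hρ i))
      intro x hx
      simpa using hx
  · funext x
    rw [Finset.sum_apply]
    by_cases hx : x ∈ tsupport ψ
    · have h1 := ρ.sum_eq_one hx
      have h2 : ∑ᶠ i, ρ i x = ∑ i ∈ hfin.toFinset, ρ i x := by
        refine finsum_eq_sum_of_support_subset _ fun i hi => ?_
        simp only [Finite.coe_toFinset, mem_ofPred_eq]
        exact ⟨x, hi, hx⟩
      rw [← Finset.sum_mul, ← Complex.ofReal_sum, ← h2, h1]
      simp
    · simp [image_eq_zero_of_notMem_tsupport hx]

/-- A distribution that vanishes near every point of the support of a test function vanishes on this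
test function. -/
lemma pair_eq_zero_of_locally {ψ : X → ℂ} (h : IsTest (Ω : Set X) ψ)
    (hloc : ∀ x ∈ tsupport ψ, ∃ O : Set X, IsOpen O ∧ x ∈ O ∧
      ∀ φ, IsTest (tsupport ψ ∩ O) φ → pair u φ = 0) : pair u ψ = 0 := by
  choose! O hO hx hz using hloc
  obtain ⟨t, f, hf, hsum⟩ := h.exists_decomposition (fun x : tsupport ψ => O x)
    (fun x => hO x x.2) fun x hx' => mem_iUnion.2 ⟨⟨x, hx'⟩, hx x hx'⟩
  rw [hsum, pair_sum u fun i hi => (hf i hi).mono (inter_subset_left.trans h.2.2)]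
  exact Finset.sum_eq_zero fun i hi => hz i i.2 _ (hf i hi)

/-- Existence of cut-off functions. -/
lemma exists_cutoff {K O : Set X} (hK : IsCompact K) (hO : IsOpen O) (hKO : K ⊆ O) :
    ∃ χ : X → ℂ, IsTest O χ ∧ ∃ O' : Set X, IsOpen O' ∧ K ⊆ O' ∧ O' ⊆ O ∧ ∀ x ∈ O', χ x = 1 := by
  obtain ⟨L, hL, hKL, hLO⟩ := exists_compact_between hK hO hKO
  obtain ⟨L', hL', hLL', hLO'⟩ := exists_compact_between hL hO hLO
  obtain ⟨ρ, hρ⟩ := SmoothPartitionOfUnity.exists_isSubordinate 𝓘(ℝ, X) hL.isClosed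
    (fun _ : Unit => interior L') (fun _ => isOpen_interior) (fun x hx => mem_iUnion.2 ⟨(), hLL' hx⟩)
  have hs : tsupport (fun x => ((ρ () x : ℝ) : ℂ)) ⊆ L' := by
    refine subset_trans (closure_mono fun x hx => ?_) ((hρ ()).trans interior_subset)
    simpa using hx
  refine ⟨fun x => ((ρ () x : ℝ) : ℂ), ⟨Complex.ofRealCLM.contDiff.comp (ρ ()).contMDiff.contDiff,
    hL'.of_isClosed_subset (isClosed_tsupport _) hs, hs.trans hLO'⟩, interior L, isOpen_interior,
    hKL, interior_subset.trans hLO, fun x hx => ?_⟩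
  have := ρ.sum_eq_one (interior_subset hx)
  rw [finsum_unique] at this
  simp only [Complex.ofReal_eq_one]
  exact this

end Test


set_option linter.style.haveILetI false

/-! ### Fourier inversion inside a pairing -/

section Kernel

open scoped FourierTransform RealInnerProductSpace SchwartzMap

variable {V : Type*} [NormedAddCommGroup V] [InnerProductSpace ℝ V] [FiniteDimensional ℝ V]
  [MeasurableSpace V] [BorelSpace V]

/-- The plane wave `y ↦ exp (-2 i π ⟪η, y⟫)`. -/
def wave (η : V) : V → ℂ := fun y => (Real.fourierChar (-⟪η, y⟫) : ℂ)

lemma wave_apply (η y : V) :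
    wave η y = Complex.exp (-(Complex.I * ((2 * Real.pi * ⟪η, y⟫ : ℝ) : ℂ))) := by
  rw [wave, Real.fourierChar_apply]
  congr 1
  push_cast
  ring

lemma norm_wave (η y : V) : ‖wave η y‖ = 1 := Circle.norm_coe _

lemma contDiff_wave (η : V) : ContDiff ℝ ∞ (wave η) := by
  have : wave η = fun y => Complex.exp (-(Complex.I * ((2 * Real.pi * ⟪η, y⟫ : ℝ) : ℂ))) :=
    funext (wave_apply η)
  rw [this]
  refine ((contDiff_const.mul (Complex.ofRealCLM.contDiff.comp ?_)).neg).cexp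
  exact contDiff_const.mul (contDiff_const.inner ℝ contDiff_id)

lemma wave_eq_fourierIntegral (η : V) :
    wave η = VectorFourier.fourierIntegral 𝐞 (Measure.dirac η)
      (innerSL ℝ (E := V)).toLinearMap₁₂ (fun _ => (1 : ℂ)) := by
  funext y
  simp [VectorFourier.fourierIntegral, wave, Circle.smul_def]

lemma iteratedFDeriv_wave (η y : V) (j : ℕ) :
    iteratedFDeriv ℝ j (wave η) y =
      wave η y • VectorFourier.fourierPowSMulRight (innerSL ℝ (E := V)) (fun _ => (1 : ℂ)) η j := by
  rw [wave_eq_fourierIntegral, VectorFourier.iteratedFDeriv_fourierIntegral (N := ⊤) _ _ _ le_top]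
  · simp only [VectorFourier.fourierIntegral, integral_dirac, Circle.smul_def, smul_eq_mul, mul_one]
  · intro n _
    exact integrable_dirac (by finiteness)
  · exact aestronglyMeasurable_const

lemma norm_iteratedFDeriv_wave_le (η y : V) (j : ℕ) :
    ‖iteratedFDeriv ℝ j (wave η) y‖ ≤
      (2 * Real.pi * ‖innerSL ℝ (E := V)‖) ^ j * ‖η‖ ^ j := by
  rw [iteratedFDeriv_wave, norm_smul, norm_wave, one_mul]
  simpa using VectorFourier.norm_fourierPowSMulRight_le (innerSL ℝ (E := V))
    (fun _ => (1 : ℂ)) η j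

lemma iteratedFDeriv_fourier (a : 𝓢(V, ℂ)) (y : V) (j : ℕ) :
    iteratedFDeriv ℝ j (𝓕 (a : V → ℂ)) y = ∫ η, a η • iteratedFDeriv ℝ j (wave η) y := by
  have h : 𝓕 (a : V → ℂ) = VectorFourier.fourierIntegral 𝐞 volume
      (innerSL ℝ (E := V)).toLinearMap₁₂ a := by
    funext y
    simp [VectorFourier.fourierIntegral, Real.fourier_eq]
  rw [h, VectorFourier.iteratedFDeriv_fourierIntegral (N := ⊤) _ _ _ le_top]
  · simp only [VectorFourier.fourierIntegral]
    refine integral_congr_ae (Eventually.of_forall fun η => ?_)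
    ext m
    have hi : 𝐞 (-((innerSL ℝ (E := V)).toLinearMap₁₂ η) y) = 𝐞 (-⟪η, y⟫) := rfl
    beta_reduce
    rw [hi]
    simp only [iteratedFDeriv_wave, wave, Circle.smul_def, smul_apply,
      VectorFourier.fourierPowSMulRight_apply, smul_eq_mul, Complex.real_smul]
    ring
  · intro n _
    exact a.integrable_pow_mul volume n
  · exact a.continuous.aestronglyMeasurable

variable (V) in
/-- The Banach space of families of continuous multilinear forms of degree at most `N` over a
compact set, in which the `N`-jets of smooth functions live. -/
def JetSpace (K : Compacts V) (N : ℕ) := ∀ j : Fin (N + 1), C(K, V [×(j : ℕ)]→L[ℝ] ℂ)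

instance (K : Compacts V) (N : ℕ) : NormedAddCommGroup (JetSpace V K N) :=
  Pi.normedAddCommGroup

instance (K : Compacts V) (N : ℕ) : NormedSpace ℂ (JetSpace V K N) := Pi.normedSpace

instance (K : Compacts V) (N : ℕ) : CompleteSpace (JetSpace V K N) :=
  inferInstanceAs (CompleteSpace (∀ j : Fin (N + 1), C(K, V [×(j : ℕ)]→L[ℝ] ℂ)))

variable (V) in
/-- The smooth complex functions. -/
def smoothFunctions : Submodule ℂ (V → ℂ) where
  carrier := {φ | ContDiff ℝ ∞ φ}
  add_mem' {f g} (h : ContDiff ℝ ∞ f) (h' : ContDiff ℝ ∞ g) := h.add h'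
  zero_mem' := (contDiff_const : ContDiff ℝ ∞ fun _ : V => (0 : ℂ))
  smul_mem' c f (h : ContDiff ℝ ∞ f) := ContDiff.smul (f := fun _ => c) contDiff_const h

lemma contDiff_of_smooth (φ : smoothFunctions V) : ContDiff ℝ ∞ (φ : V → ℂ) := φ.2

lemma contDiffAt_of_smooth (φ : smoothFunctions V) (j : ℕ) (y : V) :
    ContDiffAt ℝ j (φ : V → ℂ) y :=
  ((contDiff_of_smooth φ).of_le (mod_cast le_top)).contDiffAt

/-- The jet of a smooth function over a compact set. -/
def jet (K : Compacts V) (N : ℕ) : smoothFunctions V →ₗ[ℂ] JetSpace V K N where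
  toFun φ j := ⟨fun y => iteratedFDeriv ℝ j (φ : V → ℂ) y,
    ((contDiff_of_smooth φ).continuous_iteratedFDeriv (mod_cast le_top)).comp continuous_subtype_val⟩
  map_add' φ φ' := by
    funext j
    ext1 y
    exact iteratedFDeriv_add_apply (contDiffAt_of_smooth φ _ _) (contDiffAt_of_smooth φ' _ _)
  map_smul' c φ := by
    funext j
    ext1 y
    exact iteratedFDeriv_const_smul_apply (contDiffAt_of_smooth φ _ _)

/-- Evaluation of a jet at a point. -/
def JetSpace.eval (K : Compacts V) (N : ℕ) (j : Fin (N + 1)) (y : K) :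
    JetSpace V K N →L[ℂ] (V [×(j : ℕ)]→L[ℝ] ℂ) :=
  LinearMap.mkContinuous
    { toFun := fun f => f j y
      map_add' := fun _ _ => rfl
      map_smul' := fun _ _ => rfl } 1 fun f => by
    rw [one_mul]
    exact (ContinuousMap.norm_coe_le_norm (f j) y).trans
      (norm_le_pi_norm (f : ∀ j : Fin (N + 1), C(K, V [×(j : ℕ)]→L[ℝ] ℂ)) j)

lemma JetSpace.norm_le {K : Compacts V} {N : ℕ} {f : JetSpace V K N} {b : ℝ} (hb : 0 ≤ b)
    (h : ∀ j y, ‖JetSpace.eval K N j y f‖ ≤ b) : ‖f‖ ≤ b :=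
  (pi_norm_le_iff_of_nonneg (x := (f : ∀ j : Fin (N + 1), C(K, V [×(j : ℕ)]→L[ℝ] ℂ))) hb).2
    fun j => (ContinuousMap.norm_le _ hb).2 fun y => h j y

/-- A linear form on smooth functions that is bounded by the derivatives of order at most `N` on a
compact set is given, on Fourier transforms, by integration against its values on plane waves. -/
lemma exists_fourier_kernel (T : smoothFunctions V →ₗ[ℂ] ℂ) (K : Compacts V)
    (N : ℕ) (C : ℝ)
    (hT : ∀ (φ : smoothFunctions V) (b : ℝ), 0 ≤ b →
      (∀ j ≤ N, ∀ y ∈ K, ‖iteratedFDeriv ℝ j (φ : V → ℂ) y‖ ≤ b) → ‖T φ‖ ≤ C * b) :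
    Continuous (fun η : V => T ⟨wave η, contDiff_wave η⟩) ∧
    (∃ C' : ℝ, ∀ η : V, ‖T ⟨wave η, contDiff_wave η⟩‖ ≤ C' * (1 + ‖η‖) ^ N) ∧
    ∀ (a : 𝓢(V, ℂ)) (ha : ContDiff ℝ ∞ (𝓕 (a : V → ℂ))),
      T ⟨𝓕 (a : V → ℂ), ha⟩ = ∫ η, a η * T ⟨wave η, contDiff_wave η⟩ := by
  have hbound : ∀ φ : smoothFunctions V, ‖T φ‖ ≤ C * ‖jet K N φ‖ := fun φ => by
    refine hT φ _ (norm_nonneg _) fun j hj y hy => ?_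
    refine le_trans (b := ‖JetSpace.eval K N ⟨j, Nat.lt_succ_of_le hj⟩ ⟨y, hy⟩ (jet K N φ)‖)
      le_rfl ((ContinuousLinearMap.le_opNorm _ _).trans ?_)
    exact mul_le_of_le_one_left (norm_nonneg _)
      (LinearMap.mkContinuous_norm_le _ zero_le_one _)
  -- the functional factors through the jets and extends to the Banach space of jets
  obtain ⟨ℓ, hℓ⟩ : ∃ ℓ : JetSpace V K N →L[ℂ] ℂ, ∀ φ, ℓ (jet K N φ) = T φ := by
    have hker : LinearMap.ker (jet K N) ≤ LinearMap.ker T := fun φ hφ => by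
      have := hbound φ
      rw [LinearMap.mem_ker.1 hφ] at this
      simp only [norm_zero, mul_zero] at this
      exact LinearMap.mem_ker.2 (norm_le_zero_iff.1 this)
    let f₀ : LinearMap.range (jet K N) →ₗ[ℂ] ℂ :=
      ((LinearMap.ker (jet K N)).liftQ T hker).comp (jet K N).quotKerEquivRange.symm.toLinearMap
    have hf₀ : ∀ (x : LinearMap.range (jet K N)) φ, jet K N φ = x → f₀ x = T φ := by
      intro x φ h
      have : (jet K N).quotKerEquivRange.symm x = (LinearMap.ker (jet K N)).mkQ φ := by
        rw [LinearEquiv.symm_apply_eq]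
        exact Subtype.ext h.symm
      simp [f₀, this]
    obtain ⟨ℓ, hℓ, -⟩ := exists_extension_norm_eq (LinearMap.range (jet K N))
      (f₀.mkContinuous C fun x => by
        obtain ⟨φ, hφ⟩ := x.2
        rw [hf₀ x φ hφ]
        refine (hbound φ).trans_eq ?_
        rw [hφ]
        rfl)
    refine ⟨ℓ, fun φ => ?_⟩
    have := hℓ ⟨jet K N φ, φ, rfl⟩
    rw [LinearMap.mkContinuous_apply, hf₀ _ φ rfl] at this
    exact this
  let W : V → JetSpace V K N := fun η => jet K N ⟨wave η, contDiff_wave η⟩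
  have hWc : Continuous W := by
    refine continuous_pi fun j => ?_
    have : Continuous fun q : V × K => iteratedFDeriv ℝ (j : ℕ) (wave q.1) (q.2 : V) := by
      simp_rw [iteratedFDeriv_wave]
      refine Continuous.smul (f := fun q : V × K => wave q.1 (q.2 : V)) ?_ ?_
      · simp_rw [wave_apply]
        have : Continuous fun q : V × K => ⟪q.1, (q.2 : V)⟫ :=
          continuous_fst.inner (continuous_subtype_val.comp continuous_snd)
        fun_prop
      · exact (Continuous.fourierPowSMulRight (innerSL ℝ (E := V)) continuous_const j).comp
          continuous_fst
    exact (ContinuousMap.curry ⟨_, this⟩).continuous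
  obtain ⟨C₁, hC₁0, hC₁⟩ : ∃ C₁ : ℝ, 0 ≤ C₁ ∧ ∀ η, ‖W η‖ ≤ C₁ * (1 + ‖η‖) ^ N := by
    refine ⟨(1 + 2 * Real.pi * ‖innerSL ℝ (E := V)‖) ^ N, by positivity, fun η => ?_⟩
    refine JetSpace.norm_le (by positivity) fun j y => ?_
    have hj : (j : ℕ) ≤ N := Nat.lt_succ_iff.1 j.2
    have h0 : 0 ≤ 2 * Real.pi * ‖innerSL ℝ (E := V)‖ := by positivity
    refine (norm_iteratedFDeriv_wave_le η (y : V) j).trans ?_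
    gcongr ?_ * ?_
    · exact (pow_le_pow_left₀ h0 (by linarith) _).trans
        (pow_le_pow_right₀ (by linarith) hj)
    · exact (pow_le_pow_left₀ (norm_nonneg _) (by linarith [norm_nonneg η]) _).trans
        (pow_le_pow_right₀ (by linarith [norm_nonneg η]) hj)
  have hTW : ∀ η, T ⟨wave η, contDiff_wave η⟩ = ℓ (W η) := fun η => (hℓ _).symm
  refine ⟨?_, ⟨‖ℓ‖ * C₁, fun η => ?_⟩, fun a ha => ?_⟩
  · simp_rw [hTW]
    exact ℓ.continuous.comp hWc
  · rw [hTW]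
    refine (ℓ.le_opNorm _).trans ?_
    rw [mul_assoc]
    gcongr
    exact hC₁ η
  · have hint : Integrable fun η => a η • W η := by
      have hI : Integrable (fun η => C₁ * 2 ^ N * (‖a η‖ + ‖η‖ ^ N * ‖a η‖)) :=
        ((a.integrable (μ := volume)).norm.add (a.integrable_pow_mul volume N)).const_mul _
      refine hI.mono' (a.continuous.smul hWc).aestronglyMeasurable
        (Eventually.of_forall fun η => ?_)
      rw [norm_smul]
      have h1 : (1 + ‖η‖) ^ N ≤ 2 ^ N * (1 + ‖η‖ ^ N) := by
        have h2 : (1 + ‖η‖) ^ N ≤ (2 * max 1 ‖η‖) ^ N := by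
          gcongr
          linarith [le_max_left 1 ‖η‖, le_max_right 1 ‖η‖]
        rw [mul_pow] at h2
        refine h2.trans ?_
        gcongr
        rcases max_cases 1 ‖η‖ with h | h
        · rw [h.1, one_pow]; linarith [pow_nonneg (norm_nonneg η) N]
        · rw [h.1]; linarith
      calc ‖a η‖ * ‖W η‖ ≤ ‖a η‖ * (C₁ * (2 ^ N * (1 + ‖η‖ ^ N))) := by
            gcongr
            exact (hC₁ η).trans (by gcongr)
        _ = C₁ * 2 ^ N * (‖a η‖ + ‖η‖ ^ N * ‖a η‖) := by ring
    have hJ : jet K N ⟨𝓕 (a : V → ℂ), ha⟩ = ∫ η, a η • W η := by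
      funext j
      ext1 y
      have := (JetSpace.eval K N j y).integral_comp_comm hint
      refine Eq.trans ?_ this
      exact iteratedFDeriv_fourier a y j
    rw [← hℓ, hJ, ← ℓ.integral_comp_comm hint]
    refine integral_congr_ae (Eventually.of_forall fun η => ?_)
    simp [hTW]

end Kernel


/-! ### Regularity of a distribution off its wavefront set -/

section Bounds

variable {X V : Type*} [NormedAddCommGroup X] [NormedSpace ℝ X] [NormedAddCommGroup V]
  [NormedSpace ℝ V]

lemma IsTest.exists_bound {S : Set X} {χ : X → ℂ} (h : IsTest S χ) (N : ℕ) :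
    ∃ B : ℝ, 0 ≤ B ∧ ∀ j ≤ N, ∀ x, ‖iteratedFDeriv ℝ j χ x‖ ≤ B := by
  have h1 : ∀ j : ℕ, ∃ B : ℝ, ∀ x, ‖iteratedFDeriv ℝ j χ x‖ ≤ B := fun j =>
    (h.1.continuous_iteratedFDeriv (mod_cast le_top)).bounded_above_of_compact_support
      (h.2.1.iteratedFDeriv j)
  choose B hB using h1
  refine ⟨∑ j ∈ Finset.range (N + 1), B j,
    Finset.sum_nonneg fun j _ => (norm_nonneg _).trans (hB j 0), fun j hj x => (hB j x).trans ?_⟩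
  exact Finset.single_le_sum (f := B) (fun j _ => (norm_nonneg _).trans (hB j 0))
    (Finset.mem_range.2 (Nat.lt_succ_of_le hj))

/-- Leibniz bound for the product of a test function and a smooth function. -/
lemma IsTest.exists_mul_bound {S : Set X} {χ : X → ℂ} (h : IsTest S χ) (N : ℕ) :
    ∃ B : ℝ, 0 ≤ B ∧ ∀ φ : X → ℂ, ContDiff ℝ ∞ φ → ∀ (b : ℝ) (x : X), 0 ≤ b →
      (∀ j ≤ N, ‖iteratedFDeriv ℝ j φ x‖ ≤ b) →
      ∀ j ≤ N, ‖iteratedFDeriv ℝ j (χ * φ) x‖ ≤ B * b := by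
  obtain ⟨B, hB0, hB⟩ := h.exists_bound N
  refine ⟨2 ^ N * B, by positivity, fun φ hφ b x hb hx j hj => ?_⟩
  refine (norm_iteratedFDeriv_mul_le h.1 hφ x (n := j) (mod_cast le_top)).trans ?_
  calc ∑ i ∈ Finset.range (j + 1), (j.choose i : ℝ) * ‖iteratedFDeriv ℝ i χ x‖ *
        ‖iteratedFDeriv ℝ (j - i) φ x‖
      ≤ ∑ i ∈ Finset.range (j + 1), (j.choose i : ℝ) * B * b := by
        refine Finset.sum_le_sum fun i hi => ?_
        have hi' : i ≤ j := Nat.lt_succ_iff.1 (Finset.mem_range.1 hi)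
        gcongr
        · exact hB i (hi'.trans hj) x
        · exact hx _ ((Nat.sub_le _ _).trans hj)
    _ = 2 ^ j * B * b := by
        rw [← Finset.sum_mul, ← Finset.sum_mul]
        congr 2
        exact_mod_cast Nat.sum_range_choose j
    _ ≤ 2 ^ N * B * b := by
        gcongr
        norm_num

lemma norm_iteratedFDeriv_comp_clm_le (L : X →L[ℝ] V) {φ : V → ℂ} (hφ : ContDiff ℝ ∞ φ) (x : X)
    (j : ℕ) : ‖iteratedFDeriv ℝ j (φ ∘ L) x‖ ≤ ‖iteratedFDeriv ℝ j φ (L x)‖ * ‖L‖ ^ j := by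
  rw [L.iteratedFDeriv_comp_right hφ x (mod_cast le_top)]
  simpa using ContinuousMultilinearMap.norm_compContinuousLinearMap_le
    (iteratedFDeriv ℝ j φ (L x)) fun _ => L

end Bounds

section Regularity

open scoped FourierTransform RealInnerProductSpace SchwartzMap

variable {X : Type*} [NormedAddCommGroup X] [NormedSpace ℝ X]
variable {V : Type*} [NormedAddCommGroup V] [InnerProductSpace ℝ V] [FiniteDimensional ℝ V]
  [MeasurableSpace V] [BorelSpace V]

variable {Ω : Opens X} (u : Distr Ω)

/-- The localized Fourier transform of a distribution in the directions of `L`: it is continuous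
and polynomially bounded, and it computes the pairings with functions of `L x`. -/
lemma pair_fourier {χ : X → ℂ} (hχ : IsTest (Ω : Set X) χ) (L : X →L[ℝ] V) :
    Continuous (fun η : V => pair u (χ * fun x => wave η (L x))) ∧
    (∃ (C : ℝ) (N : ℕ), ∀ η : V, ‖pair u (χ * fun x => wave η (L x))‖ ≤ C * (1 + ‖η‖) ^ N) ∧
    ∀ a : 𝓢(V, ℂ), pair u (χ * fun x => 𝓕 (a : V → ℂ) (L x)) =
      ∫ η, a η * pair u (χ * fun x => wave η (L x)) := by
  obtain ⟨N, C, hC0, hC⟩ := exists_order_bound u hχ.2.1 hχ.2.2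
  obtain ⟨B, hB0, hB⟩ := hχ.exists_mul_bound N
  have hcomp : ∀ φ : smoothFunctions V, ContDiff ℝ ∞ fun x => (φ : V → ℂ) (L x) := fun φ =>
    (contDiff_of_smooth φ).comp L.contDiff
  have htest : ∀ φ : smoothFunctions V,
      IsTest (Ω : Set X) (χ * fun x => (φ : V → ℂ) (L x)) := fun φ => hχ.mul_right (hcomp φ)
  let T : smoothFunctions V →ₗ[ℂ] ℂ :=
    { toFun := fun φ => pair u (χ * fun x => (φ : V → ℂ) (L x))
      map_add' := fun φ φ' => by
        rw [← pair_add u (htest φ) (htest φ')]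
        congr 1
        funext x
        simp [mul_add]
      map_smul' := fun c φ => by
        rw [RingHom.id_apply, smul_eq_mul, ← pair_smul u (htest φ)]
        congr 1
        funext x
        simp only [Submodule.coe_smul, Pi.mul_apply, Pi.smul_apply, smul_eq_mul]
        ring }
  let K : Compacts V := ⟨L '' tsupport χ, hχ.2.1.isCompact.image L.continuous⟩
  have hT : ∀ (φ : smoothFunctions V) (b : ℝ), 0 ≤ b →
      (∀ j ≤ N, ∀ y ∈ K, ‖iteratedFDeriv ℝ j (φ : V → ℂ) y‖ ≤ b) →
      ‖T φ‖ ≤ (C * (B * (1 + ‖L‖) ^ N)) * b := by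
    intro φ b hb hbound
    have := hC (χ * fun x => (φ : V → ℂ) (L x)) (B * ((1 + ‖L‖) ^ N * b))
      ((htest φ).of_tsupport tsupport_mul_subset_left) (by positivity) fun j hj x hx =>
        hB _ (hcomp φ) _ x (by positivity) (fun i hi => ?_) j hj
    · refine this.trans_eq (by ring)
    · refine (norm_iteratedFDeriv_comp_clm_le L (contDiff_of_smooth φ) x i).trans ?_
      rw [mul_comm]
      gcongr
      · exact (pow_le_pow_left₀ (norm_nonneg _) (by linarith) _).trans
          (pow_le_pow_right₀ (by linarith [norm_nonneg L]) hi)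
      · exact hbound i hi _ ⟨x, hx, rfl⟩
  obtain ⟨h1, ⟨C', h2⟩, h3⟩ := exists_fourier_kernel T K N _ hT
  refine ⟨h1, ⟨C', N, h2⟩, fun a => ?_⟩
  have ha : ContDiff ℝ ∞ (𝓕 (a : V → ℂ)) := by
    rw [← SchwartzMap.fourier_coe]
    exact (𝓕 a).smooth ⊤
  exact h3 a ha

lemma integrable_schwartz_mul_pow (a : 𝓢(V, ℂ)) (K : ℕ) :
    Integrable fun η => ‖a η‖ * (1 + ‖η‖) ^ K := by
  have h : (fun η => ‖a η‖ * (1 + ‖η‖) ^ K) = fun η =>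
      ∑ i ∈ Finset.range (K + 1), (K.choose i : ℝ) * (‖η‖ ^ i * ‖a η‖) := by
    funext η
    rw [add_comm, add_pow, Finset.mul_sum]
    refine Finset.sum_congr rfl fun i _ => ?_
    rw [one_pow]
    ring
  rw [h]
  exact integrable_finsetSum _ fun i _ => (a.integrable_pow_mul volume i).const_mul _

/-- If the localized Fourier transform in the directions of `L` is rapidly decreasing, the localized
distribution acts on functions of `L x` as a smooth density. -/
lemma exists_density {χ : X → ℂ} (hχ : IsTest (Ω : Set X) χ) (L : X →L[ℝ] V)
    (h : ∀ N : ℕ, ∃ C : ℝ, ∀ η : V,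
      (1 + ‖η‖) ^ N * ‖pair u (χ * fun x => wave η (L x))‖ ≤ C) :
    ∃ f : V → ℂ, ContDiff ℝ ∞ f ∧ ∀ b : V → ℂ, IsTest univ b →
      pair u (χ * fun x => b (L x)) = ∫ y, b y * f y := by
  obtain ⟨hF, -, hker⟩ := pair_fourier u hχ L
  set F : V → ℂ := fun η => pair u (χ * fun x => wave η (L x)) with hFdef
  have hint : ∀ n : ℕ, Integrable fun η => ‖η‖ ^ n * ‖F η‖ := by
    intro n
    obtain ⟨C, hC⟩ := h (n + (Module.finrank ℝ V + 1))
    have h1 : Integrable fun η : V => C * (1 + ‖η‖) ^ (-(Module.finrank ℝ V + 1 : ℝ)) :=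
      (integrable_one_add_norm (by linarith)).const_mul C
    refine h1.mono' ((continuous_norm.pow n).mul hF.norm).aestronglyMeasurable
      (Eventually.of_forall fun η => ?_)
    have hp : 0 < 1 + ‖η‖ := by positivity
    rw [Real.norm_of_nonneg (by positivity), Real.rpow_neg hp.le, ← div_eq_mul_inv,
      le_div_iff₀ (by positivity)]
    refine le_trans ?_ (hC η)
    have : (1 + ‖η‖) ^ ((Module.finrank ℝ V : ℝ) + 1) =
        (1 + ‖η‖) ^ (Module.finrank ℝ V + 1) := by
      rw [← Real.rpow_natCast]; norm_num
    rw [this]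
    calc ‖η‖ ^ n * ‖F η‖ * (1 + ‖η‖) ^ (Module.finrank ℝ V + 1)
        ≤ (1 + ‖η‖) ^ n * ‖F η‖ * (1 + ‖η‖) ^ (Module.finrank ℝ V + 1) := by
          gcongr
          linarith
      _ = (1 + ‖η‖) ^ (n + (Module.finrank ℝ V + 1)) * ‖F η‖ := by ring
  have hintneg : ∀ n : ℕ, Integrable fun η => ‖η‖ ^ n * ‖F (-η)‖ := fun n => by
    simpa using (hint n).comp_neg
  refine ⟨𝓕 fun η => F (-η), Real.contDiff_fourier fun n _ => hintneg n, fun b hb => ?_⟩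
  let b' : 𝓢(V, ℂ) := hb.2.1.toSchwartzMap hb.1
  have hb' : (b' : V → ℂ) = b := rfl
  have h2 := hker (𝓕⁻ b')
  have h3 : 𝓕 ((𝓕⁻ b' : 𝓢(V, ℂ)) : V → ℂ) = b := by
    rw [← SchwartzMap.fourier_coe, FourierTransform.fourier_fourierInv_eq]
    exact hb'
  rw [h3] at h2
  rw [h2]
  have h4 : ∫ η, (𝓕⁻ b') η * F η = ∫ η, 𝓕 b η * F (-η) := by
    rw [← integral_neg_eq_self]
    refine integral_congr_ae (Eventually.of_forall fun η => ?_)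
    simp only [SchwartzMap.fourierInv_coe, Real.fourierInv_eq_fourier_neg, neg_neg, hb']
  rw [h4]
  have hFi : Integrable fun η => F (-η) := by
    have := hintneg 0
    simp only [pow_zero, one_mul] at this
    exact (integrable_norm_iff (hF.comp continuous_neg).aestronglyMeasurable).1 this
  have h5 := VectorFourier.integral_fourierIntegral_smul_eq_flip (𝕜 := ℝ) (e := Real.fourierChar)
    (μ := (volume : Measure V)) (ν := (volume : Measure V)) (L := innerₗ V)
    (f := b) (g := fun η => F (-η)) Real.continuous_fourierChar continuous_inner
    (hb.1.continuous.integrable_of_hasCompactSupport hb.2.1) hFi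
  rw [flip_innerₗ] at h5
  exact h5

variable [FiniteDimensional ℝ X]

/-- The localized Fourier transform of `u` at the covector `ξ`, in the normalization of the
wavefront set. -/
def localFourier (χ : X → ℂ) (ξ : X →L[ℝ] ℝ) : ℂ :=
  pair u fun y => χ y * Complex.exp (-(Complex.I * (ξ y : ℂ)))

/-- Rapid decrease of the localized Fourier transform on a set of covectors. -/
def RapidOn (χ : X → ℂ) (Γ : Set (X →L[ℝ] ℝ)) : Prop :=
  ∀ N : ℕ, ∃ C : ℝ, ∀ ξ ∈ Γ, (1 + ‖ξ‖) ^ N * ‖localFourier u χ ξ‖ ≤ C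

/-- The covector `ξ` with `exp (-i ξ) = wave η ∘ L`. -/
def waveCovector (L : X →L[ℝ] V) : V →ₗ[ℝ] (X →L[ℝ] ℝ) where
  toFun η := (2 * Real.pi) • (innerSL ℝ η).comp L
  map_add' η η' := by simp
  map_smul' c η := by ext x; simp; ring

lemma waveCovector_apply (L : X →L[ℝ] V) (η : V) (x : X) :
    waveCovector L η x = 2 * Real.pi * ⟪η, L x⟫ := by simp [waveCovector]

lemma wave_eq_exp (L : X →L[ℝ] V) (η : V) (x : X) :
    wave η (L x) = Complex.exp (-(Complex.I * (waveCovector L η x : ℂ))) := by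
  rw [wave_apply, waveCovector_apply]

lemma contDiff_exp_covector (ξ : X →L[ℝ] ℝ) :
    ContDiff ℝ ∞ fun y => Complex.exp (-(Complex.I * (ξ y : ℂ))) :=
  ((contDiff_const.mul (Complex.ofRealCLM.contDiff.comp ξ.contDiff)).neg).cexp

lemma pair_wave (χ : X → ℂ) (L : X →L[ℝ] V) (η : V) :
    pair u (χ * fun x => wave η (L x)) = localFourier u χ (waveCovector L η) := by
  unfold localFourier
  congr 1
  funext x
  simp [wave_eq_exp]

lemma waveCovector_injective {L : X →L[ℝ] V} (hL : Function.Surjective L) :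
    Function.Injective (waveCovector L) := by
  refine (injective_iff_map_eq_zero _).2 fun η h => ?_
  obtain ⟨x, hx⟩ := hL η
  have := waveCovector_apply L η x
  rw [h, hx] at this
  simpa [Real.pi_ne_zero] using this.symm

/-- Multiplication of the cut-off by a smooth function preserves rapid decrease in slightly smaller
cones. -/
lemma RapidOn.mul {χ ψ : X → ℂ} (hχ : IsTest (Ω : Set X) χ) (hψ : IsTest univ ψ)
    {Γ : Set (X →L[ℝ] ℝ)} (hcone : ∀ ξ ∈ Γ, ∀ t : ℝ, 0 < t → t • ξ ∈ Γ)
    {ξ₀ : X →L[ℝ] ℝ} {r : ℝ} (hr : 0 < r) (hball : Metric.ball ξ₀ r ⊆ Γ) (h : RapidOn u χ Γ) :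
    RapidOn u (χ * ψ) {ξ | ∃ t : ℝ, 0 < t ∧ t • ξ ∈ Metric.ball ξ₀ (r / 2)} := by
  let W := EuclideanSpace ℝ (Fin (Module.finrank ℝ X))
  let L : X ≃L[ℝ] W := toEuclidean
  let L' : X →L[ℝ] W := L
  -- the smooth factor as a Fourier transform
  have hψ' : IsTest univ (ψ ∘ L.symm) :=
    ⟨hψ.1.comp L.symm.contDiff, hψ.2.1.comp_homeomorph L.symm.toHomeomorph, subset_univ _⟩
  let b : 𝓢(W, ℂ) := hψ'.2.1.toSchwartzMap hψ'.1
  let a : 𝓢(W, ℂ) := 𝓕⁻ b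
  have ha : 𝓕 (a : W → ℂ) = ψ ∘ L.symm := by
    rw [← SchwartzMap.fourier_coe, FourierTransform.fourier_fourierInv_eq]
    rfl
  have hshift : ∀ ξ η, localFourier u χ (ξ + waveCovector L' η) =
      pair u ((χ * fun y => Complex.exp (-(Complex.I * (ξ y : ℂ)))) * fun x => wave η (L' x)) := by
    intro ξ η
    unfold localFourier
    congr 1
    funext x
    simp only [Pi.mul_apply, wave_eq_exp, mul_assoc, ← Complex.exp_add, add_apply]
    congr 2
    push_cast
    ring
  have hconv : ∀ ξ, localFourier u (χ * ψ) ξ =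
      ∫ η, a η * localFourier u χ (ξ + waveCovector L' η) := by
    intro ξ
    have h1 := (pair_fourier u (hχ.mul_right (contDiff_exp_covector ξ)) L').2.2 a
    simp_rw [hshift]
    rw [← h1, ha]
    unfold localFourier
    congr 1
    funext x
    simp only [Pi.mul_apply, Function.comp_apply]
    have : L.symm (L' x) = x := L.symm_apply_apply x
    rw [this]
    ring
  -- the polynomial bound of the localized Fourier transform
  obtain ⟨C₀, M, hC₀⟩ := (pair_fourier u hχ L').2.1
  have hLs : Function.Surjective (waveCovector L') := by
    have hinj := waveCovector_injective (L := L') L.surjective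
    refine (LinearMap.injective_iff_surjective_of_finrank_eq_finrank ?_).1 hinj
    have h1 : Module.finrank ℝ (X →L[ℝ] ℝ) = Module.finrank ℝ (X →ₗ[ℝ] ℝ) :=
      (LinearMap.toContinuousLinearMap (𝕜 := ℝ) (E := X) (F' := ℝ)).finrank_eq.symm
    rw [h1, Module.finrank_linearMap_self]
    simp [W]
  obtain ⟨k, hk, hanti⟩ := (waveCovector L').exists_antilipschitzWith
    (LinearMap.ker_eq_bot.2 (waveCovector_injective L.surjective))
  obtain ⟨m, hm0, hm⟩ : ∃ m : ℝ, 0 ≤ m ∧ ∀ η, ‖waveCovector L' η‖ ≤ m * ‖η‖ :=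
    ⟨‖LinearMap.toContinuousLinearMap (waveCovector L')‖,
      norm_nonneg (LinearMap.toContinuousLinearMap (waveCovector L')),
      (LinearMap.toContinuousLinearMap (waveCovector L')).le_opNorm⟩
  have hC₀n : 0 ≤ C₀ := by
    have := (norm_nonneg _).trans (hC₀ 0)
    simpa using this
  have hpoly : ∀ ξ, ‖localFourier u χ ξ‖ ≤ C₀ * (1 + k) ^ M * (1 + ‖ξ‖) ^ M := by
    intro ξ
    obtain ⟨η, rfl⟩ := hLs ξ
    rw [← pair_wave, mul_assoc, ← mul_pow]
    refine (hC₀ η).trans ?_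
    have h1 : ‖η‖ ≤ k * ‖waveCovector L' η‖ := by
      simpa using hanti.le_mul_dist η 0
    have hk' : (0 : ℝ) ≤ k := k.2
    gcongr
    nlinarith [norm_nonneg (waveCovector L' η)]
  intro N
  obtain ⟨C₁, hC₁⟩ := h N
  set c : ℝ := min (1 / 2) (r / (2 * (‖ξ₀‖ + r))) with hc
  have hc0 : 0 < c := lt_min (by norm_num) (by positivity)
  have hc1 : c ≤ 1 / 2 := min_le_left _ _
  let C₂ : ℝ := 2 ^ N * |C₁| + (1 + m / c) ^ N * (C₀ * (1 + k) ^ M * (1 + m / c + m) ^ M)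
  have key : ∀ ξ ∈ {ξ : X →L[ℝ] ℝ | ∃ t : ℝ, 0 < t ∧ t • ξ ∈ Metric.ball ξ₀ (r / 2)}, ∀ η : W,
      (1 + ‖ξ‖) ^ N * ‖localFourier u χ (ξ + waveCovector L' η)‖ ≤ C₂ * (1 + ‖η‖) ^ (N + M) := by
    rintro ξ ⟨t, ht, hξ⟩ η
    have hη1 : 1 ≤ 1 + ‖η‖ := by linarith [norm_nonneg η]
    have hmk : (0 : ℝ) ≤ k := k.2
    by_cases hsmall : ‖waveCovector L' η‖ ≤ c * ‖ξ‖
    · have hmem : ξ + waveCovector L' η ∈ Γ := by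
        have h1 : t • (ξ + waveCovector L' η) ∈ Γ := by
          refine hball ?_
          rw [Metric.mem_ball, dist_eq_norm] at hξ ⊢
          have hn : ‖t • ξ‖ ≤ ‖ξ₀‖ + r := by
            calc ‖t • ξ‖ = ‖(t • ξ - ξ₀) + ξ₀‖ := by rw [sub_add_cancel]
              _ ≤ ‖t • ξ - ξ₀‖ + ‖ξ₀‖ := norm_add_le _ _
              _ ≤ ‖ξ₀‖ + r := by linarith
          have h2 : ‖t • waveCovector L' η‖ ≤ r / 2 := by
            rw [norm_smul] at hn ⊢
            calc ‖t‖ * ‖waveCovector L' η‖ ≤ ‖t‖ * (c * ‖ξ‖) := by gcongr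
              _ = c * (‖t‖ * ‖ξ‖) := by ring
              _ ≤ c * (‖ξ₀‖ + r) := by gcongr
              _ ≤ r / (2 * (‖ξ₀‖ + r)) * (‖ξ₀‖ + r) := by
                  gcongr
                  exact min_le_right _ _
              _ = r / 2 := by
                  have : ‖ξ₀‖ + r ≠ 0 := by positivity
                  field_simp
          calc ‖t • (ξ + waveCovector L' η) - ξ₀‖
              = ‖(t • ξ - ξ₀) + t • waveCovector L' η‖ := by rw [smul_add]; congr 1; abel
            _ ≤ ‖t • ξ - ξ₀‖ + ‖t • waveCovector L' η‖ := norm_add_le _ _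
            _ < r := by linarith
        have h2 := hcone _ h1 t⁻¹ (inv_pos.2 ht)
        rwa [smul_smul, inv_mul_cancel₀ ht.ne', one_smul] at h2
      have h1 := hC₁ _ hmem
      have h2 : 1 + ‖ξ‖ ≤ 2 * (1 + ‖ξ + waveCovector L' η‖) := by
        have : ‖ξ‖ ≤ ‖ξ + waveCovector L' η‖ + ‖waveCovector L' η‖ := by
          simpa using norm_sub_le (ξ + waveCovector L' η) (waveCovector L' η)
        have h3 : c * ‖ξ‖ ≤ 1 / 2 * ‖ξ‖ := by gcongr
        linarith
      calc (1 + ‖ξ‖) ^ N * ‖localFourier u χ (ξ + waveCovector L' η)‖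
          ≤ (2 * (1 + ‖ξ + waveCovector L' η‖)) ^ N *
            ‖localFourier u χ (ξ + waveCovector L' η)‖ := by gcongr
        _ = 2 ^ N * ((1 + ‖ξ + waveCovector L' η‖) ^ N *
            ‖localFourier u χ (ξ + waveCovector L' η)‖) := by rw [mul_pow]; ring
        _ ≤ 2 ^ N * |C₁| := by
            gcongr
            exact h1.trans (le_abs_self _)
        _ ≤ C₂ := le_add_of_nonneg_right (by positivity)
        _ ≤ C₂ * (1 + ‖η‖) ^ (N + M) :=
            le_mul_of_one_le_right (by positivity) (one_le_pow₀ hη1)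
    · push Not at hsmall
      have h1 : ‖ξ‖ ≤ m / c * ‖η‖ := by
        have := hsmall.le.trans (hm η)
        rw [div_mul_eq_mul_div, le_div_iff₀ hc0]
        linarith
      have hmc : 0 ≤ m / c := by positivity
      have h2 : 1 + ‖ξ‖ ≤ (1 + m / c) * (1 + ‖η‖) := by nlinarith [norm_nonneg η]
      have h3 : 1 + ‖ξ + waveCovector L' η‖ ≤ (1 + m / c + m) * (1 + ‖η‖) := by
        have := norm_add_le ξ (waveCovector L' η)
        nlinarith [norm_nonneg η, hm η]
      calc (1 + ‖ξ‖) ^ N * ‖localFourier u χ (ξ + waveCovector L' η)‖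
          ≤ ((1 + m / c) * (1 + ‖η‖)) ^ N *
            (C₀ * (1 + k) ^ M * ((1 + m / c + m) * (1 + ‖η‖)) ^ M) := by
            gcongr
            exact (hpoly _).trans (by gcongr)
        _ = (1 + m / c) ^ N * (C₀ * (1 + k) ^ M * (1 + m / c + m) ^ M) *
            (1 + ‖η‖) ^ (N + M) := by
            rw [mul_pow, mul_pow, pow_add]; ring
        _ ≤ C₂ * (1 + ‖η‖) ^ (N + M) := by
            gcongr
            exact le_add_of_nonneg_left (by positivity)
  refine ⟨∫ η, C₂ * (‖a η‖ * (1 + ‖η‖) ^ (N + M)), fun ξ hξ => ?_⟩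
  rw [hconv]
  calc (1 + ‖ξ‖) ^ N * ‖∫ η, a η * localFourier u χ (ξ + waveCovector L' η)‖
      = ‖∫ η, (((1 + ‖ξ‖) ^ N : ℝ) : ℂ) * (a η * localFourier u χ (ξ + waveCovector L' η))‖ := by
        rw [integral_const_mul, norm_mul, Complex.norm_real, Real.norm_of_nonneg (by positivity)]
    _ ≤ ∫ η, C₂ * (‖a η‖ * (1 + ‖η‖) ^ (N + M)) := by
        refine norm_integral_le_of_norm_le ((integrable_schwartz_mul_pow a _).const_mul _)
          (Eventually.of_forall fun η => ?_)
        rw [norm_mul, norm_mul, Complex.norm_real, Real.norm_of_nonneg (by positivity)]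
        calc (1 + ‖ξ‖) ^ N * (‖a η‖ * ‖localFourier u χ (ξ + waveCovector L' η)‖)
            = ‖a η‖ * ((1 + ‖ξ‖) ^ N * ‖localFourier u χ (ξ + waveCovector L' η)‖) := by ring
          _ ≤ ‖a η‖ * (C₂ * (1 + ‖η‖) ^ (N + M)) :=
            mul_le_mul_of_nonneg_left (key ξ hξ η) (norm_nonneg _)
          _ = C₂ * (‖a η‖ * (1 + ‖η‖) ^ (N + M)) := by ring

/-- Near a point at which no covector `⟪η, L ·⟫` belongs to the wavefront set, a distribution acts
on functions of `L x` as a smooth density. -/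
lemma exists_density_of_waveFront {q : X} (hq : q ∈ Ω) {L : X →L[ℝ] V}
    (hL : Function.Surjective L)
    (hWF : ∀ η : V, η ≠ 0 → (q, waveCovector L η) ∉ waveFront u) :
    ∃ O : Set X, IsOpen O ∧ q ∈ O ∧ O ⊆ Ω ∧ ∀ χ, IsTest O χ →
      ∃ f : V → ℂ, ContDiff ℝ ∞ f ∧ ∀ b : V → ℂ, IsTest univ b →
        pair u (χ * fun x => b (L x)) = ∫ y, b y * f y := by
  have hinj := waveCovector_injective hL
  have h1 : ∀ η : V, η ≠ 0 → ∃ (χ : X → ℂ) (r : ℝ) (Γ : Set (X →L[ℝ] ℝ)),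
      IsTest (Ω : Set X) χ ∧ χ q ≠ 0 ∧ 0 < r ∧ Metric.ball (waveCovector L η) r ⊆ Γ ∧
      (∀ ξ ∈ Γ, ∀ t : ℝ, 0 < t → t • ξ ∈ Γ) ∧ RapidOn u χ Γ := by
    intro η hη
    have h := hWF η hη
    have h0 : waveCovector L η ≠ 0 := fun h => hη (hinj (h.trans (map_zero _).symm))
    have h' : ¬ (_ ∧ _ ∧ ¬ _) := h
    rw [not_and, not_and, not_not] at h'
    obtain ⟨χ, hχ, hχq, Γ, hΓ, hη', hcone, hrap⟩ := h' hq h0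
    obtain ⟨r, hr, hball⟩ := Metric.isOpen_iff.1 hΓ _ hη'
    exact ⟨χ, r, Γ, hχ, hχq, hr, hball, hcone, hrap⟩
  choose! χ r Γ hχ hχq hr hball hcone hrap using h1
  -- finitely many cones suffice
  have hcont : Continuous (waveCovector L) := LinearMap.continuous_of_finiteDimensional _
  obtain ⟨t, ht, hcov⟩ := (isCompact_sphere (0 : V) 1).elim_nhds_subcover
    (fun η => waveCovector L ⁻¹' Metric.ball (waveCovector L η) (r η / 2)) fun η hη =>
      (Metric.isOpen_ball.preimage hcont).mem_nhds (Metric.mem_ball_self (half_pos (hr η (by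
        rintro rfl; simp at hη))))
  have ht0 : ∀ η ∈ t, η ≠ 0 := fun η hη h => by
    have := ht η hη
    rw [h] at this
    simp at this
  refine ⟨(Ω : Set X) ∩ ⋂ η ∈ t, {x | χ η x ≠ 0}, ?_, ?_, inter_subset_left, ?_⟩
  · exact Ω.isOpen.inter (isOpen_biInter_finset fun η hη =>
      isOpen_ne_fun (hχ η (ht0 η hη)).1.continuous continuous_const)
  · exact ⟨hq, mem_iInter₂.2 fun η hη => hχq η (ht0 η hη)⟩
  intro χ' hχ'
  refine exists_density u (hχ'.mono inter_subset_left) L fun N => ?_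
  have h2 : ∀ η ∈ t, ∃ C : ℝ, ∀ ξ, (∃ s : ℝ, 0 < s ∧
      s • ξ ∈ Metric.ball (waveCovector L η) (r η / 2)) →
      (1 + ‖ξ‖) ^ N * ‖localFourier u χ' ξ‖ ≤ C := by
    intro η hη
    have hη0 := ht0 η hη
    have hsub : tsupport χ' ⊆ {x | χ η x ≠ 0} := fun x hx =>
      mem_iInter₂.1 (hχ'.2.2 hx).2 η hη
    have hdiv : IsTest univ fun x => χ' x / χ η x := by
      refine (IsTest.of_contDiffOn hχ'.2.1.isCompact
        (isOpen_ne_fun (hχ η hη0).1.continuous continuous_const) hsub ?_ fun x hx => ?_).mono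
        (subset_univ _)
      · simp_rw [div_eq_mul_inv]
        exact hχ'.1.contDiffOn.mul ((hχ η hη0).1.contDiffOn.inv fun x hx => hx)
      · rw [image_eq_zero_of_notMem_tsupport hx, zero_div]
    have heq : χ η * (fun x => χ' x / χ η x) = χ' := by
      funext x
      simp only [Pi.mul_apply]
      by_cases hx : x ∈ tsupport χ'
      · have := hsub hx
        exact mul_div_cancel₀ _ this
      · rw [image_eq_zero_of_notMem_tsupport hx, zero_div, mul_zero]
    have := RapidOn.mul u (hχ η hη0) hdiv (hcone η hη0) (hr η hη0) (hball η hη0) (hrap η hη0) N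
    rwa [heq] at this
  choose! C hC using h2
  obtain ⟨K, hK, hanti⟩ := (waveCovector L).exists_antilipschitzWith (LinearMap.ker_eq_bot.2 hinj)
  refine ⟨max (‖pair u (χ' * fun x => wave (0 : V) (L x))‖)
    (∑ η ∈ t, (1 + (K : ℝ)) ^ N * |C η|), fun η => ?_⟩
  by_cases hη : η = 0
  · subst hη
    simp
  refine le_trans ?_ (le_max_right _ _)
  have hn : ‖η‖ ≠ 0 := norm_ne_zero_iff.2 hη
  have hmem := hcov (show ‖η‖⁻¹ • η ∈ Metric.sphere (0 : V) 1 by simp [norm_smul, hn])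
  obtain ⟨η', hη', hmem⟩ := mem_iUnion₂.1 hmem
  have h3 := hC η' hη' (waveCovector L η) ⟨‖η‖⁻¹, by positivity, by
    rw [← map_smul]; exact hmem⟩
  rw [pair_wave]
  have h4 : ‖η‖ ≤ K * ‖waveCovector L η‖ := by simpa using hanti.le_mul_dist η 0
  have hK0 : (0 : ℝ) ≤ K := K.2
  have h5 : 1 + ‖η‖ ≤ (1 + K) * (1 + ‖waveCovector L η‖) := by
    nlinarith [norm_nonneg (waveCovector L η)]
  calc (1 + ‖η‖) ^ N * ‖localFourier u χ' (waveCovector L η)‖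
      ≤ ((1 + K) * (1 + ‖waveCovector L η‖)) ^ N *
        ‖localFourier u χ' (waveCovector L η)‖ := by gcongr
    _ = (1 + K) ^ N * ((1 + ‖waveCovector L η‖) ^ N *
        ‖localFourier u χ' (waveCovector L η)‖) := by rw [mul_pow]; ring
    _ ≤ (1 + K) ^ N * |C η'| := by
        gcongr
        exact h3.trans (le_abs_self _)
    _ ≤ ∑ η ∈ t, (1 + (K : ℝ)) ^ N * |C η| :=
        Finset.single_le_sum (f := fun η => (1 + (K : ℝ)) ^ N * |C η|)
          (fun i _ => by positivity) hη'

end Regularity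


/-! ### Smooth dependence of integrals on parameters, and Taylor expansions -/

section Parametric

variable {X G : Type} [NormedAddCommGroup X] [NormedSpace ℝ X] [FiniteDimensional ℝ X]
  [NormedAddCommGroup G] [NormedSpace ℝ G]

lemma hasFDerivAt_intervalIntegral_param {F : X × ℝ → G} (hF : ContDiff ℝ 1 F) (a b : ℝ) (x₀ : X) :
    HasFDerivAt (fun x => ∫ t in a..b, F (x, t))
      (∫ t in a..b, (fderiv ℝ F (x₀, t)).comp (ContinuousLinearMap.inl ℝ X ℝ)) x₀ := by
  let F' : X → ℝ → X →L[ℝ] G := fun x t => (fderiv ℝ F (x, t)).comp (ContinuousLinearMap.inl ℝ X ℝ)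
  have hF'c : Continuous fun q : X × ℝ => F' q.1 q.2 :=
    (hF.continuous_fderiv one_ne_zero).clm_comp continuous_const
  obtain ⟨B, hB⟩ := ((isCompact_closedBall x₀ 1).prod isCompact_uIcc).bddAbove_image
    (f := fun q : X × ℝ => ‖F' q.1 q.2‖) (K := Metric.closedBall x₀ 1 ×ˢ uIcc a b)
    hF'c.norm.continuousOn
  refine intervalIntegral.hasFDerivAt_integral_of_dominated_of_fderiv_le (F' := F')
    (bound := fun _ => B) (Metric.closedBall_mem_nhds x₀ one_pos) ?_ ?_ ?_ ?_ ?_ ?_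
  · refine Eventually.of_forall fun x => Continuous.aestronglyMeasurable ?_
    exact hF.continuous.comp (by fun_prop)
  · exact (hF.continuous.comp (by fun_prop : Continuous fun t : ℝ => (x₀, t))).intervalIntegrable _ _
  · exact (hF'c.comp (by fun_prop : Continuous fun t : ℝ => (x₀, t))).aestronglyMeasurable
  · refine Eventually.of_forall fun t ht x hx => hB ?_
    exact ⟨(x, t), ⟨hx, uIoc_subset_uIcc ht⟩, rfl⟩
  · simp
  · refine Eventually.of_forall fun t _ x _ => ?_
    have h1 : HasFDerivAt F (fderiv ℝ F (x, t)) (x, t) :=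
      (hF.differentiable one_ne_zero _).hasFDerivAt
    exact h1.comp x (hasFDerivAt_prodMk_left x t)

end Parametric

/-- Smooth dependence of an integral on parameters. -/
lemma contDiff_intervalIntegral_param {X : Type} [NormedAddCommGroup X] [NormedSpace ℝ X]
    [FiniteDimensional ℝ X] {G : Type} [NormedAddCommGroup G] [NormedSpace ℝ G]
    {F : X × ℝ → G} (hF : ContDiff ℝ ∞ F) (a b : ℝ) :
    ContDiff ℝ ∞ fun x => ∫ t in a..b, F (x, t) := by
  rw [contDiff_infty]
  intro n
  induction n generalizing G with
  | zero =>
    have : Differentiable ℝ fun x => ∫ t in a..b, F (x, t) := fun x =>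
      (hasFDerivAt_intervalIntegral_param (hF.of_le (mod_cast le_top)) a b x).differentiableAt
    exact_mod_cast contDiff_zero.2 this.continuous
  | succ n ih =>
    have h1 := fun x => hasFDerivAt_intervalIntegral_param (hF.of_le (mod_cast le_top)) a b x
    rw [show ((n + 1 : ℕ) : WithTop ℕ∞) = (n : WithTop ℕ∞) + 1 from by push_cast; rfl,
      contDiff_succ_iff_hasFDerivAt]
    refine ⟨_, ih (F := fun q : X × ℝ => (fderiv ℝ F q).comp (ContinuousLinearMap.inl ℝ X ℝ)) ?_, h1⟩
    exact (hF.fderiv_right (m := ∞) (mod_cast le_top)).clm_comp contDiff_const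

section Taylor

variable {V : Type} [NormedAddCommGroup V] [NormedSpace ℝ V] [FiniteDimensional ℝ V]

/-- The derivation `∂_v + s ∂_w` of complex functions. -/
def dirDeriv (s : ℂ) (v w : V) (g : V → ℂ) : V → ℂ := fun z =>
  fderiv ℝ g z v + s * fderiv ℝ g z w

lemma contDiff_dirDeriv {g : V → ℂ} (hg : ContDiff ℝ ∞ g) (s : ℂ) (v w : V) :
    ContDiff ℝ ∞ (dirDeriv s v w g) := by
  have h := hg.fderiv_right (m := ∞) (mod_cast le_top)
  exact (h.clm_apply contDiff_const).add (contDiff_const.mul (h.clm_apply contDiff_const))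

lemma IsTest.dirDeriv {S : Set V} {g : V → ℂ} (h : IsTest S g) (s : ℂ) (v w : V) :
    IsTest S (dirDeriv s v w g) := by
  have hs : tsupport (ClosedOrbit.dirDeriv s v w g) ⊆ tsupport g := by
    refine closure_minimal (fun x hx => by_contra fun h' => hx ?_) (isClosed_tsupport _)
    have : fderiv ℝ g x = 0 := by
      by_contra h0
      exact h' (support_fderiv_subset ℝ h0)
    simp [ClosedOrbit.dirDeriv, this]
  exact ⟨contDiff_dirDeriv h.1 s v w, h.2.1.of_isClosed_subset (isClosed_tsupport _) hs,
    hs.trans h.2.2⟩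

variable {ι : Type} [Fintype ι] (s : ι → ℂ) (v w : ι → V)

/-- The composition of the derivations attached to the letters of a word. -/
def wordDeriv (l : List ι) (g : V → ℂ) : V → ℂ :=
  l.foldr (fun k f => dirDeriv (s k) (v k) (w k) f) g

@[simp] lemma wordDeriv_nil (g : V → ℂ) : wordDeriv s v w [] g = g := rfl

@[simp] lemma wordDeriv_cons (k : ι) (l : List ι) (g : V → ℂ) :
    wordDeriv s v w (k :: l) g = dirDeriv (s k) (v k) (w k) (wordDeriv s v w l g) := rfl

lemma contDiff_wordDeriv {g : V → ℂ} (hg : ContDiff ℝ ∞ g) (l : List ι) :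
    ContDiff ℝ ∞ (wordDeriv s v w l g) := by
  induction l with
  | nil => exact hg
  | cons k l ih => exact contDiff_dirDeriv ih _ _ _

lemma IsTest.wordDeriv {S : Set V} {g : V → ℂ} (h : IsTest S g) (l : List ι) :
    IsTest S (wordDeriv s v w l g) := by
  induction l with
  | nil => exact h
  | cons k l ih => exact ih.dirDeriv _ _ _

/-- The averages of a function on the segment from `π z` to `z` that occur in the remainders of
Taylor expansions. -/
def segmentMean (π : V →L[ℝ] V) (m : ℕ) (h : V → ℂ) : V → ℂ := fun z =>
  ∫ t in (0 : ℝ)..1, (((1 - t) ^ m / m.factorial : ℝ) : ℂ) * h (π z + t • (z - π z))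

lemma contDiff_segmentMean (π : V →L[ℝ] V) (m : ℕ) {h : V → ℂ} (hh : ContDiff ℝ ∞ h) :
    ContDiff ℝ ∞ (segmentMean π m h) := by
  refine contDiff_intervalIntegral_param (F := fun q : V × ℝ =>
    (((1 - q.2) ^ m / m.factorial : ℝ) : ℂ) * h (π q.1 + q.2 • (q.1 - π q.1))) ?_ 0 1
  refine ContDiff.mul ?_ (hh.comp ?_)
  · refine Complex.ofRealCLM.contDiff.comp (ContDiff.div_const ?_ _)
    exact (contDiff_const.sub contDiff_snd).pow m
  · have h1 : ContDiff ℝ ∞ fun q : V × ℝ => π q.1 := π.contDiff.comp contDiff_fst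
    exact h1.add (contDiff_snd.smul (contDiff_fst.sub h1))

variable {s v w} {π : V →L[ℝ] V} {c : ι → V →L[ℝ] ℂ}
  (hdec : ∀ (ℓ : V →L[ℝ] ℂ) (z : V), ℓ (z - π z) = ∑ k, c k z * (ℓ (v k) + s k * ℓ (w k)))
include hdec

lemma sum_mul_segmentMean (m : ℕ) {h : V → ℂ} (hh : ContDiff ℝ ∞ h) (z : V) :
    ∑ k, c k z * segmentMean π m (dirDeriv (s k) (v k) (w k) h) z =
      ∫ t in (0 : ℝ)..1, (((1 - t) ^ m / m.factorial : ℝ) : ℂ) *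
        fderiv ℝ h (π z + t • (z - π z)) (z - π z) := by
  have hc : ∀ k, Continuous fun t : ℝ => (((1 - t) ^ m / m.factorial : ℝ) : ℂ) *
      dirDeriv (s k) (v k) (w k) h (π z + t • (z - π z)) := fun k => by
    have := (contDiff_dirDeriv hh (s k) (v k) (w k)).continuous
    fun_prop
  simp only [segmentMean]
  simp_rw [← intervalIntegral.integral_const_mul]
  have hc' : ∀ k, Continuous fun t : ℝ => c k z * ((((1 - t) ^ m / m.factorial : ℝ) : ℂ) *
      dirDeriv (s k) (v k) (w k) h (π z + t • (z - π z))) := fun k => continuous_const.mul (hc k)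
  rw [← intervalIntegral.integral_finsetSum fun k _ => (hc' k).intervalIntegrable _ _]
  refine intervalIntegral.integral_congr fun t _ => ?_
  rw [hdec, Finset.mul_sum]
  refine Finset.sum_congr rfl fun k _ => ?_
  simp only [dirDeriv]
  ring

lemma segmentMean_eq (m : ℕ) {h : V → ℂ} (hh : ContDiff ℝ ∞ h) (z : V) :
    segmentMean π m h z = h (π z) / (m + 1).factorial +
      ∑ k, c k z * segmentMean π (m + 1) (dirDeriv (s k) (v k) (w k) h) z := by
  rw [sum_mul_segmentMean hdec (m + 1) hh]
  have hd : ∀ t : ℝ, HasDerivAt (fun t : ℝ =>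
      -((((1 - t) ^ (m + 1) / (m + 1).factorial : ℝ) : ℂ) * h (π z + t • (z - π z))))
      ((((1 - t) ^ m / m.factorial : ℝ) : ℂ) * h (π z + t • (z - π z)) -
        (((1 - t) ^ (m + 1) / (m + 1).factorial : ℝ) : ℂ) *
          fderiv ℝ h (π z + t • (z - π z)) (z - π z)) t := by
    intro t
    have h1 : HasDerivAt (fun t : ℝ => (1 - t) ^ (m + 1) / ((m + 1).factorial : ℝ))
        (-((1 - t) ^ m / m.factorial)) t := by
      have := (((hasDerivAt_id t).const_sub 1).pow (m + 1)).div_const ((m + 1).factorial : ℝ)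
      refine this.congr_deriv ?_
      rw [Nat.factorial_succ]
      have h2 : (m.factorial : ℝ) ≠ 0 := by positivity
      have h3 : ((m : ℝ) + 1) ≠ 0 := by positivity
      push_cast
      simp only [id_eq]
      field_simp
    have h2 : HasDerivAt (fun t : ℝ => h (π z + t • (z - π z)))
        (fderiv ℝ h (π z + t • (z - π z)) (z - π z)) t := by
      have h3 : HasDerivAt (fun t : ℝ => π z + t • (z - π z)) (z - π z) t := by
        simpa using ((hasDerivAt_id t).smul_const (z - π z)).const_add (π z)
      exact ((hh.differentiable (by simp)) _).hasFDerivAt.comp_hasDerivAt t h3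
    refine ((h1.ofReal_comp.mul h2).neg).congr_deriv ?_
    push_cast
    ring
  have hc1 : Continuous fun t : ℝ => (((1 - t) ^ m / m.factorial : ℝ) : ℂ) *
      h (π z + t • (z - π z)) := by
    have := hh.continuous
    fun_prop
  have hc2 : Continuous fun t : ℝ => (((1 - t) ^ (m + 1) / (m + 1).factorial : ℝ) : ℂ) *
      fderiv ℝ h (π z + t • (z - π z)) (z - π z) := by
    have h1 : Continuous fun t : ℝ => fderiv ℝ h (π z + t • (z - π z)) (z - π z) :=
      ((hh.continuous_fderiv (by simp)).comp (by fun_prop)).clm_apply continuous_const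
    fun_prop
  have := intervalIntegral.integral_eq_sub_of_hasDerivAt (a := 0) (b := 1) (fun t _ => hd t)
    ((hc1.sub hc2).intervalIntegrable _ _)
  rw [intervalIntegral.integral_sub (hc1.intervalIntegrable _ _) (hc2.intervalIntegrable _ _)]
    at this
  rw [segmentMean, ← sub_eq_iff_eq_add, this]
  simp [div_eq_inv_mul]

lemma eq_add_sum_segmentMean {h : V → ℂ} (hh : ContDiff ℝ ∞ h) (z : V) :
    h z = h (π z) + ∑ k, c k z * segmentMean π 0 (dirDeriv (s k) (v k) (w k) h) z := by
  rw [sum_mul_segmentMean hdec 0 hh]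
  have hd : ∀ t : ℝ, HasDerivAt (fun t : ℝ => h (π z + t • (z - π z)))
      (fderiv ℝ h (π z + t • (z - π z)) (z - π z)) t := by
    intro t
    have h3 : HasDerivAt (fun t : ℝ => π z + t • (z - π z)) (z - π z) t := by
      simpa using ((hasDerivAt_id t).smul_const (z - π z)).const_add (π z)
    exact ((hh.differentiable (by simp)) _).hasFDerivAt.comp_hasDerivAt t h3
  have hc : Continuous fun t : ℝ => fderiv ℝ h (π z + t • (z - π z)) (z - π z) :=
    ((hh.continuous_fderiv (by simp)).comp (by fun_prop)).clm_apply continuous_const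
  have := intervalIntegral.integral_eq_sub_of_hasDerivAt (a := 0) (b := 1) (fun t _ => hd t)
    (hc.intervalIntegrable _ _)
  simp only [pow_zero, Nat.factorial_zero, Nat.cast_one, div_one, Complex.ofReal_one, one_mul]
  rw [this]
  simp

/-- Taylor expansion along the fibres of a projection `π`, in terms of words in derivations `∂_k`
and dual complex coordinates `c k`. -/
lemma taylor_words {g : V → ℂ} (hg : ContDiff ℝ ∞ g) (N : ℕ) (z : V) :
    g z = (∑ m ∈ Finset.range (N + 1), ∑ κ : Fin m → ι, (∏ i, c (κ i) z) *
        (wordDeriv s v w (List.ofFn κ) g (π z) / m.factorial)) +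
      ∑ κ : Fin (N + 1) → ι, (∏ i, c (κ i) z) *
        segmentMean π N (wordDeriv s v w (List.ofFn κ) g) z := by
  have hcons : ∀ (m : ℕ) (f : (Fin (m + 1) → ι) → ℂ),
      ∑ κ, f κ = ∑ κ' : Fin m → ι, ∑ k, f (Fin.cons k κ') := by
    intro m f
    rw [← (Fin.consEquiv fun _ : Fin (m + 1) => ι).sum_comp, Fintype.sum_prod_type,
      Finset.sum_comm]
    rfl
  induction N with
  | zero =>
    rw [hcons]
    simpa using eq_add_sum_segmentMean hdec hg z
  | succ N ih =>
    rw [Finset.sum_range_succ, hcons (N + 1), add_assoc, ← Finset.sum_add_distrib]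
    refine ih.trans ?_
    congr 1
    refine Finset.sum_congr rfl fun κ _ => ?_
    rw [segmentMean_eq hdec N (contDiff_wordDeriv s v w hg _) z, mul_add, Finset.mul_sum]
    congr 1
    refine Finset.sum_congr rfl fun k _ => ?_
    rw [Fin.prod_univ_succ (fun i => c ((Fin.cons k κ : Fin (N + 1 + 1) → ι) i) z)]
    simp only [Fin.cons_zero, Fin.cons_succ, List.ofFn_cons, wordDeriv_cons]
    ring

end Taylor


/-! ### Asymptotics of exponential polynomials -/

section Sequences

open Polynomial

/-- The shift of complex sequences. -/
def shift : Module.End ℂ (ℕ → ℂ) where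
  toFun a n := a (n + 1)
  map_add' _ _ := rfl
  map_smul' _ _ := rfl

lemma shift_apply (a : ℕ → ℂ) (n : ℕ) : shift a n = a (n + 1) := rfl

/-- A polynomial sequence that tends to zero vanishes. -/
lemma eq_zero_of_shift_sub_one_pow {p : ℕ} {a : ℕ → ℂ} (h : ((shift - 1) ^ p) a = 0)
    (ha : Tendsto a atTop (𝓝 0)) : a = 0 := by
  induction p generalizing a with
  | zero => simpa using h
  | succ p ih =>
    have h1 : (shift - 1) a = 0 := by
      refine ih (by rwa [pow_succ] at h) ?_
      have := (ha.comp (tendsto_add_atTop_nat 1)).sub ha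
      rw [sub_zero] at this
      exact this
    have h2 : ∀ n, a n = a 0 := by
      intro n
      induction n with
      | zero => rfl
      | succ n ihn =>
        have := congrFun h1 n
        simp only [LinearMap.sub_apply, Module.End.one_apply, Pi.sub_apply, shift_apply,
          Pi.zero_apply, sub_eq_zero] at this
        rw [this, ihn]
    have h3 : a 0 = 0 := by
      refine tendsto_nhds_unique (tendsto_const_nhds.congr fun n => (h2 n).symm) ha
    funext n
    rw [h2, h3]
    rfl

lemma tendsto_aeval_shift (Z : ℂ[X]) {a : ℕ → ℂ} (ha : Tendsto a atTop (𝓝 0)) :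
    Tendsto (aeval shift Z a) atTop (𝓝 0) := by
  induction Z using Polynomial.induction_on' with
  | add p q hp hq =>
    rw [map_add]
    have := hp.add hq
    rw [add_zero] at this
    exact this
  | monomial n c =>
    have h : ∀ m, aeval shift (monomial n c) a m = c * a (m + n) := by
      intro m
      rw [aeval_monomial]
      simp only [Module.End.mul_apply, Module.algebraMap_end_apply, Pi.smul_apply, smul_eq_mul]
      congr 1
      induction n generalizing m with
      | zero => simp
      | succ n ih =>
        rw [pow_succ', Module.End.mul_apply, shift_apply, ih]
        congr 1
        ring
    rw [funext h]
    simpa using (ha.comp (tendsto_add_atTop_nat n)).const_mul c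

lemma aeval_shift_geometric (Z : ℂ[X]) (r : ℂ) :
    aeval shift Z (fun n => r ^ n) = Z.eval r • fun n => r ^ n := by
  have h : shift (fun n => r ^ n) = r • fun n => r ^ n := by
    funext n
    simp [shift_apply, pow_succ, mul_comm]
  have := Module.End.aeval_apply_of_hasEigenvector (f := shift) (p := Z) (μ := r)
    (x := fun n => r ^ n) ⟨Module.End.mem_eigenspace_iff.2 h, fun h0 => by
      simpa using congrFun h0 0⟩
  exact this

/-- A polynomial sequence that is asymptotic to a combination of geometric sequences is constant,
equal to the sum of the coefficients of the constant geometric sequences. -/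
lemma eq_sum_of_asymptotic {ι : Type*} [Fintype ι] {p : ℕ} {a : ℕ → ℂ}
    (h : ((shift - 1) ^ p) a = 0) (r A : ι → ℂ) [DecidablePred fun i => r i = 1]
    (ha : Tendsto (fun n => a n - ∑ i, A i * r i ^ n) atTop (𝓝 0)) (n : ℕ) :
    a n = ∑ i with r i = 1, A i := by
  classical
  set A₁ : ℂ := ∑ i with r i = 1, A i with hA₁
  let b : ℕ → ℂ := fun n => a n - A₁
  let S : Finset ℂ := (Finset.univ.image r).filter fun z => z ≠ 1 ∧ 1 ≤ ‖z‖
  let Z : ℂ[X] := ∏ z ∈ S, (X - C z)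
  have hone : (shift - 1 : Module.End ℂ (ℕ → ℂ)) = aeval shift (X - C 1 : ℂ[X]) := by simp
  have hb : ((shift - 1) ^ (p + 1)) b = 0 := by
    have h1 : b = a - fun _ => A₁ := rfl
    have h2 : (shift - 1) (fun _ : ℕ => A₁) = 0 := by
      funext n
      simp [shift_apply]
    have h3 : ((shift - 1) ^ (p + 1)) a = 0 := by
      rw [pow_succ', Module.End.mul_apply, h, map_zero]
    rw [h1, map_sub, h3, pow_succ, Module.End.mul_apply, h2, map_zero, sub_zero]
  have hsplit : b = (fun n => a n - ∑ i, A i * r i ^ n) +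
      ∑ i with r i ≠ 1, A i • fun n => r i ^ n := by
    funext n
    simp only [b, Pi.add_apply, Finset.sum_apply, Pi.smul_apply, smul_eq_mul]
    rw [← Finset.sum_filter_add_sum_filter_not Finset.univ (fun i => r i = 1)
      (fun i => A i * r i ^ n)]
    have : ∑ i with r i = 1, A i * r i ^ n = A₁ := by
      refine Finset.sum_congr rfl fun i hi => ?_
      rw [(Finset.mem_filter.1 hi).2, one_pow, mul_one]
    rw [this]
    ring
  have hZb : Tendsto (aeval shift Z b) atTop (𝓝 0) := by
    rw [hsplit, map_add, map_sum]
    have h0 : (0 : ℂ) = 0 + ∑ i with r i ≠ 1, 0 := by simp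
    rw [h0]
    refine (tendsto_aeval_shift Z ha).add ?_
    have : (fun n => (∑ i with r i ≠ 1, aeval shift Z (A i • fun n => r i ^ n)) n) =
        fun n => ∑ i with r i ≠ 1, (A i * Z.eval (r i)) * r i ^ n := by
      funext n
      simp [aeval_shift_geometric, mul_assoc]
    refine Tendsto.congr (fun n => (congrFun this n).symm) ?_
    refine tendsto_finsetSum _ fun i hi => ?_
    by_cases hr : 1 ≤ ‖r i‖
    · have hz : Z.eval (r i) = 0 := by
        rw [Polynomial.eval_prod]
        refine Finset.prod_eq_zero (i := r i) ?_ (by simp)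
        simp only [S, Finset.mem_filter, Finset.mem_image, Finset.mem_univ, true_and]
        exact ⟨⟨i, rfl⟩, (Finset.mem_filter.1 hi).2, hr⟩
      simp [hz]
    · simpa using (tendsto_pow_atTop_nhds_zero_of_norm_lt_one (not_le.1 hr)).const_mul
        (A i * Z.eval (r i))
  have hZb0 : aeval shift Z b = 0 := by
    refine eq_zero_of_shift_sub_one_pow (p := p + 1) ?_ hZb
    rw [hone, ← map_pow, ← Module.End.mul_apply, ← map_mul, mul_comm, map_mul,
      Module.End.mul_apply, map_pow, ← hone, hb, map_zero]
  have hcop : IsCoprime ((X - C 1 : ℂ[X]) ^ (p + 1)) Z := by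
    refine IsCoprime.pow_left (IsCoprime.prod_right fun z hz => ?_)
    refine Polynomial.isCoprime_X_sub_C_of_isUnit_sub ?_
    rw [isUnit_iff_ne_zero, sub_ne_zero]
    exact ((Finset.mem_filter.1 hz).2.1).symm
  obtain ⟨f, g, hfg⟩ := hcop
  have h1 : aeval shift (f * (X - C 1) ^ (p + 1) + g * Z) b = b := by rw [hfg]; simp
  rw [map_add, map_mul, map_mul, LinearMap.add_apply, Module.End.mul_apply, Module.End.mul_apply,
    hZb0, map_pow, ← hone, hb, map_zero, map_zero, add_zero] at h1
  have := congrFun h1 n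
  simp only [Pi.zero_apply, b] at this
  exact (sub_eq_zero.1 this.symm)

end Sequences


/-! ### Hyperbolic splittings -/

/-- A linear hyperbolic isomorphism `D` of `E`, in a form adapted to Taylor expansions: `E` is the
sum of the range of `emb` (the unstable space, parametrized by `Y`) and of the kernel of `proj`
(the stable space). The maps `c k` and `c' k` are complex coordinates on the stable space and on
`Y` that diagonalize `D`, and the derivations `∂_{v k} + s k ∂_{w k}` are dual to them. -/
structure HyperbolicSplitting (E Y K K' : Type) [NormedAddCommGroup E] [NormedSpace ℝ E]
    [NormedAddCommGroup Y] [NormedSpace ℝ Y] [Fintype K] [Fintype K'] where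
  s : K → ℂ
  v : K → E
  w : K → E
  c : K → E →L[ℝ] ℂ
  proj : E →L[ℝ] Y
  emb : Y →L[ℝ] E
  proj_emb : ∀ y, proj (emb y) = y
  dec : ∀ (ℓ : E →L[ℝ] ℂ) (z : E),
    ℓ (z - emb (proj z)) = ∑ k, c k z * (ℓ (v k) + s k * ℓ (w k))
  s' : K' → ℂ
  v' : K' → Y
  w' : K' → Y
  c' : K' → Y →L[ℝ] ℂ
  dec' : ∀ (ℓ : Y →L[ℝ] ℂ) (y : Y), ℓ y = ∑ k, c' k y * (ℓ (v' k) + s' k * ℓ (w' k))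
  D : E ≃L[ℝ] E
  Du : Y ≃L[ℝ] Y
  proj_D : ∀ z, proj (D z) = Du (proj z)
  D_emb : ∀ y, D (emb y) = emb (Du y)
  ν : K → ℂ
  μ : K' → ℂ
  c_D : ∀ k z, c k (D z) = ν k * c k z
  vec_D : ∀ (ℓ : E →L[ℝ] ℂ) k,
    ℓ (D (v k)) + s k * ℓ (D (w k)) = ν k * (ℓ (v k) + s k * ℓ (w k))
  c'_Du : ∀ k y, c' k (Du.symm y) = μ k * c' k y
  ν_lt : ∀ k, ‖ν k‖ < 1
  μ_lt : ∀ k, ‖μ k‖ < 1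

lemma equiv_mul_apply {V : Type} [NormedAddCommGroup V] [NormedSpace ℝ V] (L L' : V ≃L[ℝ] V)
    (x : V) : (L * L') x = L (L' x) := rfl

lemma equiv_one_apply {V : Type} [NormedAddCommGroup V] [NormedSpace ℝ V] (x : V) :
    (1 : V ≃L[ℝ] V) x = x := rfl

lemma exists_norm_le_lt_one {K : Type} [Fintype K] {ν : K → ℂ} (h : ∀ k, ‖ν k‖ < 1) :
    ∃ ρ : ℝ, 0 ≤ ρ ∧ ρ < 1 ∧ ∀ k, ‖ν k‖ ≤ ρ := by
  refine ⟨((Finset.univ.sup fun k => ‖ν k‖₊ : NNReal) : ℝ), NNReal.coe_nonneg _, ?_, fun k => ?_⟩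
  · have : (Finset.univ.sup fun k => ‖ν k‖₊ : NNReal) < 1 := by
      rw [Finset.sup_lt_iff (by simp)]
      intro k _
      exact_mod_cast h k
    exact_mod_cast this
  · exact_mod_cast Finset.le_sup (f := fun k => ‖ν k‖₊) (Finset.mem_univ k)

lemma norm_list_prod_map_le {K : Type} {ν : K → ℂ} {ρ : ℝ} (h0 : 0 ≤ ρ) (h : ∀ k, ‖ν k‖ ≤ ρ)
    (l : List K) : ‖(l.map ν).prod‖ ≤ ρ ^ l.length := by
  induction l with
  | nil => simp
  | cons k l ih =>
    simp only [List.map_cons, List.prod_cons, norm_mul, List.length_cons, pow_succ']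
    exact mul_le_mul (h k) ih (norm_nonneg _) h0

lemma norm_le_sum_of_decomposition {V K : Type} [NormedAddCommGroup V] [NormedSpace ℝ V]
    [Fintype K] {x : V} {a s : K → ℂ} {v w : K → V}
    (h : ∀ ℓ : V →L[ℝ] ℂ, ℓ x = ∑ k, a k * (ℓ (v k) + s k * ℓ (w k))) :
    ‖x‖ ≤ ∑ k, ‖a k‖ * (‖v k‖ + ‖s k‖ * ‖w k‖) := by
  obtain ⟨ℓ, hℓ, hx⟩ := exists_dual_vector'' ℝ x
  have hb : ∀ y : V, ‖((ℓ y : ℝ) : ℂ)‖ ≤ ‖y‖ := fun y => by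
    rw [Complex.norm_real]
    exact (ℓ.le_opNorm y).trans (by nlinarith [norm_nonneg y])
  have h1 := h (Complex.ofRealCLM.comp ℓ)
  simp only [ContinuousLinearMap.comp_apply, Complex.ofRealCLM_apply] at h1
  have h2 : ‖x‖ = ‖((ℓ x : ℝ) : ℂ)‖ := by
    rw [hx]
    simp
  rw [h2, h1]
  refine (norm_sum_le _ _).trans (Finset.sum_le_sum fun k _ => ?_)
  rw [norm_mul]
  refine mul_le_mul_of_nonneg_left ((norm_add_le _ _).trans ?_) (norm_nonneg _)
  rw [norm_mul]
  exact add_le_add (hb _) (mul_le_mul_of_nonneg_left (hb _) (norm_nonneg _))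

/-- `taylor_words` with the expansion indexed by one finite type. -/
lemma taylor_sigma {V ι : Type} [NormedAddCommGroup V] [NormedSpace ℝ V] [FiniteDimensional ℝ V]
    [Fintype ι] {s : ι → ℂ} {v w : ι → V} {π : V →L[ℝ] V} {c : ι → V →L[ℝ] ℂ}
    (hdec : ∀ (ℓ : V →L[ℝ] ℂ) (z : V), ℓ (z - π z) = ∑ k, c k z * (ℓ (v k) + s k * ℓ (w k)))
    {g : V → ℂ} (hg : ContDiff ℝ ∞ g) (N : ℕ) (z : V) :
    g z = (∑ i : Σ m : Fin (N + 1), (Fin m → ι), ((List.ofFn i.2).map fun k => c k z).prod *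
        (wordDeriv s v w (List.ofFn i.2) g (π z) / (i.1 : ℕ).factorial)) +
      ∑ κ : Fin (N + 1) → ι, ((List.ofFn κ).map fun k => c k z).prod *
        segmentMean π N (wordDeriv s v w (List.ofFn κ) g) z := by
  have h : ∀ (m : ℕ) (κ : Fin m → ι),
      ((List.ofFn κ).map fun k => c k z).prod = ∏ i, c (κ i) z := by
    intro m κ
    rw [List.map_ofFn, List.prod_ofFn]
    rfl
  rw [Fintype.sum_sigma]
  simp only [h]
  rw [Fin.sum_univ_eq_sum_range (fun m => ∑ κ : Fin m → ι, (∏ i, c (κ i) z) *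
        (wordDeriv s v w (List.ofFn κ) g (π z) / (m : ℕ).factorial)) (N + 1)]
  exact taylor_words hdec hg N z

lemma IsTest.comp_equiv {V W : Type} [NormedAddCommGroup V] [NormedSpace ℝ V]
    [NormedAddCommGroup W] [NormedSpace ℝ W] {S : Set W} {ψ : W → ℂ}
    (h : IsTest S ψ) (L : V ≃L[ℝ] W) : IsTest (L ⁻¹' S) fun x => ψ (L x) := by
  refine ⟨h.1.comp L.contDiff, h.2.1.comp_homeomorph L.toHomeomorph, ?_⟩
  have : tsupport (fun x => ψ (L x)) = L ⁻¹' tsupport ψ :=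
    tsupport_comp_eq_preimage ψ L.toHomeomorph
  rw [this]
  exact preimage_mono h.2.2

namespace HyperbolicSplitting

variable {E Y K K' : Type} [NormedAddCommGroup E] [NormedSpace ℝ E] [FiniteDimensional ℝ E]
  [NormedAddCommGroup Y] [InnerProductSpace ℝ Y] [FiniteDimensional ℝ Y]
  [Fintype K] [Fintype K'] [MeasurableSpace Y] [BorelSpace Y]
  (H : HyperbolicSplitting E Y K K')

/-- The product of the multipliers of a pair of words. -/
def mult (l : List K × List K') : ℂ := (l.1.map H.ν).prod * (l.2.map H.μ).prod

/-- The monomial of a word in the coordinates of `Y`. -/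
def mono (l : List K') (y : Y) : ℂ := (l.map fun k => H.c' k y).prod

/-- The monomial of a word in the stable coordinates. -/
def stableMono (l : List K) (z : E) : ℂ := (l.map fun k => H.c k z).prod

/-- The distribution on `E` attached to a pair of words: up to sign, a derivative of the Dirac mass
in the stable variables times a monomial in the unstable variables. -/
def form (l : List K × List K') (g : E → ℂ) : ℂ :=
  ∫ y : Y, H.mono l.2 y * wordDeriv H.s H.v H.w l.1 g (H.emb y)

lemma contDiff_list_prod {V K : Type} [NormedAddCommGroup V] [NormedSpace ℝ V]
    (c : K → V →L[ℝ] ℂ) (l : List K) :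
    ContDiff ℝ ∞ fun z => (l.map fun k => c k z).prod := by
  induction l with
  | nil => simpa using contDiff_const
  | cons k l ih => simpa using (c k).contDiff.mul ih

lemma contDiff_mono (l : List K') : ContDiff ℝ ∞ (H.mono l) := contDiff_list_prod H.c' l

lemma contDiff_stableMono (l : List K) : ContDiff ℝ ∞ (H.stableMono l) := contDiff_list_prod H.c l

lemma proj_D_pow (n : ℕ) (z : E) : H.proj ((H.D ^ n) z) = (H.Du ^ n) (H.proj z) := by
  induction n with
  | zero => rfl
  | succ n ih =>
    rw [pow_succ', pow_succ', equiv_mul_apply, equiv_mul_apply,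
      H.proj_D, ih]

lemma stableMono_D_pow (l : List K) (n : ℕ) (z : E) :
    H.stableMono l ((H.D ^ n) z) = (l.map H.ν).prod ^ n * H.stableMono l z := by
  have h1 : ∀ k, H.c k ((H.D ^ n) z) = H.ν k ^ n * H.c k z := by
    intro k
    induction n with
    | zero => simp [equiv_one_apply]
    | succ n ih =>
      rw [pow_succ', equiv_mul_apply, H.c_D, ih]
      ring
  induction l with
  | nil => simp [stableMono]
  | cons k l ih =>
    simp only [stableMono, List.map_cons, List.prod_cons] at ih ⊢
    rw [ih, h1]
    ring

lemma c'_Du_pow (k : K') (n : ℕ) (y : Y) :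
    H.c' k ((H.Du.symm ^ n) y) = H.μ k ^ n * H.c' k y := by
  induction n with
  | zero => simp [equiv_one_apply]
  | succ n ih =>
    rw [pow_succ', equiv_mul_apply, H.c'_Du, ih]
    ring

lemma mono_Du_pow (l : List K') (n : ℕ) (y : Y) :
    H.mono l ((H.Du.symm ^ n) y) = (l.map H.μ).prod ^ n * H.mono l y := by
  induction l with
  | nil => simp [mono]
  | cons k l ih =>
    simp only [mono, List.map_cons, List.prod_cons] at ih ⊢
    rw [ih, H.c'_Du_pow]
    ring

/-- The inverse of `D` contracts the unstable space exponentially. -/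
lemma exists_contraction : ∃ A ρ : ℝ, 0 ≤ A ∧ 0 ≤ ρ ∧ ρ < 1 ∧
    ∀ (n : ℕ) (y : Y), ‖(H.Du.symm ^ n) y‖ ≤ A * ρ ^ n * ‖y‖ := by
  obtain ⟨ρ, h0, h1, hρ⟩ := exists_norm_le_lt_one H.μ_lt
  refine ⟨∑ k, ‖H.c' k‖ * (‖H.v' k‖ + ‖H.s' k‖ * ‖H.w' k‖), ρ, by positivity, h0, h1,
    fun n y => ?_⟩
  refine (norm_le_sum_of_decomposition fun ℓ => H.dec' ℓ ((H.Du.symm ^ n) y)).trans ?_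
  rw [Finset.sum_mul, Finset.sum_mul]
  refine Finset.sum_le_sum fun k _ => ?_
  rw [H.c'_Du_pow, norm_mul, norm_pow]
  have h2 : ‖H.μ k‖ ^ n ≤ ρ ^ n := pow_le_pow_left₀ (norm_nonneg _) (hρ k) n
  have h3 := (H.c' k).le_opNorm y
  calc _ ≤ (ρ ^ n * (‖H.c' k‖ * ‖y‖)) * (‖H.v' k‖ + ‖H.s' k‖ * ‖H.w' k‖) := by
        refine mul_le_mul_of_nonneg_right ?_ (by positivity)
        exact mul_le_mul h2 h3 (norm_nonneg _) (by positivity)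
    _ = _ := by ring

/-- The points of the unstable space. -/
def unstable : Set E := {z | H.emb (H.proj z) = z}

lemma D_pow_mem_unstable {z : E} (hz : z ∈ H.unstable) (n : ℕ) : (H.D ^ n) z ∈ H.unstable := by
  have h : ∀ y, (H.D ^ n) (H.emb y) = H.emb ((H.Du ^ n) y) := by
    intro y
    induction n with
    | zero => rfl
    | succ n ih =>
      rw [pow_succ', pow_succ', equiv_mul_apply, equiv_mul_apply,
        ih, H.D_emb]
  show H.emb (H.proj _) = _
  rw [H.proj_D_pow, ← h]
  congr 1

lemma integral_comp_Du_pow (n : ℕ) (F : Y → ℂ) :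
    ∫ y, F ((H.Du ^ n) y) =
      ((|LinearMap.det (H.Du : Y →ₗ[ℝ] Y)|⁻¹ ^ n : ℝ) : ℂ) * ∫ y, F y := by
  have hdet : LinearMap.det (((H.Du ^ n : Y ≃L[ℝ] Y) : Y →L[ℝ] Y) : Y →ₗ[ℝ] Y) =
      LinearMap.det (H.Du : Y →ₗ[ℝ] Y) ^ n := by
    rw [← map_pow]
    congr 1
    induction n with
    | zero => rfl
    | succ n ih =>
      rw [pow_succ, pow_succ, ← ih]
      rfl
  have hne : LinearMap.det (H.Du : Y →ₗ[ℝ] Y) ≠ 0 :=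
    (LinearEquiv.isUnit_det' H.Du.toLinearEquiv).ne_zero
  have h1 := Measure.map_linearMap_addHaar_eq_smul_addHaar (volume : Measure Y)
    (f := (((H.Du ^ n : Y ≃L[ℝ] Y) : Y →L[ℝ] Y) : Y →ₗ[ℝ] Y)) (by
      rw [hdet]
      exact pow_ne_zero _ hne)
  have h2 : ∫ y, F ((H.Du ^ n) y) = ∫ y, F y ∂(Measure.map (H.Du ^ n) volume) :=
    ((H.Du ^ n).toHomeomorph.measurableEmbedding.integral_map F).symm
  rw [h2]
  have h3 : Measure.map (H.Du ^ n) (volume : Measure Y) = _ := h1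
  rw [h3, integral_smul_measure, hdet, ENNReal.toReal_ofReal (abs_nonneg _), abs_inv, abs_pow,
    inv_pow]
  simp

end HyperbolicSplitting


/-! ### Functionals with a polynomial behaviour under a hyperbolic splitting -/

namespace HyperbolicSplitting

variable {E Y K K' : Type} [NormedAddCommGroup E] [NormedSpace ℝ E] [FiniteDimensional ℝ E]
  [NormedAddCommGroup Y] [InnerProductSpace ℝ Y] [FiniteDimensional ℝ Y]
  [Fintype K] [Fintype K'] [MeasurableSpace Y] [BorelSpace Y]
  (H : HyperbolicSplitting E Y K K')

/-- The factor `|det|⁻¹` of the unstable part. -/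
def jac : ℝ := |LinearMap.det (H.Du : Y →ₗ[ℝ] Y)|⁻¹

lemma jac_nonneg : 0 ≤ H.jac := inv_nonneg.2 (abs_nonneg _)

/-- The indices of Taylor expansions of order `N`. -/
abbrev TaylorIndex (ι : Type) (N : ℕ) := Σ m : Fin (N + 1), (Fin m → ι)

lemma IsTest.comp_D_pow {O : Set E} (hO : ∀ z, H.D z ∈ O → z ∈ O) {g : E → ℂ} (hg : IsTest O g)
    (n : ℕ) : IsTest O fun z => g ((H.D ^ n) z) := by
  refine (hg.comp_equiv (H.D ^ n)).mono fun z hz => ?_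
  induction n with
  | zero => exact hz
  | succ n ih =>
    refine ih (hO _ ?_)
    rw [mem_preimage, pow_succ', equiv_mul_apply] at hz
    exact hz

/-- The asymptotics, for large `n`, of the pairing of `b ∘ Du ^ n` with a smooth density `f`: the
function `b ∘ Du ^ n` concentrates at the origin, and only a Taylor polynomial of `f` matters. -/
lemma tendsto_integral_sub {b f : Y → ℂ} (hb : IsTest univ b) (hf : ContDiff ℝ ∞ f) (q : ℂ)
    {ρ : ℝ} (h0 : 0 ≤ ρ) (hρ : ∀ k, ‖H.μ k‖ ≤ ρ) (N : ℕ) (hq : ‖q‖ * H.jac * ρ ^ (N + 1) < 1) :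
    Tendsto (fun n : ℕ => q ^ n * (∫ y, b ((H.Du ^ n) y) * f y) -
      ∑ i : TaylorIndex K' N, ((wordDeriv H.s' H.v' H.w' (List.ofFn i.2) f 0 /
        (i.1 : ℕ).factorial) * ∫ y, H.mono (List.ofFn i.2) y * b y) *
        (q * H.jac * ((List.ofFn i.2).map H.μ).prod) ^ n) atTop (𝓝 0) := by
  obtain ⟨A, ρ₁, hA, hρ0, hρ1, hcon⟩ := H.exists_contraction
  let seg : (Fin (N + 1) → K') → Y → ℂ := fun κ =>
    segmentMean (0 : Y →L[ℝ] Y) N (wordDeriv H.s' H.v' H.w' (List.ofFn κ) f)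
  have hseg : ∀ κ, ContDiff ℝ ∞ (seg κ) := fun κ =>
    contDiff_segmentMean _ _ (contDiff_wordDeriv _ _ _ hf _)
  have htaylor : ∀ y, f y = (∑ i : TaylorIndex K' N, H.mono (List.ofFn i.2) y *
        (wordDeriv H.s' H.v' H.w' (List.ofFn i.2) f 0 / (i.1 : ℕ).factorial)) +
      ∑ κ : Fin (N + 1) → K', H.mono (List.ofFn κ) y * seg κ y := fun y => by
    have := taylor_sigma (π := (0 : Y →L[ℝ] Y)) (c := H.c') (s := H.s') (v := H.v') (w := H.w')
      (fun ℓ z => by simpa using H.dec' ℓ z) hf N y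
    exact this
  have hbc : Continuous b := hb.1.continuous
  have hint : ∀ {F : Y → ℂ}, Continuous F → Integrable fun y => b y * F y := fun hF =>
    (hbc.mul hF).integrable_of_hasCompactSupport hb.2.1.mul_right
  have hexp : ∀ n : ℕ, q ^ n * (∫ y, b ((H.Du ^ n) y) * f y) -
      ∑ i : TaylorIndex K' N, ((wordDeriv H.s' H.v' H.w' (List.ofFn i.2) f 0 /
        (i.1 : ℕ).factorial) * ∫ y, H.mono (List.ofFn i.2) y * b y) *
        (q * H.jac * ((List.ofFn i.2).map H.μ).prod) ^ n =
      ∑ κ : Fin (N + 1) → K', (q * H.jac * ((List.ofFn κ).map H.μ).prod) ^ n *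
        ∫ y, b y * (H.mono (List.ofFn κ) y * seg κ ((H.Du.symm ^ n) y)) := by
    intro n
    have h1 : ∫ y, b ((H.Du ^ n) y) * f y =
        ((H.jac ^ n : ℝ) : ℂ) * ∫ y, b y * f ((H.Du.symm ^ n) y) := by
      rw [jac, ← H.integral_comp_Du_pow n fun y => b y * f ((H.Du.symm ^ n) y)]
      refine integral_congr_ae (Eventually.of_forall fun y => ?_)
      have : (H.Du.symm ^ n) ((H.Du ^ n) y) = y := by
        have h : H.Du.symm = H.Du⁻¹ := rfl
        rw [h, ← equiv_mul_apply, inv_pow, inv_mul_cancel]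
        rfl
      simp only [this]
    have h2 : ∀ y, b y * f ((H.Du.symm ^ n) y) =
        (∑ i : TaylorIndex K' N, (((List.ofFn i.2).map H.μ).prod ^ n *
          (wordDeriv H.s' H.v' H.w' (List.ofFn i.2) f 0 / (i.1 : ℕ).factorial)) *
            (b y * H.mono (List.ofFn i.2) y)) +
        ∑ κ : Fin (N + 1) → K', ((List.ofFn κ).map H.μ).prod ^ n *
          (b y * (H.mono (List.ofFn κ) y * seg κ ((H.Du.symm ^ n) y))) := by
      intro y
      rw [htaylor, mul_add, Finset.mul_sum, Finset.mul_sum]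
      congr 1 <;> refine Finset.sum_congr rfl fun i _ => ?_ <;> rw [H.mono_Du_pow] <;> ring
    have h3 : ∀ κ : Fin (N + 1) → K', Integrable fun y =>
        b y * (H.mono (List.ofFn κ) y * seg κ ((H.Du.symm ^ n) y)) := fun κ =>
      hint ((H.contDiff_mono _).continuous.mul
        ((hseg κ).continuous.comp (H.Du.symm ^ n).continuous))
    have h4 : ∀ i : TaylorIndex K' N, Integrable fun y => b y * H.mono (List.ofFn i.2) y :=
      fun i => hint (H.contDiff_mono _).continuous
    rw [h1]
    simp_rw [h2]
    rw [integral_add (integrable_finsetSum _ fun i _ => (h4 i).const_mul _)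
      (integrable_finsetSum _ fun κ _ => (h3 κ).const_mul _),
      integral_finsetSum _ fun i _ => (h4 i).const_mul _,
      integral_finsetSum _ fun κ _ => (h3 κ).const_mul _]
    simp_rw [integral_const_mul]
    rw [mul_add, mul_add, add_sub_right_comm]
    have h5 : q ^ n * (((H.jac ^ n : ℝ) : ℂ) * ∑ i : TaylorIndex K' N,
        (((List.ofFn i.2).map H.μ).prod ^ n *
          (wordDeriv H.s' H.v' H.w' (List.ofFn i.2) f 0 / (i.1 : ℕ).factorial)) *
            (∫ y, b y * H.mono (List.ofFn i.2) y)) -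
        ∑ i : TaylorIndex K' N, ((wordDeriv H.s' H.v' H.w' (List.ofFn i.2) f 0 /
        (i.1 : ℕ).factorial) * ∫ y, H.mono (List.ofFn i.2) y * b y) *
        (q * H.jac * ((List.ofFn i.2).map H.μ).prod) ^ n = 0 := by
      rw [sub_eq_zero, Finset.mul_sum, Finset.mul_sum]
      refine Finset.sum_congr rfl fun i _ => ?_
      simp_rw [mul_comm (b _)]
      push_cast
      ring
    rw [h5, zero_add, Finset.mul_sum, Finset.mul_sum]
    refine Finset.sum_congr rfl fun κ _ => ?_
    push_cast
    ring
  simp_rw [hexp]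
  rw [show (0 : ℂ) = ∑ κ : Fin (N + 1) → K', 0 by simp]
  refine tendsto_finsetSum _ fun κ _ => ?_
  have hlt : ‖q * H.jac * ((List.ofFn κ).map H.μ).prod‖ < 1 := by
    refine lt_of_le_of_lt ?_ hq
    rw [norm_mul, norm_mul, Complex.norm_real, Real.norm_of_nonneg H.jac_nonneg]
    refine mul_le_mul_of_nonneg_left ?_ (mul_nonneg (norm_nonneg _) H.jac_nonneg)
    simpa using norm_list_prod_map_le h0 hρ (List.ofFn κ)
  -- the integrals stay bounded, as the points `Du⁻ⁿ y` stay in a fixed ball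
  obtain ⟨R, hR⟩ := hb.2.1.isBounded.subset_closedBall (0 : Y)
  obtain ⟨S, hS⟩ := (isCompact_closedBall (0 : Y) (A * R)).exists_bound_of_continuousOn
    (hseg κ).continuous.continuousOn
  have hbound : ∀ n : ℕ, ‖∫ y, b y * (H.mono (List.ofFn κ) y * seg κ ((H.Du.symm ^ n) y))‖ ≤
      ∫ y, ‖b y * H.mono (List.ofFn κ) y‖ * S := by
    intro n
    refine norm_integral_le_of_norm_le
      ((hint (H.contDiff_mono _).continuous).norm.mul_const _) (Eventually.of_forall fun y => ?_)
    rw [← mul_assoc, norm_mul]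
    by_cases hy : y ∈ tsupport b
    · refine mul_le_mul_of_nonneg_left (hS _ ?_) (norm_nonneg _)
      have hyR : ‖y‖ ≤ R := by simpa using hR hy
      rw [mem_closedBall_zero_iff]
      refine (hcon n y).trans ?_
      have : ρ₁ ^ n ≤ 1 := pow_le_one₀ hρ0 hρ1.le
      calc A * ρ₁ ^ n * ‖y‖ ≤ A * 1 * R := by gcongr
        _ = A * R := by ring
    · simp [image_eq_zero_of_notMem_tsupport hy]
  have hlim := (tendsto_pow_atTop_nhds_zero_of_lt_one (norm_nonneg _) hlt).mul_const
    (∫ y, ‖b y * H.mono (List.ofFn κ) y‖ * S)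
  rw [zero_mul] at hlim
  refine squeeze_zero_norm (fun n => ?_) hlim
  rw [norm_mul, norm_pow]
  exact mul_le_mul_of_nonneg_left (hbound n) (by positivity)

/-- A bound for the growth of the pairings of a functional of finite order with `χ · h ∘ D ^ n`. -/
lemma tendsto_pow_mul_apply (W : (E → ℂ) → ℂ) {B : Set E} {M : ℕ} {C : ℝ}
    (hord : ∀ (ψ : E → ℂ) (b : ℝ), IsTest B ψ → 0 ≤ b →
      (∀ j ≤ M, ∀ x, ‖iteratedFDeriv ℝ j ψ x‖ ≤ b) → ‖W ψ‖ ≤ C * b)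
    {χ h : E → ℂ} (hχ : IsTest B χ) (hh : IsTest univ h) {q : ℂ}
    (hq : ‖q‖ * max 1 ‖(H.D : E →L[ℝ] E)‖ ^ M < 1) :
    Tendsto (fun n : ℕ => q ^ n * W (fun z => χ z * h ((H.D ^ n) z))) atTop (𝓝 0) := by
  set d := max 1 ‖(H.D : E →L[ℝ] E)‖ with hd
  have hd1 : 1 ≤ d := le_max_left _ _
  obtain ⟨S, hS0, hS⟩ := hh.exists_bound M
  obtain ⟨B', hB0, hB⟩ := hχ.exists_mul_bound M
  have hnorm : ∀ n : ℕ, ‖((H.D ^ n : E ≃L[ℝ] E) : E →L[ℝ] E)‖ ≤ d ^ n := by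
    intro n
    induction n with
    | zero => exact ContinuousLinearMap.norm_id_le.trans (by simp)
    | succ n ih =>
      have : ((H.D ^ (n + 1) : E ≃L[ℝ] E) : E →L[ℝ] E) =
          ((H.D ^ n : E ≃L[ℝ] E) : E →L[ℝ] E).comp (H.D : E →L[ℝ] E) := by
        rw [pow_succ]
        rfl
      rw [this, pow_succ]
      exact (ContinuousLinearMap.opNorm_comp_le _ _).trans
        (mul_le_mul ih (le_max_right _ _) (norm_nonneg _) (by positivity))
  have hbound : ∀ n : ℕ, ‖W (fun z => χ z * h ((H.D ^ n) z))‖ ≤ C * (B' * (S * (d ^ n) ^ M)) := by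
    intro n
    have hcd : ContDiff ℝ ∞ (h ∘ ((H.D ^ n : E ≃L[ℝ] E) : E →L[ℝ] E)) :=
      hh.1.comp (ContinuousLinearMap.contDiff _)
    have hdn : 1 ≤ d ^ n := one_le_pow₀ hd1
    refine hord _ _ (hχ.mul_right hcd) (by positivity) fun j hj x => ?_
    refine hB _ hcd _ x (by positivity) (fun i hi => ?_) j hj
    refine (norm_iteratedFDeriv_comp_clm_le _ hh.1 x i).trans ?_
    refine mul_le_mul (hS i hi _) ?_ (by positivity) hS0
    exact (pow_le_pow_left₀ (norm_nonneg _) (hnorm n) i).trans (pow_le_pow_right₀ hdn hi)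
  refine squeeze_zero_norm (a := fun n : ℕ => (‖q‖ * d ^ M) ^ n * (C * (B' * S))) (fun n => ?_)
    (by simpa using (tendsto_pow_atTop_nhds_zero_of_lt_one (by positivity) hq).mul_const _)
  rw [norm_mul, norm_pow]
  calc ‖q‖ ^ n * _ ≤ ‖q‖ ^ n * (C * (B' * (S * (d ^ n) ^ M))) :=
        mul_le_mul_of_nonneg_left (hbound n) (by positivity)
    _ = _ := by rw [mul_pow, ← pow_mul, ← pow_mul, mul_comm n M]; ring

end HyperbolicSplitting


namespace HyperbolicSplitting

variable {E Y K K' : Type} [NormedAddCommGroup E] [NormedSpace ℝ E] [FiniteDimensional ℝ E]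
  [NormedAddCommGroup Y] [InnerProductSpace ℝ Y] [FiniteDimensional ℝ Y]
  [Fintype K] [Fintype K'] [MeasurableSpace Y] [BorelSpace Y]
  (H : HyperbolicSplitting E Y K K')

/-- If a functional vanishes on the test functions that are supported off the unstable space, its
value only depends on the germ of the test function along the unstable space. -/
lemma apply_eq_of_eventuallyEq {O : Set E} (W : (E → ℂ) →ₗ[ℂ] ℂ)
    (hsupp : ∀ g, IsTest O g → Disjoint (tsupport g) H.unstable → W g = 0)
    {F G : E → ℂ} (hF : IsTest O F) (hG : IsTest O G) (h : ∀ z ∈ H.unstable, F =ᶠ[𝓝 z] G) :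
    W F = W G := by
  rw [← sub_eq_zero, ← map_sub]
  refine hsupp _ (hF.sub hG) (Set.disjoint_right.2 fun z hz => ?_)
  rw [notMem_tsupport_iff_eventuallyEq]
  filter_upwards [h z hz] with x hx
  simp [hx]

/-- Let `W` be a functional of finite order, carried by the unstable space and regular with respect
to it near the origin, such that `n ↦ κ ^ n W (g ∘ D ^ n)` is a polynomial sequence for all test
functions `g`. Then `W` is a finite combination of the forms attached to the pairs of words whose
multiplier is `1`. -/
theorem exists_form_expansion {O : Set E} (hO : ∀ z, H.D z ∈ O → z ∈ O)
    (W : (E → ℂ) →ₗ[ℂ] ℂ) (κ : ℂ) {r : ℝ} (hr : 0 < r) (hrO : Metric.ball 0 r ⊆ O) {p : ℕ}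
    (hsupp : ∀ g, IsTest O g → Disjoint (tsupport g) H.unstable → W g = 0)
    (hpoly : ∀ g, IsTest O g →
      ((shift - 1) ^ p) (fun n => κ ^ n * W (fun z => g ((H.D ^ n) z))) = 0)
    (hord : ∃ (M : ℕ) (C : ℝ), ∀ (ψ : E → ℂ) (b : ℝ), IsTest (Metric.ball 0 r) ψ → 0 ≤ b →
      (∀ j ≤ M, ∀ x, ‖iteratedFDeriv ℝ j ψ x‖ ≤ b) → ‖W ψ‖ ≤ C * b)
    (hreg : ∀ χ, IsTest (Metric.ball 0 r) χ → ∃ f : Y → ℂ, ContDiff ℝ ∞ f ∧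
      ∀ b : Y → ℂ, IsTest univ b → W (fun z => χ z * b (H.proj z)) = ∫ y, b y * f y) :
    ∃ (ι : Type) (_ : Fintype ι) (l : ι → List K × List K') (F : ι → ℂ),
      (∀ i, κ * H.jac * H.mult (l i) = 1) ∧
      ∀ g, IsTest O g → W g = ∑ i, F i * H.form (l i) g := by
  classical
  obtain ⟨M, C, hord⟩ := hord
  obtain ⟨ρs, hs0, hs1, hρs⟩ := exists_norm_le_lt_one H.ν_lt
  obtain ⟨ρu, hu0, hu1, hρu⟩ := exists_norm_le_lt_one H.μ_lt
  set d := max 1 ‖(H.D : E →L[ℝ] E)‖ with hd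
  -- the orders of the Taylor expansions in the stable and unstable variables
  have hpow : ∀ {a ρ : ℝ}, 0 ≤ a → 0 ≤ ρ → ρ < 1 → ∃ N : ℕ, a * ρ ^ (N + 1) < 1 := by
    intro a ρ ha h0 h1
    have h := ((tendsto_pow_atTop_nhds_zero_of_lt_one h0 h1).comp
      (tendsto_add_atTop_nat 1)).const_mul a
    rw [mul_zero] at h
    exact (h.eventually (gt_mem_nhds one_pos)).exists
  obtain ⟨N, hN⟩ := hpow (a := ‖κ‖ * d ^ M) (by positivity) hs0 hs1
  obtain ⟨N', hN'⟩ := hpow (a := ‖κ‖ * H.jac) (mul_nonneg (norm_nonneg _) H.jac_nonneg) hu0 hu1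
  obtain ⟨χ, hχ, O', hO', h0O', -, hχ1⟩ := exists_cutoff (isCompact_singleton (x := (0 : E)))
    Metric.isOpen_ball (singleton_subset_iff.2 (Metric.mem_ball_self hr))
  obtain ⟨β, hβ, O₂, hO₂, h0O₂, -, hβ1⟩ := exists_cutoff (isCompact_singleton (x := (0 : E)))
    isOpen_univ (subset_univ _)
  rw [singleton_subset_iff] at h0O' h0O₂
  have hχs : ∀ l, IsTest (Metric.ball 0 r) fun z => χ z * H.stableMono l z := fun l =>
    hχ.mul_right (H.contDiff_stableMono l)
  choose f hf hreg' using fun i : TaylorIndex K N => hreg _ (hχs (List.ofFn i.2))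
  let π : E →L[ℝ] E := H.emb.comp H.proj
  have hβπ : ContDiff ℝ ∞ fun z => β (z - π z) :=
    hβ.1.comp (contDiff_id.sub π.contDiff)
  have hβ1' : ∀ z ∈ H.unstable, ∀ᶠ x in 𝓝 z, β (x - π x) = 1 := by
    intro z hz
    have hc : Continuous fun x => x - π x := continuous_id.sub π.continuous
    have : z - π z ∈ O₂ := by
      have h' : π z = z := hz
      rwa [h', sub_self]
    filter_upwards [(hO₂.preimage hc).mem_nhds this] with x hx using hβ1 _ hx
  -- a function with compact support in the unstable variables, cut off in the stable variables
  have hcut : ∀ {S : Set Y} {h : E → ℂ}, IsCompact S → ContDiff ℝ ∞ h →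
      (∀ z, H.proj z ∉ S → h z = 0) → IsTest univ fun z => β (z - π z) * h z := by
    intro S h hS hh h0
    have hc : IsCompact ((fun q : E × Y => q.1 + H.emb q.2) '' (tsupport β ×ˢ S)) :=
      (hβ.2.1.isCompact.prod hS).image (by fun_prop)
    refine (IsTest.of_contDiffOn hc isOpen_univ (subset_univ _) (hβπ.mul hh).contDiffOn
      fun z hz => ?_).mono (subset_univ _)
    by_cases h1 : z - π z ∈ tsupport β
    · by_cases h2 : H.proj z ∈ S
      · exact absurd ⟨(z - π z, H.proj z), ⟨h1, h2⟩, by simp [π]⟩ hz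
      · rw [h0 z h2, mul_zero]
    · rw [image_eq_zero_of_notMem_tsupport h1, zero_mul]
  let ι₀ := TaylorIndex K N × TaylorIndex K' N'
  let rr : ι₀ → ℂ := fun i => κ * H.jac * H.mult (List.ofFn i.1.2, List.ofFn i.2.2)
  let F₀ : ι₀ → ℂ := fun i =>
    wordDeriv H.s' H.v' H.w' (List.ofFn i.2.2) (f i.1) 0 / (i.2.1 : ℕ).factorial /
      (i.1.1 : ℕ).factorial
  refine ⟨{i : ι₀ // rr i = 1}, inferInstance,
    fun i => (List.ofFn i.1.1.2, List.ofFn i.1.2.2), fun i => F₀ i.1, fun i => i.2, fun g hg => ?_⟩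
  have hdec : ∀ (ℓ : E →L[ℝ] ℂ) (z : E),
      ℓ (z - π z) = ∑ k, H.c k z * (ℓ (H.v k) + H.s k * ℓ (H.w k)) := H.dec
  -- the derivatives of `g` along the unstable space
  let b : TaylorIndex K N → Y → ℂ := fun i y =>
    wordDeriv H.s H.v H.w (List.ofFn i.2) g (H.emb y) / (i.1 : ℕ).factorial
  have hwd : ∀ l, IsTest O (wordDeriv H.s H.v H.w l g) := fun l => hg.wordDeriv _ _ _ l
  have hembc : ∀ {h : E → ℂ}, IsTest O h → IsTest univ fun y => h (H.emb y) := by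
    intro h hh
    refine (IsTest.of_contDiffOn (hh.2.1.isCompact.image H.proj.continuous) isOpen_univ
      (subset_univ _) (hh.1.comp H.emb.contDiff).contDiffOn fun y hy => ?_).mono (subset_univ _)
    exact image_eq_zero_of_notMem_tsupport (f := h) fun h' => hy ⟨_, h', H.proj_emb y⟩
  have hb : ∀ i, IsTest univ (b i) := fun i => by
    have := (hembc (hwd (List.ofFn i.2))).smul ((i.1 : ℕ).factorial : ℂ)⁻¹
    refine (funext fun y => ?_ : b i = _) ▸ this
    simp [b, div_eq_inv_mul]
  let S : Set Y := H.proj '' tsupport g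
  have hS : IsCompact S := hg.2.1.isCompact.image H.proj.continuous
  have hwS : ∀ l z, H.proj z ∉ S → wordDeriv H.s H.v H.w l g z = 0 := by
    intro l z hz
    have h := hg.of_tsupport (subset_rfl : tsupport g ⊆ tsupport g) |>.wordDeriv H.s H.v H.w l
    exact h.eq_zero fun h' => hz ⟨z, h', rfl⟩
  let h : (Fin (N + 1) → K) → E → ℂ := fun k z =>
    β (z - π z) * segmentMean π N (wordDeriv H.s H.v H.w (List.ofFn k) g) z
  have hh : ∀ k, IsTest univ (h k) := fun k => by
    refine hcut hS (contDiff_segmentMean π N (hwd _).1) fun z hz => ?_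
    refine (intervalIntegral.integral_congr fun t _ => ?_).trans intervalIntegral.integral_zero
    have : H.proj (π z + t • (z - π z)) = H.proj z := by simp [π, H.proj_emb]
    rw [hwS _ _ (by rwa [this]), mul_zero]
  -- the main terms and the remainders
  let T : TaylorIndex K N → ℕ → ℂ := fun i n =>
    (κ * ((List.ofFn i.2).map H.ν).prod) ^ n * ∫ y, b i ((H.Du ^ n) y) * f i y
  let Rm : (Fin (N + 1) → K) → ℕ → ℂ := fun k n =>
    (κ * ((List.ofFn k).map H.ν).prod) ^ n *
      W (fun z => (χ z * H.stableMono (List.ofFn k) z) * h k ((H.D ^ n) z))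
  -- For large `n` the support of `g ∘ D ^ n` meets the unstable space only where `χ = 1`, because
  -- `D⁻¹` contracts the unstable space. There `g ∘ D ^ n` is replaced by its Taylor expansion in the
  -- stable variables.
  have hlarge : ∀ᶠ n in atTop, κ ^ n * W (fun z => g ((H.D ^ n) z)) =
      (∑ i, T i n) + ∑ k, Rm k n := by
    obtain ⟨A, ρ₁, hA, hρ0, hρ1, hcon⟩ := H.exists_contraction
    obtain ⟨R, hR⟩ := hS.isBounded.subset_closedBall (0 : Y)
    obtain ⟨η, hη, hηO'⟩ := Metric.isOpen_iff.1 hO' 0 h0O'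
    have hsmall : ∀ᶠ n : ℕ in atTop, ‖H.emb‖ * (A * ρ₁ ^ n * |R|) < η := by
      have h := (((tendsto_pow_atTop_nhds_zero_of_lt_one hρ0 hρ1).const_mul A).mul_const
        |R|).const_mul ‖H.emb‖
      simp only [mul_zero, zero_mul] at h
      exact h.eventually (gt_mem_nhds hη)
    filter_upwards [hsmall] with n hn
    have hDc : ContDiff ℝ ∞ fun z => (H.D ^ n) z := (H.D ^ n).contDiff
    have hDcont : Continuous fun z => (H.D ^ n) z := (H.D ^ n).continuous
    have hβn : ∀ z ∈ H.unstable, ∀ᶠ x in 𝓝 z, β ((H.D ^ n) x - π ((H.D ^ n) x)) = 1 :=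
      fun z hz => (hDcont.tendsto z).eventually (hβ1' _ (H.D_pow_mem_unstable hz n))
    have e1 : W (fun z => g ((H.D ^ n) z)) =
        W (fun z => χ z * (β ((H.D ^ n) z - π ((H.D ^ n) z)) * g ((H.D ^ n) z))) := by
      refine H.apply_eq_of_eventuallyEq W hsupp (IsTest.comp_D_pow H hO hg n)
        ((hχ.mul_right ((hβπ.comp hDc).mul (hg.1.comp hDc))).mono hrO) fun z hz => ?_
      by_cases hz' : (H.D ^ n) z ∈ tsupport g
      · have hzO : z ∈ O' := by
          refine hηO' ?_
          rw [mem_ball_zero_iff]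
          have e : z = H.emb ((H.Du.symm ^ n) (H.proj ((H.D ^ n) z))) := by
            rw [H.proj_D_pow]
            have h' : (H.Du.symm ^ n) ((H.Du ^ n) (H.proj z)) = H.proj z := by
              have h : H.Du.symm = H.Du⁻¹ := rfl
              rw [h, ← equiv_mul_apply, inv_pow, inv_mul_cancel]
              rfl
            rw [h']
            exact hz.symm
          rw [e]
          refine ((H.emb.le_opNorm _).trans (mul_le_mul_of_nonneg_left ((hcon n _).trans ?_)
            (norm_nonneg _))).trans_lt hn
          refine mul_le_mul_of_nonneg_left ?_ (by positivity)
          have : H.proj ((H.D ^ n) z) ∈ S := ⟨_, hz', rfl⟩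
          exact (mem_closedBall_zero_iff.1 (hR this)).trans (le_abs_self R)
        filter_upwards [hO'.mem_nhds hzO, hβn z hz] with x hx hx'
        rw [hχ1 x hx, hx', one_mul, one_mul]
      · have : ∀ᶠ x in 𝓝 z, (H.D ^ n) x ∉ tsupport g :=
          (hDcont.tendsto z).eventually ((isClosed_tsupport g).isOpen_compl.mem_nhds hz')
        filter_upwards [this] with x hx
        simp [image_eq_zero_of_notMem_tsupport hx]
    have e2 : (fun z => χ z * (β ((H.D ^ n) z - π ((H.D ^ n) z)) * g ((H.D ^ n) z))) =
        (∑ i : TaylorIndex K N, ((List.ofFn i.2).map H.ν).prod ^ n • fun z =>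
          (χ z * H.stableMono (List.ofFn i.2) z) * (β ((H.D ^ n) z - π ((H.D ^ n) z)) *
            b i ((H.Du ^ n) (H.proj z)))) +
        ∑ k : Fin (N + 1) → K, ((List.ofFn k).map H.ν).prod ^ n • fun z =>
          (χ z * H.stableMono (List.ofFn k) z) * h k ((H.D ^ n) z) := by
      funext z
      rw [taylor_sigma hdec hg.1 N ((H.D ^ n) z)]
      simp only [Pi.add_apply, Finset.sum_apply, Pi.smul_apply, smul_eq_mul]
      rw [mul_add, mul_add, Finset.mul_sum, Finset.mul_sum, Finset.mul_sum, Finset.mul_sum]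
      congr 1 <;> refine Finset.sum_congr rfl fun i _ => ?_
      · have e := H.stableMono_D_pow (List.ofFn i.2) n z
        simp only [stableMono] at e ⊢
        have e' : π ((H.D ^ n) z) = H.emb ((H.Du ^ n) (H.proj z)) := by
          rw [← H.proj_D_pow]
          rfl
        rw [e]
        simp only [b, e']
        ring
      · have e := H.stableMono_D_pow (List.ofFn i) n z
        simp only [stableMono] at e ⊢
        rw [e]
        simp only [h]
        ring
    have hbn : ∀ i, IsTest univ fun y => b i ((H.Du ^ n) y) := fun i =>
      ((hb i).comp_equiv (H.Du ^ n)).mono (subset_univ _)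
    have e3 : ∀ i : TaylorIndex K N,
        W (fun z => (χ z * H.stableMono (List.ofFn i.2) z) *
          (β ((H.D ^ n) z - π ((H.D ^ n) z)) * b i ((H.Du ^ n) (H.proj z)))) =
        ∫ y, b i ((H.Du ^ n) y) * f i y := by
      intro i
      rw [← hreg' i _ (hbn i)]
      have hbc : ContDiff ℝ ∞ fun z => b i ((H.Du ^ n) (H.proj z)) :=
        (hbn i).1.comp H.proj.contDiff
      refine H.apply_eq_of_eventuallyEq W hsupp
        (((hχs _).mul_right ((hβπ.comp hDc).mul hbc)).mono hrO)
        (((hχs _).mul_right hbc).mono hrO) fun z hz => ?_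
      filter_upwards [hβn z hz] with x hx
      rw [hx, one_mul]
    rw [e1, e2, map_add, map_sum, map_sum, mul_add, Finset.mul_sum, Finset.mul_sum]
    congr 1 <;> refine Finset.sum_congr rfl fun i _ => ?_
    · rw [map_smul, e3, smul_eq_mul]
      simp only [T]
      ring
    · rw [map_smul, smul_eq_mul]
      simp only [Rm]
      ring
  -- Taylor expansion of the density `f i` in the unstable variables
  have hT : ∀ i, Tendsto (fun n : ℕ => T i n - ∑ j : TaylorIndex K' N',
      F₀ (i, j) * H.form (List.ofFn i.2, List.ofFn j.2) g * rr (i, j) ^ n) atTop (𝓝 0) := by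
    intro i
    have hle : ‖κ * ((List.ofFn i.2).map H.ν).prod‖ ≤ ‖κ‖ := by
      rw [norm_mul]
      exact mul_le_of_le_one_right (norm_nonneg _)
        ((norm_list_prod_map_le hs0 hρs _).trans (pow_le_one₀ hs0 hs1.le))
    refine (H.tendsto_integral_sub (hb i) (hf i) (κ * ((List.ofFn i.2).map H.ν).prod) hu0 hρu N'
      (lt_of_le_of_lt ?_ hN')).congr fun n => ?_
    · exact mul_le_mul_of_nonneg_right (mul_le_mul_of_nonneg_right hle H.jac_nonneg)
        (by positivity)
    · simp only [T]
      congr 1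
      refine Finset.sum_congr rfl fun j _ => ?_
      have e : ∫ y, H.mono (List.ofFn j.2) y * b i y =
          H.form (List.ofFn i.2, List.ofFn j.2) g / (i.1 : ℕ).factorial := by
        simp only [form, b]
        rw [← integral_div]
        refine integral_congr_ae (Eventually.of_forall fun y => ?_)
        simp only
        ring
      rw [e]
      simp only [F₀, rr, mult]
      rw [show κ * ((List.ofFn i.2).map H.ν).prod * (H.jac : ℂ) *
        ((List.ofFn j.2).map H.μ).prod = κ * H.jac * (((List.ofFn i.2).map H.ν).prod *
          ((List.ofFn j.2).map H.μ).prod) by ring]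
      ring
  -- the `N + 1` stable factors beat the growth `d ^ M` of the derivatives of order `M`
  have hRm : ∀ k, Tendsto (Rm k) atTop (𝓝 0) := by
    intro k
    refine H.tendsto_pow_mul_apply W hord (hχs _) (hh k) (lt_of_le_of_lt ?_ hN)
    rw [norm_mul, mul_assoc, mul_assoc, mul_comm (d ^ M)]
    refine mul_le_mul_of_nonneg_left ?_ (norm_nonneg _)
    refine mul_le_mul_of_nonneg_right ?_ (by positivity)
    simpa using norm_list_prod_map_le hs0 hρs (List.ofFn k)
  have hasym : Tendsto (fun n : ℕ => κ ^ n * W (fun z => g ((H.D ^ n) z)) -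
      ∑ i : ι₀, (F₀ i * H.form (List.ofFn i.1.2, List.ofFn i.2.2) g) * rr i ^ n) atTop (𝓝 0) := by
    have h1 := (tendsto_finsetSum (Finset.univ) fun i _ => hT i).add
      (tendsto_finsetSum (Finset.univ) fun k _ => hRm k)
    simp only [Finset.sum_const_zero, add_zero] at h1
    refine h1.congr' ?_
    filter_upwards [hlarge] with n hn
    rw [hn, Fintype.sum_prod_type, Finset.sum_sub_distrib]
    ring
  have := eq_sum_of_asymptotic (hpoly g hg) rr _ hasym 0
  rw [pow_zero, one_mul] at this
  have h0 : (fun z => g ((H.D ^ 0) z)) = g := rfl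
  rw [h0] at this
  rw [this, ← Finset.sum_subtype_eq_sum_filter, Finset.subtype_univ]

end HyperbolicSplitting


/-! ### The transport equation on a product with the line -/

section Transport

variable {X : Type} [NormedAddCommGroup X] [NormedSpace ℝ X] [FiniteDimensional ℝ X]

/-- The transpose `lam - ∂_θ` of the operator `∂_θ + lam` on `X × ℝ`. -/
def thetaOp (lam : ℂ) (ψ : X × ℝ → ℂ) : X × ℝ → ℂ := fun q => lam * ψ q - fderiv ℝ ψ q (0, 1)

/-- The translation in the variable `θ`, with a factor that makes it commute with the equation. -/
def shiftOp (X : Type) (lam : ℂ) (s : ℝ) : Module.End ℂ (X × ℝ → ℂ) where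
  toFun ψ q := Complex.exp (-lam * s) * ψ (q.1, q.2 + s)
  map_add' _ _ := by funext q; simp [mul_add]
  map_smul' _ _ := by funext q; simp [mul_left_comm]

/-- The mean of the translates by `0 ≤ t ≤ L`. -/
def flowMean (lam : ℂ) (L : ℝ) (ψ : X × ℝ → ℂ) : X × ℝ → ℂ := fun q =>
  ∫ t in (0 : ℝ)..L, Complex.exp (-lam * t) * ψ (q.1, q.2 + t)

/-- The integral along the lines `{z} × ℝ` against the solution `exp (-lam θ)` of the equation. -/
def expMean (lam : ℂ) (ψ : X × ℝ → ℂ) : X → ℂ := fun z =>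
  ∫ θ : ℝ, Complex.exp (-lam * θ) * ψ (z, θ)

lemma shiftOp_apply (lam : ℂ) (s : ℝ) (ψ : X × ℝ → ℂ) (q : X × ℝ) :
    shiftOp X lam s ψ q = Complex.exp (-lam * s) * ψ (q.1, q.2 + s) := rfl

variable {lam : ℂ} {ψ φ : X × ℝ → ℂ} {Ω : Set (X × ℝ)}

lemma contDiff_exp_mul (lam : ℂ) : ContDiff ℝ ∞ fun t : ℝ => Complex.exp (lam * t) :=
  (contDiff_const.mul Complex.ofRealCLM.contDiff).cexp

lemma contDiff_thetaOp (hψ : ContDiff ℝ ∞ ψ) : ContDiff ℝ ∞ (thetaOp lam ψ) :=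
  (contDiff_const.mul hψ).sub
    ((hψ.fderiv_right (m := ∞) (mod_cast le_top)).clm_apply contDiff_const)

lemma tsupport_thetaOp_subset : tsupport (thetaOp lam ψ) ⊆ tsupport ψ := by
  refine closure_minimal (fun x hx => by_contra fun h' => hx ?_) (isClosed_tsupport _)
  have h1 : fderiv ℝ ψ x = 0 := by
    by_contra h0
    exact h' (support_fderiv_subset ℝ h0)
  simp [thetaOp, h1, image_eq_zero_of_notMem_tsupport h']

lemma IsTest.thetaOp (h : IsTest Ω ψ) : IsTest Ω (thetaOp lam ψ) :=
  ⟨contDiff_thetaOp h.1, h.2.1.of_isClosed_subset (isClosed_tsupport _) tsupport_thetaOp_subset,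
    tsupport_thetaOp_subset.trans h.2.2⟩

lemma IsTest.thetaOp_iterate (h : IsTest Ω ψ) (k : ℕ) : IsTest Ω ((ClosedOrbit.thetaOp lam)^[k] ψ) := by
  induction k with
  | zero => exact h
  | succ k ih => rw [Function.iterate_succ_apply']; exact ih.thetaOp

lemma thetaOp_sub (hψ : ContDiff ℝ ∞ ψ) (hφ : ContDiff ℝ ∞ φ) :
    thetaOp lam (ψ - φ) = thetaOp lam ψ - thetaOp lam φ := by
  funext q
  simp only [thetaOp, Pi.sub_apply]
  rw [fderiv_sub (hψ.differentiable (by simp) q) (hφ.differentiable (by simp) q)]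
  simp only [_root_.sub_apply]
  ring

lemma thetaOp_smul (c : ℂ) : thetaOp lam (c • ψ) = c • thetaOp lam ψ := by
  funext q
  have h : fderiv ℝ (c • ψ) q (0, 1) = c * fderiv ℝ ψ q (0, 1) := by
    rw [fderiv_const_smul_field]
    rfl
  simp only [thetaOp, Pi.smul_apply, smul_eq_mul, h]
  ring

lemma thetaOp_iterate_sub (k : ℕ) (hψ : IsTest Ω ψ) (hφ : IsTest Ω φ) :
    (thetaOp lam)^[k] (ψ - φ) = (thetaOp lam)^[k] ψ - (thetaOp lam)^[k] φ := by
  induction k with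
  | zero => rfl
  | succ k ih =>
    rw [Function.iterate_succ_apply', Function.iterate_succ_apply', Function.iterate_succ_apply',
      ih, thetaOp_sub (hψ.thetaOp_iterate k).1 (hφ.thetaOp_iterate k).1]

lemma thetaOp_shiftOp (s : ℝ) :
    thetaOp lam (shiftOp X lam s ψ) = shiftOp X lam s (thetaOp lam ψ) := by
  funext q
  have h : shiftOp X lam s ψ = Complex.exp (-lam * s) • fun q => ψ (q + (0, s)) := by
    funext q
    simp [shiftOp_apply, Prod.add_def]
  rw [h, thetaOp_smul]
  simp only [Pi.smul_apply, smul_eq_mul, shiftOp_apply, thetaOp]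
  rw [fderiv_comp_add_right]
  simp [Prod.add_def]

lemma thetaOp_comp_equiv (D : X ≃L[ℝ] X) :
    thetaOp lam (fun q => ψ (D q.1, q.2)) = fun q => thetaOp lam ψ (D q.1, q.2) := by
  funext q
  have h := (D.prodCongr (ContinuousLinearEquiv.refl ℝ ℝ)).comp_right_fderiv (f := ψ) (x := q)
  have h' : (ψ ∘ (D.prodCongr (ContinuousLinearEquiv.refl ℝ ℝ))) = fun q => ψ (D q.1, q.2) := rfl
  rw [h'] at h
  simp only [thetaOp, h]
  simp

lemma thetaOp_tensor {g : X → ℂ} {e : ℝ → ℂ} (hg : ContDiff ℝ ∞ g) (he : ContDiff ℝ ∞ e) :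
    thetaOp lam (fun q : X × ℝ => g q.1 * e q.2) =
      fun q => g q.1 * (lam * e q.2 - deriv e q.2) := by
  funext q
  have h1 : HasFDerivAt (fun q : X × ℝ => g q.1) ((fderiv ℝ g q.1).comp (.fst ℝ X ℝ)) q :=
    ((hg.differentiable (by simp)) q.1).hasFDerivAt.comp q hasFDerivAt_fst
  have h2 : HasFDerivAt (fun q : X × ℝ => e q.2) ((fderiv ℝ e q.2).comp (.snd ℝ X ℝ)) q :=
    ((he.differentiable (by simp)) q.2).hasFDerivAt.comp q hasFDerivAt_snd
  have h3 : fderiv ℝ (fun q : X × ℝ => g q.1 * e q.2) q = _ := (h1.mul h2).fderiv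
  simp only [thetaOp, h3]
  simp
  ring

lemma contDiff_flowMean (L : ℝ) (hψ : ContDiff ℝ ∞ ψ) : ContDiff ℝ ∞ (flowMean lam L ψ) := by
  refine contDiff_intervalIntegral_param (X := X × ℝ) (F := fun q : (X × ℝ) × ℝ =>
    Complex.exp (-lam * q.2) * ψ (q.1.1, q.1.2 + q.2)) ?_ 0 L
  exact ((contDiff_exp_mul (-lam)).comp contDiff_snd).mul (hψ.comp (by fun_prop))

/-- The mean over the time interval `[0, L]` is a primitive, with respect to
`thetaOp`, of the difference between a function and its weighted translate. -/
lemma thetaOp_flowMean (L : ℝ) (hψ : ContDiff ℝ ∞ ψ) :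
    thetaOp lam (flowMean lam L ψ) = ψ - shiftOp X lam L ψ := by
  funext ⟨z, θ⟩
  let F : ℝ → ℂ := fun s => Complex.exp (-lam * s) * ψ (z, s)
  have hF : Continuous F :=
    (contDiff_exp_mul (-lam)).continuous.mul (hψ.continuous.comp (by fun_prop))
  let I : ℝ → ℂ := fun x => ∫ s in (0 : ℝ)..x, F s
  have hI : ∀ x, HasDerivAt I (F x) x := fun x => (hF.integral_hasStrictDerivAt 0 x).hasDerivAt
  have hG : ∀ x, flowMean lam L ψ (z, x) = Complex.exp (lam * x) * (I (x + L) - I x) := by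
    intro x
    have h1 : I (x + L) - I x = ∫ s in x..(x + L), F s :=
      intervalIntegral.integral_interval_sub_left (hF.intervalIntegrable _ _)
        (hF.intervalIntegrable _ _)
    have h2 : ∫ s in x..(x + L), F s = ∫ t in (0 : ℝ)..L, F (x + t) := by
      rw [intervalIntegral.integral_comp_add_left]
      simp
    rw [h1, h2, ← intervalIntegral.integral_const_mul]
    refine intervalIntegral.integral_congr fun t _ => ?_
    simp only [F]
    rw [← mul_assoc, ← Complex.exp_add]
    congr 2
    push_cast
    ring
  have h1 : HasDerivAt (fun x => flowMean lam L ψ (z, x))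
      (fderiv ℝ (flowMean lam L ψ) (z, θ) (0, 1)) θ := by
    have h2 : HasDerivAt (fun x : ℝ => (z, x)) ((0 : X), (1 : ℝ)) θ :=
      (hasDerivAt_const θ z).prodMk (hasDerivAt_id θ)
    exact ((contDiff_flowMean L hψ).differentiable (by simp) (z, θ)).hasFDerivAt.comp_hasDerivAt
      θ h2
  have h2 : HasDerivAt (fun x : ℝ => Complex.exp (lam * x) * (I (x + L) - I x))
      (lam * Complex.exp (lam * θ) * (I (θ + L) - I θ) +
        Complex.exp (lam * θ) * (F (θ + L) - F θ)) θ := by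
    have h3 : HasDerivAt (fun x : ℝ => Complex.exp (lam * x)) (lam * Complex.exp (lam * θ)) θ := by
      have := ((hasDerivAt_id θ).ofReal_comp.const_mul lam).cexp
      simpa [mul_comm] using this
    exact h3.mul (((hI (θ + L)).comp_add_const θ L).sub (hI θ))
  rw [funext hG] at h1
  have h3 := h1.unique h2
  simp only [thetaOp, h3, hG, Pi.sub_apply, shiftOp_apply, F]
  have e1 : Complex.exp (lam * θ) * Complex.exp (-lam * θ) = 1 := by
    rw [← Complex.exp_add]; simp
  have e2 : Complex.exp (lam * θ) * Complex.exp (-lam * (θ + L : ℝ)) = Complex.exp (-lam * L) := by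
    rw [← Complex.exp_add]
    congr 1
    push_cast
    ring
  linear_combination (ψ (z, θ)) * e1 - (ψ (z, θ + L)) * e2

/-- A set of pairs `(z, θ)` that is stable under decreasing `θ`. -/
def DownClosed (Ω : Set (X × ℝ)) : Prop := ∀ z θ θ', (z, θ) ∈ Ω → θ' ≤ θ → (z, θ') ∈ Ω

lemma DownClosed.isTest_shiftOp (hΩ : DownClosed Ω) {s : ℝ} (hs : 0 ≤ s) (hψ : IsTest Ω ψ) :
    IsTest Ω (shiftOp X lam s ψ) := by
  have hc : IsCompact ((fun q : X × ℝ => (q.1, q.2 - s)) '' tsupport ψ) :=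
    hψ.2.1.isCompact.image (by fun_prop)
  refine (IsTest.of_contDiffOn hc isOpen_univ (subset_univ _)
    (contDiff_const.mul (hψ.1.comp (by fun_prop))).contDiffOn fun q hq => ?_).mono ?_
  · show _ * ψ (q.1, q.2 + s) = 0
    rw [image_eq_zero_of_notMem_tsupport (f := ψ), mul_zero]
    exact fun h => hq ⟨_, h, by simp⟩
  · rintro _ ⟨q, hq, rfl⟩
    exact hΩ q.1 q.2 _ (hψ.2.2 hq) (by linarith)

lemma isCompact_lower {S : Set (X × ℝ)} (hS : IsCompact S) (L : ℝ) :
    IsCompact ((fun q : (X × ℝ) × ℝ => (q.1.1, q.1.2 - q.2)) '' (S ×ˢ Icc 0 L)) :=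
  (hS.prod isCompact_Icc).image (by fun_prop)

lemma DownClosed.isTest_flowMean (hΩ : DownClosed Ω) {L : ℝ} (hL : 0 ≤ L) (hψ : IsTest Ω ψ) :
    IsTest Ω (flowMean lam L ψ) := by
  refine (IsTest.of_contDiffOn (isCompact_lower hψ.2.1.isCompact L) isOpen_univ (subset_univ _)
    (contDiff_flowMean L hψ.1).contDiffOn fun q hq => ?_).mono ?_
  · refine (intervalIntegral.integral_congr fun t ht => ?_).trans intervalIntegral.integral_zero
    rw [uIcc_of_le hL] at ht
    rw [image_eq_zero_of_notMem_tsupport (f := ψ), mul_zero]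
    exact fun h => hq ⟨((q.1, q.2 + t), t), ⟨h, ht⟩, by simp⟩
  · rintro _ ⟨⟨q, t⟩, ⟨hq, ht⟩, rfl⟩
    exact hΩ q.1 q.2 _ (hψ.2.2 hq) (by linarith [ht.1])

/-- The integrals along the lines are integrals over a bounded interval. -/
lemma IsTest.exists_expMean_eq (hψ : IsTest Ω ψ) : ∃ a b : ℝ, a ≤ b ∧
    (∀ q ∈ tsupport ψ, q.2 ∈ Ioc a b) ∧
    ∀ φ : X × ℝ → ℂ, tsupport φ ⊆ tsupport ψ →
      ∀ z, expMean lam φ z = ∫ θ in a..b, Complex.exp (-lam * θ) * φ (z, θ) := by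
  obtain ⟨R, hR⟩ := (hψ.2.1.isCompact.image continuous_snd).isBounded.subset_closedBall (0 : ℝ)
  have h1 : ∀ q ∈ tsupport ψ, q.2 ∈ Ioc (-|R| - 1) (|R| + 1) := fun q hq => by
    have h := hR ⟨q, hq, rfl⟩
    rw [mem_closedBall_zero_iff, Real.norm_eq_abs] at h
    have := abs_le.1 (h.trans (le_abs_self R))
    exact ⟨by linarith [this.1], by linarith [this.2]⟩
  refine ⟨-|R| - 1, |R| + 1, by linarith [abs_nonneg R], h1, fun φ hφ z => ?_⟩
  refine (intervalIntegral.integral_eq_integral_of_support_subset fun θ hθ => ?_).symm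
  refine h1 (z, θ) (hφ (subset_tsupport _ fun h0 => hθ ?_))
  simp [h0]

lemma contDiff_expMean (hψ : IsTest Ω ψ) : ContDiff ℝ ∞ (expMean lam ψ) := by
  obtain ⟨a, b, -, -, h⟩ := hψ.exists_expMean_eq (lam := lam)
  rw [funext (h ψ subset_rfl)]
  exact contDiff_intervalIntegral_param (F := fun q : X × ℝ => Complex.exp (-lam * q.2) * ψ q)
    (((contDiff_exp_mul (-lam)).comp contDiff_snd).mul hψ.1) a b

lemma IsTest.expMean {O : Set X} (hψ : IsTest Ω ψ) (h : ∀ q ∈ tsupport ψ, q.1 ∈ O) :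
    IsTest O (expMean lam ψ) := by
  refine (IsTest.of_contDiffOn (hψ.2.1.isCompact.image continuous_fst) isOpen_univ
    (subset_univ _) (contDiff_expMean hψ).contDiffOn fun z hz => ?_).mono ?_
  · refine (integral_congr_ae (Eventually.of_forall fun θ => ?_)).trans (integral_zero _ _)
    rw [image_eq_zero_of_notMem_tsupport (f := ψ), mul_zero]
    exact fun h => hz ⟨_, h, rfl⟩
  · rintro _ ⟨q, hq, rfl⟩
    exact h q hq

lemma dirDeriv_expMean (hψ : IsTest Ω ψ) (s : ℂ) (v w : X) :
    dirDeriv s v w (expMean lam ψ) = expMean lam (dirDeriv s (v, 0) (w, 0) ψ) := by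
  obtain ⟨a, b, -, -, h⟩ := hψ.exists_expMean_eq (lam := lam)
  funext z
  have h1 : tsupport (dirDeriv s (v, (0 : ℝ)) (w, 0) ψ) ⊆ tsupport ψ :=
    ((hψ.of_tsupport subset_rfl).dirDeriv s (v, (0 : ℝ)) (w, 0)).2.2
  rw [h _ h1, funext (h ψ subset_rfl)]
  let F : X × ℝ → ℂ := fun q => Complex.exp (-lam * q.2) * ψ q
  have hF : ContDiff ℝ ∞ F := ((contDiff_exp_mul (-lam)).comp contDiff_snd).mul hψ.1
  have h2 := (hasFDerivAt_intervalIntegral_param (hF.of_le (mod_cast le_top)) a b z).fderiv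
  have hc : Continuous fun t : ℝ => (fderiv ℝ F (z, t)).comp (ContinuousLinearMap.inl ℝ X ℝ) :=
    ((hF.continuous_fderiv (by simp)).comp (by fun_prop : Continuous fun t : ℝ => (z, t))).clm_comp
      continuous_const
  have h3 : ∀ (v : X) (t : ℝ), fderiv ℝ F (z, t) (v, 0) =
      Complex.exp (-lam * t) * fderiv ℝ ψ (z, t) (v, 0) := by
    intro v t
    have h4 : HasFDerivAt (fun q : X × ℝ => Complex.exp (-lam * q.2))
        ((fderiv ℝ (fun t : ℝ => Complex.exp (-lam * t)) t).comp (.snd ℝ X ℝ)) (z, t) :=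
      HasFDerivAt.comp (g := fun t : ℝ => Complex.exp (-lam * t)) (z, t)
        ((contDiff_exp_mul (-lam)).differentiable (by simp) t).hasFDerivAt hasFDerivAt_snd
    have h5 := h4.mul (hψ.1.differentiable (by simp) (z, t)).hasFDerivAt
    rw [show fderiv ℝ F (z, t) = _ from h5.fderiv]
    simp
  have h4 : ∀ v : X, fderiv ℝ (fun x => ∫ t in a..b, F (x, t)) z v =
      ∫ t in a..b, Complex.exp (-lam * t) * fderiv ℝ ψ (z, t) (v, 0) := by
    intro v
    rw [h2, ContinuousLinearMap.intervalIntegral_apply (hc.intervalIntegrable _ _)]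
    refine intervalIntegral.integral_congr fun t _ => ?_
    simp [h3]
  have hc2 : ∀ v : X, IntervalIntegrable
      (fun t : ℝ => Complex.exp (-lam * t) * fderiv ℝ ψ (z, t) (v, 0)) volume a b := fun v => by
    refine Continuous.intervalIntegrable ?_ _ _
    exact (contDiff_exp_mul (-lam)).continuous.mul (((hψ.1.continuous_fderiv (by simp)).comp
      (by fun_prop : Continuous fun t : ℝ => (z, t))).clm_apply continuous_const)
  show fderiv ℝ (fun x => ∫ t in a..b, F (x, t)) z v +
    s * fderiv ℝ (fun x => ∫ t in a..b, F (x, t)) z w = _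
  rw [h4, h4, ← intervalIntegral.integral_const_mul, ← intervalIntegral.integral_add (hc2 v)
    ((hc2 w).const_mul s)]
  refine intervalIntegral.integral_congr fun t _ => ?_
  simp only [dirDeriv]
  ring

/-- A test function with vanishing integrals along all lines is in the image of `thetaOp`. -/
lemma DownClosed.exists_thetaOp_eq (hΩ : DownClosed Ω) (hψ : IsTest Ω ψ)
    (h0 : ∀ z, expMean lam ψ z = 0) : ∃ φ, IsTest Ω φ ∧ thetaOp lam φ = ψ := by
  obtain ⟨a, b, hab, hsupp, hmean⟩ := hψ.exists_expMean_eq (lam := lam)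
  set L := b - a + 1 with hL
  have hz : ∀ z θ, θ ∉ Ioc a b → ψ (z, θ) = 0 := fun z θ hθ =>
    image_eq_zero_of_notMem_tsupport fun h => hθ (hsupp _ h)
  let φ : X × ℝ → ℂ := fun q => if a - 1 < q.2 then flowMean lam L ψ q else 0
  let O : Set (X × ℝ) := {q | a - 1 < q.2}
  have hO : IsOpen O := isOpen_lt continuous_const continuous_snd
  let S := ((fun q : (X × ℝ) × ℝ => (q.1.1, q.1.2 - q.2)) '' (tsupport ψ ×ˢ Icc 0 L)) ∩
    {q | a ≤ q.2}
  have hS : IsCompact S :=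
    (isCompact_lower hψ.2.1.isCompact L).inter_right (isClosed_le continuous_const continuous_snd)
  have hSO : S ⊆ O := fun q hq => by
    have : a ≤ q.2 := hq.2
    show a - 1 < q.2
    linarith
  have hψS : tsupport ψ ⊆ S := fun q hq =>
    ⟨⟨(q, 0), ⟨hq, le_rfl, by linarith⟩, by simp⟩, (hsupp q hq).1.le⟩
  have hφ : IsTest S φ := by
    refine IsTest.of_contDiffOn hS hO hSO ((contDiff_flowMean (lam := lam) L hψ.1).contDiffOn.congr
      fun q hq => if_pos hq) fun q hq => ?_
    by_cases hqO : a - 1 < q.2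
    · simp only [φ, if_pos hqO]
      by_cases hqa : a ≤ q.2
      · refine (intervalIntegral.integral_congr fun t ht => ?_).trans
          intervalIntegral.integral_zero
        rw [uIcc_of_le (by linarith)] at ht
        rw [image_eq_zero_of_notMem_tsupport (f := ψ), mul_zero]
        exact fun h => hq ⟨⟨((q.1, q.2 + t), t), ⟨h, ht⟩, by simp⟩, hqa⟩
      · -- the interval of integration contains the whole support
        push Not at hqa
        have h1 := h0 q.1
        have h2 : ∫ t in (0 : ℝ)..L, Complex.exp (-lam * t) * ψ (q.1, q.2 + t) =
            Complex.exp (lam * q.2) * ∫ t in (0 : ℝ)..L,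
              Complex.exp (-lam * (q.2 + t : ℝ)) * ψ (q.1, q.2 + t) := by
          rw [← intervalIntegral.integral_const_mul]
          refine intervalIntegral.integral_congr fun t _ => ?_
          rw [← mul_assoc, ← Complex.exp_add]
          congr 2
          push_cast
          ring
        have h3 : expMean lam ψ q.1 = ∫ s in q.2..(q.2 + L), Complex.exp (-lam * s) * ψ (q.1, s) := by
          refine (intervalIntegral.integral_eq_integral_of_support_subset fun θ hθ => ?_).symm
          have : θ ∈ Ioc a b := by
            by_contra h
            exact hθ (by simp [hz q.1 θ h])
          exact ⟨by linarith [this.1], by linarith [this.2]⟩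
        have h4 := intervalIntegral.integral_comp_add_left (a := 0) (b := L)
          (fun s : ℝ => Complex.exp (-lam * s) * ψ (q.1, s)) q.2
        rw [add_zero] at h4
        simp only [flowMean]
        rw [h2, h4, ← h3, h1, mul_zero]
    · simp [φ, hqO]
  refine ⟨φ, hφ.mono ?_, ?_⟩
  · rintro _ ⟨⟨⟨q, t⟩, ⟨hq, ht⟩, rfl⟩, -⟩
    exact hΩ q.1 q.2 _ (hψ.2.2 hq) (by linarith [ht.1])
  · funext q
    by_cases hq : q ∈ O
    · have h1 : φ =ᶠ[𝓝 q] flowMean lam L ψ := by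
        filter_upwards [hO.mem_nhds hq] with x hx using if_pos hx
      have h2 : thetaOp lam φ q = thetaOp lam (flowMean lam L ψ) q := by
        simp only [thetaOp, h1.fderiv_eq, h1.eq_of_nhds]
      have hq' : a - 1 < q.2 := hq
      rw [h2, thetaOp_flowMean L hψ.1, Pi.sub_apply, shiftOp_apply,
        hz q.1 (q.2 + L) fun h => by linarith [h.2], mul_zero, sub_zero]
    · rw [(hφ.thetaOp).eq_zero fun h => hq (hSO h),
        image_eq_zero_of_notMem_tsupport fun h => hq (hSO (hψS h))]

lemma expMean_flowMean (hψ : IsTest Ω ψ) {L : ℝ} (hL : 0 ≤ L) (z : X) :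
    expMean lam (flowMean lam L ψ) z = L * expMean lam ψ z := by
  have hshift : ∀ t : ℝ, ∫ θ : ℝ, Complex.exp (-lam * (θ + t : ℝ)) * ψ (z, θ + t) =
      expMean lam ψ z := fun t =>
    integral_add_right_eq_self (fun θ : ℝ => Complex.exp (-lam * θ) * ψ (z, θ)) t
  have hK := isCompact_lower hψ.2.1.isCompact L
  have hcont : Continuous fun q : ℝ × ℝ =>
      Complex.exp (-lam * (q.2 + q.1 : ℝ)) * ψ (z, q.2 + q.1) :=
    ((contDiff_exp_mul (-lam)).continuous.comp (by fun_prop : Continuous fun q : ℝ × ℝ =>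
      q.2 + q.1)).mul (hψ.1.continuous.comp (by fun_prop))
  have hint : Integrable (Function.uncurry fun t θ : ℝ =>
      Complex.exp (-lam * (θ + t : ℝ)) * ψ (z, θ + t))
      ((volume.restrict (uIoc 0 L)).prod volume) := by
    have hset : (volume.restrict (uIoc 0 L)).prod (volume : Measure ℝ) =
        ((volume : Measure ℝ).prod volume).restrict (uIoc 0 L ×ˢ univ) := by
      rw [← Measure.prod_restrict, Measure.restrict_univ]
    rw [hset]
    have hK' : IsCompact (Icc (0 : ℝ) L ×ˢ (Prod.snd '' ((fun q : (X × ℝ) × ℝ =>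
        (q.1.1, q.1.2 - q.2)) '' (tsupport ψ ×ˢ Icc 0 L)))) :=
      isCompact_Icc.prod (hK.image continuous_snd)
    refine ((hcont.continuousOn.integrableOn_compact hK').of_forall_sdiff_eq_zero
      (measurableSet_uIoc.prod MeasurableSet.univ) fun q hq => ?_)
    have hq1 : q.1 ∈ Icc 0 L := by
      have := hq.1.1
      rw [uIoc_of_le hL] at this
      exact Ioc_subset_Icc_self this
    rw [image_eq_zero_of_notMem_tsupport (f := ψ), mul_zero]
    intro h
    exact hq.2 ⟨hq1, _, ⟨((z, q.2 + q.1), q.1), ⟨h, hq1⟩, rfl⟩, by simp⟩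
  have h1 : ∀ θ : ℝ, Complex.exp (-lam * θ) * flowMean lam L ψ (z, θ) =
      ∫ t in (0 : ℝ)..L, Complex.exp (-lam * (θ + t : ℝ)) * ψ (z, θ + t) := by
    intro θ
    simp only [flowMean]
    rw [← intervalIntegral.integral_const_mul]
    refine intervalIntegral.integral_congr fun t _ => ?_
    rw [← mul_assoc, ← Complex.exp_add]
    congr 2
    push_cast
    ring
  simp only [expMean] at hshift ⊢
  simp_rw [h1]
  rw [← intervalIntegral_integral_swap hint]
  simp_rw [hshift]
  simp

end Transport


/-! ### Solutions of the transport equation on the suspension of a hyperbolic splitting -/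

lemma shift_sub_one_pow_apply {V : Type} [AddCommGroup V] [Module ℂ V] (v : V →ₗ[ℂ] ℂ)
    (R : Module.End ℂ V) (p : ℕ) (ψ : V) :
    ((shift - 1) ^ p) (fun n => v ((R ^ n) ψ)) = fun n => v ((R ^ n) (((R - 1) ^ p) ψ)) := by
  induction p generalizing ψ with
  | zero => rfl
  | succ p ih =>
    have h : (shift - 1) (fun n => v ((R ^ n) ψ)) = fun n => v ((R ^ n) ((R - 1) ψ)) := by
      funext n
      simp only [LinearMap.sub_apply, Module.End.one_apply, Pi.sub_apply, shift_apply, map_sub]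
      rw [pow_succ, Module.End.mul_apply]
    rw [pow_succ, Module.End.mul_apply, h, ih, pow_succ, Module.End.mul_apply]

lemma IsTest.tensor {X : Type} [NormedAddCommGroup X] [NormedSpace ℝ X] {S : Set X} {T : Set ℝ}
    {g : X → ℂ} {e : ℝ → ℂ} (hg : IsTest S g) (he : IsTest T e) :
    IsTest (S ×ˢ T) fun q : X × ℝ => g q.1 * e q.2 := by
  refine (IsTest.of_contDiffOn (hg.2.1.isCompact.prod he.2.1.isCompact) isOpen_univ
    (subset_univ _) ((hg.1.comp contDiff_fst).mul (he.1.comp contDiff_snd)).contDiffOn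
    fun q hq => ?_).mono (prod_mono hg.2.2 he.2.2)
  by_cases h : q.1 ∈ tsupport g
  · show g q.1 * e q.2 = 0
    rw [image_eq_zero_of_notMem_tsupport fun h' => hq ⟨h, h'⟩, mul_zero]
  · show g q.1 * e q.2 = 0
    rw [image_eq_zero_of_notMem_tsupport h, zero_mul]

namespace HyperbolicSplitting

variable {E Y K K' : Type} [NormedAddCommGroup E] [NormedSpace ℝ E] [FiniteDimensional ℝ E]
  [NormedAddCommGroup Y] [InnerProductSpace ℝ Y] [FiniteDimensional ℝ Y]
  [Fintype K] [Fintype K'] [MeasurableSpace Y] [BorelSpace Y]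
  (H : HyperbolicSplitting E Y K K')

lemma wordDeriv_comp_D {g : E → ℂ} (hg : ContDiff ℝ ∞ g) (l : List K) :
    wordDeriv H.s H.v H.w l (fun z => g (H.D z)) =
      fun z => (l.map H.ν).prod * wordDeriv H.s H.v H.w l g (H.D z) := by
  induction l with
  | nil => simp
  | cons k l ih =>
    funext z
    rw [wordDeriv_cons, wordDeriv_cons, ih]
    set G := wordDeriv H.s H.v H.w l g with hG
    have hGd : DifferentiableAt ℝ G (H.D z) :=
      (contDiff_wordDeriv H.s H.v H.w hg l).differentiable (by simp) _
    have h1 : HasFDerivAt (fun z => (l.map H.ν).prod * G (H.D z))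
        ((l.map H.ν).prod • (fderiv ℝ G (H.D z)).comp (H.D : E →L[ℝ] E)) z :=
      (hGd.hasFDerivAt.comp z H.D.hasFDerivAt).const_mul _
    simp only [dirDeriv, h1.fderiv, List.map_cons, List.prod_cons]
    have h2 := H.vec_D (fderiv ℝ G (H.D z)) k
    simp only [_root_.smul_apply, ContinuousLinearMap.comp_apply, smul_eq_mul,
      ContinuousLinearEquiv.coe_coe]
    linear_combination (l.map H.ν).prod * h2

lemma form_comp_D {g : E → ℂ} (hg : ContDiff ℝ ∞ g) (l : List K × List K') :
    H.form l (fun z => g (H.D z)) = H.jac * H.mult l * H.form l g := by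
  have h1 : ∀ y, H.mono l.2 y = (l.2.map H.μ).prod * H.mono l.2 (H.Du y) := by
    intro y
    have := H.mono_Du_pow l.2 1 (H.Du y)
    rw [pow_one, pow_one] at this
    rw [← this]
    simp
  have h2 := H.integral_comp_Du_pow 1 fun y => H.mono l.2 y *
    wordDeriv H.s H.v H.w l.1 g (H.emb y)
  rw [pow_one, pow_one] at h2
  simp only [form, wordDeriv_comp_D H hg]
  have h3 : ∀ y, H.mono l.2 y * ((l.1.map H.ν).prod *
      wordDeriv H.s H.v H.w l.1 g (H.D (H.emb y))) =
      H.mult l * (H.mono l.2 (H.Du y) * wordDeriv H.s H.v H.w l.1 g (H.emb (H.Du y))) := by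
    intro y
    rw [h1, H.D_emb, mult]
    ring
  simp_rw [h3]
  rw [integral_const_mul, h2, jac]
  ring

lemma wordDeriv_smul (g : E → ℂ) (c : ℂ) (l : List K) :
    wordDeriv H.s H.v H.w l (c • g) = c • wordDeriv H.s H.v H.w l g := by
  induction l with
  | nil => rfl
  | cons k l ih =>
    rw [wordDeriv_cons, wordDeriv_cons, ih]
    funext z
    have h : fderiv ℝ (c • wordDeriv H.s H.v H.w l g) z =
        c • fderiv ℝ (wordDeriv H.s H.v H.w l g) z := by
      rw [fderiv_const_smul_field]
      rfl
    simp only [dirDeriv, h, Pi.smul_apply, _root_.smul_apply, smul_eq_mul]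
    ring

lemma form_smul (g : E → ℂ) (c : ℂ) (l : List K × List K') :
    H.form l (c • g) = c * H.form l g := by
  simp only [form, H.wordDeriv_smul, Pi.smul_apply, smul_eq_mul]
  rw [← integral_const_mul]
  congr 1
  funext y
  ring

/-- The operator of composition with `D`, with a factor. -/
def dilOp (κ : ℂ) : Module.End ℂ (E × ℝ → ℂ) where
  toFun ψ q := κ * ψ (H.D q.1, q.2)
  map_add' _ _ := by funext q; simp [mul_add]
  map_smul' _ _ := by funext q; simp [mul_left_comm]

lemma dilOp_apply (κ : ℂ) (ψ : E × ℝ → ℂ) (q : E × ℝ) :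
    H.dilOp κ ψ q = κ * ψ (H.D q.1, q.2) := rfl

lemma dilOp_pow_apply (κ : ℂ) (n : ℕ) (ψ : E × ℝ → ℂ) (q : E × ℝ) :
    (H.dilOp κ ^ n) ψ q = κ ^ n * ψ ((H.D ^ n) q.1, q.2) := by
  induction n generalizing q with
  | zero => simp [equiv_one_apply]
  | succ n ih =>
    rw [pow_succ', Module.End.mul_apply, dilOp_apply, ih]
    rw [show (H.D ^ (n + 1)) q.1 = (H.D ^ n) (H.D q.1) by rw [pow_succ, equiv_mul_apply]]
    ring

lemma thetaOp_dilOp (lam κ : ℂ) (ψ : E × ℝ → ℂ) :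
    thetaOp lam (H.dilOp κ ψ) = H.dilOp κ (thetaOp lam ψ) := by
  have h : H.dilOp κ ψ = κ • fun q => ψ (H.D q.1, q.2) := rfl
  rw [h, thetaOp_smul, thetaOp_comp_equiv]
  rfl

variable {lam κ : ℂ} {P : ℝ} {Ω : Set (E × ℝ)}

lemma thetaOp_iterate_dilOp (k : ℕ) (ψ : E × ℝ → ℂ) :
    (thetaOp lam)^[k] (H.dilOp κ ψ) = H.dilOp κ ((thetaOp lam)^[k] ψ) := by
  induction k with
  | zero => rfl
  | succ k ih =>
    rw [Function.iterate_succ_apply', Function.iterate_succ_apply', ih, thetaOp_dilOp]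

lemma thetaOp_iterate_shiftOp (k : ℕ) (s : ℝ) (ψ : E × ℝ → ℂ) :
    (thetaOp lam)^[k] (shiftOp E lam s ψ) = shiftOp E lam s ((thetaOp lam)^[k] ψ) := by
  induction k with
  | zero => rfl
  | succ k ih =>
    rw [Function.iterate_succ_apply', Function.iterate_succ_apply', ih, thetaOp_shiftOp]

lemma isTest_dilOp {S S' : Set (E × ℝ)} {ψ : E × ℝ → ℂ} (hψ : IsTest S ψ)
    (h : ∀ z θ, (H.D z, θ) ∈ S → (z, θ) ∈ S') (κ : ℂ) : IsTest S' (H.dilOp κ ψ) :=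
  ((hψ.comp_equiv (H.D.prodCongr (ContinuousLinearEquiv.refl ℝ ℝ))).smul κ).mono
    fun q hq => h q.1 q.2 hq

lemma expMean_dilOp (ψ : E × ℝ → ℂ) :
    expMean lam (H.dilOp κ ψ) = κ • fun z => expMean lam ψ (H.D z) := by
  funext z
  simp only [expMean, dilOp_apply, Pi.smul_apply, smul_eq_mul]
  rw [← integral_const_mul]
  congr 1
  funext θ
  ring

lemma form_expMean_dilOp {l : List K × List K'} (hl : κ * H.jac * H.mult l = 1)
    {ψ : E × ℝ → ℂ} (hψ : IsTest Ω ψ) :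
    H.form l (expMean lam (H.dilOp κ ψ)) = H.form l (expMean lam ψ) := by
  have h := contDiff_expMean (lam := lam) hψ
  rw [expMean_dilOp, H.form_smul, H.form_comp_D h]
  linear_combination hl * H.form l (expMean lam ψ)

section Main

variable (hP : 0 < P) (hΩ : DownClosed Ω)
  (hper : ∀ z θ, (H.D z, θ) ∈ Ω ↔ (z, θ + P) ∈ Ω)
include hP hΩ hper

lemma isTest_dilOp' {ψ : E × ℝ → ℂ} (hψ : IsTest Ω ψ) : IsTest Ω (H.dilOp κ ψ) :=
  H.isTest_dilOp hψ (fun z θ h => hΩ z (θ + P) θ ((hper z θ).1 h) (by linarith)) κ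

lemma isTest_dilOp_pow {ψ : E × ℝ → ℂ} (hψ : IsTest Ω ψ) (n : ℕ) :
    IsTest Ω ((H.dilOp κ ^ n) ψ) := by
  induction n with
  | zero => exact hψ
  | succ n ih =>
    rw [pow_succ', Module.End.mul_apply]
    exact H.isTest_dilOp' hP hΩ hper ih

/-- The functions `R ^ n ψ` are supported, for large `n`, over a neighborhood of the origin that
does not depend on `ψ`. -/
lemma exists_isTest_dilOp_pow {ψ : E × ℝ → ℂ} (hψ : IsTest Ω ψ) (ε : ℝ) : ∃ n₀ : ℕ, ∀ n ≥ n₀,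
    ∀ q ∈ tsupport ((H.dilOp κ ^ n) ψ), (q.1, ε) ∈ Ω := by
  obtain ⟨a, b, -, hsupp, -⟩ := hψ.exists_expMean_eq (lam := 0)
  obtain ⟨n₀, hn₀⟩ := exists_nat_ge ((ε - a) / P)
  refine ⟨n₀, fun n hn q hq => ?_⟩
  have hiter : ∀ (m : ℕ) (z : E) (θ : ℝ), ((H.D ^ m) z, θ) ∈ Ω → (z, θ + m * P) ∈ Ω := by
    intro m
    induction m with
    | zero => intro z θ h; simpa [equiv_one_apply] using h
    | succ m ih =>
      intro z θ h
      rw [pow_succ', equiv_mul_apply, hper] at h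
      have := ih z _ h
      push_cast
      convert this using 2
      ring
  have hq' : ((H.D ^ n) q.1, q.2) ∈ tsupport ψ := by
    have h1 : (H.dilOp κ ^ n) ψ = κ ^ n • fun q => ψ ((H.D ^ n) q.1, q.2) :=
      funext fun q => H.dilOp_pow_apply κ n ψ q
    rw [h1] at hq
    have h2 := ((hψ.of_tsupport subset_rfl).comp_equiv
      ((H.D ^ n).prodCongr (ContinuousLinearEquiv.refl ℝ ℝ))).smul (κ ^ n)
    exact h2.2.2 hq
  refine hΩ _ _ _ (hiter n _ _ (hψ.2.2 hq')) ?_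
  have h1 := (hsupp _ hq').1
  have h2 : (ε - a) / P ≤ n := hn₀.trans (by exact_mod_cast hn)
  rw [div_le_iff₀ hP] at h2
  simp only at h1
  linarith

variable (v : (E × ℝ → ℂ) →ₗ[ℂ] ℂ)
  (hR : ∀ ψ, IsTest Ω ψ → v (H.dilOp κ ψ) = v (shiftOp E lam P ψ))
include hR

omit hR in
/-- If `v` is killed by the power `p` of `thetaOp`, then it is killed by the power `p` of the
translation minus the identity, which factors through `thetaOp`. -/
lemma apply_shiftOp_sub_one_pow {p : ℕ} (hN : ∀ ψ, IsTest Ω ψ → v ((thetaOp lam)^[p] ψ) = 0)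
    {ψ : E × ℝ → ℂ} (hψ : IsTest Ω ψ) : v (((shiftOp E lam P - 1) ^ p) ψ) = 0 := by
  induction p generalizing v with
  | zero => exact hN ψ hψ
  | succ p ih =>
    have h := ih (v ∘ₗ (shiftOp E lam P - 1)) fun φ hφ => ?_
    · rw [pow_succ', Module.End.mul_apply]
      exact h
    · have hS := hΩ.isTest_shiftOp (lam := lam) hP.le hφ
      have hG := hΩ.isTest_flowMean (lam := lam) hP.le hφ
      have h1 : (shiftOp E lam P - 1) ((thetaOp lam)^[p] φ) =
          -((thetaOp lam)^[p + 1] (flowMean lam P φ)) := by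
        rw [Function.iterate_succ_apply, thetaOp_flowMean P hφ.1, thetaOp_iterate_sub p hφ hS,
          thetaOp_iterate_shiftOp, LinearMap.sub_apply, Module.End.one_apply, neg_sub]
      rw [LinearMap.comp_apply, h1, map_neg, hN _ hG, neg_zero]

/-- The nilpotency passes from the translation to the dilation, which have the same action on `v` and
commute with each other. -/
lemma apply_dilOp_sub_one_pow (p : ℕ)
    (hS : ∀ ψ, IsTest Ω ψ → v (((shiftOp E lam P - 1) ^ p) ψ) = 0)
    {ψ : E × ℝ → ℂ} (hψ : IsTest Ω ψ) : v (((H.dilOp κ - 1) ^ p) ψ) = 0 := by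
  have hsub : ∀ {φ}, IsTest Ω φ → IsTest Ω ((shiftOp E lam P - 1) φ) := fun hφ =>
    (hΩ.isTest_shiftOp hP.le hφ).sub hφ
  have hcomm : ∀ φ, (shiftOp E lam P - 1) (H.dilOp κ φ) = H.dilOp κ ((shiftOp E lam P - 1) φ) := by
    intro φ
    funext q
    simp only [LinearMap.sub_apply, Module.End.one_apply, Pi.sub_apply, shiftOp_apply, dilOp_apply]
    ring
  induction p generalizing v with
  | zero => exact hS ψ hψ
  | succ p ih =>
    have h := ih (v ∘ₗ (shiftOp E lam P - 1)) (fun φ hφ => ?_) fun φ hφ => ?_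
    · have hpow : ∀ (m : ℕ) {φ}, IsTest Ω φ → IsTest Ω (((H.dilOp κ - 1) ^ m) φ) := by
        intro m
        induction m with
        | zero => exact fun h => h
        | succ m ihm =>
          intro φ hφ
          rw [pow_succ', Module.End.mul_apply]
          exact (H.isTest_dilOp' hP hΩ hper (ihm hφ)).sub (ihm hφ)
      have h1 := hR _ (hpow p hψ)
      rw [pow_succ', Module.End.mul_apply, LinearMap.sub_apply, map_sub, h1, ← map_sub]
      exact h
    · rw [LinearMap.comp_apply, LinearMap.comp_apply, hcomm, hR _ (hsub hφ)]
      congr 1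
      simp only [LinearMap.sub_apply, Module.End.one_apply, map_sub]
    · have := hS φ hφ
      rw [pow_succ', Module.End.mul_apply] at this
      exact this

end Main

/-- A function supported in a cylinder over `{z | (z, ε) ∈ Ω}` is the sum of a tensor product with
`e` and of a function in the range of `thetaOp`. -/
lemma exists_decomposition {ε : ℝ} {e : ℝ → ℂ} (he : IsTest (Ioo (-ε) ε) e)
    (he1 : ∫ θ : ℝ, Complex.exp (-lam * θ) * e θ = 1) (hΩ : DownClosed Ω) {ψ : E × ℝ → ℂ}
    (hψ : IsTest Ω ψ) (hε : ∀ q ∈ tsupport ψ, (q.1, ε) ∈ Ω) :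
    ∃ φ, IsTest Ω φ ∧ ψ = (fun q => expMean lam ψ q.1 * e q.2) + thetaOp lam φ := by
  have hM : IsTest {z | (z, ε) ∈ Ω} (expMean lam ψ) := hψ.expMean hε
  have hT : IsTest Ω fun q : E × ℝ => expMean lam ψ q.1 * e q.2 :=
    (hM.tensor he).mono fun q hq => hΩ _ _ _ hq.1 hq.2.2.le
  obtain ⟨φ, hφ, h⟩ := hΩ.exists_thetaOp_eq (lam := lam) (hψ.sub hT) fun z => by
    have h1 : ∀ θ : ℝ, Complex.exp (-lam * θ) *
        (ψ - fun q : E × ℝ => expMean lam ψ q.1 * e q.2) (z, θ) =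
        Complex.exp (-lam * θ) * ψ (z, θ) -
          expMean lam ψ z * (Complex.exp (-lam * θ) * e θ) := fun θ => by
      simp only [Pi.sub_apply]
      ring
    have hi1 : Integrable fun θ : ℝ => Complex.exp (-lam * θ) * ψ (z, θ) := by
      refine ((contDiff_exp_mul (-lam)).continuous.mul
        (hψ.1.continuous.comp (by fun_prop))).integrable_of_hasCompactSupport ?_
      refine HasCompactSupport.intro (hψ.2.1.isCompact.image continuous_snd) fun θ hθ => ?_
      show _ * ψ (z, θ) = 0
      rw [image_eq_zero_of_notMem_tsupport (f := ψ) fun h => hθ ⟨_, h, rfl⟩, mul_zero]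
    have hi2 : Integrable fun θ : ℝ => Complex.exp (-lam * θ) * e θ :=
      ((contDiff_exp_mul (-lam)).continuous.mul he.1.continuous).integrable_of_hasCompactSupport
        he.2.1.mul_left
    show ∫ θ : ℝ, _ = _
    simp_rw [h1]
    rw [integral_sub hi1 (hi2.const_mul _), integral_const_mul, he1, mul_one]
    exact sub_self _
  exact ⟨φ, hφ, by rw [h]; abel⟩

/-- The space `Ω` carries the functional `v`, which satisfies `(∂_θ + lam) ^ p v = 0` and is
equivariant under the deck transformation `(z, θ) ↦ (D z, θ - P)`. If moreover `v` is carried by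
the unstable space and is regular with respect to it near one point of the closed orbit, then `v`
is a finite combination of the model functionals, and `(∂_θ + lam) v = 0`. -/
theorem exists_flow_expansion (hP : 0 < P) (hΩ : DownClosed Ω)
    (hper : ∀ z θ, (H.D z, θ) ∈ Ω ↔ (z, θ + P) ∈ Ω) (v : (E × ℝ → ℂ) →ₗ[ℂ] ℂ)
    (hR : ∀ ψ, IsTest Ω ψ → v (H.dilOp κ ψ) = v (shiftOp E lam P ψ)) {p : ℕ}
    (hN : ∀ ψ, IsTest Ω ψ → v ((thetaOp lam)^[p] ψ) = 0)
    (hsupp : ∀ ψ, IsTest Ω ψ → (∀ q ∈ tsupport ψ, q.1 ∉ H.unstable) → v ψ = 0)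
    {O : Set (E × ℝ)} (hO : IsOpen O) (h0 : (0, 0) ∈ O) (hOΩ : O ⊆ Ω)
    (hord : ∃ (M : ℕ) (C : ℝ), ∀ (ψ : E × ℝ → ℂ) (b : ℝ), IsTest O ψ → 0 ≤ b →
      (∀ j ≤ M, ∀ x, ‖iteratedFDeriv ℝ j ψ x‖ ≤ b) → ‖v ψ‖ ≤ C * b)
    (hreg : ∀ χ, IsTest O χ → ∃ f : Y → ℂ, ContDiff ℝ ∞ f ∧
      ∀ b : Y → ℂ, IsTest univ b → v (fun q => χ q * b (H.proj q.1)) = ∫ y, b y * f y) :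
    (∀ ψ, IsTest Ω ψ → v (thetaOp lam ψ) = 0) ∧
    ∃ (ι : Type) (_ : Fintype ι) (l : ι → List K × List K') (F : ι → ℂ),
      (∀ i, κ * H.jac * H.mult (l i) = 1) ∧
      ∀ ψ, IsTest Ω ψ → v ψ = ∑ i, F i * H.form (l i) (expMean lam ψ) := by
  obtain ⟨ε, hε, hεO⟩ : ∃ ε > 0, Metric.closedBall (0 : E) ε ×ˢ Icc (-ε) ε ⊆ O := by
    obtain ⟨η, hη, hηO⟩ := Metric.isOpen_iff.1 hO _ h0
    refine ⟨η / 2, by positivity, fun q hq => hηO ?_⟩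
    rw [← ball_prod_same]
    refine ⟨Metric.closedBall_subset_ball (by linarith) hq.1, ?_⟩
    rw [mem_ball_zero_iff, Real.norm_eq_abs, abs_lt]
    constructor <;> linarith [hq.2.1, hq.2.2]
  obtain ⟨e, he, he1⟩ : ∃ e : ℝ → ℂ, IsTest (Ioo (-ε) ε) e ∧
      ∫ θ : ℝ, Complex.exp (-lam * θ) * e θ = 1 := by
    let f : ContDiffBump (0 : ℝ) := ⟨ε / 4, ε / 2, by positivity, by linarith⟩
    refine ⟨fun θ => Complex.exp (lam * θ) * ((f.normed volume θ : ℝ) : ℂ), ?_, ?_⟩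
    · refine (IsTest.of_contDiffOn (isCompact_closedBall (0 : ℝ) (ε / 2)) isOpen_univ
        (subset_univ _) ((contDiff_exp_mul lam).mul (Complex.ofRealCLM.contDiff.comp
          f.contDiff_normed)).contDiffOn fun θ hθ => ?_).mono fun θ hθ => ?_
      · have : f.normed volume θ = 0 := by
          refine image_eq_zero_of_notMem_tsupport (f := f.normed volume) fun h => hθ ?_
          rwa [f.tsupport_normed_eq] at h
        simp [this]
      · rw [mem_closedBall_zero_iff, Real.norm_eq_abs, abs_le] at hθ
        constructor <;> linarith [hθ.1, hθ.2]
    · have : ∀ θ : ℝ, Complex.exp (-lam * θ) * (Complex.exp (lam * θ) *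
          ((f.normed volume θ : ℝ) : ℂ)) = ((f.normed volume θ : ℝ) : ℂ) := fun θ => by
        rw [← mul_assoc, ← Complex.exp_add]
        simp
      simp_rw [this]
      have h1 := integral_ofReal (𝕜 := ℂ) (μ := (volume : Measure ℝ)) (f := f.normed volume)
      rw [f.integral_normed] at h1
      exact h1.trans (by simp)
  -- the functions `e`, `(lam - ∂_θ) e`, ...
  let ek : ℕ → ℝ → ℂ := fun k => (fun (a : ℝ → ℂ) θ => lam * a θ - deriv a θ)^[k] e
  have hek : ∀ k, IsTest (Ioo (-ε) ε) (ek k) := by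
    intro k
    induction k with
    | zero => exact he
    | succ k ih =>
      have h1 : ek (k + 1) = fun θ => lam * ek k θ - deriv (ek k) θ :=
        Function.iterate_succ_apply' _ _ _
      rw [h1]
      have h2 : deriv (ek k) = dirDeriv 0 (1 : ℝ) 0 (ek k) := by
        funext θ
        simp [dirDeriv]
      exact (ih.smul lam).sub (h2 ▸ ih.dirDeriv 0 1 0)
  have htens : ∀ (k : ℕ) {S : Set E} {g : E → ℂ}, IsTest S g →
      (thetaOp lam)^[k] (fun q : E × ℝ => g q.1 * e q.2) = fun q => g q.1 * ek k q.2 := by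
    intro k S g hg
    induction k with
    | zero => rfl
    | succ k ih =>
      rw [Function.iterate_succ_apply', ih, thetaOp_tensor hg.1 (hek k).1]
      have h1 : ek (k + 1) = fun θ => lam * ek k θ - deriv (ek k) θ :=
        Function.iterate_succ_apply' _ _ _
      rw [h1]
  let OE : Set E := {z | (z, ε) ∈ Ω}
  have htest : ∀ (k : ℕ) {g : E → ℂ}, IsTest OE g → IsTest Ω fun q : E × ℝ => g q.1 * ek k q.2 :=
    fun k g hg => (hg.tensor (hek k)).mono fun q hq => hΩ _ _ _ hq.1 hq.2.2.le
  have htestO : ∀ (k : ℕ) {g : E → ℂ}, IsTest (Metric.ball 0 ε) g →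
      IsTest O fun q : E × ℝ => g q.1 * ek k q.2 := fun k g hg =>
    (hg.tensor (hek k)).mono fun q hq =>
      hεO ⟨Metric.ball_subset_closedBall hq.1, Ioo_subset_Icc_self hq.2⟩
  -- the functionals of the variable `z` obtained by fixing the factor `ek k` in the variable `θ`
  let W : ℕ → (E → ℂ) →ₗ[ℂ] ℂ := fun k =>
    { toFun := fun g => v fun q => g q.1 * ek k q.2
      map_add' := fun g g' => by
        rw [← map_add]
        congr 1
        funext q
        simp [add_mul]
      map_smul' := fun c g => by
        rw [RingHom.id_apply, ← map_smul]
        congr 1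
        funext q
        simp [mul_assoc] }
  have hW : ∀ k g, W k g = v fun q => g q.1 * ek k q.2 := fun _ _ => rfl
  have hWD : ∀ (k : ℕ) (g : E → ℂ) (n : ℕ), κ ^ n * W k (fun z => g ((H.D ^ n) z)) =
      v ((H.dilOp κ ^ n) fun q => g q.1 * ek k q.2) := by
    intro k g n
    rw [hW, ← smul_eq_mul, ← map_smul]
    congr 1
    funext q
    rw [dilOp_pow_apply, Pi.smul_apply, smul_eq_mul]
  have hpoly : ∀ {ψ}, IsTest Ω ψ → ((shift - 1) ^ p) (fun n => v ((H.dilOp κ ^ n) ψ)) = 0 := by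
    intro ψ hψ
    rw [shift_sub_one_pow_apply]
    funext n
    have h1 : (H.dilOp κ ^ n) (((H.dilOp κ - 1) ^ p) ψ) =
        ((H.dilOp κ - 1) ^ p) ((H.dilOp κ ^ n) ψ) := by
      have hc : Commute (H.dilOp κ ^ n) ((H.dilOp κ - 1) ^ p) :=
        ((Commute.refl (H.dilOp κ)).sub_right (Commute.one_right _)).pow_pow n p
      rw [← Module.End.mul_apply, hc.eq, Module.End.mul_apply]
    rw [h1]
    exact H.apply_dilOp_sub_one_pow hP hΩ hper v hR p
      (fun φ hφ => H.apply_shiftOp_sub_one_pow hP hΩ hper v hN hφ)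
      (H.isTest_dilOp_pow hP hΩ hper hψ n)
  have hOE : ∀ z, H.D z ∈ OE → z ∈ OE := fun z hz =>
    hΩ z (ε + P) ε ((hper z ε).1 hz) (by linarith)
  have hball : Metric.ball 0 ε ⊆ OE := fun z hz =>
    hOΩ (hεO ⟨Metric.ball_subset_closedBall hz, by constructor <;> linarith⟩)
  -- each `W k` has finite order and is carried by, and regular along, the unstable space
  have hexp : ∀ k, ∃ (ι : Type) (_ : Fintype ι) (l : ι → List K × List K') (F : ι → ℂ),
      (∀ i, κ * H.jac * H.mult (l i) = 1) ∧
      ∀ g, IsTest OE g → W k g = ∑ i, F i * H.form (l i) g := by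
    intro k
    refine H.exists_form_expansion hOE (W k) κ hε hball (p := p) (fun g hg hdis => ?_)
      (fun g hg => ?_) ?_ fun χ hχ => ?_
    · refine hsupp _ (htest k hg) fun q hq => Set.disjoint_left.1 hdis ?_
      have : IsTest (tsupport g ×ˢ Ioo (-ε) ε) fun q : E × ℝ => g q.1 * ek k q.2 :=
        (hg.of_tsupport subset_rfl).tensor (hek k)
      exact (this.2.2 hq).1
    · simp_rw [hWD]
      exact hpoly (htest k hg)
    · obtain ⟨M, C, hMC⟩ := hord
      obtain ⟨χ, hχ, O', -, hKO', -, hχ1⟩ := exists_cutoff (isCompact_closedBall (0 : E) ε)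
        isOpen_univ (subset_univ _)
      obtain ⟨B, hB0, hB⟩ := (hχ.tensor (hek k)).exists_mul_bound M
      refine ⟨M, C * B, fun g b hg hb hgb => ?_⟩
      rw [mul_assoc]
      refine hMC _ _ (htestO k hg) (by positivity) fun j hj x => ?_
      have h1 : (fun q : E × ℝ => g q.1 * ek k q.2) =
          (fun q : E × ℝ => χ q.1 * ek k q.2) * (g ∘ ContinuousLinearMap.fst ℝ E ℝ) := by
        funext q
        simp only [Pi.mul_apply, Function.comp_apply, ContinuousLinearMap.coe_fst']
        by_cases hq : q.1 ∈ Metric.ball (0 : E) ε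
        · rw [hχ1 _ (hKO' (Metric.ball_subset_closedBall hq))]
          ring
        · rw [hg.eq_zero hq]
          ring
      rw [h1]
      refine hB _ (hg.1.comp (ContinuousLinearMap.contDiff _)) b x hb (fun i hi => ?_) j hj
      refine (norm_iteratedFDeriv_comp_clm_le _ hg.1 x i).trans ?_
      refine (mul_le_of_le_one_right (norm_nonneg _) (pow_le_one₀ (norm_nonneg _)
        (ContinuousLinearMap.norm_fst_le ..))).trans (hgb i hi _)
    · obtain ⟨f, hf, hf'⟩ := hreg _ (htestO k hχ)
      refine ⟨f, hf, fun b hb => ?_⟩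
      rw [← hf' b hb, hW]
      congr 1
      funext q
      ring
  have hWinv : ∀ (k : ℕ) (g : E → ℂ), IsTest OE g → κ * W k (fun z => g (H.D z)) = W k g := by
    intro k g hg
    obtain ⟨ι, _, l, F, hl, hF⟩ := hexp k
    rw [hF g hg, hF _ (by simpa using IsTest.comp_D_pow H hOE hg 1), Finset.mul_sum]
    refine Finset.sum_congr rfl fun i _ => ?_
    rw [H.form_comp_D hg.1]
    linear_combination (F i * H.form (l i) g) * hl i
  have hRT : ∀ {ψ}, IsTest Ω ψ → IsTest Ω (H.dilOp κ ψ) := fun hψ =>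
    H.isTest_dilOp' hP hΩ hper hψ
  have hadd : ∀ k {ψ φ}, IsTest Ω ψ → IsTest Ω φ →
      (thetaOp lam)^[k] (ψ + φ) = (thetaOp lam)^[k] ψ + (thetaOp lam)^[k] φ := by
    intro k ψ φ hψ hφ
    have := thetaOp_iterate_sub (lam := lam) k (hψ.add hφ) hφ
    rw [add_sub_cancel_right] at this
    rw [this]
    abel
  -- the invariance of `v` under `R`
  -- By descending induction on `k`. Modulo the range of `thetaOp`, which is dealt with by the case
  -- `k + 1`, a test function is the tensor product of its mean with `e`, on which `v` is given by
  -- `W k`.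
  have hinv : ∀ j k, k + j = p → ∀ ψ, IsTest Ω ψ →
      v ((thetaOp lam)^[k] (H.dilOp κ ψ)) = v ((thetaOp lam)^[k] ψ) := by
    intro j
    induction j with
    | zero =>
      intro k hk ψ hψ
      obtain rfl : k = p := by omega
      rw [hN _ hψ, hN _ (hRT hψ)]
    | succ j ih =>
      intro k hk
      have key : ∀ ψ, IsTest Ω ψ → (∀ q ∈ tsupport ψ, (q.1, ε) ∈ Ω) →
          v ((thetaOp lam)^[k] (H.dilOp κ ψ)) = v ((thetaOp lam)^[k] ψ) := by
        intro ψ hψ hψε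
        have hM : IsTest OE (expMean lam ψ) := hψ.expMean hψε
        have hT : IsTest Ω fun q : E × ℝ => expMean lam ψ q.1 * e q.2 := htest 0 hM
        obtain ⟨φ, hφ, h⟩ := exists_decomposition he he1 hΩ hψ hψε
        have h2 := ih (k + 1) (by omega) φ hφ
        rw [Function.iterate_succ_apply, Function.iterate_succ_apply, H.thetaOp_dilOp] at h2
        have h3 := hWinv k _ hM
        have h4 := hWD k (expMean lam ψ) 1
        rw [pow_one, pow_one, pow_one] at h4
        rw [h4, hW, ← htens k hM, ← H.thetaOp_iterate_dilOp] at h3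
        rw [h, map_add, hadd k (hRT hT) (hRT hφ.thetaOp), hadd k hT hφ.thetaOp, map_add, map_add, h2]
        congr 1
      intro ψ hψ
      -- The support condition of `key` holds after sufficiently many iterations of `R`. So the sequence
      -- `shift a - a` is eventually zero, and it vanishes because `a` is polynomial.
      obtain ⟨n₀, hn₀⟩ := H.exists_isTest_dilOp_pow hP hΩ hper (κ := κ) hψ ε
      let a : ℕ → ℂ := fun n => v ((H.dilOp κ ^ n) ((thetaOp lam)^[k] ψ))
      have hcomm : ∀ n, (H.dilOp κ ^ n) ((thetaOp lam)^[k] ψ) =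
          (thetaOp lam)^[k] ((H.dilOp κ ^ n) ψ) := by
        intro n
        induction n with
        | zero => rfl
        | succ n ihn =>
          rw [pow_succ', Module.End.mul_apply, Module.End.mul_apply, ihn, H.thetaOp_iterate_dilOp]
      have ha : ((shift - 1) ^ p) ((shift - 1) a) = 0 := by
        rw [← Module.End.mul_apply, ← pow_succ, pow_succ', Module.End.mul_apply,
          hpoly (hψ.thetaOp_iterate k), map_zero]
      have hlim : Tendsto ((shift - 1) a) atTop (𝓝 0) := by
        refine tendsto_const_nhds.congr' ?_
        filter_upwards [eventually_ge_atTop n₀] with n hn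
        have := key _ (H.isTest_dilOp_pow hP hΩ hper hψ n) (hn₀ n hn)
        simp only [LinearMap.sub_apply, Module.End.one_apply, Pi.sub_apply, shift_apply, a]
        rw [hcomm, hcomm, pow_succ', Module.End.mul_apply, this, sub_self]
      have h1 := congrFun (eq_zero_of_shift_sub_one_pow ha hlim) 0
      simp only [LinearMap.sub_apply, Module.End.one_apply, Pi.sub_apply, shift_apply, a,
        Pi.zero_apply, sub_eq_zero, hcomm, zero_add, pow_one, pow_zero] at h1
      exact h1
  have hinv0 : ∀ ψ, IsTest Ω ψ → v (H.dilOp κ ψ) = v ψ := hinv p 0 (zero_add p)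
  have hST : ∀ {ψ}, IsTest Ω ψ → IsTest Ω (shiftOp E lam P ψ) := fun hψ =>
    hΩ.isTest_shiftOp hP.le hψ
  have hinvS : ∀ ψ, IsTest Ω ψ → v (shiftOp E lam P ψ) = v ψ := fun ψ hψ => by
    rw [← hR ψ hψ, hinv0 ψ hψ]
  -- the invariance under the flow
  have hflow : ∀ j, (∀ ψ, IsTest Ω ψ → v ((thetaOp lam)^[j + 1] ψ) = 0) →
      ∀ ψ, IsTest Ω ψ → v (thetaOp lam ψ) = 0 := by
    intro j
    induction j with
    | zero => exact fun h => h
    | succ j ih =>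
      refine fun h => ih fun φ hφ => ?_
      -- `φ - G / P` has mean zero along the flow, hence lies in the range of `thetaOp`, and
      -- `thetaOp G` is the difference of `φ` and of its translate
      set G := flowMean lam P φ with hG
      have hGt : IsTest Ω G := hΩ.isTest_flowMean hP.le hφ
      have hPC : (P : ℂ) ≠ 0 := by exact_mod_cast hP.ne'
      obtain ⟨χ, hχ, hχ'⟩ := hΩ.exists_thetaOp_eq (lam := lam) (hφ.sub (hGt.smul (P : ℂ)⁻¹))
        fun z => by
          have h1 := expMean_flowMean (lam := lam) hφ hP.le z
          have h2 : expMean lam (φ - (P : ℂ)⁻¹ • G) z =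
              expMean lam φ z - (P : ℂ)⁻¹ * expMean lam G z := by
            obtain ⟨a, b, -, -, hab⟩ := (hφ.of_tsupport (S' := univ)
              (subset_univ _)).exists_expMean_eq (lam := lam)
            have hi : ∀ {χ : E × ℝ → ℂ}, IsTest Ω χ →
                Integrable fun θ : ℝ => Complex.exp (-lam * θ) * χ (z, θ) := by
              intro χ hχ
              refine ((contDiff_exp_mul (-lam)).continuous.mul
                (hχ.1.continuous.comp (by fun_prop))).integrable_of_hasCompactSupport ?_
              refine HasCompactSupport.intro (hχ.2.1.isCompact.image continuous_snd) fun θ hθ => ?_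
              show _ * χ (z, θ) = 0
              rw [image_eq_zero_of_notMem_tsupport (f := χ) fun h => hθ ⟨_, h, rfl⟩, mul_zero]
            simp only [expMean]
            rw [← integral_const_mul, ← integral_sub (hi hφ) ((hi hGt).const_mul _)]
            congr 1
            funext θ
            simp only [Pi.sub_apply, Pi.smul_apply, smul_eq_mul]
            ring
          rw [h2, hG, h1]
          field_simp
          ring
      have h1 : φ = thetaOp lam χ + (P : ℂ)⁻¹ • G := by rw [hχ']; abel
      have h2 : v ((thetaOp lam)^[j + 1] G) = 0 := by
        rw [Function.iterate_succ_apply, hG, thetaOp_flowMean P hφ.1,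
          thetaOp_iterate_sub j hφ (hST hφ), thetaOp_iterate_shiftOp, map_sub,
          hinvS _ (hφ.thetaOp_iterate j), sub_self]
      have h3 : ∀ k, (thetaOp lam)^[k] ((P : ℂ)⁻¹ • G) = (P : ℂ)⁻¹ • (thetaOp lam)^[k] G := by
        intro k
        induction k with
        | zero => rfl
        | succ k ihk =>
          rw [Function.iterate_succ_apply', Function.iterate_succ_apply', ihk, thetaOp_smul]
      rw [h1, hadd (j + 1) hχ.thetaOp (hGt.smul _), map_add, ← Function.iterate_succ_apply,
        h χ hχ, h3, map_smul, h2, smul_zero, add_zero]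
  have hvN : ∀ ψ, IsTest Ω ψ → v (thetaOp lam ψ) = 0 := by
    refine hflow p fun ψ hψ => ?_
    rw [Function.iterate_succ_apply]
    exact hN _ hψ.thetaOp
  refine ⟨hvN, ?_⟩
  -- Both sides are invariant under `R`, and after sufficiently many iterations the test function is
  -- the tensor product of its mean with `e` modulo the range of `thetaOp`.
  obtain ⟨ι, _, l, F, hl, hF⟩ := hexp 0
  refine ⟨ι, inferInstance, l, F, hl, fun ψ hψ => ?_⟩
  obtain ⟨n₀, hn₀⟩ := H.exists_isTest_dilOp_pow hP hΩ hper (κ := κ) hψ ε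
  have h1 : ∀ n, v ((H.dilOp κ ^ n) ψ) = v ψ := by
    intro n
    induction n with
    | zero => rfl
    | succ n ih =>
      rw [pow_succ', Module.End.mul_apply, hinv0 _ (H.isTest_dilOp_pow hP hΩ hper hψ n), ih]
  have h2 : ∀ i n, H.form (l i) (expMean lam ((H.dilOp κ ^ n) ψ)) =
      H.form (l i) (expMean lam ψ) := by
    intro i n
    induction n with
    | zero => rfl
    | succ n ih =>
      rw [pow_succ', Module.End.mul_apply,
        H.form_expMean_dilOp (hl i) (H.isTest_dilOp_pow hP hΩ hper hψ n), ih]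
  have hψn := H.isTest_dilOp_pow hP hΩ hper (κ := κ) hψ n₀
  have hM : IsTest OE (expMean lam ((H.dilOp κ ^ n₀) ψ)) := hψn.expMean (hn₀ n₀ le_rfl)
  obtain ⟨φ, hφ, h⟩ := exists_decomposition he he1 hΩ hψn (hn₀ n₀ le_rfl)
  rw [← h1 n₀, h, map_add, hvN φ hφ, add_zero]
  have h3 := hF _ hM
  rw [hW] at h3
  refine h3.trans (Finset.sum_congr rfl fun i _ => ?_)
  rw [h2]

end HyperbolicSplitting


/-! ### Block-diagonal matrices -/

section BlockAlgebra

variable {l p : ℕ}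

/-- The block-diagonal matrix whose two-dimensional blocks are the multiplications by the complex
numbers `m j`. -/
def complexBlocks (a : Fin l → ℝ) (m : Fin p → ℂ) : Matrix (Label l p) (Label l p) ℝ :=
  blockMatrix a (fun j => (m j).re) (fun j => (m j).im)

lemma complexBlocks_mul (a a' : Fin l → ℝ) (m m' : Fin p → ℂ) :
    complexBlocks a m * complexBlocks a' m' = complexBlocks (a * a') (m * m') := by
  simp only [complexBlocks, blockMatrix, Matrix.fromBlocks_multiply, Matrix.diagonal_mul_diagonal,
    Matrix.zero_mul, Matrix.mul_zero, add_zero, zero_add]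
  rw [← Matrix.blockDiagonal_mul]
  congr 2
  funext j
  ext i k
  fin_cases i <;> fin_cases k <;> simp [Matrix.mul_apply, Fin.sum_univ_two] <;> ring

lemma complexBlocks_one : complexBlocks (1 : Fin l → ℝ) (1 : Fin p → ℂ) = 1 := by
  have h : (fun j : Fin p => !![((1 : Fin p → ℂ) j).re, -((1 : Fin p → ℂ) j).im;
      ((1 : Fin p → ℂ) j).im, ((1 : Fin p → ℂ) j).re]) = 1 := by
    funext j
    ext i k
    fin_cases i <;> fin_cases k <;> simp
  rw [complexBlocks, blockMatrix, h, Matrix.blockDiagonal_one]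
  simp

lemma complexBlocks_det (a : Fin l → ℝ) (m : Fin p → ℂ) :
    (complexBlocks a m).det = (∏ j, a j) * ∏ j, Complex.normSq (m j) := by
  rw [complexBlocks, blockMatrix, Matrix.det_fromBlocks_zero₂₁, Matrix.det_diagonal,
    Matrix.det_blockDiagonal]
  congr 1
  refine Finset.prod_congr rfl fun j _ => ?_
  rw [Matrix.det_fin_two_of, Complex.normSq_apply]
  ring

lemma complexBlocks_mulVec_inl (a : Fin l → ℝ) (m : Fin p → ℂ) (x : Label l p → ℝ) (j : Fin l) :
    (complexBlocks a m *ᵥ x) (.inl j) = a j * x (.inl j) := by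
  simp [complexBlocks, blockMatrix, Matrix.fromBlocks_mulVec, Matrix.mulVec_diagonal]

lemma complexBlocks_mulVec_zero (a : Fin l → ℝ) (m : Fin p → ℂ) (x : Label l p → ℝ) (j : Fin p) :
    (complexBlocks a m *ᵥ x) (.inr (0, j)) =
      (m j).re * x (.inr (0, j)) - (m j).im * x (.inr (1, j)) := by
  simp [complexBlocks, blockMatrix, Matrix.mulVec, dotProduct,
    Matrix.blockDiagonal_apply, Fintype.sum_prod_type, Fin.sum_univ_two]
  ring

lemma complexBlocks_mulVec_one (a : Fin l → ℝ) (m : Fin p → ℂ) (x : Label l p → ℝ) (j : Fin p) :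
    (complexBlocks a m *ᵥ x) (.inr (1, j)) =
      (m j).im * x (.inr (0, j)) + (m j).re * x (.inr (1, j)) := by
  simp [complexBlocks, blockMatrix, Matrix.mulVec, dotProduct,
    Matrix.blockDiagonal_apply, Fintype.sum_prod_type, Fin.sum_univ_two]

/-- The moduli of the multipliers of the real coordinates. -/
def blockModulus (a : Fin l → ℝ) (m : Fin p → ℂ) : Label l p → ℝ :=
  Sum.elim (fun j => |a j|) fun q => ‖m q.2‖

lemma sum_sq_complexBlocks_mulVec (a : Fin l → ℝ) (m : Fin p → ℂ) (b : Fin l → ℝ) (c : Fin p → ℝ)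
    (x : Label l p → ℝ) :
    ∑ k : Label l p, Sum.elim b (fun q => c q.2) k * (complexBlocks a m *ᵥ x) k ^ 2 =
      ∑ k : Label l p, Sum.elim b (fun q => c q.2) k * (blockModulus a m k * x k) ^ 2 := by
  simp only [Fintype.sum_sum_type, Fintype.sum_prod_type_right, Fin.sum_univ_two,
    complexBlocks_mulVec_inl, complexBlocks_mulVec_zero, complexBlocks_mulVec_one, Sum.elim_inl,
    Sum.elim_inr, blockModulus]
  congr 1
  · refine Finset.sum_congr rfl fun j _ => ?_
    rw [mul_pow, mul_pow, sq_abs]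
  · refine Finset.sum_congr rfl fun j _ => ?_
    have h : ‖m j‖ ^ 2 = (m j).re ^ 2 + (m j).im ^ 2 := by
      rw [← Complex.normSq_eq_norm_sq, Complex.normSq_apply]
      ring
    rw [mul_pow, mul_pow, h]
    ring

end BlockAlgebra

/-- The continuous linear automorphism attached to an invertible matrix. -/
def matrixEquiv {ι : Type} [Fintype ι] [DecidableEq ι] (M N : Matrix ι ι ℝ) (h : M * N = 1)
    (h' : N * M = 1) : EuclideanSpace ℝ ι ≃L[ℝ] EuclideanSpace ℝ ι :=
  LinearEquiv.toContinuousLinearEquiv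
    { toFun := fun x => WithLp.toLp 2 (M *ᵥ x.ofLp)
      invFun := fun x => WithLp.toLp 2 (N *ᵥ x.ofLp)
      map_add' := fun x y => by simp [Matrix.mulVec_add]
      map_smul' := fun c x => by simp [Matrix.mulVec_smul]
      left_inv := fun x => by simp [Matrix.mulVec_mulVec, h']
      right_inv := fun x => by simp [Matrix.mulVec_mulVec, h] }

lemma det_matrixEquiv {ι : Type} [Fintype ι] [DecidableEq ι] (M N : Matrix ι ι ℝ) (h : M * N = 1)
    (h' : N * M = 1) :
    LinearMap.det (matrixEquiv M N h h' : EuclideanSpace ℝ ι →ₗ[ℝ] EuclideanSpace ℝ ι) = M.det := by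
  rw [← LinearMap.det_toLin', ← LinearMap.det_conj (Matrix.toLin' M) (WithLp.linearEquiv 2 ℝ _).symm]
  congr 1

section Act

variable {d : ℕ}

lemma act_mul (A B : Matrix (Fin d) (Fin d) ℝ) (x : EuclideanSpace ℝ (Fin d)) :
    act (A * B) x = act A (act B x) := by
  simp [act, Matrix.mulVec_mulVec]

lemma act_one (x : EuclideanSpace ℝ (Fin d)) : act 1 x = x := by simp [act]

lemma act_zero_right (A : Matrix (Fin d) (Fin d) ℝ) : act A 0 = 0 := by simp [act]

lemma act_smul (A : Matrix (Fin d) (Fin d) ℝ) (c : ℝ) (x : EuclideanSpace ℝ (Fin d)) :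
    act A (c • x) = c • act A x := by simp [act, Matrix.mulVec_smul]

lemma act_add (A : Matrix (Fin d) (Fin d) ℝ) (x y : EuclideanSpace ℝ (Fin d)) :
    act A (x + y) = act A x + act A y := by simp [act, Matrix.mulVec_add]

lemma act_apply (A : Matrix (Fin d) (Fin d) ℝ) (x : EuclideanSpace ℝ (Fin d)) (i : Fin d) :
    act A x i = ∑ j, A i j * x j := by simp [act, Matrix.mulVec, dotProduct]

end Act

namespace Blocks

variable {d : ℕ} (B : Blocks d)

/-- The block-diagonal matrix with the numbering of `B` and with arbitrary blocks. -/
def full (a : Fin B.ls → ℝ) (m : Fin B.ps → ℂ) (a' : Fin B.lu → ℝ) (m' : Fin B.pu → ℂ) :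
    Matrix (Fin d) (Fin d) ℝ :=
  Matrix.reindex B.numbering B.numbering
    (Matrix.fromBlocks (complexBlocks a m) 0 0 (complexBlocks a' m'))

lemma full_mul (a b : Fin B.ls → ℝ) (m n : Fin B.ps → ℂ) (a' b' : Fin B.lu → ℝ)
    (m' n' : Fin B.pu → ℂ) :
    B.full a m a' m' * B.full b n b' n' = B.full (a * b) (m * n) (a' * b') (m' * n') := by
  simp only [full, Matrix.reindex_apply]
  rw [Matrix.submatrix_mul_equiv]
  simp [Matrix.fromBlocks_multiply, complexBlocks_mul]

lemma full_one : B.full 1 1 1 1 = 1 := by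
  simp [full, complexBlocks_one]

lemma det_full (a : Fin B.ls → ℝ) (m : Fin B.ps → ℂ) (a' : Fin B.lu → ℝ) (m' : Fin B.pu → ℂ) :
    (B.full a m a' m').det = ((∏ j, a j) * ∏ j, Complex.normSq (m j)) *
      ((∏ j, a' j) * ∏ j, Complex.normSq (m' j)) := by
  rw [full, Matrix.det_reindex_self, Matrix.det_fromBlocks_zero₂₁, complexBlocks_det,
    complexBlocks_det]

lemma act_full_inl (a : Fin B.ls → ℝ) (m : Fin B.ps → ℂ) (a' : Fin B.lu → ℝ) (m' : Fin B.pu → ℂ)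
    (x : EuclideanSpace ℝ (Fin d)) (k : Label B.ls B.ps) :
    act (B.full a m a' m') x (B.numbering (.inl k)) =
      (complexBlocks a m *ᵥ fun k => x (B.numbering (.inl k))) k := by
  rw [act_apply, ← B.numbering.sum_comp, Fintype.sum_sum_type]
  simp [full, Matrix.mulVec, dotProduct]

lemma act_full_inr (a : Fin B.ls → ℝ) (m : Fin B.ps → ℂ) (a' : Fin B.lu → ℝ) (m' : Fin B.pu → ℂ)
    (x : EuclideanSpace ℝ (Fin d)) (k : Label B.lu B.pu) :
    act (B.full a m a' m') x (B.numbering (.inr k)) =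
      (complexBlocks a' m' *ᵥ fun k => x (B.numbering (.inr k))) k := by
  rw [act_apply, ← B.numbering.sum_comp, Fintype.sum_sum_type]
  simp [full, Matrix.mulVec, dotProduct]

/-- The complex multiplier of a stable plane. -/
def ms (j : Fin B.ps) : ℂ := B.νps j * Complex.exp (B.ϑps j * Complex.I)

/-- The complex multiplier of an unstable plane. -/
def mu (j : Fin B.pu) : ℂ := B.νpu j * Complex.exp (B.ϑpu j * Complex.I)

lemma matrix_eq : B.matrix = B.full B.νls B.ms B.νlu B.mu := by
  simp [matrix, full, complexBlocks, ms, mu, Complex.exp_re, Complex.exp_im]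

lemma norm_ms (j : Fin B.ps) : ‖B.ms j‖ = B.νps j := by
  rw [ms, norm_mul, Complex.norm_exp_ofReal_mul_I, mul_one, Complex.norm_real,
    Real.norm_of_nonneg (B.νps_mem j).1.le]

lemma norm_mu (j : Fin B.pu) : ‖B.mu j‖ = B.νpu j := by
  rw [mu, norm_mul, Complex.norm_exp_ofReal_mul_I, mul_one, Complex.norm_real,
    Real.norm_of_nonneg (zero_le_one.trans (B.νpu_mem j).le)]

lemma νls_ne (j : Fin B.ls) : B.νls j ≠ 0 := abs_pos.1 (B.νls_mem j).1

lemma νlu_ne (j : Fin B.lu) : B.νlu j ≠ 0 := abs_pos.1 (zero_lt_one.trans (B.νlu_mem j))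

lemma ms_ne (j : Fin B.ps) : B.ms j ≠ 0 := by
  rw [← norm_pos_iff, norm_ms]
  exact (B.νps_mem j).1

lemma mu_ne (j : Fin B.pu) : B.mu j ≠ 0 := by
  rw [← norm_pos_iff, norm_mu]
  exact zero_lt_one.trans (B.νpu_mem j)

/-- The inverse of the block matrix. -/
def invMatrix : Matrix (Fin d) (Fin d) ℝ := B.full B.νls⁻¹ B.ms⁻¹ B.νlu⁻¹ B.mu⁻¹

lemma inv_mul_aux {ι α : Type} [Field α] {f : ι → α} (h : ∀ j, f j ≠ 0) : f * f⁻¹ = 1 := by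
  funext j
  simp [h j]

lemma matrix_mul_inv : B.matrix * B.invMatrix = 1 := by
  rw [matrix_eq, invMatrix, full_mul, inv_mul_aux B.νls_ne, inv_mul_aux B.ms_ne,
    inv_mul_aux B.νlu_ne, inv_mul_aux B.mu_ne, full_one]

lemma inv_mul_matrix : B.invMatrix * B.matrix = 1 := by
  rw [matrix_eq, invMatrix, full_mul, mul_comm _ B.νls, mul_comm _ B.ms, mul_comm _ B.νlu,
    mul_comm _ B.mu, inv_mul_aux B.νls_ne, inv_mul_aux B.ms_ne,
    inv_mul_aux B.νlu_ne, inv_mul_aux B.mu_ne, full_one]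

/-- The rate of growth of the squares of the coordinates. -/
def rate (P : ℝ) : Label B.ls B.ps ⊕ Label B.lu B.pu → ℝ :=
  Sum.elim
    (Sum.elim (fun j => Real.log |B.νls j| / P) fun q => Real.log (B.νps q.2) / P)
    (Sum.elim (fun j => Real.log |B.νlu j| / P) fun q => Real.log (B.νpu q.2) / P)

/-- The matrix `exp (θ A_Λ)`. -/
def flowMatrix (P θ : ℝ) : Matrix (Fin d) (Fin d) ℝ :=
  B.full (fun j => Real.exp (Real.log |B.νls j| / P * θ))
    (fun j => Complex.exp (((Real.log (B.νps j) / P : ℝ) + (B.ϑps j / P : ℝ) * Complex.I) * θ))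
    (fun j => Real.exp (Real.log |B.νlu j| / P * θ))
    (fun j => Complex.exp (((Real.log (B.νpu j) / P : ℝ) + (B.ϑpu j / P : ℝ) * Complex.I) * θ))

lemma generator_eq (P : ℝ) : B.generator P =
    B.full (fun j => Real.log |B.νls j| / P)
      (fun j => (Real.log (B.νps j) / P : ℝ) + (B.ϑps j / P : ℝ) * Complex.I)
      (fun j => Real.log |B.νlu j| / P)
      (fun j => (Real.log (B.νpu j) / P : ℝ) + (B.ϑpu j / P : ℝ) * Complex.I) := by
  have hre : ∀ a b : ℝ, ((a : ℂ) + b * Complex.I).re = a := fun a b => by simp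
  have him : ∀ a b : ℝ, ((a : ℂ) + b * Complex.I).im = b := fun a b => by simp
  simp only [generator, full, complexBlocks, hre, him]

lemma flowMatrix_zero (P : ℝ) : B.flowMatrix P 0 = 1 := by
  rw [← B.full_one, flowMatrix]
  congr 1 <;> funext j <;> simp

lemma flowMatrix_add (P s t : ℝ) :
    B.flowMatrix P (s + t) = B.flowMatrix P s * B.flowMatrix P t := by
  simp only [flowMatrix, full_mul]
  congr 1 <;> funext j
  · simp only [Pi.mul_apply, ← Real.exp_add]
    congr 1
    ring
  · simp only [Pi.mul_apply, ← Complex.exp_add]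
    congr 1
    push_cast
    ring
  · simp only [Pi.mul_apply, ← Real.exp_add]
    congr 1
    ring
  · simp only [Pi.mul_apply, ← Complex.exp_add]
    congr 1
    push_cast
    ring

lemma hasDerivAt_full {a : ℝ → Fin B.ls → ℝ} {m : ℝ → Fin B.ps → ℂ} {a' : ℝ → Fin B.lu → ℝ}
    {m' : ℝ → Fin B.pu → ℂ} {b n b' n'} {θ : ℝ} (ha : ∀ j, HasDerivAt (fun t => a t j) (b j) θ)
    (hm : ∀ j, HasDerivAt (fun t => m t j) (n j) θ)
    (ha' : ∀ j, HasDerivAt (fun t => a' t j) (b' j) θ)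
    (hm' : ∀ j, HasDerivAt (fun t => m' t j) (n' j) θ) (i k : Fin d) :
    HasDerivAt (fun t => B.full (a t) (m t) (a' t) (m' t) i k) (B.full b n b' n' i k) θ := by
  have hblock : ∀ {l p : ℕ} {a : ℝ → Fin l → ℝ} {m : ℝ → Fin p → ℂ} {b n}
      (_ : ∀ j, HasDerivAt (fun t => a t j) (b j) θ) (_ : ∀ j, HasDerivAt (fun t => m t j) (n j) θ)
      (i k : Label l p), HasDerivAt (fun t => complexBlocks (a t) (m t) i k)
        (complexBlocks b n i k) θ := by
    intro l p a m b n ha hm i k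
    have hre : ∀ j, HasDerivAt (fun t => (m t j).re) (n j).re θ := fun j =>
      Complex.reCLM.hasFDerivAt.comp_hasDerivAt θ (hm j)
    have him : ∀ j, HasDerivAt (fun t => (m t j).im) (n j).im θ := fun j =>
      Complex.imCLM.hasFDerivAt.comp_hasDerivAt θ (hm j)
    rcases i with i | ⟨i, i'⟩ <;> rcases k with k | ⟨k, k'⟩
    · simp only [complexBlocks, blockMatrix, Matrix.fromBlocks_apply₁₁, Matrix.diagonal_apply]
      split_ifs with h
      · exact ha i
      · exact hasDerivAt_const _ _
    · simpa [complexBlocks, blockMatrix] using hasDerivAt_const θ (0 : ℝ)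
    · simpa [complexBlocks, blockMatrix] using hasDerivAt_const θ (0 : ℝ)
    · simp only [complexBlocks, blockMatrix, Matrix.fromBlocks_apply₂₂, Matrix.blockDiagonal_apply]
      split_ifs with h
      · fin_cases i <;> fin_cases k
        · exact hre i'
        · exact (him i').neg
        · exact him i'
        · exact hre i'
      · exact hasDerivAt_const _ _
  simp only [full, Matrix.reindex_apply, Matrix.submatrix_apply]
  generalize B.numbering.symm i = i
  generalize B.numbering.symm k = k
  rcases i with i | i <;> rcases k with k | k
  · exact hblock ha hm i k
  · exact hasDerivAt_const _ _
  · exact hasDerivAt_const _ _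
  · exact hblock ha' hm' i k

lemma hasDerivAt_flowMatrix (P θ : ℝ) (i k : Fin d) :
    HasDerivAt (fun t => B.flowMatrix P t i k) ((B.generator P * B.flowMatrix P θ) i k) θ := by
  have hr : ∀ c : ℝ, HasDerivAt (fun t : ℝ => Real.exp (c * t)) (c * Real.exp (c * θ)) θ :=
    fun c => by
      have := ((hasDerivAt_id θ).const_mul c).exp
      simpa [mul_comm] using this
  have hc : ∀ c : ℂ, HasDerivAt (fun t : ℝ => Complex.exp (c * t)) (c * Complex.exp (c * θ)) θ :=
    fun c => by
      have := ((hasDerivAt_id θ).ofReal_comp.const_mul c).cexp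
      simpa [mul_comm] using this
  rw [generator_eq, flowMatrix, full_mul]
  exact B.hasDerivAt_full (fun j => hr _) (fun j => hc _) (fun j => hr _) (fun j => hc _) i k

end Blocks


/-! ### The hyperbolic splitting of a block-diagonal matrix -/

lemma complexBlocks_add {l p : ℕ} (a b : Fin l → ℝ) (m n : Fin p → ℂ) :
    complexBlocks (a + b) (m + n) = complexBlocks a m + complexBlocks b n := by
  simp only [complexBlocks, blockMatrix, Matrix.fromBlocks_add, add_zero]
  rw [← Matrix.blockDiagonal_add, Matrix.diagonal_add]
  congr 2
  funext j
  ext i k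
  fin_cases i <;> fin_cases k <;> simp [add_comm]

lemma complexBlocks_smul {l p : ℕ} (c : ℝ) (a : Fin l → ℝ) (m : Fin p → ℂ) :
    complexBlocks (c • a) (c • m) = c • complexBlocks a m := by
  simp only [complexBlocks, blockMatrix, Matrix.fromBlocks_smul, smul_zero]
  rw [← Matrix.blockDiagonal_smul, ← Matrix.diagonal_smul]
  congr 2
  funext j
  ext i k
  fin_cases i <;> fin_cases k <;> simp

namespace Blocks

variable {d : ℕ} (B : Blocks d)

/-- The algebra homomorphism from the parameters of the blocks to matrices. -/
def fullHom : (Fin B.ls → ℝ) × (Fin B.ps → ℂ) × (Fin B.lu → ℝ) × (Fin B.pu → ℂ) →ₐ[ℝ]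
    Matrix (Fin d) (Fin d) ℝ :=
  AlgHom.ofLinearMap
    { toFun := fun x => B.full x.1 x.2.1 x.2.2.1 x.2.2.2
      map_add' := fun x y => by
        simp only [full, Prod.fst_add, Prod.snd_add, complexBlocks_add]
        ext i k
        simp only [Matrix.reindex_apply, Matrix.submatrix_apply, Matrix.add_apply]
        rcases B.numbering.symm i with i | i <;> rcases B.numbering.symm k with k | k <;> simp
      map_smul' := fun c x => by
        simp only [full, Prod.smul_fst, Prod.smul_snd, complexBlocks_smul]
        ext i k
        simp only [Matrix.reindex_apply, Matrix.submatrix_apply, Matrix.smul_apply,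
          RingHom.id_apply]
        rcases B.numbering.symm i with i | i <;> rcases B.numbering.symm k with k | k <;> simp }
    B.full_one fun x y => (B.full_mul ..).symm

lemma exp_smul_generator (P θ : ℝ) :
    NormedSpace.exp (θ • B.generator P) = B.flowMatrix P θ := by
  let x : (Fin B.ls → ℝ) × (Fin B.ps → ℂ) × (Fin B.lu → ℝ) × (Fin B.pu → ℂ) :=
    (fun j => Real.log |B.νls j| / P,
      fun j => (Real.log (B.νps j) / P : ℝ) + (B.ϑps j / P : ℝ) * Complex.I,
      fun j => Real.log |B.νlu j| / P,
      fun j => (Real.log (B.νpu j) / P : ℝ) + (B.ϑpu j / P : ℝ) * Complex.I)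
  have hx : B.generator P = B.fullHom x := B.generator_eq P
  have hf : Continuous B.fullHom := B.fullHom.toLinearMap.continuous_of_finiteDimensional
  let _ : NormedRing (Matrix (Fin d) (Fin d) ℝ) := Matrix.linftyOpNormedRing
  let _ : NormedAlgebra ℝ (Matrix (Fin d) (Fin d) ℝ) := Matrix.linftyOpNormedAlgebra
  rw [hx, ← map_smul]
  refine (NormedSpace.map_exp B.fullHom hf (θ • x)).symm.trans ?_
  show B.full _ _ _ _ = _
  rw [flowMatrix]
  congr 1 <;> funext j <;>
    simp only [Prod.fst_exp, Prod.snd_exp, Pi.coe_exp, ← Real.exp_eq_exp_ℝ,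
      ← Complex.exp_eq_exp_ℂ] <;>
    simp [x, mul_comm, mul_add]

lemma act_full_line (a : Fin B.ls → ℝ) (m : Fin B.ps → ℂ) (a' : Fin B.lu → ℝ)
    (m' : Fin B.pu → ℂ) (j : Fin B.ls) :
    act (B.full a m a' m') (B.unitVec (.inl (.inl j))) = a j • B.unitVec (.inl (.inl j)) := by
  ext i
  obtain ⟨(k | ⟨k, k'⟩) | k, rfl⟩ := B.numbering.surjective i
  · rw [act_full_inl, complexBlocks_mulVec_inl]
    by_cases h : k = j <;> simp [unitVec, h]
  · rw [act_full_inl]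
    fin_cases k
    · simp [complexBlocks_mulVec_zero, unitVec]
    · simp [complexBlocks_mulVec_one, unitVec]
  · rw [act_full_inr]
    simp [unitVec, Matrix.mulVec, dotProduct]

lemma act_full_plane_zero (a : Fin B.ls → ℝ) (m : Fin B.ps → ℂ) (a' : Fin B.lu → ℝ)
    (m' : Fin B.pu → ℂ) (j : Fin B.ps) :
    act (B.full a m a' m') (B.unitVec (.inl (.inr (0, j)))) =
      (m j).re • B.unitVec (.inl (.inr (0, j))) + (m j).im • B.unitVec (.inl (.inr (1, j))) := by
  ext i
  obtain ⟨(k | ⟨k, k'⟩) | k, rfl⟩ := B.numbering.surjective i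
  · rw [act_full_inl, complexBlocks_mulVec_inl]
    simp [unitVec]
  · rw [act_full_inl]
    fin_cases k
    · by_cases h : k' = j <;> simp [complexBlocks_mulVec_zero, unitVec, h]
    · by_cases h : k' = j <;> simp [complexBlocks_mulVec_one, unitVec, h]
  · rw [act_full_inr]
    simp [unitVec, Matrix.mulVec, dotProduct]

lemma act_full_plane_one (a : Fin B.ls → ℝ) (m : Fin B.ps → ℂ) (a' : Fin B.lu → ℝ)
    (m' : Fin B.pu → ℂ) (j : Fin B.ps) :
    act (B.full a m a' m') (B.unitVec (.inl (.inr (1, j)))) =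
      -(m j).im • B.unitVec (.inl (.inr (0, j))) + (m j).re • B.unitVec (.inl (.inr (1, j))) := by
  ext i
  obtain ⟨(k | ⟨k, k'⟩) | k, rfl⟩ := B.numbering.surjective i
  · rw [act_full_inl, complexBlocks_mulVec_inl]
    simp [unitVec]
  · rw [act_full_inl]
    fin_cases k
    · by_cases h : k' = j <;> simp [complexBlocks_mulVec_zero, unitVec, h]
    · by_cases h : k' = j <;> simp [complexBlocks_mulVec_one, unitVec, h]
  · rw [act_full_inr]
    simp [unitVec, Matrix.mulVec, dotProduct]

lemma sub_embedUnstable (z : EuclideanSpace ℝ (Fin d)) :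
    z - B.embedUnstable (fun k => z (B.numbering (.inr k))) =
      ∑ k : Label B.ls B.ps, z (B.numbering (.inl k)) • B.unitVec (.inl k) := by
  ext i
  obtain ⟨k | k, rfl⟩ := B.numbering.surjective i
  · rw [WithLp.ofLp_sum, Finset.sum_apply, Finset.sum_eq_single k]
    · simp [embedUnstable, unitVec]
    · intro k' _ h
      simp [unitVec, h.symm]
    · simp
  · rw [WithLp.ofLp_sum, Finset.sum_apply, Finset.sum_eq_zero]
    · simp [embedUnstable]
    · intro k' _
      simp [unitVec]

/-- The stable derivations are `∂_{v k} + s k ∂_{w k}`. -/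
def stableFactor : Label B.ls B.ps → ℂ :=
  Sum.elim (fun _ => 0) fun q => if q.1 = 0 then Complex.I else -Complex.I

/-- The first vectors of the stable derivations. -/
def stableVec : Label B.ls B.ps → EuclideanSpace ℝ (Fin d) :=
  Sum.elim (fun j => B.unitVec (.inl (.inl j))) fun q => B.unitVec (.inl (.inr (0, q.2)))

/-- The second vectors of the stable derivations. -/
def stableVec' : Label B.ls B.ps → EuclideanSpace ℝ (Fin d) :=
  Sum.elim (fun _ => 0) fun q => B.unitVec (.inl (.inr (1, q.2)))

/-- The complex stable coordinates, dual to the stable derivations. -/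
def stableCoord : Label B.ls B.ps → EuclideanSpace ℝ (Fin d) →L[ℝ] ℂ :=
  Sum.elim
    (fun j => Complex.ofRealCLM.comp (EuclideanSpace.proj (B.numbering (.inl (.inl j)))))
    fun q => (1 / 2 : ℂ) •
      (Complex.ofRealCLM.comp (EuclideanSpace.proj (B.numbering (.inl (.inr (0, q.2))))) +
        (if q.1 = 0 then -Complex.I else Complex.I) •
          Complex.ofRealCLM.comp (EuclideanSpace.proj (B.numbering (.inl (.inr (1, q.2))))))

/-- The multipliers of the complex stable coordinates. -/
def stableMult : Label B.ls B.ps → ℂ :=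
  Sum.elim (fun j => (B.νls j : ℂ)) fun q =>
    if q.1 = 0 then (starRingEnd ℂ) (B.ms q.2) else B.ms q.2

/-- The factors of the monomials in the unstable coordinates. -/
def unstableCoord : Label B.lu B.pu → EuclideanSpace ℝ (Label B.lu B.pu) →L[ℝ] ℂ :=
  Sum.elim (fun j => Complex.ofRealCLM.comp (EuclideanSpace.proj (.inl j)))
    fun q => Complex.ofRealCLM.comp (EuclideanSpace.proj (.inr (0, q.2))) +
      (if q.1 = 0 then Complex.I else -Complex.I) •
        Complex.ofRealCLM.comp (EuclideanSpace.proj (.inr (1, q.2)))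

/-- The inverses of the multipliers of the complex unstable coordinates. -/
def unstableMult : Label B.lu B.pu → ℂ :=
  Sum.elim (fun j => ((B.νlu j)⁻¹ : ℂ)) fun q =>
    if q.1 = 0 then (B.mu q.2)⁻¹ else (starRingEnd ℂ) (B.mu q.2)⁻¹

lemma clm_smul {V : Type} [NormedAddCommGroup V] [NormedSpace ℝ V] (ℓ : V →L[ℝ] ℂ) (r : ℝ) (v : V) :
    ℓ (r • v) = r * ℓ v := by simp

lemma euclidean_eq_sum {ι : Type} [Fintype ι] [DecidableEq ι] (x : EuclideanSpace ℝ ι) :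
    x = ∑ k, x k • EuclideanSpace.single k (1 : ℝ) := by
  ext i
  rw [WithLp.ofLp_sum, Finset.sum_apply, Finset.sum_eq_single i]
  · simp
  · intro k' _ h
    simp [h.symm]
  · simp

/-- The hyperbolic splitting attached to a block-diagonal matrix: the stable coordinates are
diagonalized by `x_j` and `(x_{j1} ∓ i x_{j2}) / 2`, which are dual to the derivations of
`stableDeriv`, and the unstable coordinates by the factors of `unstableMonomial`. -/
def splitting : HyperbolicSplitting (EuclideanSpace ℝ (Fin d))
    (EuclideanSpace ℝ (Label B.lu B.pu)) (Label B.ls B.ps) (Label B.lu B.pu) where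
  s := B.stableFactor
  v := B.stableVec
  w := B.stableVec'
  c := B.stableCoord
  proj := LinearMap.toContinuousLinearMap
    { toFun := fun z => WithLp.toLp 2 fun k => z (B.numbering (.inr k))
      map_add' := fun _ _ => rfl
      map_smul' := fun _ _ => rfl }
  emb := LinearMap.toContinuousLinearMap
    { toFun := fun y => B.embedUnstable y.ofLp
      map_add' := fun x y => by
        ext i
        simp only [embedUnstable, PiLp.add_apply]
        rcases B.numbering.symm i with i | i <;> simp
      map_smul' := fun c y => by
        ext i
        simp only [embedUnstable, PiLp.smul_apply, RingHom.id_apply]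
        rcases B.numbering.symm i with i | i <;> simp }
  proj_emb := fun y => by
    ext k
    show (B.embedUnstable y.ofLp) (B.numbering (.inr k)) = _
    simp [embedUnstable]
  dec := fun ℓ z => by
    have h := congrArg ℓ (B.sub_embedUnstable z)
    refine h.trans ((map_sum ℓ _ _).trans ?_)
    simp only [clm_smul, Fintype.sum_sum_type, Fintype.sum_prod_type_right,
      Fin.sum_univ_two]
    congr 1
    · refine Finset.sum_congr rfl fun j _ => ?_
      simp [stableCoord, stableVec, stableVec', stableFactor]
    · refine Finset.sum_congr rfl fun j _ => ?_
      simp [stableCoord, stableVec, stableVec', stableFactor]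
      ring_nf
      simp only [Complex.I_sq]
      ring
  s' := Sum.elim (fun _ => 0) fun q => if q.1 = 0 then -Complex.I else Complex.I
  v' := Sum.elim (fun j => EuclideanSpace.single (.inl j) 1)
    fun q => (1 / 2 : ℝ) • EuclideanSpace.single (.inr (0, q.2)) 1
  w' := Sum.elim (fun _ => 0) fun q => (1 / 2 : ℝ) • EuclideanSpace.single (.inr (1, q.2)) 1
  c' := B.unstableCoord
  dec' := fun ℓ y => by
    have h := congrArg ℓ (euclidean_eq_sum y)
    refine h.trans ((map_sum ℓ _ _).trans ?_)
    simp only [clm_smul, Fintype.sum_sum_type, Fintype.sum_prod_type_right,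
      Fin.sum_univ_two]
    congr 1
    · refine Finset.sum_congr rfl fun j _ => ?_
      simp [unstableCoord]
    · refine Finset.sum_congr rfl fun j _ => ?_
      simp [unstableCoord, -map_smul]
      ring_nf
      simp only [Complex.I_sq]
      ring
  D := matrixEquiv B.matrix B.invMatrix B.matrix_mul_inv B.inv_mul_matrix
  Du := matrixEquiv (complexBlocks B.νlu B.mu) (complexBlocks B.νlu⁻¹ B.mu⁻¹)
    (by rw [complexBlocks_mul, inv_mul_aux B.νlu_ne, inv_mul_aux B.mu_ne, complexBlocks_one])
    (by rw [complexBlocks_mul, mul_comm _ B.νlu, mul_comm _ B.mu, inv_mul_aux B.νlu_ne,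
      inv_mul_aux B.mu_ne, complexBlocks_one])
  proj_D := fun z => by
    ext k
    have := B.act_full_inr B.νls B.ms B.νlu B.mu z k
    rw [← matrix_eq] at this
    exact this
  D_emb := fun y => by
    show act B.matrix (B.embedUnstable y.ofLp) =
      B.embedUnstable (complexBlocks B.νlu B.mu *ᵥ y.ofLp)
    rw [matrix_eq]
    ext i
    obtain ⟨k | k, rfl⟩ := B.numbering.surjective i
    · rw [act_full_inl]
      simp [embedUnstable, Matrix.mulVec, dotProduct]
    · rw [act_full_inr]
      simp [embedUnstable]
  ν := B.stableMult
  μ := B.unstableMult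
  c_D := fun k z => by
    show B.stableCoord k (act B.matrix z) = _
    rw [matrix_eq]
    rcases k with j | ⟨i, j⟩
    · simp [stableCoord, stableMult, act_full_inl, complexBlocks_mulVec_inl]
    · have h0 : ∀ z : ℂ, z = z.re + z.im * Complex.I := fun z => (Complex.re_add_im z).symm
      have h1 : (starRingEnd ℂ) (B.ms j) = (B.ms j).re - (B.ms j).im * Complex.I := by
        apply Complex.ext <;> simp
      fin_cases i
      · simp [stableCoord, stableMult, act_full_inl, complexBlocks_mulVec_zero,
          complexBlocks_mulVec_one, h1]
        ring_nf
        simp only [Complex.I_sq]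
        ring
      · simp [stableCoord, stableMult, act_full_inl, complexBlocks_mulVec_zero,
          complexBlocks_mulVec_one]
        nth_rw 5 [h0 (B.ms j)]
        ring_nf
        simp only [Complex.I_sq]
        ring
  vec_D := fun ℓ k => by
    show ℓ (act B.matrix _) + _ * ℓ (act B.matrix _) = _
    rw [matrix_eq]
    rcases k with j | ⟨i, j⟩
    · simp [stableVec, stableVec', stableFactor, stableMult, act_full_line]
    · have h1 : (starRingEnd ℂ) (B.ms j) = (B.ms j).re - (B.ms j).im * Complex.I := by
        apply Complex.ext <;> simp
      simp only [stableVec, stableVec', stableFactor, stableMult, Sum.elim_inr,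
        act_full_plane_zero, act_full_plane_one, map_add, clm_smul]
      fin_cases i
      · simp [h1]
        ring_nf
        simp only [Complex.I_sq]
        ring
      · simp
        generalize ℓ (B.unitVec _) = x
        generalize ℓ (B.unitVec _) = y
        linear_combination (x - y * Complex.I) * Complex.re_add_im (B.ms j) +
          y * (B.ms j).im * Complex.I_mul_I
  c'_Du := fun k y => by
    show B.unstableCoord k (WithLp.toLp 2 (complexBlocks B.νlu⁻¹ B.mu⁻¹ *ᵥ y.ofLp)) = _
    rcases k with j | ⟨i, j⟩
    · simp [unstableCoord, unstableMult, complexBlocks_mulVec_inl]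
    · have h1 : ∀ z : ℂ, (starRingEnd ℂ) z = z.re - z.im * Complex.I := fun z => by
        apply Complex.ext <;> simp
      have h2 : (B.mu j)⁻¹ = B.mu⁻¹ j := rfl
      fin_cases i
      · simp only [unstableCoord, unstableMult, Sum.elim_inr, Fin.zero_eta, if_true, h2]
        generalize B.mu⁻¹ = n
        simp [complexBlocks_mulVec_zero, complexBlocks_mulVec_one]
        linear_combination (y (.inr (0, j)) + y (.inr (1, j)) * Complex.I) *
          Complex.re_add_im (n j) - y (.inr (1, j)) * (n j).im * Complex.I_mul_I
      · simp only [unstableCoord, unstableMult, Sum.elim_inr, h2]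
        generalize B.mu⁻¹ = n
        simp only [h1]
        simp [complexBlocks_mulVec_zero, complexBlocks_mulVec_one]
        ring_nf
        simp only [Complex.I_sq]
        ring
  ν_lt := fun k => by
    rcases k with j | ⟨i, j⟩
    · simpa [stableMult] using (B.νls_mem j).2
    · have := (B.νps_mem j).2
      rw [← norm_ms] at this
      fin_cases i <;> simpa [stableMult] using this
  μ_lt := fun k => by
    rcases k with j | ⟨i, j⟩
    · simpa [unstableMult] using inv_lt_one_of_one_lt₀ (B.νlu_mem j)
    · have := inv_lt_one_of_one_lt₀ (B.νpu_mem j)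
      rw [← norm_mu] at this
      fin_cases i <;> simpa [unstableMult] using this

end Blocks


/-! ### The model functionals as forms attached to words -/

section Words

variable {V ι : Type} [NormedAddCommGroup V] [NormedSpace ℝ V]

lemma dirDeriv_comm {g : V → ℂ} (hg : ContDiff ℝ ∞ g) (s s' : ℂ) (v w v' w' : V) :
    dirDeriv s v w (dirDeriv s' v' w' g) = dirDeriv s' v' w' (dirDeriv s v w g) := by
  have hd : ∀ z, DifferentiableAt ℝ (fderiv ℝ g) z := fun z =>
    (hg.fderiv_right (m := ∞) (mod_cast le_top)).differentiable (by simp) z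
  have h : ∀ (s : ℂ) (a b c : V) (z : V),
      fderiv ℝ (dirDeriv s a b g) z c = fderiv ℝ (fderiv ℝ g) z c a +
        s * fderiv ℝ (fderiv ℝ g) z c b := by
    intro s a b c z
    have h1 : ∀ a : V, HasFDerivAt (fun z => fderiv ℝ g z a)
        ((fderiv ℝ (fderiv ℝ g) z).flip a) z := fun a => by
      have := (hd z).hasFDerivAt.clm_apply (hasFDerivAt_const a z)
      refine this.congr_fderiv ?_
      ext x
      simp
    have h2 : fderiv ℝ (dirDeriv s a b g) z = _ := ((h1 a).add ((h1 b).const_mul s)).fderiv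
    rw [h2]
    simp
  have hsymm : ∀ z a b, fderiv ℝ (fderiv ℝ g) z a b = fderiv ℝ (fderiv ℝ g) z b a := fun z a b =>
    (hg.contDiffAt.isSymmSndFDerivAt (by simpa using ENat.LEInfty.out)) a b
  funext z
  show fderiv ℝ _ z v + s * fderiv ℝ _ z w = fderiv ℝ _ z v' + s' * fderiv ℝ _ z w'
  rw [h, h, h, h, hsymm z v' v, hsymm z v' w, hsymm z w' v, hsymm z w' w]
  ring

variable (s : ι → ℂ) (v w : ι → V)

lemma wordDeriv_perm {g : V → ℂ} (hg : ContDiff ℝ ∞ g) {l l' : List ι} (h : l.Perm l') :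
    wordDeriv s v w l g = wordDeriv s v w l' g := by
  have hc : ∀ l : List ι, ContDiff ℝ ∞ (wordDeriv s v w l g) := by
    intro l
    induction l with
    | nil => exact hg
    | cons k l ih =>
      have h := ih.fderiv_right (m := ∞) (mod_cast le_top)
      exact (h.clm_apply contDiff_const).add (contDiff_const.mul (h.clm_apply contDiff_const))
  induction h with
  | nil => rfl
  | cons k _ ih => exact congrArg (dirDeriv (s k) (v k) (w k)) ih
  | swap k k' l => exact dirDeriv_comm (hc l) _ _ _ _ _ _
  | trans _ _ ih ih' => exact ih.trans ih'

lemma wordDeriv_append (l l' : List ι) (g : V → ℂ) :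
    wordDeriv s v w (l ++ l') g = wordDeriv s v w l (wordDeriv s v w l' g) :=
  List.foldr_append

lemma wordDeriv_replicate (n : ℕ) (k : ι) (g : V → ℂ) :
    wordDeriv s v w (List.replicate n k) g = (dirDeriv (s k) (v k) (w k))^[n] g := by
  induction n with
  | zero => rfl
  | succ n ih =>
    rw [List.replicate_succ, Function.iterate_succ_apply', ← ih]
    rfl

lemma wordDeriv_flatMap {κ : Type} (L : List κ) (f : κ → List ι) (g : V → ℂ) :
    wordDeriv s v w (L.flatMap f) g = L.foldr (fun j h => wordDeriv s v w (f j) h) g := by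
  induction L with
  | nil => rfl
  | cons j L ih =>
    rw [List.flatMap_cons, wordDeriv_append, ih]
    rfl

/-- The number of occurrences of a letter in a word. -/
def letterCount [DecidableEq ι] (k : ι) (l : List ι) : ℕ := l.count k

section LetterCount

variable [DecidableEq ι]

lemma perm_of_letterCount {l l' : List ι} (h : ∀ k, letterCount k l = letterCount k l') :
    l.Perm l' := List.perm_iff_count.2 h

lemma letterCount_append (k : ι) (l l' : List ι) :
    letterCount k (l ++ l') = letterCount k l + letterCount k l' := List.count_append

lemma letterCount_replicate (k k' : ι) (n : ℕ) :
    letterCount k (List.replicate n k') = if k' = k then n else 0 := by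
  simp [letterCount, List.count_replicate]

lemma letterCount_flatMap_finRange (k : ι) {n : ℕ} (f : Fin n → List ι) :
    letterCount k ((List.finRange n).flatMap f) = ∑ j, letterCount k (f j) := by
  rw [letterCount, List.count_flatMap, ← Fin.sum_univ_def]
  rfl

lemma length_eq_sum_letterCount [Fintype ι] (l : List ι) : l.length = ∑ k, letterCount k l := by
  induction l with
  | nil => simp [letterCount]
  | cons a l ih =>
    simp only [letterCount] at ih ⊢
    simp [List.count_cons, Finset.sum_add_distrib, ← ih]

lemma list_prod_map_eq_prod_pow [Fintype ι] (l : List ι) (f : ι → ℂ) :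
    (l.map f).prod = ∏ k, f k ^ letterCount k l := by
  rw [Finset.prod_list_map_count]
  refine Finset.prod_subset (Finset.subset_univ _) fun k _ hk => ?_
  rw [List.count_eq_zero.2 (by simpa using hk), pow_zero]

end LetterCount

end Words

namespace Blocks

variable {d : ℕ} (B : Blocks d)

/-- The index that counts the letters of a pair of words. -/
def wordIndex (l : List (Label B.ls B.ps) × List (Label B.lu B.pu)) (n : ℤ) : B.Index :=
  (Sum.elim (fun k => letterCount k l.1) fun k => letterCount k l.2, n)

lemma stableDeriv_eq_wordDeriv {g : EuclideanSpace ℝ (Fin d) → ℂ} (hg : ContDiff ℝ ∞ g)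
    (l : List (Label B.ls B.ps) × List (Label B.lu B.pu)) (n : ℤ) :
    B.stableDeriv (B.wordIndex l n) g =
      wordDeriv B.splitting.s B.splitting.v B.splitting.w l.1 g := by
  let α := B.wordIndex l n
  let L : List (Label B.ls B.ps) :=
    ((List.finRange B.ps).flatMap fun j =>
      List.replicate (α.1 (.inl (.inr (0, j)))) (.inr (0, j)) ++
        List.replicate (α.1 (.inl (.inr (1, j)))) (.inr (1, j))) ++
    (List.finRange B.ls).flatMap fun j => List.replicate (α.1 (.inl (.inl j))) (.inl j)
  have h1 : B.stableDeriv α g = wordDeriv B.splitting.s B.splitting.v B.splitting.w L g := by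
    simp only [L, wordDeriv_append, wordDeriv_flatMap, wordDeriv_replicate]
    rfl
  have h2 : L.Perm l.1 := by
    refine perm_of_letterCount fun k => ?_
    rcases k with j | ⟨i, j⟩
    · simp [L, letterCount_append, letterCount_flatMap_finRange, letterCount_replicate, α,
        wordIndex]
    · fin_cases i <;>
      simp [L, letterCount_append, letterCount_flatMap_finRange, letterCount_replicate, α,
        wordIndex]
  rw [h1, wordDeriv_perm _ _ _ hg h2]

lemma unstableMonomial_eq (l : List (Label B.ls B.ps) × List (Label B.lu B.pu)) (n : ℤ)
    (y : EuclideanSpace ℝ (Label B.lu B.pu)) :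
    B.unstableMonomial (B.wordIndex l n) y.ofLp = B.splitting.mono l.2 y := by
  rw [HyperbolicSplitting.mono, list_prod_map_eq_prod_pow, Fintype.prod_sum_type,
    Fintype.prod_prod_type_right]
  simp only [Fin.prod_univ_two, unstableMonomial, wordIndex, Sum.elim_inr]
  congr 1
  refine Finset.prod_congr rfl fun j _ => ?_
  congr 2
  simp [splitting, unstableCoord, sub_eq_add_neg]

lemma form_eq_transversePairing {g : EuclideanSpace ℝ (Fin d) → ℂ} (hg : ContDiff ℝ ∞ g)
    (l : List (Label B.ls B.ps) × List (Label B.lu B.pu)) (n : ℤ) :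
    B.splitting.form l g = (-1) ^ l.1.length * B.transversePairing (B.wordIndex l n) g := by
  have horder : B.stableOrder (B.wordIndex l n) = l.1.length :=
    (length_eq_sum_letterCount l.1).symm
  have hsign : ((-1 : ℂ) ^ l.1.length) * (-1) ^ l.1.length = 1 := by
    rw [← mul_pow]
    simp
  rw [transversePairing, ← integral_const_mul,
    ← (PiLp.volume_preserving_ofLp (Label B.lu B.pu)).integral_comp
      (MeasurableEquiv.toLp 2 (Label B.lu B.pu → ℝ)).symm.measurableEmbedding]
  refine integral_congr_ae (.of_forall fun y => ?_)
  simp only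
  rw [B.stableDeriv_eq_wordDeriv hg, horder, B.unstableMonomial_eq]
  show B.splitting.mono l.2 y * wordDeriv _ _ _ l.1 g (B.embedUnstable y.ofLp) = _
  linear_combination -(B.splitting.mono l.2 y *
    wordDeriv B.splitting.s B.splitting.v B.splitting.w l.1 g (B.embedUnstable y.ofLp)) * hsign

end Blocks


/-! ### Resonances and homogeneity of the models -/

namespace Blocks

variable {d : ℕ} (B : Blocks d)

/-- The exponents of the stable derivations. -/
def stableExp (P : ℝ) : Label B.ls B.ps → ℂ :=
  Sum.elim
    (fun j => ((Real.log |B.νls j| / P : ℝ) : ℂ) + 2 * Real.pi * Complex.I * twist (B.νls j) / P)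
    fun q => ((Real.log (B.νps q.2) / P : ℝ) : ℂ) +
      (if q.1 = 0 then -Complex.I else Complex.I) * ((B.ϑps q.2 / P : ℝ) : ℂ)

/-- The exponents of the unstable coordinates. -/
def unstableExp (P : ℝ) : Label B.lu B.pu → ℂ :=
  Sum.elim
    (fun j => ((Real.log |B.νlu j| / P : ℝ) : ℂ) - 2 * Real.pi * Complex.I * twist (B.νlu j) / P)
    fun q => ((Real.log (B.νpu q.2) / P : ℝ) : ℂ) +
      (if q.1 = 0 then Complex.I else -Complex.I) * ((B.ϑpu q.2 / P : ℝ) : ℂ)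

lemma eigenvalue_eq (P : ℝ) (α : B.Index) : B.eigenvalue P α =
    -(∑ j, ((|Real.log |B.νls j| / P| : ℝ) : ℂ)) - 2 * (∑ j, ((|Real.log (B.νps j) / P| : ℝ) : ℂ))
      - 2 * Real.pi * Complex.I * α.2 / P + (∑ k, α.1 (.inl k) * B.stableExp P k)
      - ∑ k, α.1 (.inr k) * B.unstableExp P k := by
  simp only [eigenvalue, stableExp, unstableExp, Fintype.sum_sum_type,
    Fintype.sum_prod_type_right, Fin.sum_univ_two, Sum.elim_inl, Sum.elim_inr, if_true,
    one_ne_zero, if_false, neg_mul, sub_eq_add_neg]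
  ring

lemma exp_twist (ν : ℝ) :
    ((|ν| : ℝ) : ℂ) * Complex.exp (2 * Real.pi * Complex.I * twist ν) = ν := by
  rw [twist]
  split_ifs with h
  · have : (2 * Real.pi * Complex.I * ((1 / 2 : ℝ) : ℂ)) = Real.pi * Complex.I := by
      push_cast
      ring
    rw [this, Complex.exp_pi_mul_I, abs_of_neg h]
    simp
  · rw [abs_of_nonneg (not_lt.1 h)]
    simp

lemma exp_stableExp {P : ℝ} (hP : P ≠ 0) (k : Label B.ls B.ps) :
    Complex.exp (P * B.stableExp P k) = B.stableMult k := by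
  have hP' : (P : ℂ) ≠ 0 := mod_cast hP
  rcases k with j | ⟨i, j⟩
  · have : P * B.stableExp P (.inl j) =
        (Real.log |B.νls j| : ℝ) + 2 * Real.pi * Complex.I * twist (B.νls j) := by
      simp only [stableExp, Sum.elim_inl]
      push_cast
      field_simp
    rw [this, Complex.exp_add, ← Complex.ofReal_exp, Real.exp_log (B.νls_mem j).1]
    exact exp_twist _
  · have h1 : Complex.exp ((Real.log (B.νps j) : ℝ)) = B.νps j := by
      rw [← Complex.ofReal_exp, Real.exp_log (B.νps_mem j).1]
    have h2 : P * B.stableExp P (.inr (i, j)) = (Real.log (B.νps j) : ℝ) +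
        (if i = 0 then -Complex.I else Complex.I) * B.ϑps j := by
      simp only [stableExp, Sum.elim_inr]
      push_cast
      field_simp
    rw [h2, Complex.exp_add, h1]
    fin_cases i
    · simp [stableMult, ms, ← Complex.exp_conj, mul_comm]
    · simp [stableMult, ms, mul_comm]

lemma exp_unstableExp {P : ℝ} (hP : P ≠ 0) (k : Label B.lu B.pu) :
    Complex.exp (-(P * B.unstableExp P k)) = B.unstableMult k := by
  have hP' : (P : ℂ) ≠ 0 := mod_cast hP
  rcases k with j | ⟨i, j⟩
  · have hν := zero_lt_one.trans (B.νlu_mem j)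
    have : -(P * B.unstableExp P (.inl j)) =
        (2 * Real.pi * Complex.I * twist (B.νlu j)) - (Real.log |B.νlu j| : ℝ) := by
      simp only [unstableExp, Sum.elim_inl]
      push_cast
      field_simp
      ring
    rw [this, Complex.exp_sub, ← Complex.ofReal_exp, Real.exp_log hν]
    have h1 := exp_twist (B.νlu j)
    have h2 : (B.νlu j : ℂ) ^ 2 = ((|B.νlu j| : ℝ) : ℂ) ^ 2 := by
      exact_mod_cast (sq_abs (B.νlu j)).symm
    have h3 : (B.νlu j : ℂ) ≠ 0 := mod_cast B.νlu_ne j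
    have h4 : ((|B.νlu j| : ℝ) : ℂ) ≠ 0 := mod_cast hν.ne'
    simp only [unstableMult, Sum.elim_inl]
    rw [div_eq_iff h4, ← mul_right_inj' h4, h1]
    field_simp
    exact h2
  · have hν := zero_lt_one.trans (B.νpu_mem j)
    have h1 : Complex.exp (-(Real.log (B.νpu j) : ℝ)) = (B.νpu j : ℂ)⁻¹ := by
      rw [Complex.exp_neg, ← Complex.ofReal_exp, Real.exp_log hν]
    have h2 : -(P * B.unstableExp P (.inr (i, j))) = -(Real.log (B.νpu j) : ℝ) +
        -((if i = 0 then Complex.I else -Complex.I) * B.ϑpu j) := by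
      simp only [unstableExp, Sum.elim_inr]
      push_cast
      field_simp
      ring
    rw [h2, Complex.exp_add, h1]
    fin_cases i
    · simp [unstableMult, mu, Complex.exp_neg, mul_comm]
    · simp [unstableMult, mu, ← Complex.exp_conj, mul_comm, ← Complex.exp_neg]

lemma exp_sum_abs {ι : Type} [Fintype ι] {P : ℝ} (hP : 0 < P) (ν : ι → ℝ)
    (hν : ∀ j, 0 < ν j ∧ ν j < 1) :
    Complex.exp (-(P * ∑ j, ((|Real.log (ν j) / P| : ℝ) : ℂ))) = ∏ j, (ν j : ℂ) := by
  rw [Finset.mul_sum, ← Finset.sum_neg_distrib, Complex.exp_sum]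
  refine Finset.prod_congr rfl fun j _ => ?_
  have h : |Real.log (ν j) / P| = -(Real.log (ν j) / P) :=
    abs_of_neg (div_neg_of_neg_of_pos (Real.log_neg (hν j).1 (hν j).2) hP)
  have hP' : (P : ℂ) ≠ 0 := mod_cast hP.ne'
  have h2 : -((P : ℂ) * (|Real.log (ν j) / P| : ℝ)) = (Real.log (ν j) : ℝ) := by
    rw [h]
    push_cast
    field_simp
  rw [h2, ← Complex.ofReal_exp, Real.exp_log (hν j).1]

/-- The eigenvalue of an index is, up to the frequency, a logarithm of the multiplier of the
corresponding form. -/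
lemma exp_eigenvalue {P : ℝ} (hP : 0 < P)
    (l : List (Label B.ls B.ps) × List (Label B.lu B.pu)) :
    Complex.exp (P * B.eigenvalue P (B.wordIndex l 0)) =
      (|B.matrix.det| : ℝ) * B.splitting.jac * B.splitting.mult l := by
  have hdet : ((|B.matrix.det| : ℝ) : ℂ) * B.splitting.jac =
      (∏ j, ((|B.νls j| : ℝ) : ℂ)) * (∏ j, (B.νps j : ℂ)) ^ 2 := by
    have h1 : LinearMap.det (B.splitting.Du : EuclideanSpace ℝ (Label B.lu B.pu) →ₗ[ℝ] _) =
        (complexBlocks B.νlu B.mu).det := by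
      have h := det_matrixEquiv (complexBlocks B.νlu B.mu) (complexBlocks B.νlu⁻¹ B.mu⁻¹)
        (by rw [complexBlocks_mul, inv_mul_aux B.νlu_ne, inv_mul_aux B.mu_ne, complexBlocks_one])
        (by rw [complexBlocks_mul, mul_comm _ B.νlu, mul_comm _ B.mu, inv_mul_aux B.νlu_ne,
          inv_mul_aux B.mu_ne, complexBlocks_one])
      exact h
    have h2 : (complexBlocks B.νlu B.mu).det ≠ 0 := by
      rw [complexBlocks_det]
      exact mul_ne_zero (Finset.prod_ne_zero_iff.2 fun j _ => B.νlu_ne j)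
        (Finset.prod_ne_zero_iff.2 fun j _ => (Complex.normSq_pos.2 (B.mu_ne j)).ne')
    rw [HyperbolicSplitting.jac, h1, matrix_eq, det_full, ← complexBlocks_det _ B.mu, abs_mul,
      ← Complex.ofReal_mul, mul_assoc, mul_inv_cancel₀ (abs_ne_zero.2 h2), mul_one, abs_mul,
      Finset.abs_prod, abs_of_nonneg (Finset.prod_nonneg fun j _ => Complex.normSq_nonneg _)]
    push_cast
    rw [← Finset.prod_pow]
    congr 1
    refine Finset.prod_congr rfl fun j _ => ?_
    rw [Complex.normSq_eq_norm_sq, norm_ms]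
    push_cast
    rfl
  rw [hdet, HyperbolicSplitting.mult, list_prod_map_eq_prod_pow, list_prod_map_eq_prod_pow,
    eigenvalue_eq, ← exp_sum_abs hP _ B.νls_mem, ← exp_sum_abs hP _ B.νps_mem, ← Complex.exp_nat_mul]
  have h1 : ∀ k, B.splitting.ν k = _ := fun k => (B.exp_stableExp hP.ne' k).symm
  have h2 : ∀ k, B.splitting.μ k = _ := fun k => (B.exp_unstableExp hP.ne' k).symm
  simp only [h1, h2, ← Complex.exp_nat_mul, ← Complex.exp_sum, ← Complex.exp_add]
  congr 1
  simp only [wordIndex, Sum.elim_inl, Sum.elim_inr, mul_add, mul_sub, Finset.mul_sum, mul_neg,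
    Finset.sum_neg_distrib]
  simp only [mul_left_comm (P : ℂ)]
  push_cast
  ring

/-- The forms that are invariant under the return map correspond to resonances. -/
lemma exists_eigenvalue_eq {P : ℝ} (hP : 0 < P) {lam : ℂ}
    {l : List (Label B.ls B.ps) × List (Label B.lu B.pu)}
    (h : Complex.exp (-lam * P) * (|B.matrix.det| : ℝ) * B.splitting.jac * B.splitting.mult l = 1) :
    ∃ n : ℤ, B.eigenvalue P (B.wordIndex l n) = lam := by
  have hP' : (P : ℂ) ≠ 0 := mod_cast hP.ne'
  rw [mul_assoc, mul_assoc, ← mul_assoc (((|B.matrix.det| : ℝ) : ℂ)), ← B.exp_eigenvalue hP,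
    ← Complex.exp_add, Complex.exp_eq_one_iff] at h
  obtain ⟨n, hn⟩ := h
  refine ⟨n, ?_⟩
  rw [eigenvalue_eq] at hn ⊢
  simp only [wordIndex] at hn ⊢
  rw [← mul_right_inj' hP']
  field_simp
  push_cast at hn
  linear_combination hn

/-- The blocks of the matrix `exp (t A_Λ)`. -/
def flowBlocks {P : ℝ} (hP : 0 < P) {t : ℝ} (ht : 0 < t) : Blocks d where
  ls := B.ls
  ps := B.ps
  lu := B.lu
  pu := B.pu
  numbering := B.numbering
  νls j := Real.exp (Real.log |B.νls j| / P * t)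
  νps j := Real.exp (Real.log (B.νps j) / P * t)
  ϑps j := B.ϑps j / P * t
  νlu j := Real.exp (Real.log |B.νlu j| / P * t)
  νpu j := Real.exp (Real.log (B.νpu j) / P * t)
  ϑpu j := B.ϑpu j / P * t
  νls_mem j := by
    have h := div_neg_of_neg_of_pos (Real.log_neg (B.νls_mem j).1 (B.νls_mem j).2) hP
    rw [Real.abs_exp]
    exact ⟨Real.exp_pos _, Real.exp_lt_one_iff.2 (mul_neg_of_neg_of_pos h ht)⟩
  νps_mem j := by
    have h := div_neg_of_neg_of_pos (Real.log_neg (B.νps_mem j).1 (B.νps_mem j).2) hP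
    exact ⟨Real.exp_pos _, Real.exp_lt_one_iff.2 (mul_neg_of_neg_of_pos h ht)⟩
  νlu_mem j := by
    rw [Real.abs_exp]
    exact Real.one_lt_exp_iff.2 (mul_pos (div_pos (Real.log_pos (B.νlu_mem j)) hP) ht)
  νpu_mem j := Real.one_lt_exp_iff.2 (mul_pos (div_pos (Real.log_pos (B.νpu_mem j)) hP) ht)

lemma flowBlocks_matrix {P : ℝ} (hP : 0 < P) {t : ℝ} (ht : 0 < t) :
    (B.flowBlocks hP ht).matrix = B.flowMatrix P t := by
  have key : ∀ (ν ϑ : ℝ), ((Real.exp (Real.log ν / P * t) : ℝ) : ℂ) *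
      Complex.exp (((ϑ / P * t : ℝ) : ℂ) * Complex.I) =
      Complex.exp (((Real.log ν / P : ℝ) + (ϑ / P : ℝ) * Complex.I) * t) := by
    intro ν ϑ
    rw [Complex.ofReal_exp, ← Complex.exp_add]
    congr 1
    push_cast
    ring
  rw [matrix_eq, flowMatrix]
  show B.full _ _ _ _ = _
  congr 1
  · funext j
    exact key _ _
  · funext j
    exact key _ _

lemma flowBlocks_eigenvalue {P : ℝ} (hP : 0 < P) {t : ℝ} (ht : 0 < t) (α : B.Index) :
    (B.flowBlocks hP ht).eigenvalue t (α.1, 0) =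
      B.eigenvalue P α + 2 * Real.pi * Complex.I * (α.2 - B.twistPairing α) / P := by
  have h1 : ∀ x : ℝ, Real.log |Real.exp (Real.log x / P * t)| / t = Real.log x / P := fun x => by
    rw [Real.abs_exp, Real.log_exp]
    field_simp
  have h2 : ∀ x : ℝ, Real.log (Real.exp (Real.log x / P * t)) / t = Real.log x / P := fun x => by
    rw [Real.log_exp]
    field_simp
  have h3 : ∀ x : ℝ, twist (Real.exp x) = 0 := fun x => if_neg (Real.exp_pos x).le.not_gt
  have h4 : ∀ x : ℝ, x / P * t / t = x / P := fun x => by field_simp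
  rw [eigenvalue_eq, eigenvalue_eq]
  have e1 : (∑ j, ((|Real.log |(B.flowBlocks hP ht).νls j| / t| : ℝ) : ℂ)) =
      ∑ j, ((|Real.log |B.νls j| / P| : ℝ) : ℂ) := Finset.sum_congr rfl fun j _ => by
    rw [← h1]
    rfl
  have e2 : (∑ j, ((|Real.log ((B.flowBlocks hP ht).νps j) / t| : ℝ) : ℂ)) =
      ∑ j, ((|Real.log (B.νps j) / P| : ℝ) : ℂ) := Finset.sum_congr rfl fun j _ => by
    rw [← h2]
    rfl
  have e3 : (∑ k, α.1 (.inl k) * (B.flowBlocks hP ht).stableExp t k) =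
      ∑ k, α.1 (.inl k) * B.stableExp P k -
        2 * Real.pi * Complex.I / P * ∑ j, (twist (B.νls j) : ℂ) * α.1 (.inl (.inl j)) := by
    rw [Fintype.sum_sum_type, Fintype.sum_sum_type, Finset.mul_sum, add_sub_right_comm,
      ← Finset.sum_sub_distrib]
    congr 1
    · refine Finset.sum_congr rfl fun j _ => ?_
      simp only [stableExp, Sum.elim_inl]
      rw [← h1 |B.νls j|]
      simp only [flowBlocks, h3]
      simp
      ring
    · refine Finset.sum_congr rfl fun j _ => ?_
      simp only [stableExp, Sum.elim_inr]
      rw [← h2, ← h4 (B.ϑps j.2)]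
      rfl
  have e4 : (∑ k, α.1 (.inr k) * (B.flowBlocks hP ht).unstableExp t k) =
      ∑ k, α.1 (.inr k) * B.unstableExp P k +
        2 * Real.pi * Complex.I / P * ∑ j, (twist (B.νlu j) : ℂ) * α.1 (.inr (.inl j)) := by
    rw [Fintype.sum_sum_type, Fintype.sum_sum_type, Finset.mul_sum, add_right_comm,
      ← Finset.sum_add_distrib]
    congr 1
    · refine Finset.sum_congr rfl fun j _ => ?_
      simp only [unstableExp, Sum.elim_inl]
      rw [← h1 |B.νlu j|]
      simp only [flowBlocks, h3]
      simp
      try ring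
    · refine Finset.sum_congr rfl fun j _ => ?_
      simp only [unstableExp, Sum.elim_inr]
      rw [← h2, ← h4 (B.ϑpu j.2)]
      rfl
  rw [e1, e2]
  refine (congrArg₂ (fun a b => _ + a - b) e3 e4).trans ?_
  rw [twistPairing]
  push_cast
  ring


lemma form_congr {E Y K K' : Type} [NormedAddCommGroup E] [NormedSpace ℝ E]
    [FiniteDimensional ℝ E] [NormedAddCommGroup Y] [InnerProductSpace ℝ Y] [FiniteDimensional ℝ Y]
    [Fintype K] [Fintype K'] [MeasurableSpace Y] [BorelSpace Y]
    (H H' : HyperbolicSplitting E Y K K') (hs : H.s = H'.s) (hv : H.v = H'.v) (hw : H.w = H'.w)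
    (he : H.emb = H'.emb) (hc : H.c' = H'.c') (l : List K × List K') (g : E → ℂ) :
    H.form l g = H'.form l g := by
  simp only [HyperbolicSplitting.form, HyperbolicSplitting.mono, hs, hv, hw, he, hc]

lemma form_flowBlocks {P : ℝ} (hP : 0 < P) {t : ℝ} (ht : 0 < t)
    (g : EuclideanSpace ℝ (Fin d) → ℂ) (l : List (Label B.ls B.ps) × List (Label B.lu B.pu)) :
    (B.flowBlocks hP ht).splitting.form l g = B.splitting.form l g :=
  form_congr (B.flowBlocks hP ht).splitting B.splitting rfl rfl rfl rfl rfl l g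

lemma D_flowBlocks {P : ℝ} (hP : 0 < P) {t : ℝ} (ht : 0 < t) (z : EuclideanSpace ℝ (Fin d)) :
    (B.flowBlocks hP ht).splitting.D z = act (B.flowMatrix P t) z := by
  rw [← B.flowBlocks_matrix hP ht]
  rfl

lemma wordIndex_flowBlocks {P : ℝ} (hP : 0 < P) {t : ℝ} (ht : 0 < t)
    (l : List (Label B.ls B.ps) × List (Label B.lu B.pu)) (n : ℤ) :
    (B.flowBlocks hP ht).eigenvalue t ((B.flowBlocks hP ht).wordIndex l 0) =
      B.eigenvalue P (B.wordIndex l n) +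
        2 * Real.pi * Complex.I * (n - B.twistPairing (B.wordIndex l n)) / P :=
  B.flowBlocks_eigenvalue hP ht (B.wordIndex l n)

lemma form_comp_flowMatrix_pos {P : ℝ} (hP : 0 < P) {t : ℝ} (ht : 0 < t)
    {g : EuclideanSpace ℝ (Fin d) → ℂ}
    (hg : ContDiff ℝ ∞ g) (l : List (Label B.ls B.ps) × List (Label B.lu B.pu)) (n : ℤ) :
    (|(B.flowMatrix P t).det| : ℝ) * B.splitting.form l (fun z => g (act (B.flowMatrix P t) z)) =
      Complex.exp (t * (B.eigenvalue P (B.wordIndex l n) +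
        2 * Real.pi * Complex.I * (n - B.twistPairing (B.wordIndex l n)) / P)) *
      B.splitting.form l g := by
  have h1 := (B.flowBlocks hP ht).splitting.form_comp_D hg l
  have h2 := (B.flowBlocks hP ht).exp_eigenvalue ht l
  simp only [D_flowBlocks] at h1
  rw [flowBlocks_matrix, B.wordIndex_flowBlocks hP ht l n] at h2
  have h3 := (B.form_flowBlocks hP ht (fun z => g (act (B.flowMatrix P t) z)) l).symm.trans h1
  rw [h3, ← mul_assoc, ← mul_assoc, ← h2, B.form_flowBlocks hP ht g l]

/-- The forms are homogeneous under the flow of `A_Λ`, with the exponent given by the eigenvalue. -/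
lemma form_comp_flowMatrix {P : ℝ} (hP : 0 < P) (t : ℝ) {g : EuclideanSpace ℝ (Fin d) → ℂ}
    (hg : ContDiff ℝ ∞ g) (l : List (Label B.ls B.ps) × List (Label B.lu B.pu)) (n : ℤ) :
    (|(B.flowMatrix P t).det| : ℝ) * B.splitting.form l (fun z => g (act (B.flowMatrix P t) z)) =
      Complex.exp (t * (B.eigenvalue P (B.wordIndex l n) +
        2 * Real.pi * Complex.I * (n - B.twistPairing (B.wordIndex l n)) / P)) *
      B.splitting.form l g := by
  have hsmooth : ContDiff ℝ ∞ fun z => g (act (B.flowMatrix P t) z) := by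
    refine hg.comp (contDiff_euclidean.2 fun i => ?_)
    simp only [act_apply]
    fun_prop
  rcases lt_trichotomy t 0 with ht | rfl | ht
  · have h1 := B.form_comp_flowMatrix_pos hP (neg_pos.2 ht) hsmooth l n
    have h2 : B.flowMatrix P t * B.flowMatrix P (-t) = 1 := by
      rw [← flowMatrix_add, add_neg_cancel, flowMatrix_zero]
    simp only [← act_mul, h2, act_one] at h1
    have h3 : ((|(B.flowMatrix P t).det| : ℝ) : ℂ) * (|(B.flowMatrix P (-t)).det| : ℝ) = 1 := by
      rw [← Complex.ofReal_mul, ← abs_mul, ← Matrix.det_mul, h2]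
      simp
    set c := (B.eigenvalue P (B.wordIndex l n) +
        2 * Real.pi * Complex.I * (n - B.twistPairing (B.wordIndex l n)) / P)
    have h4 : Complex.exp (t * c) * Complex.exp ((-t : ℝ) * c) = 1 := by
      rw [← Complex.exp_add]
      simp
    generalize B.splitting.form l (fun z => g (act (B.flowMatrix P t) z)) = x at h1 ⊢
    linear_combination (-(((|(B.flowMatrix P t).det| : ℝ) : ℂ)) * x) * h4 -
      (((|(B.flowMatrix P t).det| : ℝ) : ℂ)) * Complex.exp (t * c) * h1 +
      Complex.exp (t * c) * B.splitting.form l g * h3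
  · simp [flowMatrix_zero, act_one]
  · exact B.form_comp_flowMatrix_pos hP ht hg l n

end Blocks

namespace HyperbolicSplitting

variable {E Y K K' : Type} [NormedAddCommGroup E] [NormedSpace ℝ E] [FiniteDimensional ℝ E]
  [NormedAddCommGroup Y] [InnerProductSpace ℝ Y] [FiniteDimensional ℝ Y]
  [Fintype K] [Fintype K'] [MeasurableSpace Y] [BorelSpace Y]
  (H : HyperbolicSplitting E Y K K')

/-- The word derivatives along `E`, on functions on `E × ℝ`. -/
def wordDerivProd (l : List K) (ψ : E × ℝ → ℂ) : E × ℝ → ℂ :=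
  wordDeriv H.s (fun k => (H.v k, (0 : ℝ))) (fun k => (H.w k, (0 : ℝ))) l ψ

lemma wordDerivProd_apply {ψ : E × ℝ → ℂ} (hψ : ContDiff ℝ ∞ ψ) (l : List K) (θ : ℝ) (z : E) :
    H.wordDerivProd l ψ (z, θ) = wordDeriv H.s H.v H.w l (fun z => ψ (z, θ)) z := by
  have hc : ∀ l : List K, ContDiff ℝ ∞ (H.wordDerivProd l ψ) := by
    intro l
    induction l with
    | nil => exact hψ
    | cons k l ih => exact contDiff_dirDeriv ih _ _ _
  induction l generalizing z with
  | nil => rfl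
  | cons k l ih =>
    rw [wordDeriv_cons, ← funext ih]
    have h1 : HasFDerivAt (fun z : E => H.wordDerivProd l ψ (z, θ))
        ((fderiv ℝ (H.wordDerivProd l ψ) (z, θ)).comp (ContinuousLinearMap.inl ℝ E ℝ)) z :=
      (((hc l).differentiable (by simp)) (z, θ)).hasFDerivAt.comp z (hasFDerivAt_prodMk_left z θ)
    rw [dirDeriv, h1.fderiv]
    rfl

lemma isTest_wordDerivProd {Ω : Set (E × ℝ)} {ψ : E × ℝ → ℂ} (hψ : IsTest Ω ψ) (l : List K) :
    IsTest Ω (H.wordDerivProd l ψ) := by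
  induction l with
  | nil => exact hψ
  | cons k l ih =>
    have := ih.dirDeriv (H.s k) (H.v k, (0 : ℝ)) (H.w k, 0)
    exact this

lemma wordDeriv_expMean {Ω : Set (E × ℝ)} {lam : ℂ} {ψ : E × ℝ → ℂ} (hψ : IsTest Ω ψ)
    (l : List K) :
    wordDeriv H.s H.v H.w l (expMean lam ψ) = expMean lam (H.wordDerivProd l ψ) := by
  induction l with
  | nil => rfl
  | cons k l ih =>
    rw [wordDeriv_cons, ih, dirDeriv_expMean (H.isTest_wordDerivProd hψ l)]
    rfl

/-- The pairing of a form with a mean along the lines is the mean of the pairings. -/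
lemma form_expMean {Ω : Set (E × ℝ)} {lam : ℂ} {ψ : E × ℝ → ℂ} (hψ : IsTest Ω ψ)
    (l : List K × List K') :
    H.form l (expMean lam ψ) =
      ∫ θ : ℝ, Complex.exp (-lam * θ) * H.form l fun z => ψ (z, θ) := by
  have hW := H.isTest_wordDerivProd hψ l.1
  simp only [form, H.wordDeriv_expMean hψ, expMean, ← H.wordDerivProd_apply hψ.1]
  simp only [← integral_const_mul]
  rw [integral_integral_swap_of_hasCompactSupport]
  · refine integral_congr_ae (.of_forall fun θ => integral_congr_ae (.of_forall fun y => ?_))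
    simp only
    ring
  · have h1 := (H.contDiff_mono l.2).continuous
    have h2 := hW.1.continuous
    have h3 := H.emb.continuous
    simp only [Function.uncurry_def]
    fun_prop
  · have hinj : IsClosedEmbedding fun q : Y × ℝ => (H.emb q.1, q.2) := by
      have h1 : Function.LeftInverse (fun q : E × ℝ => (H.proj q.1, q.2))
          fun q : Y × ℝ => (H.emb q.1, q.2) := fun q => by simp [H.proj_emb]
      have h2 := H.emb.continuous
      have h3 := H.proj.continuous
      exact h1.isClosedEmbedding (by fun_prop) (by fun_prop)
    have h := hW.2.1.comp_isClosedEmbedding hinj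
    have h' := h.mul_left (f := fun q : Y × ℝ => H.mono l.2 q.1 * Complex.exp (-lam * q.2))
    refine h'.mono (Function.support_subset_iff'.2 fun q hq => ?_)
    rw [← Function.notMem_support.1 hq]
    simp only [Pi.mul_apply, Function.comp_apply, Function.uncurry_def]
    ring

end HyperbolicSplitting

namespace LinearizingChart

variable {d : ℕ} {M : Type*} [TopologicalSpace M] [ChartedSpace (Model d) M]
  {V : ∀ x : M, TangentSpace 𝓘(ℝ, Model d) x} {Λ : Set M} {P : ℝ}
  (C : LinearizingChart V Λ P) (B : Blocks d) (Q : Matrix (Fin d) (Fin d) ℝ)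

/-- The expression of a test density in the coordinates `(ζ, θ)` in which the vector field is
`∂_θ`. -/
def pullDensity (ψ : Model d → ℂ) : Model d → ℂ := fun q =>
  ((|(C.U q.2 * Q).det| : ℝ) : ℂ) * ψ (act (C.U q.2 * Q) q.1, q.2)

lemma contDiff_act (A : Matrix (Fin d) (Fin d) ℝ) : ContDiff ℝ ∞ (act A) := by
  refine contDiff_euclidean.2 fun i => ?_
  simp only [act_apply]
  fun_prop

/-- The model distributions are the means of the forms against `exp (-λ_α θ)`, in the
coordinates `(ζ, θ)`. -/
lemma form_expMean_pullDensity {Ω : Set (Model d)} (hP : 0 < P) {ψ : Model d → ℂ}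
    (hψ : ContDiff ℝ ∞ ψ) (hψ' : IsTest Ω (C.pullDensity Q ψ))
    (l : List (Label B.ls B.ps) × List (Label B.lu B.pu)) (n : ℤ) :
    B.splitting.form l (expMean (B.eigenvalue P (B.wordIndex l n)) (C.pullDensity Q ψ)) =
      (-1) ^ l.1.length * C.modelPairing B Q (B.wordIndex l n) ψ := by
  rw [B.splitting.form_expMean hψ', modelPairing, ← integral_const_mul]
  refine integral_congr_ae (.of_forall fun θ => ?_)
  simp only
  have hF : C.floquet B Q θ = C.U θ * Q * B.flowMatrix P (-θ) := by
    rw [floquet, ← neg_smul, B.exp_smul_generator]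
  have hg : ContDiff ℝ ∞ fun z => ψ (act (C.U θ * Q) z, θ) :=
    hψ.comp ((contDiff_act _).prodMk contDiff_const)
  have h1 := B.form_comp_flowMatrix hP (-θ) hg l n
  have h2 : (fun z => ψ (act (C.floquet B Q θ) z, θ)) =
      fun z => ψ (act (C.U θ * Q) (act (B.flowMatrix P (-θ)) z), θ) := by
    funext z
    rw [hF, act_mul]
  have hg' : ContDiff ℝ ∞ fun z => ψ (act (C.floquet B Q θ) z, θ) :=
    hψ.comp ((contDiff_act _).prodMk contDiff_const)
  have h3 := B.form_eq_transversePairing hg' l n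
  have h4 : B.splitting.form l (fun z => C.pullDensity Q ψ (z, θ)) =
      (|(C.U θ * Q).det| : ℝ) * B.splitting.form l fun z => ψ (act (C.U θ * Q) z, θ) :=
    B.splitting.form_smul (fun z => ψ (act (C.U θ * Q) z, θ)) (|(C.U θ * Q).det| : ℝ) l
  rw [h4]
  rw [← h2, h3] at h1
  have h5 : (((|(C.floquet B Q θ).det| : ℝ)) : ℂ) =
      (|(C.U θ * Q).det| : ℝ) * (|(B.flowMatrix P (-θ)).det| : ℝ) := by
    rw [hF, Matrix.det_mul, abs_mul]
    push_cast
    rfl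
  have h6 : Complex.exp (-B.eigenvalue P (B.wordIndex l n) * θ) =
      Complex.exp (2 * Complex.I * Real.pi * (((B.wordIndex l n).2 : ℂ) -
        (B.twistPairing (B.wordIndex l n) : ℂ)) * θ / P) *
      Complex.exp ((-θ : ℝ) * (B.eigenvalue P (B.wordIndex l n) +
        2 * Real.pi * Complex.I * (n - B.twistPairing (B.wordIndex l n)) / P)) := by
    rw [← Complex.exp_add]
    congr 1
    simp only [Blocks.wordIndex]
    push_cast
    ring
  rw [h5, h6]
  linear_combination (-Complex.exp (2 * Complex.I * Real.pi * (((B.wordIndex l n).2 : ℂ) -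
        (B.twistPairing (B.wordIndex l n) : ℂ)) * θ / P) * (|(C.U θ * Q).det| : ℝ)) * h1

end LinearizingChart


/-! ### Real block-diagonal form of semisimple endomorphisms -/

section BlockForm

open Polynomial

lemma aeval_matrix_mulVec {d : ℕ} {𝕜 : Type} [Field 𝕜] (A : Matrix (Fin d) (Fin d) 𝕜)
    {x : Fin d → 𝕜} {μ : 𝕜} (h : A *ᵥ x = μ • x) (q : 𝕜[X]) :
    (aeval A q) *ᵥ x = q.eval μ • x := by
  induction q using Polynomial.induction_on' with
  | add p q hp hq => rw [map_add, Matrix.add_mulVec, hp, hq, eval_add, add_smul]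
  | monomial n a =>
    have hn : ∀ n : ℕ, (A ^ n) *ᵥ x = μ ^ n • x := by
      intro n
      induction n with
      | zero => simp
      | succ n ih => rw [pow_succ, ← Matrix.mulVec_mulVec, h, Matrix.mulVec_smul, ih, smul_smul,
          mul_comm, pow_succ]
    rw [aeval_monomial, eval_monomial, ← Matrix.mulVec_mulVec, hn, Algebra.algebraMap_eq_smul_one,
      Matrix.smul_mulVec, Matrix.one_mulVec, smul_smul]

/-- A real matrix that is diagonalizable over `ℂ` is annihilated by a squarefree real
polynomial, the radical of its minimal polynomial. -/
lemma IsDiagonalizableOverComplex.isSemisimple {d : ℕ} {A : Matrix (Fin d) (Fin d) ℝ}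
    (h : IsDiagonalizableOverComplex A) : Module.End.IsSemisimple (Matrix.toLinAlgEquiv' A : Module.End ℝ (Fin d → ℝ)) := by
  obtain ⟨S, D, hS, hAS⟩ := h
  let φ : Matrix (Fin d) (Fin d) ℝ →ₐ[ℝ] Matrix (Fin d) (Fin d) ℂ :=
    (Algebra.ofId ℝ ℂ).mapMatrix
  have hφ : ∀ q : ℝ[X], φ (aeval A q) = aeval (A.map Complex.ofReal) (q.map (algebraMap ℝ ℂ)) := by
    intro q
    rw [aeval_map_algebraMap, ← aeval_algHom_apply]
    rfl
  have hinj : Function.Injective φ := fun M N hMN => by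
    ext i j
    exact Complex.ofReal_injective (congrFun (congrFun hMN i) j)
  have hcol : ∀ j, (A.map Complex.ofReal) *ᵥ (fun i => S i j) = D j • fun i => S i j := by
    intro j
    funext i
    have := congrFun (congrFun hAS i) j
    rw [Matrix.mul_apply, Matrix.mul_diagonal] at this
    simpa [Matrix.mulVec, dotProduct, mul_comm] using this
  have hne : ∀ j, (fun i => S i j) ≠ 0 := by
    intro j h0
    refine hS.ne_zero (Matrix.det_eq_zero_of_column_eq_zero j fun i => congrFun h0 i)
  have hp : minpoly ℝ A ≠ 0 := minpoly.ne_zero (Algebra.IsIntegral.isIntegral A)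
  obtain ⟨n, hn⟩ := (UniqueFactorizationMonoid.exists_dvd_pow_iff_radical_dvd hp).2
    (dvd_refl (UniqueFactorizationMonoid.radical (minpoly ℝ A)))
  set q := UniqueFactorizationMonoid.radical (minpoly ℝ A) with hq
  have hroot : ∀ j, (q.map (algebraMap ℝ ℂ)).eval (D j) = 0 := by
    intro j
    have h1 : ((minpoly ℝ A).map (algebraMap ℝ ℂ)).eval (D j) = 0 := by
      have h2 := aeval_matrix_mulVec _ (hcol j) ((minpoly ℝ A).map (algebraMap ℝ ℂ))
      rw [← hφ, minpoly.aeval, map_zero, Matrix.zero_mulVec] at h2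
      exact (smul_eq_zero.1 h2.symm).resolve_right (hne j)
    have h3 := eval_dvd (x := D j) (Polynomial.map_dvd (algebraMap ℝ ℂ) hn)
    rw [h1, zero_dvd_iff, Polynomial.map_pow, eval_pow] at h3
    by_contra h4
    exact pow_ne_zero n h4 h3
  have hz : aeval A q = 0 := by
    apply hinj
    rw [hφ, map_zero]
    have h1 : aeval (A.map Complex.ofReal) (q.map (algebraMap ℝ ℂ)) * S = 0 := by
      ext i j
      have h2 := congrFun (aeval_matrix_mulVec _ (hcol j) (q.map (algebraMap ℝ ℂ))) i
      rw [hroot j, zero_smul] at h2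
      rw [Matrix.mul_apply]
      exact h2
    have h2 := congrArg (· * S⁻¹) h1
    simpa [Matrix.mul_assoc, Matrix.mul_nonsing_inv S hS] using h2
  refine Module.End.isSemisimple_of_squarefree_aeval_eq_zero (p := q)
    (UniqueFactorizationMonoid.isRadical_radical.squarefree
      UniqueFactorizationMonoid.radical_ne_zero) ?_
  have h := aeval_algHom_apply (Matrix.toLinAlgEquiv' (R := ℝ) (n := Fin d)).toAlgHom A q
  rw [hz, map_zero] at h
  exact h

variable {V : Type} [AddCommGroup V] [Module ℝ V] [FiniteDimensional ℝ V]

/-- The vectors of a family of lines and planes. -/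
def familyVectors (L : List (ℝ × V)) (R : List (ℂ × V × V)) : Set V :=
  {y | (∃ x ∈ L, y = x.2) ∨ ∃ x ∈ R, y = x.2.1 ∨ y = x.2.2}

/-- `x` spans an invariant line of `T`, with eigenvalue `x.1`. -/
def IsLine (T : Module.End ℝ V) (x : ℝ × V) : Prop := T x.2 = x.1 • x.2 ∧ x.2 ≠ 0

/-- `x` spans an invariant plane of `T`, on which `T` is the multiplication by `x.1`. -/
def IsPlane (T : Module.End ℝ V) (x : ℂ × V × V) : Prop :=
  T x.2.1 = x.1.re • x.2.1 + x.1.im • x.2.2 ∧ T x.2.2 = -x.1.im • x.2.1 + x.1.re • x.2.2 ∧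
    x.2.1 ≠ 0 ∧ x.1 ≠ 0

/-- A nonzero invariant subspace contains an eigenvector or an invariant plane on which the
endomorphism is a similarity: a real polynomial of minimal degree that kills a nonzero vector of the
subspace is irreducible. -/
lemma exists_line_or_plane (T : Module.End ℝ V) {W : Submodule ℝ V} (hW : W ∈ T.invtSubmodule)
    (hne : W ≠ ⊥) : (∃ x, IsLine T x ∧ x.2 ∈ W) ∨
      ∃ x, IsPlane T x ∧ x.2.1 ∈ W ∧ x.2.2 ∈ W ∧ LinearIndependent ℝ ![x.2.1, x.2.2] := by
  classical
  have hex : ∃ n : ℕ, ∃ q : ℝ[X], q ≠ 0 ∧ q.natDegree = n ∧ ∃ v ∈ W, v ≠ 0 ∧ aeval T q v = 0 := by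
    obtain ⟨v, hv, hv0⟩ := W.exists_mem_ne_zero_of_ne_bot hne
    exact ⟨_, minpoly ℝ T, minpoly.ne_zero (Algebra.IsIntegral.isIntegral T), rfl, v, hv, hv0, by
      rw [minpoly.aeval]; rfl⟩
  obtain ⟨q, hq0, hdeg, v, hv, hv0, hqv⟩ := Nat.find_spec hex
  have hmin : ∀ q : ℝ[X], q ≠ 0 → q.natDegree < Nat.find hex → ∀ v ∈ W, aeval T q v = 0 → v = 0 := by
    intro q hq hd v hv hqv
    by_contra hv0
    exact Nat.find_min hex hd ⟨q, hq, rfl, v, hv, hv0, hqv⟩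
  have hWT := (Module.End.mem_invtSubmodule_iff_forall_mem_of_mem T).1 hW
  have hinv : ∀ (q : ℝ[X]) (v : V), v ∈ W → aeval T q v ∈ W := by
    intro q v hv
    induction q using Polynomial.induction_on' generalizing v with
    | add p q hp hq => rw [map_add]; exact W.add_mem (hp v hv) (hq v hv)
    | monomial n a =>
      have hn : ∀ n : ℕ, (T ^ n) v ∈ W := by
        intro n
        induction n with
        | zero => exact hv
        | succ n ih => rw [pow_succ']; exact hWT _ ih
      rw [aeval_monomial, ← Algebra.smul_def]
      exact W.smul_mem _ (hn n)
  have hirr : Irreducible q := by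
    refine ⟨fun hu => ?_, fun a b hab => ?_⟩
    · obtain ⟨c, hc, rfl⟩ := Polynomial.isUnit_iff.1 hu
      rw [aeval_C, Module.algebraMap_end_apply] at hqv
      exact (smul_eq_zero.1 hqv).elim hc.ne_zero hv0
    · have ha : a ≠ 0 := fun h => hq0 (by rw [hab, h, zero_mul])
      have hb : b ≠ 0 := fun h => hq0 (by rw [hab, h, mul_zero])
      have hsum : a.natDegree + b.natDegree = Nat.find hex := by
        rw [← hdeg, hab, natDegree_mul ha hb]
      by_contra hu
      push Not at hu
      have hda : a.natDegree ≠ 0 := fun h => hu.1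
        (Polynomial.isUnit_iff_degree_eq_zero.2 (by rw [degree_eq_natDegree ha, h]; rfl))
      have hdb : b.natDegree ≠ 0 := fun h => hu.2
        (Polynomial.isUnit_iff_degree_eq_zero.2 (by rw [degree_eq_natDegree hb, h]; rfl))
      have h1 : aeval T b v ≠ 0 := fun h => hv0 (hmin b hb (by omega) v hv h)
      refine h1 (hmin a ha (by omega) _ (hinv b v hv) ?_)
      rw [hab, map_mul] at hqv
      exact hqv
  have hd2 : q.natDegree ≤ 2 := natDegree_le_of_degree_le hirr.degree_le_two
  have hd0 : 0 < q.natDegree := hirr.natDegree_pos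
  have hev : ∀ (a b c : ℝ), q = C a * X ^ 2 + C b * X + C c →
      a • T (T v) + b • T v + c • v = 0 := by
    intro a b c h
    rw [h] at hqv
    simpa [pow_two, Module.algebraMap_end_apply] using hqv
  have hquad := eq_quadratic_of_degree_le_two hirr.degree_le_two
  have hT := hev _ _ _ hquad
  set a := q.coeff 2
  set b := q.coeff 1
  set c := q.coeff 0
  by_cases ha : a = 0
  · left
    have hb : b ≠ 0 := by
      intro hb
      rw [ha, hb] at hquad
      have : q.natDegree = 0 := by
        rw [hquad]
        simp
      omega
    refine ⟨(-(c / b), v), ⟨?_, hv0⟩, hv⟩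
    rw [ha, zero_smul, zero_add] at hT
    have h1 : b • T v = -(c • v) := eq_neg_of_add_eq_zero_left hT
    have h2 := congrArg (b⁻¹ • ·) h1
    simp only [smul_smul, inv_mul_cancel₀ hb, one_smul, smul_neg] at h2
    rw [h2, neg_smul, div_eq_inv_mul]
  · right
    have hdisc : b ^ 2 - 4 * a * c < 0 := by
      by_contra hcon
      push Not at hcon
      obtain ⟨s, hs⟩ : ∃ s, s ^ 2 = b ^ 2 - 4 * a * c := ⟨_, Real.sq_sqrt hcon⟩
      let r := (-b + s) / (2 * a)
      have hr : q.IsRoot r := by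
        rw [IsRoot.def, hquad]
        simp only [eval_add, eval_mul, eval_C, eval_pow, eval_X, r]
        field_simp
        linear_combination hs
      have h1 : q.natDegree = 1 := natDegree_eq_of_degree_eq_some (degree_eq_one_of_irreducible_of_root hirr hr)
      have h2 : a = 0 := coeff_eq_zero_of_natDegree_lt (by omega)
      exact ha h2
    -- the complex roots of `q` are `α ± i β`, and the plane is spanned by `v` and `(T v - α v) / β`
    let α : ℝ := -b / (2 * a)
    let β : ℝ := √((4 * a * c - b ^ 2) / (4 * a ^ 2))
    have hβ0 : 0 < β := Real.sqrt_pos.2 (by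
      have : 0 < a ^ 2 := by positivity
      apply div_pos <;> linarith)
    have hβ2 : β ^ 2 = (4 * a * c - b ^ 2) / (4 * a ^ 2) := Real.sq_sqrt (by
      have : 0 < a ^ 2 := by positivity
      apply div_nonneg <;> linarith)
    have hTT : T (T v) = (2 * α) • T v - (α ^ 2 + β ^ 2) • v := by
      have h2 := congrArg (a⁻¹ • ·) hT
      simp only [smul_add, smul_smul, inv_mul_cancel₀ ha, one_smul, smul_zero] at h2
      have h3 : α ^ 2 + β ^ 2 = a⁻¹ * c := by
        rw [hβ2]
        simp only [α]
        field_simp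
        ring
      have h4 : 2 * α = -(a⁻¹ * b) := by
        simp only [α]
        field_simp
      rw [h3, h4, neg_smul]
      have h5 := eq_neg_of_add_eq_zero_left ((add_assoc _ _ _).symm.trans h2)
      rw [h5]
      abel
    let w := β⁻¹ • (T v - α • v)
    have hTv : T v = α • v + β • w := by
      simp only [w, smul_smul, mul_inv_cancel₀ hβ0.ne', one_smul]
      abel
    have hTw : T w = -β • v + α • w := by
      have h1 : β • T w = β • (-β • v + α • w) := by
        have h2 : T (β • w) = T (T v - α • v) := by
          simp only [w, smul_smul, mul_inv_cancel₀ hβ0.ne', one_smul]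
        rw [← map_smul, h2, map_sub, map_smul, hTT, hTv]
        module
      have h2 := congrArg (β⁻¹ • ·) h1
      simpa only [smul_smul, inv_mul_cancel₀ hβ0.ne', one_smul] using h2
    have hw : w ∈ W := W.smul_mem _ (W.sub_mem
      (hWT v hv) (W.smul_mem _ hv))
    refine ⟨(⟨α, β⟩, v, w), ⟨hTv, hTw, hv0, fun h => hβ0.ne' (congrArg Complex.im h)⟩, hv, hw, ?_⟩
    rw [LinearIndependent.pair_iff' hv0]
    intro k hk
    change k • v = w at hk
    have h1 : T (k • v) = k • T v := map_smul _ _ _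
    rw [hk, hTw, hTv, ← hk] at h1
    have h2 : (β * (1 + k ^ 2)) • v = 0 := by
      have := sub_eq_zero.2 h1
      rw [← neg_eq_zero, ← this]
      module
    exact (smul_eq_zero.1 h2).elim (fun h => absurd h (by positivity)) hv0

/-- An invariant subspace of a semisimple endomorphism is spanned by invariant lines and planes whose
dimensions add up to its own, by induction on the dimension: invariant lines and planes have
invariant complements. -/
lemma exists_block_family (T : Module.End ℝ V) (hT : T.IsSemisimple) (n : ℕ) :
    ∀ W ∈ T.invtSubmodule, Module.finrank ℝ W = n →
      ∃ (L : List (ℝ × V)) (R : List (ℂ × V × V)), (∀ x ∈ L, IsLine T x) ∧ (∀ x ∈ R, IsPlane T x) ∧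
        W ≤ Submodule.span ℝ (familyVectors L R) ∧ L.length + 2 * R.length = n := by
  induction n using Nat.strong_induction_on with
  | _ n ih =>
  intro W hW hn
  by_cases hne : W = ⊥
  · subst hne
    rw [finrank_bot] at hn
    exact ⟨[], [], by simp, by simp, bot_le, by simpa using hn⟩
  have hstep : ∀ N : Submodule ℝ V, N ∈ T.invtSubmodule → N ≤ W → 0 < Module.finrank ℝ N →
      ∃ (L : List (ℝ × V)) (R : List (ℂ × V × V)), (∀ x ∈ L, IsLine T x) ∧
        (∀ x ∈ R, IsPlane T x) ∧ W ≤ N ⊔ Submodule.span ℝ (familyVectors L R) ∧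
        Module.finrank ℝ N + (L.length + 2 * R.length) = n := by
    intro N hN hNW hpos
    obtain ⟨W', -, hW', hdisj, hsup⟩ := Module.End.isFinitelySemisimple_iff.1
      hT.isFinitelySemisimple W hW inferInstance N hN hNW
    have h1 := Submodule.finrank_sup_add_finrank_inf_eq N W'
    rw [hsup, hdisj.eq_bot, finrank_bot, hn] at h1
    obtain ⟨L, R, hL, hR, hspan, hlen⟩ := ih (Module.finrank ℝ W') (by omega) W' hW' rfl
    exact ⟨L, R, hL, hR, hsup.ge.trans (sup_le_sup_left hspan N), by omega⟩
  have hmem := fun N => (Module.End.mem_invtSubmodule_iff_forall_mem_of_mem T (p := N)).2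
  rcases exists_line_or_plane T hW hne with ⟨x, hx, hxW⟩ | ⟨x, hx, hxW, hxW', hli⟩
  · have hN : Submodule.span ℝ {x.2} ∈ T.invtSubmodule := by
      refine hmem _ fun y hy => ?_
      obtain ⟨c, rfl⟩ := Submodule.mem_span_singleton.1 hy
      rw [map_smul, hx.1, smul_smul]
      exact Submodule.smul_mem _ _ (Submodule.mem_span_singleton_self _)
    have h1 := finrank_span_singleton (K := ℝ) hx.2
    obtain ⟨L, R, hL, hR, hspan, hlen⟩ := hstep _ hN
      ((Submodule.span_singleton_le_iff_mem _ _).2 hxW) (by omega)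
    refine ⟨x :: L, R, List.forall_mem_cons.2 ⟨hx, hL⟩, hR, hspan.trans (sup_le ?_ ?_), ?_⟩
    · exact Submodule.span_mono (by
        rintro _ rfl
        exact .inl ⟨x, by simp, rfl⟩)
    · refine Submodule.span_mono ?_
      rintro y (⟨z, hz, h⟩ | ⟨z, hz, h⟩)
      · exact .inl ⟨z, by simp [hz], h⟩
      · exact .inr ⟨z, hz, h⟩
    · rw [List.length_cons]
      omega
  · have hN : Submodule.span ℝ (Set.range ![x.2.1, x.2.2]) ∈ T.invtSubmodule := by
      have h0 : x.2.1 ∈ Submodule.span ℝ (Set.range ![x.2.1, x.2.2]) :=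
        Submodule.subset_span ⟨0, rfl⟩
      have h1 : x.2.2 ∈ Submodule.span ℝ (Set.range ![x.2.1, x.2.2]) :=
        Submodule.subset_span ⟨1, rfl⟩
      refine hmem _ fun y hy => ?_
      induction hy using Submodule.span_induction with
      | mem y hy =>
        obtain ⟨i, rfl⟩ := hy
        fin_cases i
        · show T x.2.1 ∈ _
          rw [hx.1]
          exact Submodule.add_mem _ (Submodule.smul_mem _ _ h0) (Submodule.smul_mem _ _ h1)
        · show T x.2.2 ∈ _
          rw [hx.2.1]
          exact Submodule.add_mem _ (Submodule.smul_mem _ _ h0) (Submodule.smul_mem _ _ h1)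
      | zero => simp
      | add y z _ _ hy hz => rw [map_add]; exact Submodule.add_mem _ hy hz
      | smul c y _ hy => rw [map_smul]; exact Submodule.smul_mem _ _ hy
    have h1 := finrank_span_eq_card hli
    rw [Fintype.card_fin] at h1
    obtain ⟨L, R, hL, hR, hspan, hlen⟩ := hstep _ hN
      (Submodule.span_le.2 (by
        rintro _ ⟨i, rfl⟩
        fin_cases i
        · exact hxW
        · exact hxW')) (by omega)
    refine ⟨L, x :: R, hL, List.forall_mem_cons.2 ⟨hx, hR⟩, hspan.trans (sup_le ?_ ?_), ?_⟩
    · refine Submodule.span_mono ?_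
      rintro _ ⟨i, rfl⟩
      fin_cases i
      · exact .inr ⟨x, by simp, .inl rfl⟩
      · exact .inr ⟨x, by simp, .inr rfl⟩
    · refine Submodule.span_mono ?_
      rintro y (⟨z, hz, h⟩ | ⟨z, hz, h⟩)
      · exact .inl ⟨z, hz, h⟩
      · exact .inr ⟨z, by simp [hz], h⟩
    · rw [List.length_cons]
      omega

/-- A matrix whose columns satisfy the relations of the blocks one by one intertwines `A` with the
block-diagonal matrix. -/
lemma Blocks.mul_of_columns {d : ℕ} (B : Blocks d) {A : Matrix (Fin d) (Fin d) ℝ}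
    (vec : Label B.ls B.ps ⊕ Label B.lu B.pu → Fin d → ℝ)
    (h1 : ∀ j, A *ᵥ vec (.inl (.inl j)) = B.νls j • vec (.inl (.inl j)))
    (h2 : ∀ j, A *ᵥ vec (.inl (.inr (0, j))) =
      (B.ms j).re • vec (.inl (.inr (0, j))) + (B.ms j).im • vec (.inl (.inr (1, j))))
    (h3 : ∀ j, A *ᵥ vec (.inl (.inr (1, j))) =
      -(B.ms j).im • vec (.inl (.inr (0, j))) + (B.ms j).re • vec (.inl (.inr (1, j))))
    (h4 : ∀ j, A *ᵥ vec (.inr (.inl j)) = B.νlu j • vec (.inr (.inl j)))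
    (h5 : ∀ j, A *ᵥ vec (.inr (.inr (0, j))) =
      (B.mu j).re • vec (.inr (.inr (0, j))) + (B.mu j).im • vec (.inr (.inr (1, j))))
    (h6 : ∀ j, A *ᵥ vec (.inr (.inr (1, j))) =
      -(B.mu j).im • vec (.inr (.inr (0, j))) + (B.mu j).re • vec (.inr (.inr (1, j)))) :
    A * Matrix.of (fun i k => vec (B.numbering.symm k) i) =
      Matrix.of (fun i k => vec (B.numbering.symm k) i) * B.matrix := by
  ext i k
  obtain ⟨k, rfl⟩ := B.numbering.surjective k
  have e1 : (A * Matrix.of (fun i k => vec (B.numbering.symm k) i)) i (B.numbering k) =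
      (A *ᵥ vec k) i := by
    simp [Matrix.mul_apply, Matrix.mulVec, dotProduct]
  have e2 : (Matrix.of (fun i k => vec (B.numbering.symm k) i) * B.matrix) i (B.numbering k) =
      ∑ k', vec k' i * B.matrix (B.numbering k') (B.numbering k) := by
    rw [Matrix.mul_apply, ← B.numbering.sum_comp]
    simp
  rw [e1, e2, B.matrix_eq, Fintype.sum_sum_type, Fintype.sum_sum_type, Fintype.sum_sum_type,
    Fintype.sum_prod_type_right, Fintype.sum_prod_type_right]
  simp only [Fin.sum_univ_two]
  rcases k with (j | ⟨e, j⟩) | (j | ⟨e, j⟩)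
  · rw [h1]
    simp [Blocks.full, complexBlocks, blockMatrix, Matrix.diagonal_apply, mul_comm]
  · fin_cases e
    · refine (congrFun (h2 j) i).trans ?_
      simp [Blocks.full, complexBlocks, blockMatrix, Matrix.blockDiagonal_apply, mul_comm,
        Finset.sum_add_distrib]
    · refine (congrFun (h3 j) i).trans ?_
      simp [Blocks.full, complexBlocks, blockMatrix, Matrix.blockDiagonal_apply, mul_comm,
        Finset.sum_add_distrib]
  · rw [h4]
    simp [Blocks.full, complexBlocks, blockMatrix, Matrix.diagonal_apply, mul_comm]
  · fin_cases e
    · refine (congrFun (h5 j) i).trans ?_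
      simp [Blocks.full, complexBlocks, blockMatrix, Matrix.blockDiagonal_apply, mul_comm,
        Finset.sum_add_distrib]
    · refine (congrFun (h6 j) i).trans ?_
      simp [Blocks.full, complexBlocks, blockMatrix, Matrix.blockDiagonal_apply, mul_comm,
        Finset.sum_add_distrib]

/-- An invertible hyperbolic real matrix that is diagonalizable over `ℂ` has a block-diagonal
form. -/
lemma exists_blocks {d : ℕ} {A : Matrix (Fin d) (Fin d) ℝ} (hdiag : IsDiagonalizableOverComplex A)
    (hhyp : IsHyperbolicMatrix A) (hA : IsUnit A.det) :
    ∃ (B : Blocks d) (Q : Matrix (Fin d) (Fin d) ℝ), IsUnit Q.det ∧ A * Q = Q * B.matrix := by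
  classical
  obtain ⟨L, R, hL, hR, hspan, hlen⟩ := exists_block_family
    (Matrix.toLinAlgEquiv' A : Module.End ℝ (Fin d → ℝ)) hdiag.isSemisimple d ⊤ (by simp)
    (by simp)
  have hspec : ∀ (m : ℂ) (x : Fin d → ℂ), x ≠ 0 → (A.map Complex.ofReal) *ᵥ x = m • x →
      ‖m‖ ≠ 1 := by
    intro m x hx h
    apply hhyp
    rw [← Matrix.spectrum_toLin', ← Module.End.hasEigenvalue_iff_mem_spectrum]
    exact Module.End.hasEigenvalue_of_hasEigenvector
      ((Module.End.hasEigenvector_iff).2 ⟨Module.End.mem_eigenspace_iff.2 h, hx⟩)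
  have hmap : ∀ x : Fin d → ℝ, (A.map Complex.ofReal) *ᵥ (fun i => (x i : ℂ)) =
      fun i => ((A *ᵥ x) i : ℂ) := by
    intro x
    funext i
    simp [Matrix.mulVec, dotProduct]
  have hL1 : ∀ x ∈ L, |x.1| ≠ 1 ∧ x.1 ≠ 0 := by
    intro x hx
    obtain ⟨h1, h2⟩ := hL x hx
    change A *ᵥ x.2 = _ at h1
    constructor
    · have := hspec x.1 (fun i => (x.2 i : ℂ))
        (fun h => h2 (funext fun i => Complex.ofReal_injective (congrFun h i))) (by
          rw [hmap, h1]
          funext i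
          simp)
      rwa [Complex.norm_real] at this
    · intro h0
      rw [h0, zero_smul] at h1
      exact h2 (Matrix.eq_zero_of_mulVec_eq_zero hA.ne_zero h1)
  have hR1 : ∀ x ∈ R, ‖x.1‖ ≠ 1 := by
    intro x hx
    obtain ⟨h1, h2, h3, -⟩ := hR x hx
    change A *ᵥ x.2.1 = _ at h1
    change A *ᵥ x.2.2 = _ at h2
    -- a plane spanned by `v`, `w` carries the complex eigenvector `v - i w`
    refine hspec x.1 ((fun i => (x.2.1 i : ℂ)) - Complex.I • fun i => (x.2.2 i : ℂ)) ?_ ?_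
    · intro h
      refine h3 (funext fun i => ?_)
      have := congrArg Complex.re (congrFun h i)
      simpa using this
    · rw [Matrix.mulVec_sub, Matrix.mulVec_smul, hmap, hmap, h1, h2]
      funext i
      simp
      linear_combination (x.2.1 i - Complex.I * x.2.2 i) * Complex.re_add_im x.1 +
        ((x.1.im : ℂ) * x.2.2 i) * Complex.I_mul_I
  -- the stable blocks are the lines and planes whose multiplier has modulus less than `1`
  let Ls := L.filter fun x => |x.1| < 1
  let Lu := L.filter fun x => ¬ |x.1| < 1
  let Rs := R.filter fun x => ‖x.1‖ < 1
  let Ru := R.filter fun x => ¬ ‖x.1‖ < 1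
  have hLs : ∀ x ∈ Ls, x ∈ L ∧ |x.1| < 1 := fun x hx => by simpa [Ls] using hx
  have hLu : ∀ x ∈ Lu, x ∈ L ∧ ¬ |x.1| < 1 := fun x hx => by simpa [Lu] using hx
  have hRs : ∀ x ∈ Rs, x ∈ R ∧ ‖x.1‖ < 1 := fun x hx => by simpa [Rs] using hx
  have hRu : ∀ x ∈ Ru, x ∈ R ∧ ¬ ‖x.1‖ < 1 := fun x hx => by simpa [Ru] using hx
  have hcard : Fintype.card (Label Ls.length Rs.length ⊕ Label Lu.length Ru.length) = d := by
    have h1 : Ls.length + Lu.length = L.length := by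
      have := List.length_eq_length_filter_add (l := L) fun x => decide (|x.1| < 1)
      simpa [Ls, Lu, ← not_lt] using this.symm
    have h2 : Rs.length + Ru.length = R.length := by
      have := List.length_eq_length_filter_add (l := R) fun x => decide (‖x.1‖ < 1)
      simpa [Rs, Ru, ← not_lt] using this.symm
    simp only [Fintype.card_sum, Fintype.card_prod, Fintype.card_fin]
    omega
  let B : Blocks d :=
    { ls := Ls.length
      ps := Rs.length
      lu := Lu.length
      pu := Ru.length
      numbering := Fintype.equivFinOfCardEq hcard
      νls := fun j => (Ls.get j).1
      νps := fun j => ‖(Rs.get j).1‖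
      ϑps := fun j => (Rs.get j).1.arg
      νlu := fun j => (Lu.get j).1
      νpu := fun j => ‖(Ru.get j).1‖
      ϑpu := fun j => (Ru.get j).1.arg
      νls_mem := fun j => by
        obtain ⟨h1, h2⟩ := hLs _ (Ls.get_mem j)
        exact ⟨abs_pos.2 (hL1 _ h1).2, h2⟩
      νps_mem := fun j => by
        obtain ⟨h1, h2⟩ := hRs _ (Rs.get_mem j)
        exact ⟨norm_pos_iff.2 (hR _ h1).2.2.2, h2⟩
      νlu_mem := fun j => by
        obtain ⟨h1, h2⟩ := hLu _ (Lu.get_mem j)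
        exact lt_of_le_of_ne (not_lt.1 h2) (hL1 _ h1).1.symm
      νpu_mem := fun j => by
        obtain ⟨h1, h2⟩ := hRu _ (Ru.get_mem j)
        exact lt_of_le_of_ne (not_lt.1 h2) (hR1 _ h1).symm }
  let vec : Label B.ls B.ps ⊕ Label B.lu B.pu → Fin d → ℝ :=
    Sum.elim
      (Sum.elim (fun j => (Ls.get j).2)
        fun q => if q.1 = 0 then (Rs.get q.2).2.1 else (Rs.get q.2).2.2)
      (Sum.elim (fun j => (Lu.get j).2)
        fun q => if q.1 = 0 then (Ru.get q.2).2.1 else (Ru.get q.2).2.2)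
  have hrange : familyVectors L R ⊆ Set.range vec := by
    rintro y (⟨x, hx, rfl⟩ | ⟨x, hx, hy⟩)
    · by_cases h : |x.1| < 1
      · obtain ⟨j, hj⟩ := List.get_of_mem (show x ∈ Ls by simp [Ls, hx, h])
        exact ⟨.inl (.inl j), congrArg Prod.snd hj⟩
      · obtain ⟨j, hj⟩ := List.get_of_mem (show x ∈ Lu by simpa [Lu, hx] using h)
        exact ⟨.inr (.inl j), congrArg Prod.snd hj⟩
    · by_cases h : ‖x.1‖ < 1
      · obtain ⟨j, hj⟩ := List.get_of_mem (show x ∈ Rs by simp [Rs, hx, h])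
        rcases hy with rfl | rfl
        · exact ⟨.inl (.inr (0, j)), congrArg (fun x => x.2.1) hj⟩
        · exact ⟨.inl (.inr (1, j)), congrArg (fun x => x.2.2) hj⟩
      · obtain ⟨j, hj⟩ := List.get_of_mem (show x ∈ Ru by simpa [Ru, hx] using h)
        rcases hy with rfl | rfl
        · exact ⟨.inr (.inr (0, j)), congrArg (fun x => x.2.1) hj⟩
        · exact ⟨.inr (.inr (1, j)), congrArg (fun x => x.2.2) hj⟩
  -- a spanning family of `d` vectors is a basis
  have hli : LinearIndependent ℝ vec := by
    refine linearIndependent_of_top_le_span_of_card_eq_finrank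
      (hspan.trans (Submodule.span_mono hrange)) ?_
    rw [Module.finrank_fin_fun]
    exact hcard
  let Q : Matrix (Fin d) (Fin d) ℝ := Matrix.of fun i k => vec (B.numbering.symm k) i
  have hQ : IsUnit Q := by
    rw [← Matrix.linearIndependent_cols_iff_isUnit]
    exact hli.comp _ B.numbering.symm.injective
  refine ⟨B, Q, (Matrix.isUnit_iff_isUnit_det _).1 hQ, ?_⟩
  have hms : ∀ j, B.ms j = (Rs.get j).1 := fun j => Complex.norm_mul_exp_arg_mul_I _
  have hmu : ∀ j, B.mu j = (Ru.get j).1 := fun j => Complex.norm_mul_exp_arg_mul_I _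
  refine B.mul_of_columns vec (fun j => (hL _ (hLs _ (Ls.get_mem j)).1).1) (fun j => ?_)
    (fun j => ?_) (fun j => (hL _ (hLu _ (Lu.get_mem j)).1).1) (fun j => ?_) (fun j => ?_)
  · rw [hms]
    exact (hR _ (hRs _ (Rs.get_mem j)).1).1
  · rw [hms]
    exact (hR _ (hRs _ (Rs.get_mem j)).1).2.1
  · rw [hmu]
    exact (hR _ (hRu _ (Ru.get_mem j)).1).1
  · rw [hmu]
    exact (hR _ (hRu _ (Ru.get_mem j)).1).2.1

end BlockForm


/-! ### The fundamental solution -/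

lemma linear_ode_unique {d : ℕ} {A : ℝ → Matrix (Fin d) (Fin d) ℝ}
    (hA : ∀ i j, Continuous fun t => A t i j) {f g : ℝ → Fin d → ℝ}
    (hf : ∀ t, HasDerivAt f (A t *ᵥ f t) t) (hg : ∀ t, HasDerivAt g (A t *ᵥ g t) t) {t₀ : ℝ}
    (h : f t₀ = g t₀) : f = g := by
  funext t
  let T := |t| + |t₀| + 1
  have hc : Continuous fun t => ∑ i, ∑ j, |A t i j| :=
    continuous_finsetSum _ fun i _ => continuous_finsetSum _ fun j _ => (hA i j).abs
  obtain ⟨K, hK⟩ := (isCompact_Icc (a := -T) (b := T)).exists_bound_of_continuousOn hc.continuousOn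
  have hnn : 0 ≤ |t| + |t₀| := by positivity
  have ht : t ∈ Ioo (-T) T := abs_lt.1 (by simp only [T]; linarith [abs_nonneg t₀])
  have ht₀ : t₀ ∈ Ioo (-T) T := abs_lt.1 (by simp only [T]; linarith [abs_nonneg t])
  refine ODE_solution_unique_of_mem_Ioo (v := fun t x => A t *ᵥ x) (s := fun _ => univ)
    (K := K.toNNReal) (fun s hs => ?_) ht₀ (fun s _ => ⟨hf s, mem_univ _⟩)
    (fun s _ => ⟨hg s, mem_univ _⟩) h ht
  refine LipschitzWith.lipschitzOnWith (LipschitzWith.of_dist_le_mul fun x y => ?_)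
  have hK' := hK s (Ioo_subset_Icc_self hs)
  rw [Real.norm_of_nonneg (by positivity)] at hK'
  rw [dist_eq_norm, dist_eq_norm, ← Matrix.mulVec_sub]
  refine (pi_norm_le_iff_of_nonneg (by positivity)).2 fun i => ?_
  calc ‖(A s *ᵥ (x - y)) i‖ ≤ ∑ j, |A s i j| * ‖x - y‖ := by
        refine (norm_sum_le Finset.univ fun j => A s i j * (x - y) j).trans
          (Finset.sum_le_sum fun j _ => ?_)
        rw [norm_mul]
        exact mul_le_mul_of_nonneg_left (norm_le_pi_norm (x - y) j) (norm_nonneg _)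
    _ ≤ (K.toNNReal : ℝ) * ‖x - y‖ := by
        rw [← Finset.sum_mul]
        refine mul_le_mul_of_nonneg_right ?_ (norm_nonneg _)
        refine le_trans ?_ (hK'.trans (Real.le_coe_toNNReal K))
        exact Finset.single_le_sum (f := fun i => ∑ j, |A s i j|)
          (fun i _ => Finset.sum_nonneg fun j _ => abs_nonneg _) (Finset.mem_univ i)

namespace LinearizingChart

variable {d : ℕ} {M : Type*} [TopologicalSpace M] [ChartedSpace (Model d) M]
  {V : ∀ x : M, TangentSpace 𝓘(ℝ, Model d) x} {Λ : Set M} {P : ℝ}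
  (C : LinearizingChart V Λ P)

lemma hasDerivAt_U_mulVec (x : Fin d → ℝ) (θ : ℝ) :
    HasDerivAt (fun s => C.U s *ᵥ x) (C.A θ *ᵥ (C.U θ *ᵥ x)) θ := by
  refine hasDerivAt_pi.2 fun i => ?_
  rw [Matrix.mulVec_mulVec]
  simp only [Matrix.mulVec, dotProduct]
  exact HasDerivAt.fun_sum fun j _ => (C.U_deriv θ i j).mul_const (x j)

lemma U_add_period (θ : ℝ) : C.U (θ + P) = C.U θ * C.U P := by
  have key : ∀ x, (fun s => C.U (s + P) *ᵥ x) = fun s => C.U s *ᵥ (C.U P *ᵥ x) := by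
    intro x
    refine linear_ode_unique (A := C.A) (fun i j => (C.A_smooth i j).continuous) (t₀ := 0)
      (fun t => ?_) (fun t => C.hasDerivAt_U_mulVec _ t) (by simp [C.U_zero])
    have := (C.hasDerivAt_U_mulVec x (t + P)).comp_add_const t P
    rwa [C.A_periodic] at this
  refine Matrix.ext_of_mulVec_single fun j => ?_
  rw [← Matrix.mulVec_mulVec]
  exact congrFun (key _) θ

lemma isUnit_det_U (θ : ℝ) : IsUnit (C.U θ).det := by
  rw [isUnit_iff_ne_zero]
  intro h0
  obtain ⟨x, hx, h⟩ := Matrix.exists_mulVec_eq_zero_iff.2 h0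
  have key : (fun s => C.U s *ᵥ x) = fun _ => 0 :=
    linear_ode_unique (A := C.A) (fun i j => (C.A_smooth i j).continuous) (t₀ := θ)
      (fun t => C.hasDerivAt_U_mulVec _ t) (fun t => by simpa using hasDerivAt_const t (0 : Fin d → ℝ)) h
  have := congrFun key 0
  rw [C.U_zero, Matrix.one_mulVec] at this
  exact hx this

lemma contDiff_U (i j : Fin d) : ContDiff ℝ ∞ fun θ => C.U θ i j := by
  rw [contDiff_infty]
  intro n
  induction n generalizing i j with
  | zero =>
    refine contDiff_zero.2 (continuous_iff_continuousAt.2 fun θ => (C.U_deriv θ i j).continuousAt)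
  | succ n ih =>
    have h1 : deriv (fun θ => C.U θ i j) = fun θ => ∑ k, C.A θ i k * C.U θ k j :=
      funext fun θ => (C.U_deriv θ i j).deriv
    refine (contDiff_succ_iff_deriv (n := n)).2
      ⟨fun θ => (C.U_deriv θ i j).differentiableAt, by simp, ?_⟩
    rw [h1]
    exact ContDiff.sum fun k _ => ((C.A_smooth i k).of_le (mod_cast le_top)).mul (ih k j)

end LinearizingChart

lemma contDiff_det {d : ℕ} {N : ℝ → Matrix (Fin d) (Fin d) ℝ}
    (hN : ∀ i j, ContDiff ℝ ∞ fun θ => N θ i j) : ContDiff ℝ ∞ fun θ => (N θ).det := by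
  simp only [Matrix.det_apply']
  exact ContDiff.sum fun σ _ => contDiff_const.mul (contDiff_prod fun i _ => hN _ _)

lemma contDiff_inv_matrix {d : ℕ} {N : ℝ → Matrix (Fin d) (Fin d) ℝ}
    (hN : ∀ i j, ContDiff ℝ ∞ fun θ => N θ i j) (hu : ∀ θ, IsUnit (N θ).det) (i j : Fin d) :
    ContDiff ℝ ∞ fun θ => (N θ)⁻¹ i j := by
  have h : ∀ θ, (N θ)⁻¹ i j = (N θ).det⁻¹ * (N θ).adjugate i j := fun θ => by
    rw [Matrix.inv_def, Ring.inverse_eq_inv']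
    rfl
  simp only [h, Matrix.adjugate_apply]
  refine ((contDiff_det hN).inv fun θ => (hu θ).ne_zero).mul (contDiff_det fun k l => ?_)
  by_cases hk : k = j
  · subst hk
    simp only [Matrix.updateRow_self]
    exact contDiff_const
  · simp only [Matrix.updateRow_ne hk]
    exact hN k l

/-! ### Norms adapted to the splitting -/

namespace Blocks

variable {d : ℕ} (B : Blocks d) (P : ℝ)

/-- The square of the norm of the stable part of `exp (θ A_Λ) x`, at `q = (x, θ)`. -/
def stableSq (q : Model d) : ℝ :=
  ∑ k, Real.exp (2 * B.rate P (.inl k) * q.2) * q.1 (B.numbering (.inl k)) ^ 2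

/-- The square of the norm of the unstable part of `exp (θ A_Λ) x`, at `q = (x, θ)`. -/
def unstableSq (q : Model d) : ℝ :=
  ∑ k, Real.exp (2 * B.rate P (.inr k) * q.2) * q.1 (B.numbering (.inr k)) ^ 2

lemma stableSq_nonneg (q : Model d) : 0 ≤ B.stableSq P q :=
  Finset.sum_nonneg fun _ _ => by positivity

lemma unstableSq_nonneg (q : Model d) : 0 ≤ B.unstableSq P q :=
  Finset.sum_nonneg fun _ _ => by positivity

lemma contDiff_stableSq : ContDiff ℝ ∞ (B.stableSq P) := by
  unfold stableSq
  fun_prop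

lemma contDiff_unstableSq : ContDiff ℝ ∞ (B.unstableSq P) := by
  unfold unstableSq
  fun_prop

lemma sum_sq_full_inl (a : Fin B.ls → ℝ) (m : Fin B.ps → ℂ) (a' : Fin B.lu → ℝ)
    (m' : Fin B.pu → ℂ) (x : EuclideanSpace ℝ (Fin d)) (b : Fin B.ls → ℝ) (c : Fin B.ps → ℝ) :
    ∑ k : Label B.ls B.ps, Sum.elim b (fun q => c q.2) k *
        act (B.full a m a' m') x (B.numbering (.inl k)) ^ 2 =
      ∑ k : Label B.ls B.ps, Sum.elim b (fun q => c q.2) k *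
        (blockModulus a m k * x (B.numbering (.inl k))) ^ 2 := by
  simp only [act_full_inl]
  exact sum_sq_complexBlocks_mulVec a m b c _

lemma sum_sq_full_inr (a : Fin B.ls → ℝ) (m : Fin B.ps → ℂ) (a' : Fin B.lu → ℝ)
    (m' : Fin B.pu → ℂ) (x : EuclideanSpace ℝ (Fin d)) (b : Fin B.lu → ℝ) (c : Fin B.pu → ℝ) :
    ∑ k : Label B.lu B.pu, Sum.elim b (fun q => c q.2) k *
        act (B.full a m a' m') x (B.numbering (.inr k)) ^ 2 =
      ∑ k : Label B.lu B.pu, Sum.elim b (fun q => c q.2) k *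
        (blockModulus a' m' k * x (B.numbering (.inr k))) ^ 2 := by
  simp only [act_full_inr]
  exact sum_sq_complexBlocks_mulVec a' m' b c _

/-- The linear flow preserves the splitting into blocks, which are orthogonal to each other. -/
lemma norm_sq_act_flowMatrix (q : Model d) :
    ‖act (B.flowMatrix P q.2) q.1‖ ^ 2 = B.stableSq P q + B.unstableSq P q := by
  rw [EuclideanSpace.norm_sq_eq, ← B.numbering.sum_comp, Fintype.sum_sum_type]
  simp only [Real.norm_eq_abs, sq_abs, flowMatrix]
  have h1 := fun a m a' m' => B.sum_sq_full_inl a m a' m' q.1 (fun _ => 1) (fun _ => 1)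
  have h2 := fun a m a' m' => B.sum_sq_full_inr a m a' m' q.1 (fun _ => 1) (fun _ => 1)
  have e1 : ∀ {l p : ℕ} (k : Label l p),
      (Sum.elim (fun _ => 1) (fun _ => 1) k : ℝ) = 1 := by
    rintro l p (k | k) <;> rfl
  simp only [e1, one_mul] at h1 h2
  rw [h1, h2, stableSq, unstableSq]
  have e2 : ∀ x y : ℝ, (Real.exp x * y) ^ 2 = Real.exp (2 * x) * y ^ 2 := fun x y => by
    rw [mul_pow, ← Real.exp_nat_mul]
    norm_num
  congr 1
  · refine Finset.sum_congr rfl ?_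
    rintro (j | j) -
    · simp only [blockModulus, Sum.elim_inl, Real.abs_exp, e2, rate]
      ring_nf
    · simp only [blockModulus, Sum.elim_inr, Sum.elim_inl, Complex.norm_exp, rate]
      rw [e2]
      simp
      ring_nf
      simp
  · refine Finset.sum_congr rfl ?_
    rintro (j | j) -
    · simp only [blockModulus, Sum.elim_inl, Sum.elim_inr, Real.abs_exp, e2, rate]
      ring_nf
    · simp only [blockModulus, Sum.elim_inr, Complex.norm_exp, rate]
      rw [e2]
      simp
      ring_nf
      simp

variable {P}

lemma exp_rate_mul_sq (hP : P ≠ 0) {x : ℝ} (hx : 0 < x) (θ y : ℝ) :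
    Real.exp (2 * (Real.log x / P) * θ) * (x * y) ^ 2 =
      Real.exp (2 * (Real.log x / P) * (θ + P)) * y ^ 2 := by
  have h1 : 2 * (Real.log x / P) * (θ + P) = 2 * (Real.log x / P) * θ + (2 : ℕ) * Real.log x := by
    push_cast
    field_simp
  rw [h1, Real.exp_add, Real.exp_nat_mul, Real.exp_log hx]
  ring

lemma stableSq_act_matrix (hP : P ≠ 0) (x : EuclideanSpace ℝ (Fin d)) (θ : ℝ) :
    B.stableSq P (act B.matrix x, θ) = B.stableSq P (x, θ + P) := by
  have h := B.sum_sq_full_inl B.νls B.ms B.νlu B.mu x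
    (fun j => Real.exp (2 * (Real.log |B.νls j| / P) * θ))
    (fun j => Real.exp (2 * (Real.log (B.νps j) / P) * θ))
  rw [← B.matrix_eq] at h
  have e : ∀ k : Label B.ls B.ps, Real.exp (2 * B.rate P (.inl k) * θ) =
      Sum.elim (fun j => Real.exp (2 * (Real.log |B.νls j| / P) * θ))
        (fun q => Real.exp (2 * (Real.log (B.νps q.2) / P) * θ)) k := by
    rintro (k | k) <;> rfl
  simp only [stableSq, e]
  refine h.trans (Finset.sum_congr rfl ?_)
  rintro (j | j) -
  · exact exp_rate_mul_sq hP (B.νls_mem j).1 _ _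
  · simp only [blockModulus, Sum.elim_inr, norm_ms]
    exact exp_rate_mul_sq hP (B.νps_mem j.2).1 _ _

lemma unstableSq_act_matrix (hP : P ≠ 0) (x : EuclideanSpace ℝ (Fin d)) (θ : ℝ) :
    B.unstableSq P (act B.matrix x, θ) = B.unstableSq P (x, θ + P) := by
  have h := B.sum_sq_full_inr B.νls B.ms B.νlu B.mu x
    (fun j => Real.exp (2 * (Real.log |B.νlu j| / P) * θ))
    (fun j => Real.exp (2 * (Real.log (B.νpu j) / P) * θ))
  rw [← B.matrix_eq] at h
  have e : ∀ k : Label B.lu B.pu, Real.exp (2 * B.rate P (.inr k) * θ) =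
      Sum.elim (fun j => Real.exp (2 * (Real.log |B.νlu j| / P) * θ))
        (fun q => Real.exp (2 * (Real.log (B.νpu q.2) / P) * θ)) k := by
    rintro (k | k) <;> rfl
  simp only [unstableSq, e]
  refine h.trans (Finset.sum_congr rfl ?_)
  rintro (j | j) -
  · exact exp_rate_mul_sq hP (zero_lt_one.trans (B.νlu_mem j)) _ _
  · simp only [blockModulus, Sum.elim_inr, norm_mu]
    exact exp_rate_mul_sq hP (zero_lt_one.trans (B.νpu_mem j.2)) _ _

lemma rate_inl_neg (hP : 0 < P) (k : Label B.ls B.ps) : B.rate P (.inl k) < 0 := by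
  rcases k with j | j
  · exact div_neg_of_neg_of_pos (Real.log_neg (B.νls_mem j).1 (B.νls_mem j).2) hP
  · exact div_neg_of_neg_of_pos (Real.log_neg (B.νps_mem j.2).1 (B.νps_mem j.2).2) hP

lemma rate_inr_pos (hP : 0 < P) (k : Label B.lu B.pu) : 0 < B.rate P (.inr k) := by
  rcases k with j | j
  · exact div_pos (Real.log_pos (B.νlu_mem j)) hP
  · exact div_pos (Real.log_pos (B.νpu_mem j.2)) hP

lemma unstableSq_mono (hP : 0 < P) (x : EuclideanSpace ℝ (Fin d)) {θ θ' : ℝ} (h : θ' ≤ θ) :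
    B.unstableSq P (x, θ') ≤ B.unstableSq P (x, θ) := by
  refine Finset.sum_le_sum fun k _ => mul_le_mul_of_nonneg_right (Real.exp_le_exp.2 ?_)
    (sq_nonneg _)
  have := B.rate_inr_pos hP k
  nlinarith

lemma mem_unstable_iff {z : EuclideanSpace ℝ (Fin d)} :
    z ∈ B.splitting.unstable ↔ ∀ k, z (B.numbering (.inl k)) = 0 := by
  have h0 : z ∈ B.splitting.unstable ↔
      B.embedUnstable (fun k => z (B.numbering (.inr k))) = z := Iff.rfl
  rw [h0]
  constructor
  · intro h k
    rw [← h]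
    simp [embedUnstable]
  · intro h
    ext i
    obtain ⟨k | k, rfl⟩ := B.numbering.surjective i
    · simp [embedUnstable, h]
    · simp [embedUnstable]

lemma stableSq_eq_zero_iff {q : Model d} : B.stableSq P q = 0 ↔ q.1 ∈ B.splitting.unstable := by
  rw [mem_unstable_iff, stableSq, Finset.sum_eq_zero_iff_of_nonneg fun _ _ => by positivity]
  simp [Real.exp_ne_zero]

/-- A point whose stable part stays bounded in the past has no stable part. -/
lemma mem_unstable_of_bounded (hP : 0 < P) {z : EuclideanSpace ℝ (Fin d)} {θ c : ℝ}
    (h : ∀ t ≥ 0, B.stableSq P (z, θ - t) ≤ c) : z ∈ B.splitting.unstable := by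
  rw [mem_unstable_iff]
  intro k
  by_contra hk
  have h1 : ∀ t ≥ 0, Real.exp (2 * B.rate P (.inl k) * (θ - t)) * z (B.numbering (.inl k)) ^ 2 ≤ c :=
    fun t ht => (Finset.single_le_sum
      (f := fun k => Real.exp (2 * B.rate P (.inl k) * (θ - t)) * z (B.numbering (.inl k)) ^ 2)
      (fun _ _ => by positivity) (Finset.mem_univ k)).trans (h t ht)
  have hr := B.rate_inl_neg hP k
  have h2 : Tendsto (fun t : ℝ => Real.exp (2 * B.rate P (.inl k) * (θ - t)) *
      z (B.numbering (.inl k)) ^ 2) atTop atTop := by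
    refine Tendsto.atTop_mul_const (by positivity) (Real.tendsto_exp_atTop.comp ?_)
    have : (fun t : ℝ => 2 * B.rate P (.inl k) * (θ - t)) =
        fun t => (-(2 * B.rate P (.inl k))) * t + 2 * B.rate P (.inl k) * θ := by
      funext t
      ring
    rw [this]
    exact tendsto_atTop_add_const_right _ _ (tendsto_id.const_mul_atTop (by linarith))
  obtain ⟨t, ht, ht'⟩ := ((eventually_ge_atTop 0).and (h2.eventually_gt_atTop c)).exists
  exact absurd (h1 t ht) (not_le.2 ht')

end Blocks


/-! ### Flow-box coordinates -/

/-- An injective local diffeomorphism is the inverse of a smooth chart. -/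
lemma exists_chart {d : ℕ} {M : Type*} [TopologicalSpace M] [ChartedSpace (Model d) M]
    [IsManifold 𝓘(ℝ, Model d) ∞ M] {F : Model d → M} {T : Set (Model d)} (hT : IsOpen T)
    (hF : IsLocalDiffeomorphOn 𝓘(ℝ, Model d) 𝓘(ℝ, Model d) ∞ F T) (hinj : InjOn F T) :
    ∃ κ : SmoothChart d M, κ.1.target = T ∧ ∀ q, κ.1.symm q = F q := by
  have hloc := hF.isLocalHomeomorphOn
  let e : OpenPartialHomeomorph (Model d) M := OpenPartialHomeomorph.ofContinuousOpenRestrict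
    (hinj.bijOn_image.toPartialEquiv F T (F '' T)) hloc.continuousOn (by
      refine IsOpenMap.of_nhds_le fun x => ?_
      have h1 := hloc.map_nhds_eq x.2
      rw [← map_nhds_subtype_coe_eq_nhds x.2 (hT.mem_nhds x.2), Filter.map_map] at h1
      exact h1.ge) hT
  have he : ∀ q, e q = F q := fun q => rfl
  have hs : e.source = T := rfl
  refine ⟨⟨e.symm, ?_⟩, rfl, fun q => rfl⟩
  refine OpenPartialHomeomorph.mem_maximalAtlas_of_contMDiffOn _ ?_ ?_
  · rintro y ⟨x, hx, rfl⟩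
    refine ContMDiffAt.contMDiffWithinAt ?_
    have hx' := hF ⟨x, hx⟩
    refine hx'.localInverse_contMDiffAt.congr_of_eventuallyEq ?_
    have h1 : Tendsto hx'.localInverse (𝓝 (F x)) (𝓝 x) := by
      have := hx'.localInverse_contMDiffAt.continuousAt.tendsto
      rwa [hx'.localInverse_left_inv hx'.localInverse_mem_target] at this
    filter_upwards [h1.eventually (hT.mem_nhds hx), hx'.localInverse_eventuallyEq_right] with z hz hz'
    have h2 : F (hx'.localInverse z) = z := hz'
    conv_lhs => rw [← h2]
    exact e.left_inv hz
  · exact hF.contMDiffOn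

namespace LinearizingChart

variable {d : ℕ} {M : Type*} [TopologicalSpace M] [ChartedSpace (Model d) M]
  {V : ∀ x : M, TangentSpace 𝓘(ℝ, Model d) x} {Λ : Set M} {P : ℝ}
  (C : LinearizingChart V Λ P) (B : Blocks d) (Q : Matrix (Fin d) (Fin d) ℝ)

/-- The standing assumptions on the adapted coordinates and on the radius of the tube. -/
structure IsTube (δ : ℝ) : Prop where
  period_pos : 0 < P
  adapted : C.IsAdapted B Q
  radius_pos : 0 < δ
  subset : C.liftedTube B Q δ ⊆ Metric.ball 0 C.r ×ˢ univ

/-- The change of coordinates from `(ζ, θ)`, in which the vector field is `∂_θ`, to the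
linearizing coordinates. -/
def shear (q : Model d) : Model d := (act (C.U q.2 * Q) q.1, q.2)

/-- The inverse of `shear`. -/
def unshear (q : Model d) : Model d := (act (C.U q.2 * Q)⁻¹ q.1, q.2)

/-- The flow-box coordinates, in which the vector field is `∂_θ`. -/
def flowBox (q : Model d) : M := C.h (C.shear Q q)

/-- The lifted tube in the flow-box coordinates. -/
def box (δ : ℝ) : Set (Model d) := {q | B.stableSq P q + B.unstableSq P q < δ ^ 2}

lemma isOpen_box (δ : ℝ) : IsOpen (box (P := P) B δ) :=
  isOpen_lt ((B.contDiff_stableSq P).continuous.add (B.contDiff_unstableSq P).continuous)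
    continuous_const

lemma contDiff_act_family {N : ℝ → Matrix (Fin d) (Fin d) ℝ}
    (hN : ∀ i j, ContDiff ℝ ∞ fun θ => N θ i j) :
    ContDiff ℝ ∞ fun q : Model d => (act (N q.2) q.1, q.2) := by
  refine ContDiff.prodMk (contDiff_euclidean.2 fun i => ?_) contDiff_snd
  simp only [act_apply]
  refine ContDiff.sum fun j _ => ((hN i j).comp contDiff_snd).mul ?_
  exact (contDiff_euclidean.1 contDiff_fst j)

lemma contDiff_U_mul (i j : Fin d) : ContDiff ℝ ∞ fun θ => (C.U θ * Q) i j := by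
  simp only [Matrix.mul_apply]
  exact ContDiff.sum fun k _ => (C.contDiff_U i k).mul contDiff_const

lemma contDiff_shear : ContDiff ℝ ∞ (C.shear Q) := contDiff_act_family (C.contDiff_U_mul Q)

variable {C B Q} {δ : ℝ}

lemma isUnit_det_U_mul (hQ : IsUnit Q.det) (θ : ℝ) : IsUnit (C.U θ * Q).det := by
  rw [Matrix.det_mul]
  exact (C.isUnit_det_U θ).mul hQ

lemma contDiff_unshear (hQ : IsUnit Q.det) : ContDiff ℝ ∞ (C.unshear Q) :=
  contDiff_act_family (N := fun θ => (C.U θ * Q)⁻¹)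
    (contDiff_inv_matrix (C.contDiff_U_mul Q) (isUnit_det_U_mul hQ))

lemma unshear_shear (hQ : IsUnit Q.det) (q : Model d) : C.unshear Q (C.shear Q q) = q := by
  refine Prod.ext ?_ rfl
  simp only [shear, unshear, ← act_mul, Matrix.nonsing_inv_mul _ (isUnit_det_U_mul hQ q.2), act_one]

lemma shear_unshear (hQ : IsUnit Q.det) (q : Model d) : C.shear Q (C.unshear Q q) = q := by
  refine Prod.ext ?_ rfl
  simp only [shear, unshear, ← act_mul, Matrix.mul_nonsing_inv _ (isUnit_det_U_mul hQ q.2), act_one]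

lemma isLocalDiffeomorph_shear (hQ : IsUnit Q.det) :
    IsLocalDiffeomorph 𝓘(ℝ, Model d) 𝓘(ℝ, Model d) ∞ (C.shear Q) := by
  let Φ : Model d ≃ₘ^∞⟮𝓘(ℝ, Model d), 𝓘(ℝ, Model d)⟯ Model d :=
    { toFun := C.shear Q
      invFun := C.unshear Q
      left_inv := unshear_shear hQ
      right_inv := shear_unshear hQ
      contMDiff_toFun := (C.contDiff_shear Q).contMDiff
      contMDiff_invFun := (contDiff_unshear hQ).contMDiff }
  exact Φ.isLocalDiffeomorph

lemma floquet_eq (θ : ℝ) : C.floquet B Q θ = C.U θ * Q * B.flowMatrix P (-θ) := by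
  rw [floquet, ← neg_smul, B.exp_smul_generator]

lemma act_flowMatrix_neg (θ : ℝ) (x : EuclideanSpace ℝ (Fin d)) :
    act (B.flowMatrix P (-θ)) (act (B.flowMatrix P θ) x) = x := by
  rw [← act_mul, ← B.flowMatrix_add, neg_add_cancel, B.flowMatrix_zero, act_one]

lemma act_flowMatrix_neg' (θ : ℝ) (x : EuclideanSpace ℝ (Fin d)) :
    act (B.flowMatrix P θ) (act (B.flowMatrix P (-θ)) x) = x := by
  rw [← act_mul, ← B.flowMatrix_add, add_neg_cancel, B.flowMatrix_zero, act_one]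

lemma mem_box_iff (hδ : 0 < δ) {q : Model d} :
    q ∈ box (P := P) B δ ↔ ‖act (B.flowMatrix P q.2) q.1‖ < δ := by
  show B.stableSq P q + B.unstableSq P q < δ ^ 2 ↔ _
  rw [← B.norm_sq_act_flowMatrix]
  exact pow_lt_pow_iff_left₀ (norm_nonneg _) hδ.le two_ne_zero

lemma shear_mem_liftedTube (hδ : 0 < δ) {q : Model d} (hq : q ∈ box (P := P) B δ) :
    C.shear Q q ∈ C.liftedTube B Q δ := by
  refine ⟨act (B.flowMatrix P q.2) q.1, (mem_box_iff hδ).1 hq, ?_⟩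
  show act (C.U q.2 * Q) q.1 = act (C.floquet B Q q.2) _
  rw [floquet_eq, act_mul _ (B.flowMatrix P (-q.2)), act_flowMatrix_neg]

lemma exists_shear_eq (hδ : 0 < δ) {q : Model d} (hq : q ∈ C.liftedTube B Q δ) :
    ∃ q' ∈ box (P := P) B δ, C.shear Q q' = q := by
  obtain ⟨z, hz, h⟩ := hq
  refine ⟨(act (B.flowMatrix P (-q.2)) z, q.2), (mem_box_iff hδ).2 ?_, Prod.ext ?_ rfl⟩
  · simpa only [act_flowMatrix_neg'] using hz
  · rw [h, floquet_eq, act_mul _ (B.flowMatrix P (-q.2))]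
    rfl

lemma unshear_mem_box (hQ : IsUnit Q.det) (hδ : 0 < δ) {q : Model d} :
    C.unshear Q q ∈ box (P := P) B δ ↔ q ∈ C.liftedTube B Q δ := by
  constructor
  · intro h
    have := shear_mem_liftedTube (C := C) (Q := Q) hδ h
    rwa [shear_unshear hQ] at this
  · intro h
    obtain ⟨q', hq', rfl⟩ := exists_shear_eq hδ h
    rwa [unshear_shear hQ]

namespace IsTube

variable (hT : C.IsTube B Q δ)
include hT

lemma U_mul_add_period (k : ℕ) (θ : ℝ) : C.U (θ + k * P) * Q = C.U θ * Q * B.matrix ^ k := by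
  induction k with
  | zero => simp
  | succ k ih =>
    have h1 : θ + ((k + 1 : ℕ) : ℝ) * P = (θ + k * P) + P := by
      push_cast
      ring
    have h2 : C.U P * Q = Q * B.matrix := hT.adapted.2
    rw [h1, C.U_add_period, Matrix.mul_assoc, h2, ← Matrix.mul_assoc, ih, pow_succ,
      Matrix.mul_assoc, Matrix.mul_assoc]

lemma shear_mem {q : Model d} (hq : q ∈ box (P := P) B δ) :
    (C.shear Q q).1 ∈ Metric.ball (0 : EuclideanSpace ℝ (Fin d)) C.r :=
  (hT.subset (shear_mem_liftedTube hT.radius_pos hq)).1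

lemma flowBox_mem_tube {q : Model d} (hq : q ∈ box (P := P) B δ) :
    C.flowBox Q q ∈ C.tube B Q δ :=
  ⟨_, shear_mem_liftedTube hT.radius_pos hq, rfl⟩

lemma exists_flowBox_eq {m : M} (hm : m ∈ C.tube B Q δ) :
    ∃ q ∈ box (P := P) B δ, C.flowBox Q q = m := by
  obtain ⟨q, hq, rfl⟩ := hm
  obtain ⟨q', hq', rfl⟩ := exists_shear_eq hT.radius_pos hq
  exact ⟨q', hq', rfl⟩

lemma isLocalDiffeomorphOn_flowBox :
    IsLocalDiffeomorphOn 𝓘(ℝ, Model d) 𝓘(ℝ, Model d) ∞ (C.flowBox Q) (box (P := P) B δ) :=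
  fun q => IsLocalDiffeomorphAt.comp (hf := isLocalDiffeomorph_shear hT.adapted.1 q.1)
    (hg := C.smooth ⟨C.shear Q q.1, hT.shear_mem q.2, mem_univ _⟩)

/-- Points of the lifted tube with the same image differ by a power of the return map. -/
lemma flowBox_eq {q q' : Model d} (hq : q ∈ box (P := P) B δ) (hq' : q' ∈ box (P := P) B δ)
    (h : C.flowBox Q q = C.flowBox Q q') :
    ∃ k : ℕ, (q'.2 = q.2 + k * P ∧ q.1 = act (B.matrix ^ k) q'.1) ∨
      (q.2 = q'.2 + k * P ∧ q'.1 = act (B.matrix ^ k) q.1) := by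
  have hinj : ∀ {θ : ℝ} {x y : EuclideanSpace ℝ (Fin d)}, act (C.U θ * Q) x = act (C.U θ * Q) y →
      x = y := by
    intro θ x y hxy
    have h1 := congrArg (act (C.U θ * Q)⁻¹) hxy
    simpa only [← act_mul, Matrix.nonsing_inv_mul _ (isUnit_det_U_mul hT.adapted.1 θ), act_one]
      using h1
  have key : ∀ {q q' : Model d} (k : ℕ), (C.shear Q q).1 = (C.shear Q q').1 →
      q'.2 = q.2 + k * P → q.1 = act (B.matrix ^ k) q'.1 := by
    intro q q' k h1 h2
    apply hinj (θ := q.2)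
    rw [← act_mul, ← hT.U_mul_add_period, ← h2]
    exact h1
  obtain ⟨h1, k, hk⟩ := C.injective _ (hT.shear_mem hq) _ (hT.shear_mem hq') _ _ h
  change q'.2 = q.2 + k * P at hk
  obtain ⟨n, rfl | rfl⟩ := k.eq_nat_or_neg
  · exact ⟨n, .inl ⟨by simpa using hk, key n h1 (by simpa using hk)⟩⟩
  · have hk' : q.2 = q'.2 + n * P := by
      rw [hk]
      push_cast
      ring
    exact ⟨n, .inr ⟨hk', key n h1.symm hk'⟩⟩

omit hT in
lemma stableSq_act_pow (hP : P ≠ 0) (k : ℕ) (x : EuclideanSpace ℝ (Fin d)) (θ : ℝ) :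
    B.stableSq P (act (B.matrix ^ k) x, θ) = B.stableSq P (x, θ + k * P) := by
  induction k generalizing θ with
  | zero => simp [act_one]
  | succ k ih =>
    rw [pow_succ', act_mul, B.stableSq_act_matrix hP, ih]
    congr 2
    push_cast
    ring

omit hT in
lemma unstableSq_act_pow (hP : P ≠ 0) (k : ℕ) (x : EuclideanSpace ℝ (Fin d)) (θ : ℝ) :
    B.unstableSq P (act (B.matrix ^ k) x, θ) = B.unstableSq P (x, θ + k * P) := by
  induction k generalizing θ with
  | zero => simp [act_one]
  | succ k ih =>
    rw [pow_succ', act_mul, B.unstableSq_act_matrix hP, ih]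
    congr 2
    push_cast
    ring

lemma stableSq_eq_of_flowBox_eq {q q' : Model d} (hq : q ∈ box (P := P) B δ)
    (hq' : q' ∈ box (P := P) B δ) (h : C.flowBox Q q = C.flowBox Q q') :
    B.stableSq P q = B.stableSq P q' ∧ B.unstableSq P q = B.unstableSq P q' := by
  have hP := hT.period_pos.ne'
  obtain ⟨k, ⟨h1, h2⟩ | ⟨h1, h2⟩⟩ := hT.flowBox_eq hq hq' h
  · have e : q = (act (B.matrix ^ k) q'.1, q.2) := Prod.ext h2 rfl
    rw [e, stableSq_act_pow hP, unstableSq_act_pow hP, ← h1]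
    exact ⟨rfl, rfl⟩
  · have e : q' = (act (B.matrix ^ k) q.1, q'.2) := Prod.ext h2 rfl
    rw [e, stableSq_act_pow hP, unstableSq_act_pow hP, ← h1]
    exact ⟨rfl, rfl⟩

/-- Derivative of the curves `θ ↦ flowBox (ζ, θ)`. -/
lemma mfderiv_flowBox {q : Model d} (hq : q ∈ box (P := P) B δ) :
    mfderiv 𝓘(ℝ, Model d) 𝓘(ℝ, Model d) (C.flowBox Q) q ((0, 1) : Model d) =
      V (C.flowBox Q q) := by
  have h1 : MDifferentiableAt 𝓘(ℝ, Model d) 𝓘(ℝ, Model d) C.h (C.shear Q q) :=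
    (C.smooth ⟨C.shear Q q, hT.shear_mem hq, mem_univ _⟩).mdifferentiableAt (by simp)
  have h2 : DifferentiableAt ℝ (C.shear Q) q := (C.contDiff_shear Q).differentiable (by simp) q
  have h3 : fderiv ℝ (C.shear Q) q (0, 1) = (act (C.A q.2) (C.shear Q q).1, 1) := by
    have hline : HasDerivAt (fun s : ℝ => q + s • ((0, 1) : Model d)) (0, 1) 0 := by
      simpa using ((hasDerivAt_id (0 : ℝ)).smul_const ((0, 1) : Model d)).const_add q
    have hcomp : HasDerivAt (fun s : ℝ => C.shear Q (q + s • ((0, 1) : Model d)))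
        (fderiv ℝ (C.shear Q) q (0, 1)) 0 := by
      have h2' : HasFDerivAt (C.shear Q) (fderiv ℝ (C.shear Q) q) (q + (0 : ℝ) • ((0, 1) : Model d)) := by
        simpa using h2.hasFDerivAt
      exact h2'.comp_hasDerivAt (0 : ℝ) hline
    have hdir : HasDerivAt (fun s : ℝ => C.shear Q (q + s • ((0, 1) : Model d)))
        (act (C.A q.2) (C.shear Q q).1, 1) 0 := by
      have e : (fun s : ℝ => C.shear Q (q + s • ((0, 1) : Model d))) =
          fun s => (act (C.U (q.2 + s) * Q) q.1, q.2 + s) := by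
        funext s
        simp [shear]
      rw [e]
      refine HasDerivAt.prodMk ?_ (by simpa using (hasDerivAt_id (0 : ℝ)).const_add q.2)
      have h4 := C.hasDerivAt_U_mulVec (Q *ᵥ q.1.ofLp) q.2
      have h5 : HasDerivAt (fun s => C.U (q.2 + s) *ᵥ (Q *ᵥ q.1.ofLp))
          (C.A q.2 *ᵥ (C.U q.2 *ᵥ (Q *ᵥ q.1.ofLp))) 0 := by
        have h4' : HasDerivAt (fun s => C.U s *ᵥ (Q *ᵥ q.1.ofLp))
          (C.A q.2 *ᵥ (C.U q.2 *ᵥ (Q *ᵥ q.1.ofLp))) (q.2 + 0) := by simpa using h4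
        exact h4'.comp_const_add q.2 0
      have h6 := (PiLp.continuousLinearEquiv 2 ℝ (fun _ : Fin d => ℝ)).symm.hasFDerivAt.comp_hasDerivAt
        (0 : ℝ) h5
      simp only [act, shear, ← Matrix.mulVec_mulVec]
      exact h6
    exact hcomp.unique hdir
  have h4 : mfderiv 𝓘(ℝ, Model d) 𝓘(ℝ, Model d) (C.flowBox Q) q =
      (mfderiv 𝓘(ℝ, Model d) 𝓘(ℝ, Model d) C.h (C.shear Q q)).comp
        (mfderiv 𝓘(ℝ, Model d) 𝓘(ℝ, Model d) (C.shear Q) q) :=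
    mfderiv_comp q h1 h2.mdifferentiableAt
  rw [h4, mfderiv_eq_fderiv]
  show mfderiv 𝓘(ℝ, Model d) 𝓘(ℝ, Model d) C.h (C.shear Q q) (fderiv ℝ (C.shear Q) q (0, 1)) = _
  rw [h3]
  exact (C.conj _ (hT.shear_mem hq) _).symm

variable [IsManifold 𝓘(ℝ, Model d) ∞ M]

/-- The flow-box charts. -/
lemma exists_flowBox_chart (a : ℝ) : ∃ κ : SmoothChart d M,
    κ.1.target = box (P := P) B δ ∩ {q | |q.2 - a| < P / 2} ∧
      ∀ q, κ.1.symm q = C.flowBox Q q := by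
  refine exists_chart ((isOpen_box B δ).inter
    (isOpen_lt ((continuous_snd.sub continuous_const).abs) continuous_const))
    (fun q => hT.isLocalDiffeomorphOn_flowBox ⟨q.1, q.2.1⟩) ?_
  rintro q ⟨hq, hqa⟩ q' ⟨hq', hqa'⟩ h
  change |q.2 - a| < P / 2 at hqa
  change |q'.2 - a| < P / 2 at hqa'
  have hP := hT.period_pos
  have h0 : ∀ k : ℕ, (k : ℝ) * P < P → k = 0 := by
    intro k hk
    by_contra hne
    have : (1 : ℝ) ≤ k := mod_cast Nat.one_le_iff_ne_zero.2 hne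
    nlinarith
  rw [abs_lt] at hqa hqa'
  obtain ⟨k, ⟨h1, h2⟩ | ⟨h1, h2⟩⟩ := hT.flowBox_eq hq hq' h
  · obtain rfl := h0 k (by linarith)
    exact Prod.ext (by simpa [act_one] using h2) (by simpa using h1.symm)
  · obtain rfl := h0 k (by linarith)
    exact Prod.ext (by simpa [act_one] using h2.symm) (by simpa using h1)

/-- The chosen flow-box chart on the slab of width `P` around `a`. -/
def chart (a : ℝ) : SmoothChart d M := (hT.exists_flowBox_chart a).choose

lemma chart_target (a : ℝ) :
    (hT.chart a).1.target = box (P := P) B δ ∩ {q | |q.2 - a| < P / 2} :=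
  (hT.exists_flowBox_chart a).choose_spec.1

lemma chart_symm (a : ℝ) (q : Model d) : (hT.chart a).1.symm q = C.flowBox Q q :=
  (hT.exists_flowBox_chart a).choose_spec.2 q

lemma mem_chart_target {a : ℝ} {q : Model d} :
    q ∈ (hT.chart a).1.target ↔ q ∈ box (P := P) B δ ∧ |q.2 - a| < P / 2 := by
  rw [chart_target]
  rfl

lemma chart_flowBox {a : ℝ} {q : Model d} (hq : q ∈ (hT.chart a).1.target) :
    (hT.chart a).1 (C.flowBox Q q) = q := by
  rw [← hT.chart_symm a]
  exact (hT.chart a).1.right_inv hq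

lemma mem_chart_source {a : ℝ} {q : Model d} (hq : q ∈ (hT.chart a).1.target) :
    C.flowBox Q q ∈ (hT.chart a).1.source := by
  rw [← hT.chart_symm a]
  exact (hT.chart a).1.map_target hq

lemma imageOf_tube (a : ℝ) : (hT.chart a).imageOf (C.tube B Q δ) = (hT.chart a).1.target := by
  refine inter_eq_left.2 fun q hq => ?_
  rw [mem_preimage, chart_symm]
  exact hT.flowBox_mem_tube ((hT.mem_chart_target).1 hq).1

lemma mfderiv_chart_comp {a : ℝ} {q : Model d} (hq : q ∈ (hT.chart a).1.target) :
    (mfderiv 𝓘(ℝ, Model d) 𝓘(ℝ, Model d) (hT.chart a).1 (C.flowBox Q q)).comp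
      (mfderiv 𝓘(ℝ, Model d) 𝓘(ℝ, Model d) (C.flowBox Q) q) = ContinuousLinearMap.id ℝ (Model d) := by
  have h1 : MDifferentiableAt 𝓘(ℝ, Model d) 𝓘(ℝ, Model d) (C.flowBox Q) q :=
    (hT.isLocalDiffeomorphOn_flowBox ⟨q, ((hT.mem_chart_target).1 hq).1⟩).mdifferentiableAt (by simp)
  have h2 : MDifferentiableAt 𝓘(ℝ, Model d) 𝓘(ℝ, Model d) (hT.chart a).1 (C.flowBox Q q) :=
    (contMDiffAt_of_mem_maximalAtlas (hT.chart a).2 (hT.mem_chart_source hq)).mdifferentiableAt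
      (by simp)
  rw [← mfderiv_comp q h2 h1]
  have h3 : ((hT.chart a).1 ∘ C.flowBox Q) =ᶠ[𝓝 q] id := by
    filter_upwards [(hT.chart a).1.open_target.mem_nhds hq] with z hz
    exact hT.chart_flowBox hz
  rw [h3.mfderiv_eq]
  exact mfderiv_id

/-- In the flow-box charts the vector field is `∂_θ`. -/
lemma fieldInChart_chart {a : ℝ} {q : Model d} (hq : q ∈ (hT.chart a).1.target) :
    fieldInChart V (hT.chart a) q = (0, 1) := by
  rw [fieldInChart, chart_symm, ← hT.mfderiv_flowBox ((hT.mem_chart_target).1 hq).1]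
  exact congrArg (fun L : Model d →L[ℝ] Model d => L (0, 1)) (hT.mfderiv_chart_comp hq)

end IsTube

end LinearizingChart


/-! ### The unstable manifold of the closed orbit -/

namespace LinearizingChart.IsTube

variable {d : ℕ} {M : Type*} [TopologicalSpace M] [ChartedSpace (Model d) M]
  {V : ∀ x : M, TangentSpace 𝓘(ℝ, Model d) x} {Λ : Set M} {P : ℝ}
  {C : LinearizingChart V Λ P} {B : Blocks d} {Q : Matrix (Fin d) (Fin d) ℝ} {δ : ℝ}
  (hT : C.IsTube B Q δ)
include hT

lemma isOpen_image_flowBox {O : Set (Model d)} (hO : IsOpen O) (hO' : O ⊆ box (P := P) B δ) :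
    IsOpen (C.flowBox Q '' O) := by
  rw [isOpen_iff_mem_nhds]
  rintro _ ⟨q, hq, rfl⟩
  rw [← hT.isLocalDiffeomorphOn_flowBox.isLocalHomeomorphOn.map_nhds_eq (hO' hq)]
  exact image_mem_map (hO.mem_nhds hq)

lemma continuousAt_flowBox {q : Model d} (hq : q ∈ box (P := P) B δ) :
    ContinuousAt (C.flowBox Q) q :=
  hT.isLocalDiffeomorphOn_flowBox.isLocalHomeomorphOn.continuousAt hq

omit hT in
lemma box_mono {δ' : ℝ} (h0 : 0 ≤ δ') (h : δ' ≤ δ) : box (P := P) B δ' ⊆ box (P := P) B δ :=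
  fun _ hq => lt_of_lt_of_le hq (pow_le_pow_left₀ h0 h 2)

omit hT in
lemma zero_mem_box (hδ : 0 < δ) (θ : ℝ) : ((0, θ) : Model d) ∈ box (P := P) B δ := by
  show B.stableSq P _ + B.unstableSq P _ < δ ^ 2
  simpa [Blocks.stableSq, Blocks.unstableSq] using pow_pos hδ 2

variable [T2Space M] [IsManifold 𝓘(ℝ, Model d) ∞ M]
  (hV : ContMDiff 𝓘(ℝ, Model d) 𝓘(ℝ, Model d).tangent ∞
    fun x => (⟨x, V x⟩ : TangentBundle 𝓘(ℝ, Model d) M))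
  {φ : Flow ℝ M} (hφ : ∀ x : M, IsMIntegralCurve (fun t : ℝ => φ t x) V)
include hV hφ

/-- The flow is the translation of `θ` in the flow-box coordinates. -/
lemma flow_flowBox {z : EuclideanSpace ℝ (Fin d)} {a b θ s : ℝ}
    (h : ∀ s ∈ Ioo a b, (z, s) ∈ box (P := P) B δ) (hθ : θ ∈ Ioo a b) (hs : s ∈ Ioo a b) :
    φ (s - θ) (C.flowBox Q (z, θ)) = C.flowBox Q (z, s) := by
  have : IsManifold 𝓘(ℝ, Model d) 1 M := IsManifold.of_le (n := ∞) (by simp)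
  have h1 : IsMIntegralCurveOn (fun s => C.flowBox Q (z, s)) V (Ioo a b) := by
    intro s hs
    have hq := h s hs
    have h2 : HasMFDerivAt 𝓘(ℝ, Model d) 𝓘(ℝ, Model d) (C.flowBox Q) (z, s)
        (mfderiv 𝓘(ℝ, Model d) 𝓘(ℝ, Model d) (C.flowBox Q) (z, s)) :=
      ((hT.isLocalDiffeomorphOn_flowBox ⟨_, hq⟩).mdifferentiableAt (by simp)).hasMFDerivAt
    have h3 : HasFDerivAt (fun s : ℝ => ((z, s) : Model d))
        (ContinuousLinearMap.inr ℝ (EuclideanSpace ℝ (Fin d)) ℝ) s := hasFDerivAt_prodMk_right z s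
    have h4 := (h2.comp s h3.hasMFDerivAt).hasMFDerivWithinAt (s := Ioo a b)
    refine h4.congr_mfderiv ?_
    ext
    show mfderiv 𝓘(ℝ, Model d) 𝓘(ℝ, Model d) (C.flowBox Q) (z, s) ((0, 1) : Model d) =
      (1 : ℝ) • V (C.flowBox Q (z, s))
    rw [hT.mfderiv_flowBox hq, one_smul]
  have h2 : IsMIntegralCurveOn (fun s => φ (s - θ) (C.flowBox Q (z, θ))) V (Ioo a b) := by
    have := (hφ (C.flowBox Q (z, θ))).comp_add (-θ)
    exact this.isMIntegralCurveOn _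
  refine isMIntegralCurveOn_Ioo_eqOn_of_contMDiff_boundaryless hθ (hV.of_le (by simp)) h2 h1 ?_ hs
  simp

lemma exists_eq_flowBox_zero (hΛ : IsClosedOrbit φ Λ P) {m : M} (hm : m ∈ Λ) :
    ∃ θ, m = C.flowBox Q (0, θ) := by
  obtain ⟨-, x₀, -, -, rfl⟩ := hΛ
  obtain ⟨s, hs⟩ := C.center
  obtain ⟨t, rfl⟩ := hm
  have h0 : C.flowBox Q (0, 0) = C.h (0, 0) := by
    simp [flowBox, shear, act_zero_right]
  refine ⟨t - s, ?_⟩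
  have h1 := hT.flow_flowBox hV hφ (z := 0) (a := -(|t - s| + 1)) (b := |t - s| + 1) (θ := 0)
    (s := t - s) (fun s _ => zero_mem_box hT.radius_pos s)
    ⟨by linarith [abs_nonneg (t - s)], by linarith [abs_nonneg (t - s)]⟩
    ⟨by linarith [neg_abs_le (t - s)], by linarith [le_abs_self (t - s)]⟩
  rw [← h1, h0, ← hs, sub_zero]
  show φ t x₀ = φ (t - s) (φ s x₀)
  rw [← φ.map_add, sub_add_cancel]

/-- A point of the tube whose backward orbit stays in a smaller tube has no stable component. -/
lemma mem_unstable_of_trapped {δ' : ℝ} (h0 : 0 < δ') (hδ' : δ' < δ) {q : Model d}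
    (h : ∀ t ≥ 0, φ (-t) (C.flowBox Q q) ∈ C.flowBox Q '' box (P := P) B δ')
    (hq : q ∈ box (P := P) B δ') : q.1 ∈ B.splitting.unstable := by
  let N : ℝ → ℝ := fun t => B.stableSq P (q.1, q.2 - t) + B.unstableSq P (q.1, q.2 - t)
  have hN : Continuous N := by
    have h1 := (B.contDiff_stableSq P).continuous
    have h2 := (B.contDiff_unstableSq P).continuous
    fun_prop
  have hsq : δ' ^ 2 < δ ^ 2 := pow_lt_pow_left₀ hδ' h0.le two_ne_zero
  have hN0 : N 0 < δ' ^ 2 := by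
    simp only [N, sub_zero]
    exact hq
  -- at the first exit time `t` the orbit still lies in the larger tube, on which the coordinates are
  -- injective up to the deck transformation, so that `hT.stableSq_eq_of_flowBox_eq` compares it with
  -- the point of the smaller tube given by `h`
  have key : ∀ t ≥ 0, N t < δ' ^ 2 := by
    by_contra hcon
    push Not at hcon
    obtain ⟨t₁, ht₁, hNt₁⟩ := hcon
    have hS : IsCompact (Icc 0 t₁ ∩ {t | δ' ^ 2 ≤ N t}) :=
      isCompact_Icc.inter_right (isClosed_le continuous_const hN)
    obtain ⟨t, ⟨⟨ht, htt₁⟩, hNt⟩, hmin⟩ := hS.exists_isLeast ⟨t₁, ⟨ht₁, le_rfl⟩, hNt₁⟩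
    change δ' ^ 2 ≤ N t at hNt
    have hlt : ∀ s, 0 ≤ s → s < t → N s < δ' ^ 2 := by
      intro s hs hst
      by_contra hc
      exact absurd (hmin ⟨⟨hs, hst.le.trans htt₁⟩, not_lt.1 hc⟩) (not_le.2 hst)
    have hNt' : N t = δ' ^ 2 := by
      obtain ⟨s, hs, hNs⟩ := intermediate_value_Icc ht hN.continuousOn ⟨hN0.le, hNt⟩
      have : t ≤ s := hmin ⟨⟨hs.1, hs.2.trans htt₁⟩, hNs.ge⟩
      rw [le_antisymm this hs.2, hNs]
    have hopen : IsOpen {s | N s < δ ^ 2} := isOpen_lt hN continuous_const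
    obtain ⟨ε, hε, hεt⟩ := Metric.isOpen_iff.1 hopen t (by
      show N t < _
      rw [hNt']
      exact hsq)
    obtain ⟨ε', hε', hε'0⟩ := Metric.isOpen_iff.1 hopen 0 (hN0.trans hsq)
    have hbox : ∀ s ∈ Ioo (q.2 - t - ε) (q.2 + ε'), (q.1, s) ∈ box (P := P) B δ := by
      intro s hs
      have hNs : N (q.2 - s) < δ ^ 2 := by
        rcases lt_or_ge (q.2 - s) 0 with h1 | h1
        · refine hε'0 ?_
          rw [Metric.mem_ball, Real.dist_eq, abs_lt]
          constructor <;> linarith [hs.2]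
        rcases lt_or_ge (q.2 - s) t with h2 | h2
        · exact (hlt _ h1 h2).trans hsq
        · refine hεt ?_
          rw [Metric.mem_ball, Real.dist_eq, abs_lt]
          constructor <;> linarith [hs.1]
      show B.stableSq P (q.1, s) + B.unstableSq P (q.1, s) < δ ^ 2
      simpa [N] using hNs
    have h1 := hT.flow_flowBox hV hφ hbox (θ := q.2) (s := q.2 - t)
      ⟨by linarith, by linarith⟩ ⟨by linarith, by linarith⟩
    rw [show q.2 - t - q.2 = -t by ring] at h1
    obtain ⟨q', hq', h2⟩ := h t ht
    have h3 : C.flowBox Q q' = C.flowBox Q (q.1, q.2 - t) := h2.trans h1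
    have h4 := hT.stableSq_eq_of_flowBox_eq (box_mono h0.le hδ'.le hq')
      (hbox _ ⟨by linarith, by linarith⟩) h3
    have h5 : N t < δ' ^ 2 := by
      simp only [N]
      rw [← h4.1, ← h4.2]
      exact hq'
    exact absurd h5 (not_lt.2 hNt)
  -- a stable component would be unbounded in backward time
  exact B.mem_unstable_of_bounded hT.period_pos (θ := q.2) (c := δ' ^ 2) fun t ht =>
    (le_add_of_nonneg_right (B.unstableSq_nonneg P _)).trans (key t ht).le

/-- The unstable manifold is a countable union of images of pieces of the local unstable
manifold. -/
lemma exists_flow_eq (hΛ : IsClosedOrbit φ Λ P) {m : M} (hm : m ∈ unstableManifold φ Λ) :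
    ∃ n : ℕ, ∃ q ∈ box (P := P) B (δ / 2), q.1 ∈ B.splitting.unstable ∧
      φ n (C.flowBox Q q) = m := by
  have hδ := hT.radius_pos
  have hsub : box (P := P) B (δ / 2) ⊆ box (P := P) B δ := box_mono (by linarith) (by linarith)
  have hopen := hT.isOpen_image_flowBox (isOpen_box (P := P) B (δ / 2)) hsub
  have hΛ' : Λ ⊆ C.flowBox Q '' box (P := P) B (δ / 2) := by
    intro x hx
    obtain ⟨θ, rfl⟩ := hT.exists_eq_flowBox_zero hV hφ hΛ hx
    exact ⟨_, zero_mem_box (by linarith) θ, rfl⟩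
  have hev : ∀ᶠ t : ℝ in atTop, φ (-t) m ∈ C.flowBox Q '' box (P := P) B (δ / 2) :=
    hm.eventually (hopen.mem_nhdsSet.2 hΛ')
  obtain ⟨T, hT'⟩ := eventually_atTop.1 hev
  obtain ⟨n, hn⟩ := exists_nat_ge T
  obtain ⟨q, hq, hqm⟩ := hT' n hn
  refine ⟨n, q, hq, hT.mem_unstable_of_trapped hV hφ (δ' := δ / 2) (by linarith) (by linarith)
    (fun t ht => ?_) hq, ?_⟩
  · rw [hqm, ← φ.map_add, ← neg_add]
    exact hT' _ (by linarith)
  · rw [hqm, ← φ.map_add, add_neg_cancel, φ.map_zero_apply]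

omit hV hφ [T2Space M] in
/-- The local unstable manifold has empty interior as soon as there is a stable direction. -/
lemma exists_notMem_unstable {q : Model d} (hq : q ∈ box (P := P) B δ)
    (k : Label B.ls B.ps) (hqu : q.1 ∈ B.splitting.unstable) {O : Set M} (hO : IsOpen O)
    (hqO : C.flowBox Q q ∈ O) :
    ∃ q' ∈ box (P := P) B δ, q'.1 ∉ B.splitting.unstable ∧ C.flowBox Q q' ∈ O := by
  let γ : ℝ → Model d := fun s => (q.1 + s • B.unitVec (.inl k), q.2)
  have hγ : Continuous γ := by fun_prop
  have hγ0 : γ 0 = q := by simp [γ]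
  have h1 : ∀ᶠ s in 𝓝 (0 : ℝ), γ s ∈ box (P := P) B δ :=
    hγ.continuousAt.eventually ((isOpen_box B δ).mem_nhds (by rwa [hγ0]))
  have h2 : ∀ᶠ s in 𝓝 (0 : ℝ), C.flowBox Q (γ s) ∈ O := by
    have : ContinuousAt (fun s => C.flowBox Q (γ s)) 0 :=
      ContinuousAt.comp (g := C.flowBox Q) (f := γ) (x := 0)
        (by rw [hγ0]; exact hT.continuousAt_flowBox hq) hγ.continuousAt
    exact this.eventually (hO.mem_nhds (by show C.flowBox Q (γ 0) ∈ O; rwa [hγ0]))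
  obtain ⟨s, ⟨hs1, hs2⟩, hs0⟩ :=
    (((h1.and h2).filter_mono nhdsWithin_le_nhds).and
      (self_mem_nhdsWithin : ∀ᶠ s in 𝓝[≠] (0 : ℝ), s ∈ ({0} : Set ℝ)ᶜ)).exists
  refine ⟨γ s, hs1, fun h => hs0 ?_, hs2⟩
  have h3 := B.mem_unstable_iff.1 h k
  have h4 := B.mem_unstable_iff.1 hqu k
  simp only [γ] at h3
  simpa [h4, Blocks.unitVec] using h3

omit hT hV hφ [T2Space M] [IsManifold 𝓘(ℝ, Model d) ∞ M] in
lemma act_flowMatrix_mem_unstable {z : EuclideanSpace ℝ (Fin d)} (hz : z ∈ B.splitting.unstable)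
    (θ : ℝ) : act (B.flowMatrix P θ) z ∈ B.splitting.unstable := by
  rw [B.mem_unstable_iff] at hz ⊢
  intro k
  rw [Blocks.flowMatrix, Blocks.act_full_inl]
  simp [hz, Matrix.mulVec, dotProduct]

/-- Near a point of the tube with a stable component there are points outside of the unstable
manifold, by the Baire theorem. -/
lemma exists_notMem_unstableManifold [CompactSpace M] (hΛ : IsClosedOrbit φ Λ P) {q : Model d}
    (hq : q ∈ box (P := P) B δ) (hqu : q.1 ∉ B.splitting.unstable) {O : Set (Model d)}
    (hO : IsOpen O) (hqO : q ∈ O) :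
    ∃ q' ∈ O ∩ box (P := P) B δ, C.flowBox Q q' ∉ unstableManifold φ Λ := by
  have hδ := hT.radius_pos
  obtain ⟨k, -⟩ : ∃ k, q.1 (B.numbering (.inl k)) ≠ 0 := by
    rw [B.mem_unstable_iff] at hqu
    push Not at hqu
    exact hqu
  -- The compact sets `K j` are pieces of the local unstable manifold, described by the linear flow
  -- `g`. They have empty interior, and the unstable manifold is contained in the union of their
  -- images under the times `n` of the flow.
  let S : ℕ → Set (Model d) := fun j =>
    (Metric.closedBall 0 (δ / 2) ∩ {z | ∀ k, z (B.numbering (.inl k)) = 0}) ×ˢ Icc (-(j : ℝ)) j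
  let g : Model d → Model d := fun p => (act (B.flowMatrix P (-p.2)) p.1, p.2)
  have hS : ∀ j, IsCompact (S j) := fun j => by
    refine IsCompact.prod ((isCompact_closedBall _ _).inter_right ?_) isCompact_Icc
    simp only [ofPred_forall]
    refine isClosed_iInter fun k => isClosed_eq ?_ continuous_const
    fun_prop
  have hg : Continuous g := by
    refine (contDiff_act_family (N := fun θ => B.flowMatrix P (-θ)) fun i j => ?_).continuous
    have h1 : ContDiff ℝ ∞ fun θ => B.flowMatrix P θ i j := by
      rw [contDiff_infty]
      intro n
      induction n generalizing i j with
      | zero => exact contDiff_zero.2 (continuous_iff_continuousAt.2 fun θ =>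
          (B.hasDerivAt_flowMatrix P θ i j).continuousAt)
      | succ n ih =>
        have h1 : deriv (fun θ => B.flowMatrix P θ i j) =
            fun θ => ∑ k, B.generator P i k * B.flowMatrix P θ k j :=
          funext fun θ => (B.hasDerivAt_flowMatrix P θ i j).deriv
        refine (contDiff_succ_iff_deriv (n := n)).2
          ⟨fun θ => (B.hasDerivAt_flowMatrix P θ i j).differentiableAt, by simp, ?_⟩
        rw [h1]
        exact ContDiff.sum fun k _ => contDiff_const.mul (ih k j)
    exact h1.comp contDiff_neg
  have hgS : ∀ j, ∀ p ∈ S j, g p ∈ box (P := P) B δ ∧ (g p).1 ∈ B.splitting.unstable := by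
    rintro j p ⟨⟨hp, hp'⟩, -⟩
    refine ⟨(mem_box_iff hδ).2 ?_, act_flowMatrix_mem_unstable (B.mem_unstable_iff.2 hp') _⟩
    simp only [g, act_flowMatrix_neg']
    have := mem_closedBall_zero_iff.1 hp
    linarith
  let K : ℕ → Set M := fun j => C.flowBox Q '' (g '' S j)
  have hK : ∀ j, IsCompact (K j) := fun j => by
    refine ((hS j).image hg).image_of_continuousOn ?_
    rintro _ ⟨p, hp, rfl⟩
    exact (hT.continuousAt_flowBox (hgS j p hp).1).continuousWithinAt
  have hint : ∀ j, interior (K j) = ∅ := by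
    intro j
    by_contra hne
    obtain ⟨m, hm⟩ := nonempty_iff_ne_empty.2 hne
    obtain ⟨_, ⟨p, hp, rfl⟩, rfl⟩ := interior_subset hm
    obtain ⟨h1, h2⟩ := hgS j p hp
    obtain ⟨q', hq', hq'u, hq'm⟩ := hT.exists_notMem_unstable h1 k h2 isOpen_interior hm
    obtain ⟨_, ⟨p', hp', rfl⟩, h3⟩ := interior_subset hq'm
    obtain ⟨h4, h5⟩ := hgS j p' hp'
    have h6 := (hT.stableSq_eq_of_flowBox_eq h4 hq' h3).1
    rw [B.stableSq_eq_zero_iff.2 h5] at h6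
    exact hq'u (B.stableSq_eq_zero_iff.1 h6.symm)
  have hdense : Dense (⋂ nj : ℕ × ℕ, (φ.toHomeomorph (nj.1 : ℝ) '' K nj.2)ᶜ) := by
    refine dense_iInter_of_isOpen (fun nj => ?_) fun nj => ?_
    · exact (((hK nj.2).image (φ.toHomeomorph _).continuous).isClosed).isOpen_compl
    · rw [← interior_eq_empty_iff_dense_compl, ← Homeomorph.image_interior, hint, image_empty]
  have hO' : IsOpen (C.flowBox Q '' (O ∩ box (P := P) B δ)) :=
    hT.isOpen_image_flowBox (hO.inter (isOpen_box B δ)) inter_subset_right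
  obtain ⟨_, ⟨q', hq', rfl⟩, hm⟩ := hdense.inter_open_nonempty _ hO' ⟨_, q, ⟨hqO, hq⟩, rfl⟩
  refine ⟨q', hq', fun hu => ?_⟩
  obtain ⟨n, p, hp, hpu, hpm⟩ := hT.exists_flow_eq hV hφ hΛ hu
  obtain ⟨j, hj⟩ := exists_nat_ge |p.2|
  refine mem_iInter.1 hm (n, j) ⟨C.flowBox Q p, ⟨p, ⟨(act (B.flowMatrix P p.2) p.1, p.2), ?_, ?_⟩, rfl⟩,
    hpm⟩
  · refine ⟨⟨mem_closedBall_zero_iff.2 ((mem_box_iff (by linarith)).1 hp).le,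
      B.mem_unstable_iff.1 (act_flowMatrix_mem_unstable hpu _)⟩, abs_le.1 hj⟩
  · exact Prod.ext (act_flowMatrix_neg _ _) rfl

end LinearizingChart.IsTube


/-! ### Densities and vector fields under changes of coordinates -/

section Jacobian

variable {X : Type} [NormedAddCommGroup X] [NormedSpace ℝ X] [FiniteDimensional ℝ X]

lemma contDiff_clm_det : ContDiff ℝ ∞ fun L : X →L[ℝ] X => L.det := by
  let b := Module.finBasis ℝ X
  have h : (fun L : X →L[ℝ] X => L.det) =
      fun L : X →L[ℝ] X => (LinearMap.toMatrix b b (L : X →ₗ[ℝ] X)).det := by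
    funext L
    rw [LinearMap.det_toMatrix]
  rw [h]
  simp only [Matrix.det_apply]
  refine ContDiff.sum fun σ _ => ContDiff.const_smul _ (contDiff_prod fun i _ => ?_)
  let ℓ : (X →L[ℝ] X) →ₗ[ℝ] ℝ :=
    { toFun := fun L => LinearMap.toMatrix b b (L : X →ₗ[ℝ] X) (σ i) i
      map_add' := fun _ _ => by simp [LinearMap.toMatrix_apply]
      map_smul' := fun _ _ => by simp [LinearMap.toMatrix_apply] }
  exact (LinearMap.toContinuousLinearMap ℓ).contDiff

/-- The derivative of the determinant at the identity is the trace. -/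
lemma fderiv_clm_det_id (T : X →L[ℝ] X) :
    fderiv ℝ (fun L : X →L[ℝ] X => L.det) (ContinuousLinearMap.id ℝ X) T =
      LinearMap.trace ℝ X (T : X →ₗ[ℝ] X) := by
  let b := Module.finBasis ℝ X
  have h1 : HasDerivAt (fun s : ℝ => (ContinuousLinearMap.id ℝ X + s • T).det)
      (fderiv ℝ (fun L : X →L[ℝ] X => L.det) (ContinuousLinearMap.id ℝ X) T) 0 := by
    have hline : HasDerivAt (fun s : ℝ => ContinuousLinearMap.id ℝ X + s • T) T 0 := by
      simpa using ((hasDerivAt_id (0 : ℝ)).smul_const T).const_add (ContinuousLinearMap.id ℝ X)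
    have h2 : HasFDerivAt (fun L : X →L[ℝ] X => L.det)
        (fderiv ℝ (fun L : X →L[ℝ] X => L.det) (ContinuousLinearMap.id ℝ X))
        (ContinuousLinearMap.id ℝ X + (0 : ℝ) • T) := by
      simpa using (contDiff_clm_det.differentiable (by simp) (ContinuousLinearMap.id ℝ X)).hasFDerivAt
    exact h2.comp_hasDerivAt (0 : ℝ) hline
  let N := LinearMap.toMatrix b b (T : X →ₗ[ℝ] X)
  have h2 : (fun s : ℝ => (ContinuousLinearMap.id ℝ X + s • T).det) =
      fun s => 1 + N.trace * s + (Polynomial.eval s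
        (1 + (Polynomial.X : Polynomial ℝ) • N.map Polynomial.C).det.divX.divX) * s ^ 2 := by
    funext s
    rw [← Matrix.det_one_add_smul]
    show LinearMap.det _ = _
    rw [← LinearMap.det_toMatrix b]
    congr 1
    simp [N]
  rw [h2] at h1
  rw [LinearMap.trace_eq_matrix_trace ℝ b]
  refine h1.unique ?_
  have h3 : HasDerivAt (fun s : ℝ => 1 + N.trace * s) N.trace 0 := by
    simpa using ((hasDerivAt_id (0 : ℝ)).const_mul N.trace).const_add 1
  have h4 := (((1 + (Polynomial.X : Polynomial ℝ) • N.map Polynomial.C).det.divX.divX).hasDerivAt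
    (0 : ℝ)).mul (hasDerivAt_pow 2 (0 : ℝ))
  have h5 := h3.add h4
  simp only [ne_eq, OfNat.ofNat_ne_zero, not_false_eq_true, zero_pow, mul_zero, Nat.cast_ofNat,
    Nat.add_one_sub_one, pow_one, add_zero] at h5
  exact h5

/-- The formula of Jacobi for the derivative of a determinant. -/
lemma hasDerivAt_clm_det {Y : ℝ → X →L[ℝ] X} {T : X →L[ℝ] X} {s : ℝ}
    (hY : HasDerivAt Y (T.comp (Y s)) s) (h0 : (Y s).det ≠ 0) :
    HasDerivAt (fun s => (Y s).det) (LinearMap.trace ℝ X (T : X →ₗ[ℝ] X) * (Y s).det) s := by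
  let e := (Y s).toContinuousLinearEquivOfDetNeZero h0
  have he : (Y s).comp (e.symm : X →L[ℝ] X) = ContinuousLinearMap.id ℝ X := by
    ext x
    exact e.apply_symm_apply x
  have h1 : HasDerivAt (fun s => (Y s).comp (e.symm : X →L[ℝ] X)) T s := by
    have := hY.clm_comp (hasDerivAt_const s (e.symm : X →L[ℝ] X))
    simpa [ContinuousLinearMap.comp_assoc, he] using this
  have h2 : HasFDerivAt (fun L : X →L[ℝ] X => L.det)
      (fderiv ℝ (fun L : X →L[ℝ] X => L.det) (ContinuousLinearMap.id ℝ X))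
      ((Y s).comp (e.symm : X →L[ℝ] X)) := by
    rw [he]
    exact (contDiff_clm_det.differentiable (by simp) (ContinuousLinearMap.id ℝ X)).hasFDerivAt
  have h3 := (h2.comp_hasDerivAt s h1).mul_const (Y s).det
  rw [fderiv_clm_det_id] at h3
  refine h3.congr_of_eventuallyEq (.of_forall fun r => ?_)
  have h4 : ((e.symm : X →L[ℝ] X)).det * (Y s).det = 1 := by
    rw [mul_comm]
    have := congrArg ContinuousLinearMap.det he
    simpa [ContinuousLinearMap.det, LinearMap.det_comp] using this
  have h5 : ((Y r).comp (e.symm : X →L[ℝ] X)).det = (Y r).det * (e.symm : X →L[ℝ] X).det := by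
    simp only [ContinuousLinearMap.det, ContinuousLinearMap.toLinearMap_comp, LinearMap.det_comp]
  show (Y r).det = ((Y r).comp (e.symm : X →L[ℝ] X)).det * (Y s).det
  rw [h5, mul_assoc, h4, mul_one]

/-- The transpose of a vector field, acting on densities, is natural under changes of coordinates.
Here the vector field is constant in the source. -/
lemma fderiv_pullback {T b : X → X} {ψ : X → ℂ} {x e : X} (hT : ContDiffAt ℝ ∞ T x)
    (hb : DifferentiableAt ℝ b (T x)) (hψ : ContDiff ℝ ∞ ψ)
    (hTb : ∀ᶠ y in 𝓝 x, fderiv ℝ T y e = b (T y)) (h0 : (fderiv ℝ T x).det ≠ 0) :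
    fderiv ℝ (fun y => ((|(fderiv ℝ T y).det| : ℝ) : ℂ) * ψ (T y)) x e =
      ((|(fderiv ℝ T x).det| : ℝ) : ℂ) * (fderiv ℝ ψ (T x) (b (T x)) +
        ψ (T x) * ((LinearMap.trace ℝ X (fderiv ℝ b (T x)) : ℝ) : ℂ)) := by
  have hTd : DifferentiableAt ℝ T x := hT.differentiableAt (by simp)
  have hT1 : ContDiffAt ℝ ∞ (fderiv ℝ T) x := hT.fderiv_right (by simp)
  have hT1d : DifferentiableAt ℝ (fderiv ℝ T) x := hT1.differentiableAt (by simp)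
  have hline : HasDerivAt (fun s : ℝ => x + s • e) e 0 := by
    simpa using ((hasDerivAt_id (0 : ℝ)).smul_const e).const_add x
  have h2nd : fderiv ℝ (fderiv ℝ T) x e = (fderiv ℝ b (T x)).comp (fderiv ℝ T x) := by
    ext v
    have hs : IsSymmSndFDerivAt ℝ T x := hT.isSymmSndFDerivAt (by simp; exact ENat.LEInfty.out)
    rw [hs e v]
    have h1 : fderiv ℝ (fun y => fderiv ℝ T y e) x v = fderiv ℝ (fderiv ℝ T) x v e := by
      rw [fderiv_clm_apply hT1d (by fun_prop)]
      simp
    rw [← h1, EventuallyEq.fderiv_eq hTb]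
    exact congrArg (fun L : X →L[ℝ] X => L v) (fderiv_comp x hb hTd)
  have hY : HasDerivAt (fun s : ℝ => fderiv ℝ T (x + s • e))
      ((fderiv ℝ b (T x)).comp (fderiv ℝ T (x + (0 : ℝ) • e))) 0 := by
    rw [zero_smul, add_zero, ← h2nd]
    have : HasFDerivAt (fderiv ℝ T) (fderiv ℝ (fderiv ℝ T) x) (x + (0 : ℝ) • e) := by
      simpa using hT1d.hasFDerivAt
    exact this.comp_hasDerivAt (0 : ℝ) hline
  have hdet := hasDerivAt_clm_det hY (by simpa using h0)
  simp only [zero_smul, add_zero] at hdet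
  have habs := ((hasDerivAt_abs (x := (fderiv ℝ T (x + (0 : ℝ) • e)).det) (by simpa using h0)).comp
    (0 : ℝ) hdet).ofReal_comp
  have hψT : HasDerivAt (fun s : ℝ => ψ (T (x + s • e))) (fderiv ℝ ψ (T x) (b (T x))) 0 := by
    have h1 : HasFDerivAt (fun y => ψ (T y)) ((fderiv ℝ ψ (T x)).comp (fderiv ℝ T x))
        (x + (0 : ℝ) • e) := by
      rw [zero_smul, add_zero]
      exact (hψ.differentiable (by simp) (T x)).hasFDerivAt.comp x hTd.hasFDerivAt
    rw [← hTb.self_of_nhds]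
    exact HasFDerivAt.comp_hasDerivAt (l := fun y => ψ (T y)) (f := fun s : ℝ => x + s • e)
      (l' := (fderiv ℝ ψ (T x)).comp (fderiv ℝ T x)) (0 : ℝ) h1 hline
  have hmul := habs.mul hψT
  have hdiff : DifferentiableAt ℝ (fun y => ((|(fderiv ℝ T y).det| : ℝ) : ℂ) * ψ (T y)) x := by
    have h1 : DifferentiableAt ℝ (fun y => (fderiv ℝ T y).det) x :=
      (contDiff_clm_det.differentiable (by simp) _).comp x hT1d
    exact (Complex.ofRealCLM.differentiableAt.comp x (h1.abs h0)).mul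
      ((hψ.differentiable (by simp) _).comp x hTd)
  have hfull : HasDerivAt (fun s : ℝ => ((|(fderiv ℝ T (x + s • e)).det| : ℝ) : ℂ) *
      ψ (T (x + s • e))) (fderiv ℝ (fun y => ((|(fderiv ℝ T y).det| : ℝ) : ℂ) * ψ (T y)) x e) 0 := by
    have h1 : HasFDerivAt (fun y => ((|(fderiv ℝ T y).det| : ℝ) : ℂ) * ψ (T y))
        (fderiv ℝ (fun y => ((|(fderiv ℝ T y).det| : ℝ) : ℂ) * ψ (T y)) x) (x + (0 : ℝ) • e) := by
      simpa using hdiff.hasFDerivAt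
    exact h1.comp_hasDerivAt (0 : ℝ) hline
  rw [hfull.unique hmul]
  have hsgn : ∀ r : ℝ, (SignType.sign r : ℝ) * r = |r| := fun r => by
    rw [sign_mul_self]
  simp only [Function.comp_apply, zero_smul, add_zero]
  rw [mul_left_comm, hsgn]
  push_cast
  ring

/-- The pull-back of densities by a change of coordinates. -/
def pullOn (T : OpenPartialHomeomorph X X) (ψ : X → ℂ) : X → ℂ :=
  T.source.indicator fun x => ((|(fderiv ℝ T x).det| : ℝ) : ℂ) * ψ (T x)

variable {T : OpenPartialHomeomorph X X} (hT : ContDiffOn ℝ ∞ T T.source)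
  (hT' : ContDiffOn ℝ ∞ T.symm T.target)
include hT hT'

lemma det_fderiv_ne_zero {x : X} (hx : x ∈ T.source) : (fderiv ℝ T x).det ≠ 0 := by
  have h1 := ((hT x hx).contDiffAt (T.open_source.mem_nhds hx)).differentiableAt (by simp)
  have h2 := ((hT' (T x) (T.map_source hx)).contDiffAt
    (T.open_target.mem_nhds (T.map_source hx))).differentiableAt (by simp)
  have h3 : (fderiv ℝ T.symm (T x)).comp (fderiv ℝ T x) = ContinuousLinearMap.id ℝ X := by
    rw [← fderiv_comp x h2 h1, EventuallyEq.fderiv_eq (f₁ := T.symm ∘ T) (f := id)]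
    · exact fderiv_id
    · filter_upwards [T.open_source.mem_nhds hx] with y hy using T.left_inv hy
  have h4 := congrArg ContinuousLinearMap.det h3
  simp only [ContinuousLinearMap.det, ContinuousLinearMap.toLinearMap_comp, LinearMap.det_comp] at h4
  intro h
  rw [ContinuousLinearMap.det] at h
  simp [h] at h4

lemma IsTest.pullOn {ψ : X → ℂ} (hψ : IsTest T.target ψ) :
    IsTest (T.symm '' tsupport ψ) (ClosedOrbit.pullOn T ψ) := by
  have hK : IsCompact (T.symm '' tsupport ψ) :=
    hψ.2.1.isCompact.image_of_continuousOn (T.continuousOn_symm.mono hψ.2.2)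
  have hKs : T.symm '' tsupport ψ ⊆ T.source := by
    rintro _ ⟨y, hy, rfl⟩
    exact T.map_target (hψ.2.2 hy)
  refine IsTest.of_contDiffOn hK T.open_source hKs (fun x hx => ?_) fun x hx => ?_
  · have h1 := (hT x hx).contDiffAt (T.open_source.mem_nhds hx)
    have h2 : ContDiffAt ℝ ∞ (fun y => (fderiv ℝ T y).det) x :=
      contDiff_clm_det.contDiffAt.comp x (h1.fderiv_right (by simp))
    have h3 : ContDiffAt ℝ ∞ (fun y => ((|(fderiv ℝ T y).det| : ℝ) : ℂ) * ψ (T y)) x :=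
      (Complex.ofRealCLM.contDiff.contDiffAt.comp x (h2.abs (det_fderiv_ne_zero hT hT' hx))).mul
        (hψ.1.contDiffAt.comp x h1)
    refine (h3.congr_of_eventuallyEq ?_).contDiffWithinAt
    filter_upwards [T.open_source.mem_nhds hx] with y hy
    exact indicator_of_mem hy _
  · by_cases hxs : x ∈ T.source
    · rw [ClosedOrbit.pullOn, indicator_of_mem hxs, image_eq_zero_of_notMem_tsupport (f := ψ), mul_zero]
      exact fun h => hx ⟨T x, h, T.left_inv hxs⟩
    · exact indicator_of_notMem hxs _

omit hT hT' in
/-- The operator `transposeOp b lam` is local. -/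
lemma transposeOp_eq_zero {b : X → X} (lam : ℂ) {ψ : X → ℂ} {x : X} (hx : x ∉ tsupport ψ) :
    transposeOp b lam ψ x = 0 := by
  have h1 := image_eq_zero_of_notMem_tsupport hx
  have h2 : fderiv ℝ ψ x = 0 := image_eq_zero_of_notMem_tsupport fun h =>
    hx (tsupport_fderiv_subset ℝ h)
  simp [transposeOp, h1, h2]

omit hT hT' in
lemma IsTest.transposeOp {O : Set X} (hO : IsOpen O) {b : X → X} (hb : ContDiffOn ℝ ∞ b O)
    (lam : ℂ) {ψ : X → ℂ} (hψ : IsTest O ψ) :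
    IsTest (tsupport ψ) (ClosedOrbit.transposeOp b lam ψ) := by
  refine IsTest.of_contDiffOn hψ.2.1 hO hψ.2.2 ?_ fun x hx => transposeOp_eq_zero lam hx
  have h1 : ContDiffOn ℝ ∞ (fderiv ℝ ψ) O := (hψ.1.fderiv_right (by simp)).contDiffOn
  have h2 : ContDiffOn ℝ ∞ (fderiv ℝ b) O := hb.fderiv_of_isOpen hO (by simp)
  have h3 : ContDiffOn ℝ ∞ (fun x => LinearMap.trace ℝ X (fderiv ℝ b x : X →ₗ[ℝ] X)) O := by
    let ℓ : (X →L[ℝ] X) →ₗ[ℝ] ℝ :=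
      { toFun := fun L => LinearMap.trace ℝ X (L : X →ₗ[ℝ] X)
        map_add' := fun _ _ => by simp
        map_smul' := fun _ _ => by simp }
    exact (LinearMap.toContinuousLinearMap ℓ).contDiff.comp_contDiffOn h2
  exact (contDiffOn_const.mul hψ.1.contDiffOn).sub ((h1.clm_apply hb).add
    (hψ.1.contDiffOn.mul (Complex.ofRealCLM.contDiff.comp_contDiffOn h3)))

lemma contDiffOn_field {b : X → X} {e : X} (hb : ∀ x ∈ T.source, fderiv ℝ T x e = b (T x)) :
    ContDiffOn ℝ ∞ b T.target := by
  have h1 : ContDiffOn ℝ ∞ (fun x => fderiv ℝ T x e) T.source :=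
    (hT.fderiv_of_isOpen T.open_source (by simp)).clm_apply contDiffOn_const
  refine (h1.comp hT' fun y hy => T.map_target hy).congr fun y hy => ?_
  rw [Function.comp_apply, hb _ (T.map_target hy), T.right_inv hy]

lemma pullOn_transposeOp {b : X → X} {e : X} (hb : ∀ x ∈ T.source, fderiv ℝ T x e = b (T x))
    (lam : ℂ) {ψ : X → ℂ} (hψ : IsTest T.target ψ) :
    pullOn T (transposeOp b lam ψ) = fun x => lam * pullOn T ψ x - fderiv ℝ (pullOn T ψ) x e := by
  funext x
  by_cases hx : x ∈ T.source
  · have hev : pullOn T ψ =ᶠ[𝓝 x] fun y => ((|(fderiv ℝ T y).det| : ℝ) : ℂ) * ψ (T y) := by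
      filter_upwards [T.open_source.mem_nhds hx] with y hy using indicator_of_mem hy _
    rw [hev.fderiv_eq, hev.self_of_nhds, fderiv_pullback (e := e) (b := b)
      ((hT x hx).contDiffAt (T.open_source.mem_nhds hx)) _ hψ.1 _ (det_fderiv_ne_zero hT hT' hx)]
    · rw [pullOn, indicator_of_mem hx, transposeOp]
      ring
    · exact ((contDiffOn_field hT hT' hb _ (T.map_source hx)).contDiffAt
        (T.open_target.mem_nhds (T.map_source hx))).differentiableAt (by simp)
    · filter_upwards [T.open_source.mem_nhds hx] with y hy using hb y hy
  · have h1 : x ∉ tsupport (pullOn T ψ) := fun h => by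
      obtain ⟨y, hy, rfl⟩ := (hψ.pullOn hT hT').2.2 h
      exact hx (T.map_target (hψ.2.2 hy))
    have h2 : fderiv ℝ (pullOn T ψ) x = 0 := image_eq_zero_of_notMem_tsupport fun h =>
      h1 (tsupport_fderiv_subset ℝ h)
    rw [image_eq_zero_of_notMem_tsupport h1, h2, pullOn, indicator_of_notMem hx]
    simp

end Jacobian

section Manifold

variable {d : ℕ} {M : Type*} [TopologicalSpace M] [ChartedSpace (Model d) M]
  [IsManifold 𝓘(ℝ, Model d) ∞ M]

lemma contDiffOn_transition (κ κ' : SmoothChart d M) :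
    ContDiffOn ℝ ∞ (κ.1.symm.trans κ'.1) (κ.1.symm.trans κ'.1).source := by
  have h := (contDiffGroupoid ∞ 𝓘(ℝ, Model d)).compatible_of_mem_maximalAtlas κ.2 κ'.2
  rw [contDiffGroupoid, mem_groupoid_of_pregroupoid] at h
  simpa [contDiffPregroupoid] using h.1

lemma contDiffOn_transition_symm (κ κ' : SmoothChart d M) :
    ContDiffOn ℝ ∞ (κ.1.symm.trans κ'.1).symm (κ.1.symm.trans κ'.1).target := by
  have h := contDiffOn_transition κ' κ
  have h1 : (κ'.1.symm.trans κ.1) = (κ.1.symm.trans κ'.1).symm := by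
    rw [OpenPartialHomeomorph.trans_symm_eq_symm_trans_symm, OpenPartialHomeomorph.symm_symm]
  rwa [h1] at h

/-- The change of charts in `MDistr.compatible`, for a change of coordinates `τ` that is only known
where it is relevant. -/
lemma MDistr.pair_eq_of_transition (u : MDistr d M) (κ κ' : SmoothChart d M)
    {τ : Model d → Model d} {O : Set (Model d)} (hO : IsOpen O) (hOκ : O ⊆ κ.1.target)
    (hτ : ∀ x ∈ O, τ x ∈ κ'.1.target ∧ κ'.1.symm (τ x) = κ.1.symm x) {ψ : Model d → ℂ}
    (hψ : IsTest (τ '' O) ψ) (hψ' : ∀ x ∉ O, ψ (τ x) = 0) :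
    pair (u.inChart κ') ψ =
      pair (u.inChart κ) fun x => ((|(fderiv ℝ τ x).det| : ℝ) : ℂ) * ψ (τ x) := by
  set T := κ.1.symm.trans κ'.1
  have hOT : O ⊆ T.source := fun x hx => by
    refine ⟨hOκ hx, ?_⟩
    show κ.1.symm x ∈ κ'.1.source
    rw [← (hτ x hx).2]
    exact κ'.1.map_target (hτ x hx).1
  have hTτ : ∀ x ∈ O, T x = τ x := fun x hx => by
    show κ'.1 (κ.1.symm x) = τ x
    rw [← (hτ x hx).2, κ'.1.right_inv (hτ x hx).1]
  rw [u.compatible κ κ' ψ (hψ.mono ?_)]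
  · congr 1
    funext x
    by_cases hx : x ∈ O
    · have hev : T =ᶠ[𝓝 x] τ := by filter_upwards [hO.mem_nhds hx] with y hy using hTτ y hy
      rw [indicator_of_mem (hOT hx), hTτ x hx, hev.fderiv_eq]
    · rw [hψ' x hx, mul_zero]
      by_cases hxs : x ∈ T.source
      · rw [indicator_of_mem hxs, image_eq_zero_of_notMem_tsupport (f := ψ), mul_zero]
        intro h
        obtain ⟨x', hx', h'⟩ := hψ.2.2 h
        rw [← hTτ x' hx'] at h'
        exact hx (T.injOn (hOT hx') hxs h' ▸ hx')
      · exact indicator_of_notMem hxs _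
  · rintro _ ⟨x, hx, rfl⟩
    rw [← hTτ x hx]
    exact T.map_source (hOT hx)

end Manifold


/-! ### Gluing of distributions -/

section Gluing

variable {X : Type} [NormedAddCommGroup X] [NormedSpace ℝ X] [FiniteDimensional ℝ X]

/-- The space of test functions on a set. -/
def testSpace (S : Set X) : Submodule ℂ (X → ℂ) where
  carrier := {ψ | IsTest S ψ}
  add_mem' := IsTest.add
  zero_mem' := IsTest.zero
  smul_mem' c _ h := h.smul c

/-- The pairing with a distribution as a linear form on test functions. -/
def pairing {Ω : Opens X} (u : Distr Ω) : testSpace (Ω : Set X) →ₗ[ℂ] ℂ where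
  toFun ψ := pair u ψ
  map_add' ψ φ := pair_add u ψ.2 φ.2
  map_smul' c ψ := pair_smul u ψ.2 c

/-- Distributions that agree on overlaps are restrictions of one linear form. -/
lemma exists_glued {ι : Type*} (Ω : ι → Opens X) (u : ∀ i, Distr (Ω i))
    (h : ∀ i j ψ, IsTest ((Ω i : Set X) ∩ Ω j) ψ → pair (u i) ψ = pair (u j) ψ) :
    ∃ w : (X → ℂ) →ₗ[ℂ] ℂ, ∀ i ψ, IsTest (Ω i : Set X) ψ → w ψ = pair (u i) ψ := by
  classical
  let Φ : (Π₀ i, testSpace (Ω i : Set X)) →ₗ[ℂ] (X → ℂ) :=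
    DFinsupp.lsum ℂ fun i => (testSpace (Ω i : Set X)).subtype
  let Θ : (Π₀ i, testSpace (Ω i : Set X)) →ₗ[ℂ] ℂ := DFinsupp.lsum ℂ fun i => pairing (u i)
  have hΦ : ∀ x, Φ x = ∑ i ∈ x.support, (x i : X → ℂ) := fun x => by
    simp [Φ, DFinsupp.lsum_apply_apply, DFinsupp.sumAddHom_apply, DFinsupp.sum]
  have hΘ : ∀ x, Θ x = ∑ i ∈ x.support, pair (u i) (x i : X → ℂ) := fun x => by
    simp [Θ, DFinsupp.lsum_apply_apply, DFinsupp.sumAddHom_apply, DFinsupp.sum, pairing]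
  have hker : Θ ∈ (LinearMap.ker Φ).dualAnnihilator := by
    rw [Submodule.mem_dualAnnihilator]
    intro x hx
    rw [LinearMap.mem_ker, hΦ] at hx
    rw [hΘ]
    have hK : IsCompact (⋃ i ∈ x.support, tsupport (x i : X → ℂ)) :=
      x.support.isCompact_biUnion fun i _ => (x i).2.2.1
    obtain ⟨χ, hχ, O', -, hO', -, hχ1⟩ := exists_cutoff hK
      (isOpen_iUnion fun i => (Ω i).isOpen)
      (iUnion₂_subset fun i _ => (x i).2.2.2.trans (subset_iUnion (fun i => (Ω i : Set X)) i))
    obtain ⟨t, f, hf, hsum⟩ := hχ.exists_decomposition (fun i => (Ω i : Set X))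
      (fun i => (Ω i).isOpen) hχ.2.2
    have hf' : ∀ j ∈ t, IsTest (Ω j : Set X) (f j) := fun j hj => (hf j hj).mono inter_subset_right
    have h1 : ∀ i ∈ x.support, (x i : X → ℂ) = ∑ j ∈ t, f j * (x i : X → ℂ) := fun i hi => by
      rw [← Finset.sum_mul, ← hsum]
      funext y
      by_cases hy : y ∈ tsupport (x i : X → ℂ)
      · rw [Pi.mul_apply, hχ1 y (hO' (mem_biUnion hi hy)), one_mul]
      · rw [Pi.mul_apply, image_eq_zero_of_notMem_tsupport hy, mul_zero]
    have h2 : ∀ i, ∀ j ∈ t, IsTest ((Ω i : Set X) ∩ Ω j) (f j * (x i : X → ℂ)) := fun i j hj =>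
      ((hf' j hj).mul_right (x i).2.1).of_tsupport
        (subset_inter ((tsupport_mul_subset_right).trans (x i).2.2.2)
          ((tsupport_mul_subset_left).trans (hf' j hj).2.2))
    calc ∑ i ∈ x.support, pair (u i) (x i : X → ℂ)
        = ∑ i ∈ x.support, ∑ j ∈ t, pair (u j) (f j * (x i : X → ℂ)) := by
          refine Finset.sum_congr rfl fun i hi => ?_
          conv_lhs => rw [h1 i hi]
          rw [pair_sum _ fun j hj => (h2 i j hj).mono inter_subset_left]
          exact Finset.sum_congr rfl fun j hj => h i j _ (h2 i j hj)
      _ = ∑ j ∈ t, pair (u j) (∑ i ∈ x.support, f j * (x i : X → ℂ)) := by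
          rw [Finset.sum_comm]
          refine Finset.sum_congr rfl fun j hj => ?_
          rw [pair_sum _ fun i _ => (h2 i j hj).mono inter_subset_right]
      _ = 0 := by
          refine Finset.sum_eq_zero fun j _ => ?_
          rw [← Finset.mul_sum, hx, mul_zero, pair_zero]
  have hrange := LinearMap.range_dualMap_eq_dualAnnihilator_ker (K := ℂ)
    (V₁ := Π₀ i, testSpace (Ω i : Set X)) (V₂ := X → ℂ) Φ
  rw [← hrange] at hker
  obtain ⟨w, hw⟩ := hker
  refine ⟨w, fun i ψ hψ => ?_⟩
  have h1 := LinearMap.congr_fun hw (DFinsupp.single i ⟨ψ, hψ⟩)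
  simpa [Φ, Θ, pairing] using h1

end Gluing

section Determinant

variable {d : ℕ}

/-- Block-triangular determinants. -/
lemma det_clm_triangular (N : Matrix (Fin d) (Fin d) ℝ) (v : EuclideanSpace ℝ (Fin d))
    (L : Model d →L[ℝ] Model d) (hL : ∀ q, L q = (act N q.1 + q.2 • v, q.2)) : L.det = N.det := by
  let b := ((EuclideanSpace.basisFun (Fin d) ℝ).toBasis).prod (Module.Basis.singleton Unit ℝ)
  have h : LinearMap.toMatrix b b (L : Model d →ₗ[ℝ] Model d) =
      Matrix.fromBlocks N (Matrix.of fun i (_ : Unit) => v i) 0 1 := by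
    ext i j
    rw [LinearMap.toMatrix_apply]
    rcases i with i | i <;> rcases j with j | j <;>
      simp [b, hL, act, EuclideanSpace.basisFun_repr]
  rw [ContinuousLinearMap.det, ← LinearMap.det_toMatrix b, h, Matrix.det_fromBlocks_zero₂₁]
  simp

/-- The Jacobian determinant of a linear change of the first variables that depends on `θ`. -/
lemma det_fderiv_act_family {N : ℝ → Matrix (Fin d) (Fin d) ℝ}
    (hN : ∀ i j, ContDiff ℝ ∞ fun θ => N θ i j) (c : ℝ) (q : Model d) :
    (fderiv ℝ (fun q : Model d => ((act (N q.2) q.1, q.2 + c) : Model d)) q).det = (N q.2).det := by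
  have hN' : ∀ i j, HasDerivAt (fun θ => N θ i j) (deriv (fun θ => N θ i j) q.2) q.2 := fun i j =>
    ((hN i j).differentiable (by simp) q.2).hasDerivAt
  let N' : Matrix (Fin d) (Fin d) ℝ := fun i j => deriv (fun θ => N θ i j) q.2
  have hF : Differentiable ℝ (fun q : Model d => ((act (N q.2) q.1, q.2 + c) : Model d)) :=
    (((LinearizingChart.contDiff_act_family hN).differentiable (by simp)).fst).prodMk
      (differentiable_snd.add_const c)
  refine det_clm_triangular (N q.2) (act N' q.1) _ fun v => ?_
  have h1 := (hF q).hasFDerivAt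
  have hline : HasDerivAt (fun s : ℝ => q + s • v) v 0 := by
    simpa using ((hasDerivAt_id (0 : ℝ)).smul_const v).const_add q
  have h2 : HasDerivAt (fun s : ℝ => ((act (N (q + s • v).2) (q + s • v).1, (q + s • v).2 + c) :
      Model d)) (fderiv ℝ (fun q : Model d => ((act (N q.2) q.1, q.2 + c) : Model d)) q v) 0 :=
    HasFDerivAt.comp_hasDerivAt_of_eq (0 : ℝ) h1 hline (by simp)
  refine h2.unique (HasDerivAt.prodMk ?_ ?_)
  · have h3 : HasDerivAt (fun s : ℝ => N (q + s • v).2 *ᵥ (q + s • v).1.ofLp)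
        ((N q.2 *ᵥ v.1.ofLp) + v.2 • (N' *ᵥ q.1.ofLp)) 0 := by
      rw [hasDerivAt_pi]
      intro i
      have h4 : ∀ j, HasDerivAt (fun s : ℝ => N (q.2 + s * v.2) i j * (q.1 j + s * v.1 j))
          (N' i j * v.2 * (q.1 j + 0 * v.1 j) + N (q.2 + 0 * v.2) i j * v.1 j) 0 := fun j => by
        have h5 : HasDerivAt (fun s : ℝ => q.2 + s * v.2) v.2 0 := by
          simpa using ((hasDerivAt_id (0 : ℝ)).mul_const v.2).const_add q.2
        have h6 : HasDerivAt (fun s : ℝ => q.1 j + s * v.1 j) (v.1 j) 0 := by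
          simpa using ((hasDerivAt_id (0 : ℝ)).mul_const (v.1 j)).const_add (q.1 j)
        have h7 : HasDerivAt (fun θ => N θ i j) (N' i j) (q.2 + 0 * v.2) := by
          rw [zero_mul, add_zero]
          exact hN' i j
        exact (h7.comp (0 : ℝ) h5).mul h6
      have h8 := HasDerivAt.fun_sum (u := Finset.univ) fun j _ => h4 j
      refine h8.congr_deriv ?_
      show _ = ∑ j, N q.2 i j * v.1 j + v.2 * ∑ j, N' i j * q.1 j
      rw [Finset.mul_sum, ← Finset.sum_add_distrib]
      refine Finset.sum_congr rfl fun j _ => ?_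
      rw [zero_mul, zero_mul, add_zero, add_zero]
      ring
    exact (PiLp.continuousLinearEquiv 2 ℝ (fun _ : Fin d => ℝ)).symm.hasFDerivAt.comp_hasDerivAt
        (0 : ℝ) h3
  · simpa using (((hasDerivAt_id (0 : ℝ)).mul_const v.2).const_add q.2).add_const c

end Determinant

section Transpose

variable {X : Type} [NormedAddCommGroup X] [NormedSpace ℝ X] [FiniteDimensional ℝ X]

lemma transposeOp_congr {b b' : X → X} {O : Set X} (hO : IsOpen O) (h : EqOn b b' O) {lam : ℂ}
    {ψ : X → ℂ} (hψ : tsupport ψ ⊆ O) : transposeOp b lam ψ = transposeOp b' lam ψ := by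
  funext x
  by_cases hx : x ∈ tsupport ψ
  · have h1 : b =ᶠ[𝓝 x] b' := h.eventuallyEq_of_mem (hO.mem_nhds (hψ hx))
    simp only [transposeOp, h1.fderiv_eq, h1.self_of_nhds]
  · rw [transposeOp_eq_zero lam hx, transposeOp_eq_zero lam hx]

lemma transposeOp_sum (b : X → X) (lam : ℂ) {ι : Type*} {t : Finset ι} {f : ι → X → ℂ}
    (hf : ∀ i ∈ t, ContDiff ℝ ∞ (f i)) :
    transposeOp b lam (∑ i ∈ t, f i) = ∑ i ∈ t, transposeOp b lam (f i) := by
  funext x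
  have h1 : fderiv ℝ (∑ i ∈ t, f i) x = ∑ i ∈ t, fderiv ℝ (f i) x :=
    fderiv_sum fun i hi => (hf i hi).differentiable (by simp) x
  simp only [transposeOp, Finset.sum_apply, h1, _root_.sum_apply, Finset.mul_sum, Finset.sum_mul,
    Finset.sum_sub_distrib, Finset.sum_add_distrib]

lemma thetaOp_eq_transposeOp (lam : ℂ) (ψ : X × ℝ → ℂ) :
    thetaOp lam ψ = transposeOp (fun _ => (0, 1)) lam ψ := by
  funext q
  simp [thetaOp, transposeOp]

lemma thetaOp_iterate_sum {lam : ℂ} (k : ℕ) {ι : Type*} {t : Finset ι} {f : ι → X × ℝ → ℂ}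
    {S : ι → Set (X × ℝ)} (hf : ∀ i ∈ t, IsTest (S i) (f i)) :
    (thetaOp lam)^[k] (∑ i ∈ t, f i) = ∑ i ∈ t, (thetaOp lam)^[k] (f i) := by
  induction k with
  | zero => rfl
  | succ k ih =>
    simp only [Function.iterate_succ_apply', ih]
    rw [thetaOp_eq_transposeOp, transposeOp_sum _ _ fun i hi => ((hf i hi).thetaOp_iterate k).1]
    simp only [thetaOp_eq_transposeOp]

end Transpose

namespace LinearizingChart.IsTube

variable {d : ℕ} {M : Type*} [TopologicalSpace M] [ChartedSpace (Model d) M]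
  {V : ∀ x : M, TangentSpace 𝓘(ℝ, Model d) x} {Λ : Set M} {P : ℝ}
  {C : LinearizingChart V Λ P} {B : Blocks d} {Q : Matrix (Fin d) (Fin d) ℝ} {δ : ℝ}
  (hT : C.IsTube B Q δ) [IsManifold 𝓘(ℝ, Model d) ∞ M]
include hT

lemma exists_chart_decomposition {S : Set (Model d)} {ψ : Model d → ℂ} (hψ : IsTest S ψ)
    (hS : S ⊆ box (P := P) B δ) : ∃ (t : Finset ℝ) (f : ℝ → Model d → ℂ),
      (∀ a ∈ t, IsTest (tsupport ψ ∩ (hT.chart a).1.target) (f a)) ∧ ψ = ∑ a ∈ t, f a := by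
  refine hψ.exists_decomposition (fun a => (hT.chart a).1.target)
    (fun a => (hT.chart a).1.open_target) fun q hq => mem_iUnion.2 ⟨q.2, ?_⟩
  refine hT.mem_chart_target.2 ⟨hS (hψ.2.2 hq), ?_⟩
  simpa using half_pos hT.period_pos

/-- The functional is the pairing with the lift of `u` to the flow-box coordinates. -/
def IsLift (u : MDistr d M) (w : (Model d → ℂ) →ₗ[ℂ] ℂ) : Prop :=
  ∀ a ψ, IsTest (hT.chart a).1.target ψ → w ψ = pair (u.inChart (hT.chart a)) ψ

lemma exists_isLift (u : MDistr d M) : ∃ w, hT.IsLift u w := by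
  refine exists_glued (fun a : ℝ => (hT.chart a).image) (fun a => u.inChart (hT.chart a)) ?_
  intro a a' ψ hψ
  symm
  rw [u.pair_eq_of_transition (hT.chart a) (hT.chart a') (τ := id)
    (O := (hT.chart a).1.target ∩ (hT.chart a').1.target)
    ((hT.chart a).1.open_target.inter (hT.chart a').1.open_target) inter_subset_left
    (fun x hx => ⟨hx.2, by rw [id, chart_symm, chart_symm]⟩) (by rw [image_id]; exact hψ)
    (fun x hx => hψ.eq_zero hx)]
  congr 1
  funext x
  simp [ContinuousLinearMap.det]

variable {hT} {u : MDistr d M} {w : (Model d → ℂ) →ₗ[ℂ] ℂ} (hw : hT.IsLift u w)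
include hw

namespace IsLift

/-- The lift is equivariant under the deck transformation. -/
lemma comp_deck {ψ : Model d → ℂ} (hψ : IsTest (box (P := P) B δ) ψ) :
    w ψ = (|B.matrix.det| : ℝ) * w fun q => ψ (act B.matrix q.1, q.2 - P) := by
  have hP := hT.period_pos.ne'
  obtain ⟨t, f, hf, rfl⟩ := hT.exists_chart_decomposition hψ subset_rfl
  have h1 : (fun q : Model d => (∑ a ∈ t, f a) (act B.matrix q.1, q.2 - P)) =
      ∑ a ∈ t, fun q : Model d => f a (act B.matrix q.1, q.2 - P) := by
    funext q
    simp
  rw [h1, map_sum, map_sum, Finset.mul_sum]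
  refine Finset.sum_congr rfl fun a ha => ?_
  have hfa : IsTest (hT.chart a).1.target (f a) := (hf a ha).mono inter_subset_right
  let e : Model d ≃ₜ Model d :=
    B.splitting.D.toHomeomorph.prodCongr (Homeomorph.addRight (-P))
  let τ : Model d → Model d := fun q => (act B.matrix q.1, q.2 + -P)
  have hτe : τ = e := rfl
  have hτ : ∀ q, (τ q ∈ (hT.chart a).1.target ↔ q ∈ (hT.chart (a + P)).1.target) := fun q => by
    rw [hT.mem_chart_target, hT.mem_chart_target]
    have h1 : B.stableSq P (τ q) = B.stableSq P q := by
      rw [B.stableSq_act_matrix hP, neg_add_cancel_right]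
    have h2 : B.unstableSq P (τ q) = B.unstableSq P q := by
      rw [B.unstableSq_act_matrix hP, neg_add_cancel_right]
    refine and_congr ?_ ?_
    · show B.stableSq P (τ q) + B.unstableSq P (τ q) < δ ^ 2 ↔
        B.stableSq P q + B.unstableSq P q < δ ^ 2
      rw [h1, h2]
    · rw [show (τ q).2 - a = q.2 - (a + P) by simp only [τ]; ring]
  have hτb : ∀ q ∈ box (P := P) B δ, C.flowBox Q (τ q) = C.flowBox Q q := fun q hq => by
    have h1 := hT.U_mul_add_period 1 (q.2 + -P)
    rw [Nat.cast_one, one_mul, neg_add_cancel_right, pow_one] at h1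
    have h2 := C.periodic _ (hT.shear_mem hq) (q.2 + -P)
    rw [neg_add_cancel_right] at h2
    show C.h (act (C.U (q.2 + -P) * Q) (act B.matrix q.1), q.2 + -P) = C.h ((C.shear Q q).1, q.2)
    rw [← act_mul, ← h1]
    exact h2.symm
  have hsurj : Function.Surjective τ := hτe ▸ e.surjective
  have himg : τ '' (hT.chart (a + P)).1.target = (hT.chart a).1.target := by
    ext q
    obtain ⟨q', rfl⟩ := hsurj q
    rw [hτ]
    refine ⟨?_, fun h => ⟨q', h, rfl⟩⟩
    rintro ⟨q'', h, h'⟩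
    rwa [← hτ, ← h', hτ]
  have key := u.pair_eq_of_transition (hT.chart (a + P)) (hT.chart a) (τ := τ)
    (hT.chart (a + P)).1.open_target subset_rfl
    (fun x hx => ⟨(hτ x).2 hx, by
      rw [chart_symm, chart_symm, hτb x (hT.mem_chart_target.1 hx).1]⟩)
    (ψ := f a) (by rwa [himg]) fun x hx => hfa.eq_zero fun h => hx ((hτ x).1 h)
  have hdet : ∀ q, (fderiv ℝ τ q).det = B.matrix.det := fun q =>
    det_fderiv_act_family (N := fun _ => B.matrix) (fun _ _ => contDiff_const) (-P) q
  simp only [hdet] at key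
  have hτs : ContDiff ℝ ∞ τ := (B.splitting.D.contDiff.comp contDiff_fst).prodMk
    (contDiff_snd.add contDiff_const)
  have htest : IsTest (hT.chart (a + P)).1.target fun q => f a (τ q) := by
    refine ⟨hfa.1.comp hτs, hfa.2.1.comp_homeomorph e, fun q hq => (hτ q).1 (hfa.2.2 ?_)⟩
    have : tsupport (fun q => f a (e q)) = e ⁻¹' tsupport (f a) := tsupport_comp_eq_preimage _ e
    exact (this ▸ hq : q ∈ e ⁻¹' tsupport (f a))
  have he : (fun q : Model d => f a (act B.matrix q.1, q.2 - P)) = fun q => f a (τ q) := by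
    simp only [τ, sub_eq_add_neg]
  rw [hw a _ hfa, key, he, hw _ _ htest, ← pair_smul _ htest]
  rfl

/-- The equation for the lift. -/
lemma apply_thetaOp_iterate {lam : ℂ} {p : ℕ} (hu : u.SolvesOn V lam p (C.tube B Q δ))
    {ψ : Model d → ℂ} (hψ : IsTest (box (P := P) B δ) ψ) : w ((thetaOp lam)^[p] ψ) = 0 := by
  obtain ⟨t, f, hf, rfl⟩ := hT.exists_chart_decomposition hψ subset_rfl
  have hf' : ∀ a ∈ t, IsTest (hT.chart a).1.target (f a) := fun a ha =>
    (hf a ha).mono inter_subset_right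
  rw [thetaOp_iterate_sum p fun a ha => hf' a ha, map_sum]
  refine Finset.sum_eq_zero fun a ha => ?_
  have key : ∀ k, (transposeOp (fieldInChart V (hT.chart a)) lam)^[k] (f a) =
      (thetaOp lam)^[k] (f a) := fun k => by
    induction k with
    | zero => rfl
    | succ k ih =>
      rw [Function.iterate_succ_apply', Function.iterate_succ_apply', ih, thetaOp_eq_transposeOp]
      exact transposeOp_congr (hT.chart a).1.open_target
        (fun q hq => hT.fieldInChart_chart hq) ((hf' a ha).thetaOp_iterate k).2.2
  rw [hw a _ ((hf' a ha).thetaOp_iterate p), ← key]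
  exact hu _ _ (by rw [imageOf_tube]; exact hf' a ha)

end IsLift

end LinearizingChart.IsTube


/-! ### Wavefront set and support in the flow-box coordinates -/

section Vanishing

variable {X : Type} [NormedAddCommGroup X] [NormedSpace ℝ X] [FiniteDimensional ℝ X]

/-- A continuous density on an open set is determined by its integrals against test functions. -/
lemma eq_zero_of_forall_integral {Y : Type} [NormedAddCommGroup Y] [InnerProductSpace ℝ Y]
    [FiniteDimensional ℝ Y] [MeasurableSpace Y] [BorelSpace Y] {f : Y → ℂ} (hf : Continuous f)
    {W : Set Y} (hW : IsOpen W) (h : ∀ b : Y → ℂ, IsTest W b → ∫ y, b y * f y = 0) :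
    ∀ y ∈ W, f y = 0 := by
  have h1 : ∀ᵐ y, y ∈ W → f y = 0 := by
    refine hW.ae_eq_zero_of_integral_contDiff_smul_eq_zero
      (hf.locallyIntegrable.locallyIntegrableOn W) fun g hg hgc hgW => ?_
    have h2 := h (fun y => (g y : ℂ)) ⟨Complex.ofRealCLM.contDiff.comp hg,
      hgc.comp_left (g := fun r : ℝ => (r : ℂ)) Complex.ofReal_zero,
      (closure_mono fun y hy => by simpa using hy).trans hgW⟩
    simpa using h2
  have h2 : f =ᵐ[volume.restrict W] fun _ => 0 := (ae_restrict_iff' hW.measurableSet).2 h1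
  exact Measure.eqOn_open_of_ae_eq h2 hW hf.continuousOn continuousOn_const

/-- A distribution that is smooth near `q`, and that vanishes near the points of a dense set,
vanishes near `q`. -/
lemma exists_open_pair_eq_zero_of_dense {Ω : Opens X} (u : Distr Ω) {q : X} (hq : q ∈ Ω)
    (hWF : ∀ η : X →L[ℝ] ℝ, η ≠ 0 → (q, η) ∉ waveFront u) {N : Set X} (hN : IsOpen N) (hqN : q ∈ N)
    (hd : ∀ W : Set X, IsOpen W → ∀ x ∈ W ∩ N, ∃ x' ∈ W, ∃ W' : Set X, IsOpen W' ∧ x' ∈ W' ∧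
      ∀ φ, IsTest W' φ → pair u φ = 0) :
    ∃ O : Set X, IsOpen O ∧ q ∈ O ∧ ∀ χ, IsTest O χ → pair u χ = 0 := by
  let L : X ≃L[ℝ] EuclideanSpace ℝ (Fin (Module.finrank ℝ X)) := toEuclidean
  obtain ⟨O, hO, hqO, hOΩ, hdens⟩ := exists_density_of_waveFront u hq
    (L := (L : X →L[ℝ] EuclideanSpace ℝ (Fin (Module.finrank ℝ X)))) L.surjective
    fun η hη => hWF _ fun h => hη (waveCovector_injective
      (L := (L : X →L[ℝ] EuclideanSpace ℝ (Fin (Module.finrank ℝ X)))) L.surjective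
      (by rw [h, map_zero]))
  refine ⟨O ∩ N, hO.inter hN, ⟨hqO, hqN⟩, fun χ hχ => ?_⟩
  obtain ⟨f, hf, hfb⟩ := hdens χ (hχ.mono inter_subset_left)
  have hzero : ∀ W' : Set X, IsOpen W' → (∀ φ, IsTest (W' ∩ tsupport χ) φ → pair u φ = 0) →
      ∀ x ∈ W', f (L x) = 0 := by
    intro W' hW' h x hx
    refine eq_zero_of_forall_integral hf.continuous (W := L '' W')
      (L.toHomeomorph.isOpenMap _ hW') (fun b hb => ?_) _ ⟨x, hx, rfl⟩
    rw [← hfb b (hb.mono (subset_univ _))]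
    have h1 := hb.comp_equiv L
    rw [preimage_image_eq _ L.injective] at h1
    exact h _ ((hχ.mul_right h1.1).of_tsupport (subset_inter
      (tsupport_mul_subset_right.trans h1.2.2) tsupport_mul_subset_left))
  have hf0 : ∀ x, f (L x) = 0 := by
    intro x
    by_contra hx
    by_cases hxχ : x ∈ tsupport χ
    · obtain ⟨x', hx', W', hW', hxW', h'⟩ := hd {x | f (L x) ≠ 0}
        (isOpen_ne_fun (hf.continuous.comp L.continuous) continuous_const) x ⟨hx, (hχ.2.2 hxχ).2⟩
      exact hx' (hzero W' hW' (fun φ hφ => h' φ (hφ.mono inter_subset_left)) x' hxW')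
    · refine hx (hzero (tsupport χ)ᶜ (isClosed_tsupport _).isOpen_compl (fun φ hφ => ?_) x hxχ)
      have : φ = 0 := by
        funext y
        exact hφ.eq_zero fun h => h.1 h.2
      rw [this, pair_zero]
  obtain ⟨b, hb, O', -, hO', -, hb1⟩ := exists_cutoff
    (hχ.2.1.isCompact.image L.continuous) isOpen_univ (subset_univ _)
  have h1 : χ * (fun x => b (L x)) = χ := by
    funext x
    by_cases hx : x ∈ tsupport χ
    · rw [Pi.mul_apply, hb1 _ (hO' ⟨x, hx, rfl⟩), mul_one]
    · rw [Pi.mul_apply, image_eq_zero_of_notMem_tsupport hx, zero_mul]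
  have h2 := hfb b hb
  have h3 : ∀ y, f y = 0 := fun y => by
    rw [← L.apply_symm_apply y]
    exact hf0 _
  simp only [h3, mul_zero, integral_zero] at h2
  rw [← h2]
  exact congrArg _ h1.symm

end Vanishing

namespace LinearizingChart.IsTube

variable {d : ℕ} {M : Type*} [TopologicalSpace M] [ChartedSpace (Model d) M]
  {V : ∀ x : M, TangentSpace 𝓘(ℝ, Model d) x} {Λ : Set M} {P : ℝ}
  {C : LinearizingChart V Λ P} {B : Blocks d} {Q : Matrix (Fin d) (Fin d) ℝ} {δ : ℝ}
  (hT : C.IsTube B Q δ)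

lemma embedUnstable_mem_unstable (y : Label B.lu B.pu → ℝ) :
    B.embedUnstable y ∈ B.splitting.unstable := by
  rw [B.mem_unstable_iff]
  intro k
  simp [Blocks.embedUnstable]

lemma exists_embedUnstable {z : EuclideanSpace ℝ (Fin d)} (hz : z ∈ B.splitting.unstable) :
    ∃ y, B.embedUnstable y = z :=
  ⟨_, hz⟩

lemma mem_unstableSpace_iff {θ : ℝ} {v : EuclideanSpace ℝ (Fin d)} :
    v ∈ C.unstableSpace B Q θ ↔ ∃ z ∈ B.splitting.unstable, act (C.U θ * Q) z = v := by
  constructor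
  · rintro ⟨y, rfl⟩
    refine ⟨act (B.flowMatrix P (-θ)) (B.embedUnstable y),
      act_flowMatrix_mem_unstable (embedUnstable_mem_unstable y) _, ?_⟩
    rw [← act_mul, C.floquet_eq]
  · rintro ⟨z, hz, rfl⟩
    obtain ⟨y, hy⟩ := exists_embedUnstable (act_flowMatrix_mem_unstable (P := P) hz θ)
    refine ⟨y, ?_⟩
    show act (C.floquet B Q θ) (B.embedUnstable y) = _
    rw [hy, C.floquet_eq, act_mul, act_flowMatrix_neg]

include hT

lemma act_matrix_mem_unstable_iff {z : EuclideanSpace ℝ (Fin d)} :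
    act B.matrix z ∈ B.splitting.unstable ↔ z ∈ B.splitting.unstable := by
  have h1 := B.stableSq_eq_zero_iff (P := P) (q := (act B.matrix z, 0))
  have h2 := B.stableSq_eq_zero_iff (P := P) (q := (z, 0 + P))
  rw [B.stableSq_act_matrix hT.period_pos.ne'] at h1
  exact h1.symm.trans h2

lemma periodic_unstableSpace : Function.Periodic (C.unstableSpace B Q) P := fun θ => by
  have h1 := hT.U_mul_add_period 1 θ
  rw [Nat.cast_one, one_mul, pow_one] at h1
  ext v
  rw [mem_unstableSpace_iff, mem_unstableSpace_iff, h1]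
  constructor
  · rintro ⟨z, hz, rfl⟩
    exact ⟨act B.matrix z, hT.act_matrix_mem_unstable_iff.2 hz, (act_mul _ _ _).symm⟩
  · rintro ⟨z, hz, rfl⟩
    obtain ⟨z', rfl⟩ : ∃ z', act B.matrix z' = z := B.splitting.D.surjective z
    exact ⟨z', hT.act_matrix_mem_unstable_iff.1 hz, act_mul _ _ _⟩

omit hT in
lemma h_add_int_mul {x : EuclideanSpace ℝ (Fin d)} (hx : x ∈ Metric.ball 0 C.r) (θ : ℝ) (k : ℤ) :
    C.h (x, θ + k * P) = C.h (x, θ) := by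
  have : Function.Periodic (fun θ => C.h (x, θ)) P := fun θ => C.periodic x hx θ
  exact this.int_mul k θ

lemma mfderiv_h_add_int_mul {x : EuclideanSpace ℝ (Fin d)} (hx : x ∈ Metric.ball 0 C.r) (θ : ℝ)
    (k : ℤ) (w : Model d) : (mfderiv 𝓘(ℝ, Model d) 𝓘(ℝ, Model d) C.h (x, θ + k * P) w : Model d) =
      mfderiv 𝓘(ℝ, Model d) 𝓘(ℝ, Model d) C.h (x, θ) w := by
  let τ : Model d → Model d := fun q => (q.1, q.2 + k * P)
  have hτ : HasFDerivAt τ (ContinuousLinearMap.id ℝ (Model d)) (x, θ) := by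
    have := (hasFDerivAt_id (𝕜 := ℝ) ((x, θ) : Model d)).add_const ((0, k * P) : Model d)
    exact this.congr_of_eventuallyEq (.of_forall fun q => Prod.ext (by simp [τ]) rfl)
  have h1 : MDifferentiableAt 𝓘(ℝ, Model d) 𝓘(ℝ, Model d) C.h (τ (x, θ)) :=
    (C.smooth ⟨τ (x, θ), hx, mem_univ _⟩).mdifferentiableAt (by simp)
  have h2 : C.h =ᶠ[𝓝 (x, θ)] C.h ∘ τ := by
    filter_upwards [(Metric.isOpen_ball.prod isOpen_univ).mem_nhds
      (show ((x, θ) : Model d) ∈ Metric.ball 0 C.r ×ˢ univ from ⟨hx, mem_univ _⟩)] with q hq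
    exact (h_add_int_mul hq.1 q.2 k).symm
  have h3 := (h1.hasMFDerivAt.comp (x, θ) hτ.hasMFDerivAt).congr_of_eventuallyEq h2
  have h4 := h3.mfderiv
  exact (congrArg (fun L : Model d →L[ℝ] Model d => L w) h4).symm

lemma fderiv_shear_inl (q : Model d) (z : EuclideanSpace ℝ (Fin d)) :
    fderiv ℝ (C.shear Q) q (z, 0) = (act (C.U q.2 * Q) z, 0) := by
  have h2 : DifferentiableAt ℝ (C.shear Q) q := (C.contDiff_shear Q).differentiable (by simp) q
  have hline : HasDerivAt (fun s : ℝ => q + s • ((z, 0) : Model d)) (z, 0) 0 := by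
    simpa using ((hasDerivAt_id (0 : ℝ)).smul_const ((z, 0) : Model d)).const_add q
  have h3 := h2.hasFDerivAt.comp_hasDerivAt_of_eq (0 : ℝ) hline (by simp)
  refine h3.unique ?_
  have e : C.shear Q ∘ (fun s : ℝ => q + s • ((z, 0) : Model d)) =
      fun s => C.shear Q q + s • ((act (C.U q.2 * Q) z, 0) : Model d) := by
    funext s
    simp [shear, act_add, act_smul]
  rw [e]
  simpa using ((hasDerivAt_id (0 : ℝ)).smul_const ((act (C.U q.2 * Q) z, 0) : Model d)).const_add
    (C.shear Q q)

lemma mfderiv_flowBox_apply {q : Model d} (hq : q ∈ box (P := P) B δ) (w : Model d) :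
    mfderiv 𝓘(ℝ, Model d) 𝓘(ℝ, Model d) (C.flowBox Q) q w =
      mfderiv 𝓘(ℝ, Model d) 𝓘(ℝ, Model d) C.h (C.shear Q q) (fderiv ℝ (C.shear Q) q w) := by
  have h1 : MDifferentiableAt 𝓘(ℝ, Model d) 𝓘(ℝ, Model d) C.h (C.shear Q q) :=
    (C.smooth ⟨C.shear Q q, hT.shear_mem hq, mem_univ _⟩).mdifferentiableAt (by simp)
  have h2 : DifferentiableAt ℝ (C.shear Q) q := (C.contDiff_shear Q).differentiable (by simp) q
  have h4 : mfderiv 𝓘(ℝ, Model d) 𝓘(ℝ, Model d) (C.flowBox Q) q =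
      (mfderiv 𝓘(ℝ, Model d) 𝓘(ℝ, Model d) C.h (C.shear Q q)).comp
        (mfderiv 𝓘(ℝ, Model d) 𝓘(ℝ, Model d) (C.shear Q) q) :=
    mfderiv_comp q h1 h2.mdifferentiableAt
  rw [h4, mfderiv_eq_fderiv]
  rfl

variable [IsManifold 𝓘(ℝ, Model d) ∞ M] {u : MDistr d M}
  (hWF : ∀ q ∈ u.waveFront, q.1 ∈ C.tube B Q δ → q ∈ C.strongUnstableConormals B Q)
include hWF

/-- In the flow-box coordinates, the wavefront set lies over the unstable manifold and is conormal
to its leaves `θ = const`. -/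
lemma conormal_of_mem_waveFront {a : ℝ} {q : Model d} {η : Model d →L[ℝ] ℝ}
    (hq : (q, η) ∈ ClosedOrbit.waveFront (u.inChart (hT.chart a))) :
    q.1 ∈ B.splitting.unstable ∧ ∀ z ∈ B.splitting.unstable, η (z, 0) = 0 := by
  have hqt : q ∈ (hT.chart a).1.target := hq.1
  have hqb := (hT.mem_chart_target.1 hqt).1
  obtain ⟨v, θ, ξ, hv, hvu, hξ, heq⟩ := hWF
    ⟨C.flowBox Q q, η.comp (mfderiv 𝓘(ℝ, Model d) 𝓘(ℝ, Model d) (hT.chart a).1 (C.flowBox Q q))⟩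
    ⟨hT.chart a, hT.mem_chart_source hqt, η, by
      show ((hT.chart a).1 (C.flowBox Q q), η) ∈ _
      rwa [hT.chart_flowBox hqt], rfl⟩ (hT.flowBox_mem_tube hqb)
  have hfst : C.flowBox Q q = C.h (v, θ) := congrArg Sigma.fst heq
  have hsnd : ∀ w : Model d, (η (mfderiv 𝓘(ℝ, Model d) 𝓘(ℝ, Model d) (hT.chart a).1
      (C.flowBox Q q) w) : ℝ) = ξ w := by
    intro w
    have h1 : ∀ c c' : Cotangent d M, c = c' → (c.2 : Model d →L[ℝ] ℝ) w = (c'.2 : Model d →L[ℝ] ℝ) w := by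
      rintro c _ rfl
      rfl
    exact h1 _ _ heq
  obtain ⟨hxv, k, hk⟩ := C.injective _ (hT.shear_mem hqb) v hv q.2 θ hfst
  have hk : θ = q.2 + k * P := hk
  have hsp : C.unstableSpace B Q θ = C.unstableSpace B Q q.2 := by
    rw [hk]
    exact hT.periodic_unstableSpace.int_mul k q.2
  rw [hsp] at hvu hξ
  constructor
  · obtain ⟨z, hz, hzv⟩ := mem_unstableSpace_iff.1 hvu
    have h1 : act (C.U q.2 * Q) q.1 = act (C.U q.2 * Q) z := hxv.trans hzv.symm
    have h2 := congrArg (act (C.U q.2 * Q)⁻¹) h1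
    rw [← act_mul, ← act_mul, Matrix.nonsing_inv_mul _ (C.isUnit_det_U_mul hT.adapted.1 q.2),
      act_one, act_one] at h2
    rwa [h2]
  · intro z hz
    have h1 := (hsnd _).trans (hξ _ (mem_unstableSpace_iff.2 ⟨z, hz, rfl⟩))
    subst hk
    have h2 := hT.mfderiv_h_add_int_mul hv q.2 k ((act (C.U q.2 * Q) z, 0) : Model d)
    have h3 : (mfderiv 𝓘(ℝ, Model d) 𝓘(ℝ, Model d) (C.flowBox Q) q ((z, 0) : Model d) : Model d) =
        mfderiv 𝓘(ℝ, Model d) 𝓘(ℝ, Model d) C.h (v, q.2) ((act (C.U q.2 * Q) z, 0) : Model d) := by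
      rw [hT.mfderiv_flowBox_apply hqb, hT.fderiv_shear_inl, ← hxv]
      rfl
    have h4 := congrArg (fun L : Model d →L[ℝ] Model d => L (z, 0)) (hT.mfderiv_chart_comp hqt)
    have h5 : (mfderiv 𝓘(ℝ, Model d) 𝓘(ℝ, Model d) (hT.chart a).1 (C.flowBox Q q)
      (mfderiv 𝓘(ℝ, Model d) 𝓘(ℝ, Model d) (C.flowBox Q) q ((z, 0) : Model d)) : Model d) = (z, 0) := h4
    exact (congrArg η h5).symm.trans ((congrArg (fun w : Model d => η (mfderiv 𝓘(ℝ, Model d)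
      𝓘(ℝ, Model d) (hT.chart a).1 (C.flowBox Q q) w)) (h3.trans h2.symm)).trans h1)

variable [T2Space M] [CompactSpace M]
  (hV : ContMDiff 𝓘(ℝ, Model d) 𝓘(ℝ, Model d).tangent ∞
    fun x => (⟨x, V x⟩ : TangentBundle 𝓘(ℝ, Model d) M))
  {φ : Flow ℝ M} (hφ : ∀ x : M, IsMIntegralCurve (fun t : ℝ => φ t x) V)
  (hΛ : IsClosedOrbit φ Λ P) (hsupp : u.support ∩ C.tube B Q δ ⊆ unstableManifold φ Λ)
include hV hφ hΛ hsupp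

/-- Off the local unstable manifold, `u` is smooth by the condition on the wavefront set, and it
vanishes on a dense set by the condition on the support. -/
lemma exists_open_pair_eq_zero {a : ℝ} {q : Model d} (hq : q ∈ (hT.chart a).1.target)
    (hqu : q.1 ∉ B.splitting.unstable) : ∃ O : Set (Model d), IsOpen O ∧ q ∈ O ∧
      ∀ χ, IsTest O χ → pair (u.inChart (hT.chart a)) χ = 0 := by
  have hopen : IsOpen {q : Model d | q.1 ∉ B.splitting.unstable} := by
    have : {q : Model d | q.1 ∉ B.splitting.unstable} = {q | B.stableSq P q ≠ 0} := by
      ext q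
      exact not_congr B.stableSq_eq_zero_iff.symm
    rw [this]
    exact isOpen_ne_fun (B.contDiff_stableSq P).continuous continuous_const
  refine exists_open_pair_eq_zero_of_dense _ (q := q) hq
    (fun η _ h => hqu (hT.conormal_of_mem_waveFront hWF h).1)
    ((hT.chart a).1.open_target.inter hopen) ⟨hq, hqu⟩ fun W hW q₁ hq₁ => ?_
  obtain ⟨q', ⟨hq'W, hq'b⟩, hq'⟩ := hT.exists_notMem_unstableManifold hV hφ hΛ
    (hT.mem_chart_target.1 hq₁.2.1).1 hq₁.2.2
    (hW.inter ((hT.chart a).1.open_target.inter hopen)) hq₁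
  refine ⟨q', hq'W.1, ?_⟩
  have h1 : C.flowBox Q q' ∉ u.support := fun h => hq' (hsupp ⟨h, hT.flowBox_mem_tube hq'b⟩)
  simp only [MDistr.support, Set.mem_ofPred_eq] at h1
  push Not at h1
  obtain ⟨O, hO, hqO, hOu⟩ := h1
  refine ⟨(hT.chart a).imageOf O, (hT.chart a).1.isOpen_inter_preimage_symm hO, ⟨hq'W.2.1, ?_⟩,
    fun φ hφ => hOu _ _ hφ⟩
  rwa [mem_preimage, chart_symm]

/-- The lift is carried by the local unstable manifold. -/
lemma IsLift.eq_zero_of_tsupport {w : (Model d → ℂ) →ₗ[ℂ] ℂ} (hw : hT.IsLift u w)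
    {ψ : Model d → ℂ} (hψ : IsTest (box (P := P) B δ) ψ)
    (h : ∀ q ∈ tsupport ψ, q.1 ∉ B.splitting.unstable) : w ψ = 0 := by
  obtain ⟨t, f, hf, hsum⟩ := hT.exists_chart_decomposition hψ subset_rfl
  rw [hsum, map_sum]
  refine Finset.sum_eq_zero fun a ha => ?_
  have hfa := (hf a ha).mono inter_subset_right
  rw [hw a _ hfa]
  refine pair_eq_zero_of_locally _ hfa fun q hq => ?_
  obtain ⟨O, hO, hqO, hO'⟩ := hT.exists_open_pair_eq_zero hWF hV hφ hΛ hsupp (hfa.2.2 hq)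
    (h q ((hf a ha).2.2 hq).1)
  exact ⟨O, hO, hqO, fun χ hχ => hO' χ (hχ.mono inter_subset_right)⟩

end LinearizingChart.IsTube


/-! ### The expansion in the flow-box coordinates -/

namespace Blocks

variable {d : ℕ} (B : Blocks d) (P δ : ℝ)

/-- The part of the flow-box coordinates over the unstable directions of the lifted tube: unlike the
lifted tube, it is stable under the backward flow. -/
def basin : Set (Model d) := {q | B.unstableSq P q < δ ^ 2}

/-- A cut-off in the stable directions, invariant under the deck transformation. -/
def stableCutoff (q : Model d) : ℂ :=
  ((1 - Real.smoothTransition (4 * B.stableSq P q / (δ ^ 2 - B.unstableSq P q) - 1) : ℝ) : ℂ)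

/-- The set where the cut-off is `1`. -/
def core : Set (Model d) := {q | 4 * B.stableSq P q < δ ^ 2 - B.unstableSq P q}

variable {P δ}

lemma isOpen_basin : IsOpen (B.basin P δ) :=
  isOpen_lt (B.contDiff_unstableSq P).continuous continuous_const

lemma isOpen_core : IsOpen (B.core P δ) :=
  isOpen_lt (continuous_const.mul (B.contDiff_stableSq P).continuous)
    (continuous_const.sub (B.contDiff_unstableSq P).continuous)

lemma box_subset_basin : LinearizingChart.box (P := P) B δ ⊆ B.basin P δ := fun q hq =>
  lt_of_le_of_lt (le_add_of_nonneg_left (B.stableSq_nonneg P q)) hq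

lemma downClosed_basin (hP : 0 < P) : DownClosed (B.basin P δ) := fun z _ _ h hθ =>
  lt_of_le_of_lt (B.unstableSq_mono hP z hθ) h

lemma stableCutoff_eq_one {q : Model d} (hq : q ∈ B.core P δ) : B.stableCutoff P δ q = 1 := by
  change 4 * B.stableSq P q < δ ^ 2 - B.unstableSq P q at hq
  have h0 := B.stableSq_nonneg P q
  have h1 : 4 * B.stableSq P q / (δ ^ 2 - B.unstableSq P q) - 1 ≤ 0 := by
    rw [sub_nonpos, div_le_one (by linarith)]
    exact hq.le
  simp [stableCutoff, Real.smoothTransition.zero_of_nonpos h1]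

lemma mem_core {q : Model d} (hq : q ∈ B.basin P δ) (h : q.1 ∈ B.splitting.unstable) :
    q ∈ B.core P δ := by
  show 4 * B.stableSq P q < δ ^ 2 - B.unstableSq P q
  rw [B.stableSq_eq_zero_iff.2 h, mul_zero, sub_pos]
  exact hq

lemma contDiffOn_stableCutoff : ContDiffOn ℝ ∞ (B.stableCutoff P δ) (B.basin P δ) := by
  have h1 : ContDiffOn ℝ ∞ (fun q => 4 * B.stableSq P q / (δ ^ 2 - B.unstableSq P q) - 1)
      (B.basin P δ) :=
    (((contDiff_const.mul (B.contDiff_stableSq P)).contDiffOn).div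
      ((contDiff_const.sub (B.contDiff_unstableSq P)).contDiffOn)
      fun q hq => (sub_pos.2 hq).ne').sub contDiffOn_const
  exact Complex.ofRealCLM.contDiff.comp_contDiffOn
    (contDiffOn_const.sub (Real.smoothTransition.contDiff.comp_contDiffOn h1))

lemma isTest_stableCutoff_mul {ψ : Model d → ℂ} (hψ : IsTest (B.basin P δ) ψ) :
    IsTest (LinearizingChart.box (P := P) B δ) (B.stableCutoff P δ * ψ) := by
  have hK : IsCompact (tsupport ψ ∩ {q | 2 * B.stableSq P q ≤ δ ^ 2 - B.unstableSq P q}) :=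
    hψ.2.1.isCompact.inter_right (isClosed_le
      (continuous_const.mul (B.contDiff_stableSq P).continuous)
      (continuous_const.sub (B.contDiff_unstableSq P).continuous))
  refine (IsTest.of_contDiffOn hK B.isOpen_basin (inter_subset_left.trans hψ.2.2)
    (B.contDiffOn_stableCutoff.mul hψ.1.contDiffOn) fun q hq => ?_).mono fun q hq => ?_
  · by_cases h : q ∈ tsupport ψ
    · have h1 : B.unstableSq P q < δ ^ 2 := hψ.2.2 h
      have h2 : δ ^ 2 - B.unstableSq P q < 2 * B.stableSq P q := not_le.1 fun h' => hq ⟨h, h'⟩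
      have h3 : 1 ≤ 4 * B.stableSq P q / (δ ^ 2 - B.unstableSq P q) - 1 := by
        rw [le_sub_iff_add_le, le_div_iff₀ (by linarith)]
        linarith
      simp [stableCutoff, Real.smoothTransition.one_of_one_le h3]
    · simp [image_eq_zero_of_notMem_tsupport h]
  · have h1 : B.unstableSq P q < δ ^ 2 := hψ.2.2 hq.1
    have h2 : 2 * B.stableSq P q ≤ δ ^ 2 - B.unstableSq P q := hq.2
    have h3 := B.stableSq_nonneg P q
    show B.stableSq P q + B.unstableSq P q < δ ^ 2
    linarith

lemma stableCutoff_act_matrix (hP : P ≠ 0) (z : EuclideanSpace ℝ (Fin d)) (θ : ℝ) :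
    B.stableCutoff P δ (act B.matrix z, θ) = B.stableCutoff P δ (z, θ + P) := by
  simp only [stableCutoff, B.stableSq_act_matrix hP, B.unstableSq_act_matrix hP]

end Blocks

lemma thetaOp_iterate_congr {X : Type} [NormedAddCommGroup X] [NormedSpace ℝ X]
    [FiniteDimensional ℝ X] {lam : ℂ} {ψ φ : X × ℝ → ℂ} {q : X × ℝ} (h : ψ =ᶠ[𝓝 q] φ) (k : ℕ) :
    (thetaOp lam)^[k] ψ =ᶠ[𝓝 q] (thetaOp lam)^[k] φ := by
  induction k with
  | zero => exact h
  | succ k ih =>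
    rw [Function.iterate_succ_apply', Function.iterate_succ_apply']
    filter_upwards [ih, ih.fderiv (𝕜 := ℝ)] with y h1 h2
    simp only [thetaOp, h1, h2]

namespace LinearizingChart.IsTube

variable {d : ℕ} {M : Type*} [TopologicalSpace M] [ChartedSpace (Model d) M]
  {V : ∀ x : M, TangentSpace 𝓘(ℝ, Model d) x} {Λ : Set M} {P : ℝ}
  {C : LinearizingChart V Λ P} {B : Blocks d} {Q : Matrix (Fin d) (Fin d) ℝ} {δ : ℝ}
  {hT : C.IsTube B Q δ} [IsManifold 𝓘(ℝ, Model d) ∞ M] [T2Space M] [CompactSpace M]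
  {u : MDistr d M} (hWF : ∀ q ∈ u.waveFront, q.1 ∈ C.tube B Q δ → q ∈ C.strongUnstableConormals B Q)
  (hV : ContMDiff 𝓘(ℝ, Model d) 𝓘(ℝ, Model d).tangent ∞
    fun x => (⟨x, V x⟩ : TangentBundle 𝓘(ℝ, Model d) M))
  {φ : Flow ℝ M} (hφ : ∀ x : M, IsMIntegralCurve (fun t : ℝ => φ t x) V)
  (hΛ : IsClosedOrbit φ Λ P) (hsupp : u.support ∩ C.tube B Q δ ⊆ unstableManifold φ Λ)
  {w : (Model d → ℂ) →ₗ[ℂ] ℂ} (hw : hT.IsLift u w) {lam : ℂ} {p : ℕ}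
include hWF hV hφ hΛ hsupp hw

/-- The lift does not see what happens away from the local unstable manifold. -/
lemma IsLift.congr {ψ ψ' : Model d → ℂ} (hψ : IsTest (box (P := P) B δ) ψ)
    (hψ' : IsTest (box (P := P) B δ) ψ') (h : ∀ q ∈ B.core P δ, ψ =ᶠ[𝓝 q] ψ') : w ψ = w ψ' := by
  rw [← sub_eq_zero, ← map_sub]
  refine IsLift.eq_zero_of_tsupport hT hWF hV hφ hΛ hsupp hw (hψ.sub hψ') fun q hq hqu => ?_
  have h1 := h q (B.mem_core (B.box_subset_basin ((hψ.sub hψ').2.2 hq)) hqu)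
  refine (notMem_tsupport_iff_eventuallyEq.2 ?_) hq
  filter_upwards [h1] with y hy
  simp [hy]

/-- The expansion of the lift. Cut off in the stable directions, the lift extends from the box to the
basin, which is stable under the backward flow, and
`HyperbolicSplitting.exists_flow_expansion` applies to the extension. -/
theorem IsLift.exists_expansion (hu : u.SolvesOn V lam p (C.tube B Q δ)) :
    (∀ ψ, IsTest (box (P := P) B δ) ψ → w (thetaOp lam ψ) = 0) ∧
    ∃ (ι : Type) (_ : Fintype ι)
      (l : ι → List (Label B.ls B.ps) × List (Label B.lu B.pu)) (F : ι → ℂ),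
      (∀ i, Complex.exp (-lam * P) * (|B.matrix.det| : ℝ) * B.splitting.jac *
        B.splitting.mult (l i) = 1) ∧
      ∀ ψ, IsTest (box (P := P) B δ) ψ →
        w ψ = ∑ i, F i * B.splitting.form (l i) (expMean lam ψ) := by
  have hP := hT.period_pos
  let v : (Model d → ℂ) →ₗ[ℂ] ℂ := w ∘ₗ LinearMap.mulLeft ℂ (B.stableCutoff P δ)
  have hv : ∀ ψ, v ψ = w (B.stableCutoff P δ * ψ) := fun _ => rfl
  have hcore : ∀ {q}, q ∈ B.core P δ → ∀ ψ : Model d → ℂ, B.stableCutoff P δ * ψ =ᶠ[𝓝 q] ψ := by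
    intro q hq ψ
    filter_upwards [B.isOpen_core.mem_nhds hq] with y hy
    rw [Pi.mul_apply, B.stableCutoff_eq_one hy, one_mul]
  have hvw : ∀ ψ, IsTest (box (P := P) B δ) ψ → v ψ = w ψ := fun ψ hψ =>
    IsLift.congr hWF hV hφ hΛ hsupp hw (B.isTest_stableCutoff_mul (hψ.mono B.box_subset_basin)) hψ
      fun q hq => hcore hq ψ
  have hR : ∀ ψ, IsTest (B.basin P δ) ψ →
      v (B.splitting.dilOp (Complex.exp (-lam * P) * (|B.matrix.det| : ℝ)) ψ) =
        v (shiftOp (EuclideanSpace ℝ (Fin d)) lam P ψ) := by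
    intro ψ hψ
    have h1 := B.isTest_stableCutoff_mul ((B.downClosed_basin hP).isTest_shiftOp (lam := lam) hP.le hψ)
    rw [hv, hv, hw.comp_deck h1]
    refine Eq.trans (congrArg w ?_) (w.map_smul ((|B.matrix.det| : ℝ) : ℂ) _)
    funext q
    have h2 : B.stableCutoff P δ (act B.matrix q.1, q.2 - P) = B.stableCutoff P δ q := by
      rw [B.stableCutoff_act_matrix hP.ne', sub_add_cancel]
    simp only [Pi.mul_apply, Pi.smul_apply, smul_eq_mul, HyperbolicSplitting.dilOp_apply,
      shiftOp_apply, h2, sub_add_cancel]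
    show B.stableCutoff P δ q * (Complex.exp (-lam * P) * (|B.matrix.det| : ℝ) *
      ψ (act B.matrix q.1, q.2)) = _
    ring
  -- multiplication by the cutoff commutes with `thetaOp` up to functions that vanish near the local
  -- unstable manifold
  have hN : ∀ ψ, IsTest (B.basin P δ) ψ → v ((thetaOp lam)^[p] ψ) = 0 := by
    intro ψ hψ
    have h1 := B.isTest_stableCutoff_mul hψ
    rw [hv, ← hw.apply_thetaOp_iterate hu h1]
    refine IsLift.congr hWF hV hφ hΛ hsupp hw (B.isTest_stableCutoff_mul (hψ.thetaOp_iterate p))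
      (h1.thetaOp_iterate p) fun q hq => ?_
    exact (hcore hq _).trans (thetaOp_iterate_congr (hcore hq ψ) p).symm
  have hsupp' : ∀ ψ, IsTest (B.basin P δ) ψ → (∀ q ∈ tsupport ψ, q.1 ∉ B.splitting.unstable) →
      v ψ = 0 := fun ψ hψ h =>
    IsLift.eq_zero_of_tsupport hT hWF hV hφ hΛ hsupp hw (B.isTest_stableCutoff_mul hψ)
      fun q hq => h q (tsupport_mul_subset_right hq)
  have h00 : ((0, 0) : Model d) ∈ (hT.chart 0).1.target ∩ B.core P δ := by
    have h1 := zero_mem_box (B := B) (P := P) hT.radius_pos 0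
    refine ⟨hT.mem_chart_target.2 ⟨h1, by simpa using hP⟩,
      B.mem_core (B.box_subset_basin h1) ?_⟩
    rw [B.mem_unstable_iff]
    intro k
    simp
  let L : Model d →L[ℝ] EuclideanSpace ℝ (Label B.lu B.pu) :=
    B.splitting.proj.comp (ContinuousLinearMap.fst ℝ _ _)
  have hL : Function.Surjective L := fun y => ⟨(B.splitting.emb y, 0), B.splitting.proj_emb y⟩
  -- a conormal of the strong unstable leaf annihilates the unstable directions, so that the
  -- wavefront set over the base point contains no nonzero covector of the unstable variable
  obtain ⟨O₁, hO₁, h0O₁, -, hdens⟩ := exists_density_of_waveFront (u.inChart (hT.chart 0))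
    (q := (0, 0)) h00.1 hL fun η hη h => hη (by
      have h1 := (hT.conormal_of_mem_waveFront hWF h).2 (B.splitting.emb η)
        (embedUnstable_mem_unstable _)
      rw [waveCovector_apply] at h1
      have h2 : L (B.splitting.emb η, 0) = η := B.splitting.proj_emb η
      rw [h2] at h1
      simpa [Real.pi_ne_zero] using h1)
  obtain ⟨r, hr, hrO⟩ := Metric.nhds_basis_closedBall.mem_iff.1
    ((((hT.chart 0).1.open_target.inter B.isOpen_core).inter hO₁).mem_nhds ⟨h00, h0O₁⟩)
  have hball : Metric.ball ((0, 0) : Model d) r ⊆ Metric.closedBall ((0, 0) : Model d) r :=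
    Metric.ball_subset_closedBall
  have htarget : Metric.ball ((0, 0) : Model d) r ⊆ (hT.chart 0).1.target := fun q hq =>
    (hrO (hball hq)).1.1
  have hbox : Metric.ball ((0, 0) : Model d) r ⊆ box (P := P) B δ := fun q hq =>
    (hT.mem_chart_target.1 (htarget hq)).1
  have hvu : ∀ ψ, IsTest (Metric.ball ((0, 0) : Model d) r) ψ →
      v ψ = pair (u.inChart (hT.chart 0)) ψ := fun ψ hψ => by
    rw [hvw ψ (hψ.mono hbox), hw 0 ψ (hψ.mono htarget)]
  obtain ⟨m, c, -, hmc⟩ := exists_order_bound (u.inChart (hT.chart 0))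
    (isCompact_closedBall ((0, 0) : Model d) r) fun q hq => (hrO hq).1.1
  obtain ⟨h1, ι, hι, l, F, hl, hF⟩ := B.splitting.exists_flow_expansion hP
    (B.downClosed_basin (δ := δ) hP) (fun z θ => by
      show B.unstableSq P (act B.matrix z, θ) < δ ^ 2 ↔ B.unstableSq P (z, θ + P) < δ ^ 2
      rw [B.unstableSq_act_matrix hP.ne']) v hR hN hsupp'
    Metric.isOpen_ball (Metric.mem_ball_self hr) (hbox.trans B.box_subset_basin)
    ⟨m, c, fun ψ b hψ hb h => by
      rw [hvu ψ hψ]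
      exact hmc ψ b (hψ.mono hball) hb fun j hj x _ => h j hj x⟩
    fun χ hχ => by
      obtain ⟨f, hf, hfb⟩ := hdens χ (hχ.mono fun q hq => (hrO (hball hq)).2)
      refine ⟨f, hf, fun b hb => ?_⟩
      rw [← hfb b hb, ← hvu]
      · rfl
      · exact hχ.mul_right (f := fun q => b (L q)) (hb.1.comp L.contDiff)
  refine ⟨fun ψ hψ => ?_, ι, hι, l, F, hl, fun ψ hψ => ?_⟩
  · rw [← hvw _ hψ.thetaOp]
    exact h1 ψ (hψ.mono B.box_subset_basin)
  · rw [← hvw _ hψ]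
    exact hF ψ (hψ.mono B.box_subset_basin)

end LinearizingChart.IsTube


/-! ### From the flow-box coordinates to arbitrary charts -/

namespace LinearizingChart

variable {d : ℕ} {M : Type*} [TopologicalSpace M] [ChartedSpace (Model d) M]
  {V : ∀ x : M, TangentSpace 𝓘(ℝ, Model d) x} {Λ : Set M} {P : ℝ}
  {C : LinearizingChart V Λ P} {Q : Matrix (Fin d) (Fin d) ℝ}

lemma isTest_pullDensity (hQ : IsUnit Q.det) {S : Set (Model d)} {ψ : Model d → ℂ} (hψ : IsTest S ψ) :
    IsTest (C.unshear Q '' S) (C.pullDensity Q ψ) := by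
  have hK : IsCompact (C.unshear Q '' tsupport ψ) :=
    hψ.2.1.isCompact.image (contDiff_unshear hQ).continuous
  refine (IsTest.of_contDiffOn hK isOpen_univ (subset_univ _) (ContDiff.contDiffOn ?_)
    fun q hq => ?_).mono (image_mono hψ.2.2)
  · have h1 : ContDiff ℝ ∞ fun q : Model d => (C.U q.2 * Q).det :=
      (contDiff_det (C.contDiff_U_mul Q)).comp contDiff_snd
    have h2 : ContDiff ℝ ∞ fun q : Model d => |(C.U q.2 * Q).det| :=
      contDiff_iff_contDiffAt.2 fun q =>
        h1.contDiffAt.abs (isUnit_det_U_mul hQ q.2).ne_zero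
    exact (Complex.ofRealCLM.contDiff.comp h2).mul (hψ.1.comp (C.contDiff_shear Q))
  · have h1 : C.shear Q q ∉ tsupport ψ := fun h => hq ⟨_, h, unshear_shear hQ q⟩
    have h2 : ψ (act (C.U q.2 * Q) q.1, q.2) = 0 := image_eq_zero_of_notMem_tsupport h1
    rw [pullDensity, h2, mul_zero]

end LinearizingChart

namespace LinearizingChart.IsTube

variable {d : ℕ} {M : Type*} [TopologicalSpace M] [ChartedSpace (Model d) M]
  {V : ∀ x : M, TangentSpace 𝓘(ℝ, Model d) x} {Λ : Set M} {P : ℝ}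
  {C : LinearizingChart V Λ P} {B : Blocks d} {Q : Matrix (Fin d) (Fin d) ℝ} {δ : ℝ}
  (hT : C.IsTube B Q δ) [IsManifold 𝓘(ℝ, Model d) ∞ M]

/-- The change of coordinates from a flow-box chart to a chart. -/
def toChart (κ : SmoothChart d M) (a : ℝ) : OpenPartialHomeomorph (Model d) (Model d) :=
  (hT.chart a).1.symm.trans κ.1

lemma exists_toChart_decomposition (κ : SmoothChart d M) {ψ : Model d → ℂ}
    (hψ : IsTest (κ.imageOf (C.tube B Q δ)) ψ) : ∃ (t : Finset ℝ) (f : ℝ → Model d → ℂ),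
      (∀ a ∈ t, IsTest (hT.toChart κ a).target (f a)) ∧ ψ = ∑ a ∈ t, f a := by
  obtain ⟨t, f, hf, hsum⟩ := hψ.exists_decomposition (fun a => (hT.toChart κ a).target)
    (fun a => (hT.toChart κ a).open_target) fun x hx => by
      obtain ⟨hx1, hx2⟩ := hψ.2.2 hx
      obtain ⟨q, hq, hqx⟩ := hT.exists_flowBox_eq hx2
      refine mem_iUnion.2 ⟨q.2, hx1, ?_⟩
      show κ.1.symm x ∈ (hT.chart q.2).1.source
      rw [← hqx]
      exact hT.mem_chart_source (hT.mem_chart_target.2 ⟨hq, by simpa using half_pos hT.period_pos⟩)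
  exact ⟨t, f, fun a ha => (hf a ha).mono inter_subset_right, hsum⟩

lemma isTest_pullOn_toChart (κ : SmoothChart d M) {a : ℝ} {ψ : Model d → ℂ}
    (hψ : IsTest (hT.toChart κ a).target ψ) :
    IsTest (hT.chart a).1.target (pullOn (hT.toChart κ a) ψ) := by
  refine (hψ.pullOn (contDiffOn_transition (hT.chart a) κ)
    (contDiffOn_transition_symm (hT.chart a) κ)).mono ?_
  rintro _ ⟨x, hx, rfl⟩
  exact ((hT.toChart κ a).map_target (hψ.2.2 hx)).1

lemma fderiv_toChart (κ : SmoothChart d M) {a : ℝ} {x : Model d}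
    (hx : x ∈ (hT.toChart κ a).source) :
    fderiv ℝ (hT.toChart κ a) x (0, 1) = fieldInChart V κ (hT.toChart κ a x) := by
  have hxt : x ∈ (hT.chart a).1.target := hx.1
  have hxb := (hT.mem_chart_target.1 hxt).1
  have hxs : C.flowBox Q x ∈ κ.1.source := by
    rw [← hT.chart_symm a]
    exact hx.2
  have e : (hT.toChart κ a : Model d → Model d) = κ.1 ∘ C.flowBox Q := by
    funext y
    show κ.1 ((hT.chart a).1.symm y) = _
    rw [chart_symm]
    rfl
  have h1 : MDifferentiableAt 𝓘(ℝ, Model d) 𝓘(ℝ, Model d) (C.flowBox Q) x :=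
    (hT.isLocalDiffeomorphOn_flowBox ⟨x, hxb⟩).mdifferentiableAt (by simp)
  have h2 : MDifferentiableAt 𝓘(ℝ, Model d) 𝓘(ℝ, Model d) κ.1 (C.flowBox Q x) :=
    (contMDiffAt_of_mem_maximalAtlas κ.2 hxs).mdifferentiableAt (by simp)
  have h3 : fderiv ℝ (κ.1 ∘ C.flowBox Q) x (0, 1) =
      mfderiv 𝓘(ℝ, Model d) 𝓘(ℝ, Model d) κ.1 (C.flowBox Q x)
        (mfderiv 𝓘(ℝ, Model d) 𝓘(ℝ, Model d) (C.flowBox Q) x ((0, 1) : Model d)) := by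
    rw [← mfderiv_eq_fderiv, mfderiv_comp x h2 h1]
    rfl
  rw [e, h3, hT.mfderiv_flowBox hxb, fieldInChart, Function.comp_apply, κ.1.left_inv hxs]

variable {hT} {u : MDistr d M} {w : (Model d → ℂ) →ₗ[ℂ] ℂ} (hw : hT.IsLift u w)
include hw

namespace IsLift

lemma pair_eq (κ : SmoothChart d M) {a : ℝ} {ψ : Model d → ℂ}
    (hψ : IsTest (hT.toChart κ a).target ψ) :
    pair (u.inChart κ) ψ = w (pullOn (hT.toChart κ a) ψ) := by
  rw [hw a _ (hT.isTest_pullOn_toChart κ hψ)]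
  exact u.compatible (hT.chart a) κ ψ hψ

lemma vanishesOn (h : ∀ ψ, IsTest (box (P := P) B δ) ψ → w ψ = 0) :
    u.VanishesOn (C.tube B Q δ) := by
  intro κ ψ hψ
  obtain ⟨t, f, hf, rfl⟩ := hT.exists_toChart_decomposition κ hψ
  rw [pair_sum _ fun a ha => (hf a ha).mono inter_subset_left]
  refine Finset.sum_eq_zero fun a ha => ?_
  rw [hw.pair_eq κ (hf a ha)]
  exact h _ ((hT.isTest_pullOn_toChart κ (hf a ha)).mono fun q hq => (hT.mem_chart_target.1 hq).1)

lemma solvesOn {lam : ℂ} (h : ∀ ψ, IsTest (box (P := P) B δ) ψ → w (thetaOp lam ψ) = 0) :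
    u.SolvesOn V lam 1 (C.tube B Q δ) := by
  intro κ ψ hψ
  obtain ⟨t, f, hf, rfl⟩ := hT.exists_toChart_decomposition κ hψ
  have hc := fun a => contDiffOn_transition (hT.chart a) κ
  have hc' := fun a => contDiffOn_transition_symm (hT.chart a) κ
  have hf' : ∀ a ∈ t, IsTest (hT.toChart κ a).target (transposeOp (fieldInChart V κ) lam (f a)) :=
    fun a ha => ((hf a ha).transposeOp (hT.toChart κ a).open_target
      (contDiffOn_field (hc a) (hc' a) fun x hx => hT.fderiv_toChart κ hx) lam).mono (hf a ha).2.2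
  rw [Function.iterate_one, transposeOp_sum _ _ fun a ha => (hf a ha).1,
    pair_sum _ fun a ha => (hf' a ha).mono inter_subset_left]
  refine Finset.sum_eq_zero fun a ha => ?_
  rw [hw.pair_eq κ (hf' a ha)]
  have h1 := pullOn_transposeOp (hc a) (hc' a) (b := fieldInChart V κ) (e := (0, 1))
    (fun x hx => hT.fderiv_toChart κ hx) lam (hf a ha)
  refine (congrArg w h1).trans (h _ ?_)
  exact (hT.isTest_pullOn_toChart κ (hf a ha)).mono fun q hq => (hT.mem_chart_target.1 hq).1

/-- The expression of `u` in a chart given by the linearizing coordinates. -/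
lemma pair_eq_pullDensity {κ : SmoothChart d M} (hκ : C.IsCoordinateChart κ) {ψ : Model d → ℂ}
    (hψ : IsTest (κ.1.target ∩ C.liftedTube B Q δ) ψ) :
    pair (u.inChart κ) ψ = w (C.pullDensity Q ψ) := by
  have hQ := hT.adapted.1
  obtain ⟨t, f, hf, hsum⟩ := hψ.exists_decomposition
    (fun a => κ.1.target ∩ C.unshear Q ⁻¹' (hT.chart a).1.target)
    (fun a => κ.1.open_target.inter
      ((hT.chart a).1.open_target.preimage (C.contDiff_unshear hQ).continuous)) fun x hx => by
      obtain ⟨hx1, hx2⟩ := hψ.2.2 hx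
      refine mem_iUnion.2 ⟨x.2, hx1, hT.mem_chart_target.2
        ⟨(unshear_mem_box hQ hT.radius_pos).2 hx2, ?_⟩⟩
      simpa [unshear] using half_pos hT.period_pos
  have hlin : C.pullDensity Q ψ = ∑ a ∈ t, C.pullDensity Q (f a) := by
    funext q
    simp only [pullDensity, hsum, Finset.sum_apply, Finset.mul_sum]
  rw [hlin, map_sum, hsum, pair_sum _ fun a ha =>
    (hf a ha).mono (inter_subset_right.trans inter_subset_left)]
  refine Finset.sum_congr rfl fun a ha => ?_
  have hfa := (hf a ha).mono inter_subset_right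
  let O : Set (Model d) := (hT.chart a).1.target ∩ C.shear Q ⁻¹' κ.1.target
  have hO : IsOpen O := (hT.chart a).1.open_target.inter
    (κ.1.open_target.preimage (C.contDiff_shear Q).continuous)
  have h1 : IsTest (C.shear Q '' O) (f a) := hfa.mono fun x hx =>
    ⟨C.unshear Q x, ⟨hx.2, by rw [mem_preimage, C.shear_unshear hQ]; exact hx.1⟩,
      C.shear_unshear hQ x⟩
  rw [u.pair_eq_of_transition (hT.chart a) κ (τ := C.shear Q) hO inter_subset_left
    (fun x hx => ⟨hx.2, by rw [chart_symm, hκ.2 hx.2]; rfl⟩) h1 fun x hx => ?_, hw a]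
  · congr 1
    funext q
    have h2 := det_fderiv_act_family (C.contDiff_U_mul Q) 0 q
    simp only [add_zero] at h2
    show ((|(fderiv ℝ (fun q : Model d => ((act (C.U q.2 * Q) q.1, q.2) : Model d)) q).det| : ℝ) : ℂ)
      * _ = _
    rw [h2]
    rfl
  · refine (isTest_pullDensity hQ hfa).mono ?_
    rintro _ ⟨x, hx, rfl⟩
    exact hx.2
  · refine hfa.eq_zero fun h => hx ⟨?_, h.1⟩
    have := h.2
    rwa [mem_preimage, C.unshear_shear hQ] at this

lemma eqCombination {ι : Type} [Fintype ι]
    {l : ι → List (Label B.ls B.ps) × List (Label B.lu B.pu)} {F : ι → ℂ} {n : ι → ℤ} {lam : ℂ}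
    (hn : ∀ i, B.eigenvalue P (B.wordIndex (l i) (n i)) = lam)
    (hF : ∀ ψ, IsTest (box (P := P) B δ) ψ →
      w ψ = ∑ i, F i * B.splitting.form (l i) (expMean lam ψ)) :
    ∃ c : B.Index →₀ ℂ, (∀ α ∈ c.support, B.eigenvalue P α = lam) ∧ C.EqCombination B Q δ u c := by
  classical
  refine ⟨∑ i, Finsupp.single (B.wordIndex (l i) (n i)) (F i * (-1) ^ (l i).1.length),
    fun α hα => ?_, fun κ hκ ψ hψ => ?_⟩
  · obtain ⟨i, -, hi⟩ := Finset.mem_biUnion.1 (Finsupp.support_finsetSum hα)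
    rw [← hn i, Finset.mem_singleton.1 (Finsupp.support_single_subset hi)]
  · have h1 : IsTest (box (P := P) B δ) (C.pullDensity Q ψ) :=
      (isTest_pullDensity hT.adapted.1 hψ).mono (by
        rintro _ ⟨x, hx, rfl⟩
        exact (unshear_mem_box hT.adapted.1 hT.radius_pos).2 hx.2)
    have h2 : ∀ c : B.Index →₀ ℂ, (c.sum fun α a => a * C.modelPairing B Q α ψ) =
        Finsupp.linearCombination ℂ (fun α => C.modelPairing B Q α ψ) c := fun c => by
      simp [Finsupp.linearCombination_apply]
    rw [hw.pair_eq_pullDensity hκ hψ, hF _ h1, h2, map_sum]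
    refine Finset.sum_congr rfl fun i _ => ?_
    rw [Finsupp.linearCombination_single, ← hn i,
      C.form_expMean_pullDensity B Q hT.period_pos hψ.1 h1, smul_eq_mul, mul_assoc]

end IsLift

end LinearizingChart.IsTube

end ClosedOrbit

end

theorem theoremt (d : ℕ) (M : Type*) [TopologicalSpace M] [T2Space M] [CompactSpace M]
    [ChartedSpace (Model d) M] [IsManifold 𝓘(ℝ, Model d) ∞ M]
    (V : ∀ x : M, TangentSpace 𝓘(ℝ, Model d) x)
    (hV : ContMDiff 𝓘(ℝ, Model d) 𝓘(ℝ, Model d).tangent ∞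
      fun x => (⟨x, V x⟩ : TangentBundle 𝓘(ℝ, Model d) M))
    (φ : Flow ℝ M) (hφ : ∀ x : M, IsMIntegralCurve (fun t : ℝ => φ t x) V)
    (Λ : Set M) (P : ℝ) (hΛ : IsClosedOrbit φ Λ P)
    (C : LinearizingChart V Λ P)
    (hdiag : IsDiagonalizableOverComplex C.monodromy)
    (hhyp : IsHyperbolicMatrix C.monodromy) :
    (∃ (B : Blocks d) (Q : Matrix (Fin d) (Fin d) ℝ), C.IsAdapted B Q) ∧
    ∀ (B : Blocks d) (Q : Matrix (Fin d) (Fin d) ℝ), C.IsAdapted B Q →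
      ∀ δ : ℝ, 0 < δ → C.liftedTube B Q δ ⊆ Metric.ball 0 C.r ×ˢ univ →
        ∀ (u : MDistr d M) (lam : ℂ) (p : ℕ), 1 ≤ p →
          u.SolvesOn V lam p (C.tube B Q δ) →
          ¬ u.VanishesOn (C.tube B Q δ) →
          u.support ∩ C.tube B Q δ ⊆ unstableManifold φ Λ →
          (∀ q ∈ u.waveFront, q.1 ∈ C.tube B Q δ → q ∈ C.strongUnstableConormals B Q) →
            lam ∈ B.resonances P ∧
            (∃ c : B.Index →₀ ℂ, (∀ α ∈ c.support, B.eigenvalue P α = lam) ∧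
              C.EqCombination B Q δ u c) ∧
            u.SolvesOn V lam 1 (C.tube B Q δ) := by
  refine ⟨exists_blocks hdiag hhyp (C.isUnit_det_U P), ?_⟩
  intro B Q hQ δ hδ hsub u lam p _ hu hne hsupp hWF
  have hT : C.IsTube B Q δ := ⟨hΛ.1, hQ, hδ, hsub⟩
  obtain ⟨w, hw⟩ := hT.exists_isLift u
  obtain ⟨h1, ι, _, l, F, hl, hF⟩ :=
    LinearizingChart.IsTube.IsLift.exists_expansion hWF hV hφ hΛ hsupp hw hu
  choose n hn using fun i => B.exists_eigenvalue_eq hΛ.1 (hl i)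
  refine ⟨?_, hw.eqCombination hn hF, hw.solvesOn h1⟩
  by_contra hlam
  -- without resonance the sum is empty, so that `u` vanishes on the tube
  have hι : IsEmpty ι := ⟨fun i => hlam ⟨_, hn i⟩⟩
  refine hne (hw.vanishesOn fun ψ hψ => ?_)
  rw [hF ψ hψ, Finset.univ_eq_empty, Finset.sum_empty]
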